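/- Let $K$ be an algebraically closed field, let $d\ge 0$, and put $$T_S=\operatorname{Spec}\bigl(K[[u_1,\dots,u_{d+1},x,y]]/(xy-u_1\cdots u_{d+1})\bigr).$$ For $A\subseteq\{1,\dots,d+1\}$ let $u_A=\prod_{j\in A}u_j$ and $D_A=V(x,u_A)\subset T_S$. Let $\mathcal A=(A_1,\dots,A_k)$ be a finite sequence of proper nonempty subsets of $\{1,\dots,d+1\}$, and let $$\phi\colon \widetilde T_S^{\mathcal A}=\widetilde T_S^{k}\xrightarrow{\phi_k}\widetilde T_S^{k-1}\to\cdots\xrightarrow{\phi_1}\widetilde T_S^{0}=T_S$$ be the sequence of blowups in which $\phi_i$ is the blowup of $\widetilde T_S^{i-1}$ along the strict transform of $D_{A_i}$ via $\phi_1\circ\cdots\circ\phi_{i-1}$. Here the strict transform of a closed subset $Z\subseteq Y$ via a morphism $\psi\colon X\to Y$ is the closure in $X$ of $\psi^{-1}(Z\cap U)$, with its reduced structure, where $U\subseteq Y$ is the largest open subset over which $\psi$ is an isomorphism. Call $\mathcal A$ a smooth collection for $\{1,\dots,d+1\}$ if for all distinct $i,j\in\{1,\dots,d+1\}$ there is an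 $\ell$ such that $A_\ell$ contains exactly one of $i$ and $j$. Then the scheme $\widetilde T_S^{\mathcal A}$ is smooth (that is, regular: locally Noetherian with all local rings regular) if and only if $\mathcal A$ is a smooth collection for $\{1,\dots,d+1\}$. Moreover, in that case, the inverse image (scheme-theoretic fibre) under $\phi$ of the closed point of $T_S$ is a chain of $d$ rational curves over $K$: for $d\ge 1$ it is a reduced $K$-scheme which is the union of closed subschemes $E_1,\dots,E_d$, each isomorphic to $\mathbb P^1_K$ over $K$, such that $E_i\cap E_j=\emptyset$ if $|i-j|>1$, while $E_i$ and $E_{i+1}$ meet in exactly one point, and their scheme-theoretic intersection is reduced. For $d=0$ it is a single reduced $K$-rational point. -/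

import Mathlib

open CategoryTheory CategoryTheory.Limits AlgebraicGeometry TopologicalSpace

universe u

noncomputable section

namespace SmoothCollection

/-! ### Regular schemes -/

/-- A scheme is regular if it is locally Noetherian and all its local rings are regular. -/
def IsRegularScheme (X : Scheme.{u}) : Prop :=
  IsLocallyNoetherian X ∧ ∀ x : X, IsRegularLocalRing (X.presheaf.stalk x)

/-! ### Blowups and strict transforms -/

/-- An ideal sheaf is invertible (the ideal of an effective Cartier divisor) if every point has an
affine open neighbourhood on which it is generated by a single non-zero-divisor. -/
def IsInvertibleIdeal {X : Scheme.{u}} (I : X.IdealSheafData) : Prop :=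
  ∀ x : X, ∃ U : X.affineOpens, x ∈ U.1 ∧
    ∃ a : Γ(X, U.1), a ∈ nonZeroDivisors Γ(X, U.1) ∧ I.ideal U = Ideal.span {a}

/-- `π : X' ⟶ X` is the blowup of `X` along the ideal sheaf `I`: the inverse image ideal sheaf of
`I` on `X'` is invertible, and every morphism to `X` for which the inverse image ideal sheaf of
`I` is invertible factors uniquely through `π`. This determines `π` up to unique isomorphism
over `X`. -/
structure IsBlowup {X' X : Scheme.{u}} (π : X' ⟶ X) (I : X.IdealSheafData) : Prop where
  isInvertible_comap : IsInvertibleIdeal (I.comap π)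
  existsUnique_lift : ∀ {Y : Scheme.{u}} (f : Y ⟶ X), IsInvertibleIdeal (I.comap f) →
    ∃! g : Y ⟶ X', g ≫ π = f

/-- The largest open subset of the target over which a morphism is an isomorphism. -/
def isoLocus {X Y : Scheme.{u}} (φ : X ⟶ Y) : Y.Opens :=
  sSup {V : Y.Opens | IsIso (φ ∣_ V)}

/-- The strict transform of a closed subset `Z` of `Y` via a morphism `φ : X ⟶ Y`: the closure in
`X` of the inverse image of the part of `Z` lying in the open subset over which `φ` is an
isomorphism. -/
def strictTransform {X Y : Scheme.{u}} (φ : X ⟶ Y) (Z : Closeds Y) : Closeds X :=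
  Closeds.closure (φ ⁻¹' ((Z : Set Y) ∩ (isoLocus φ : Set Y)))

/-- A sequence of blowups `X_k ⟶ ⋯ ⟶ X_1 ⟶ X_0 = T`, where `X_{l+1} ⟶ X_l` is the blowup of `X_l`
along the strict transform (with its reduced scheme structure) of the closed subset `Z_{l+1}` of
`T` via the composite map `X_l ⟶ T`. The indices of `Z` start from zero, and `X_0` is identified
with `T` by means of the isomorphism `toBase 0`. -/
structure BlowupSequence {T : Scheme.{u}} {k : ℕ} (Z : Fin k → Closeds T) where
  /-- The schemes `X_0, …, X_k`. -/
  X : Fin (k + 1) → Scheme.{u}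
  /-- The blowup maps. -/
  φ : ∀ l : Fin k, X l.succ ⟶ X l.castSucc
  /-- The composite maps to `T`. -/
  toBase : ∀ l : Fin (k + 1), X l ⟶ T
  isIso_toBase_zero : IsIso (toBase 0)
  toBase_succ : ∀ l : Fin k, toBase l.succ = φ l ≫ toBase l.castSucc
  isBlowup : ∀ l : Fin k, IsBlowup (φ l)
    (Scheme.IdealSheafData.vanishingIdeal (strictTransform (toBase l.castSucc) (Z l)))

/-- The last scheme of a sequence of blowups. -/
def BlowupSequence.top {T : Scheme.{u}} {k : ℕ} {Z : Fin k → Closeds T}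
    (𝒯 : BlowupSequence Z) : Scheme.{u} :=
  𝒯.X (Fin.last k)

/-- The composite of all maps of a sequence of blowups. -/
def BlowupSequence.toT {T : Scheme.{u}} {k : ℕ} {Z : Fin k → Closeds T}
    (𝒯 : BlowupSequence Z) : 𝒯.top ⟶ T :=
  𝒯.toBase (Fin.last k)

/-! ### The local family `T_S` and the divisors `D_A` -/

section TS

variable (K : Type u) [Field K] (d : ℕ)

/-- The ring `K[[u_1, …, u_{d+1}, x, y]]`. -/
abbrev PowerSeriesRing : Type u := MvPowerSeries (Fin (d + 1) ⊕ Fin 2) K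

/-- The element `x y - u_1 ⋯ u_{d+1}`. -/
def equation : PowerSeriesRing K d :=
  MvPowerSeries.X (Sum.inr 0) * MvPowerSeries.X (Sum.inr 1) -
    ∏ j : Fin (d + 1), MvPowerSeries.X (Sum.inl j)

/-- The ring `K[[u_1, …, u_{d+1}, x, y]] / (x y - u_1 ⋯ u_{d+1})`. -/
abbrev RS : Type u := PowerSeriesRing K d ⧸ Ideal.span {equation K d}

lemma span_equation_ne_top : Ideal.span {equation K d} ≠ ⊤ := by
  rw [Ne, Ideal.span_singleton_eq_top]
  intro h
  have h' := h.map (MvPowerSeries.constantCoeff (σ := Fin (d + 1) ⊕ Fin 2) (R := K))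
  simp [equation] at h'

instance : Nontrivial (RS K d) := Ideal.Quotient.nontrivial_iff.mpr (span_equation_ne_top K d)

instance : IsLocalRing (RS K d) :=
  IsLocalRing.of_surjective' (Ideal.Quotient.mk _) Ideal.Quotient.mk_surjective

/-- The class of `u_j` (indices start from zero). -/
def uVar (j : Fin (d + 1)) : RS K d := Ideal.Quotient.mk _ (MvPowerSeries.X (Sum.inl j))

/-- The class of `x`. -/
def xVar : RS K d := Ideal.Quotient.mk _ (MvPowerSeries.X (Sum.inr 0))

/-- The scheme `T_S`. -/
def TS : Scheme.{u} := Spec (.of (RS K d))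

/-- The structure morphism of `T_S` over `K`. -/
def TS.toSpecField : TS K d ⟶ Spec (.of K) :=
  Spec.map (CommRingCat.ofHom (algebraMap K (RS K d)))

/-- The closed point of `T_S`. -/
def TS.closedPoint : TS K d := IsLocalRing.closedPoint (RS K d)

/-- The Weil divisor `D_A = V(x, u_A)`, where `u_A` is the product of the `u_j` with `j ∈ A`. (The
ideal `(x, u_A)` is radical, so `D_A` carries its reduced scheme structure.) -/
def weilDivisor (A : Finset (Fin (d + 1))) : Closeds (TS K d) :=
  ⟨PrimeSpectrum.zeroLocus {xVar K d, ∏ j ∈ A, uVar K d j}, PrimeSpectrum.isClosed_zeroLocus _⟩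

end TS

/-! ### Smooth collections -/

/-- A collection of subsets of a finite set is smooth if any two distinct elements are separated by
a member of the collection. -/
def IsSmoothCollection {F : Type*} {k : ℕ} (A : Fin k → Finset F) : Prop :=
  ∀ i j : F, i ≠ j → ∃ l : Fin k, (j ∈ A l ∧ i ∉ A l) ∨ (i ∈ A l ∧ j ∉ A l)

/-! ### Chains of rational curves -/

section Chain

attribute [local instance] MvPolynomial.gradedAlgebra

variable (K : Type u) [Field K]

/-- The projective line over `K`. -/
def ProjectiveLine : Scheme.{u} := Proj (MvPolynomial.homogeneousSubmodule (Fin 2) K)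

/-- The structure morphism of the projective line. -/
def ProjectiveLine.toSpecField : ProjectiveLine K ⟶ Spec (.of K) :=
  Proj.toSpecZero (MvPolynomial.homogeneousSubmodule (Fin 2) K) ≫
    Spec.map (CommRingCat.ofHom
      (algebraMap K (MvPolynomial.homogeneousSubmodule (Fin 2) K 0)))

variable {K}

/-- `p : F ⟶ Spec K` is a chain of `n` rational curves. For `n ≥ 1` this means: `F` is reduced and
is the union of closed subschemes `E_1, …, E_n`, each isomorphic to the projective line over `K`,
such that `E_i` and `E_j` are disjoint if `|i - j| > 1`, and `E_i` and `E_{i+1}` meet in exactly one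
point, transversally (their scheme-theoretic intersection is reduced), so that this point is a node
of `F`. (Such an `F` is automatically a connected projective nodal curve.) By convention a
chain of `0` rational curves is a reduced `K`-rational point. -/
def IsChainOfRationalCurves {F : Scheme.{u}} (p : F ⟶ Spec (.of K)) (n : ℕ) : Prop :=
  (n = 0 → IsIso p) ∧
  (0 < n → IsReduced F ∧
    ∃ E : Fin n → (ProjectiveLine K ⟶ F),
      (∀ i, IsClosedImmersion (E i) ∧ E i ≫ p = ProjectiveLine.toSpecField K) ∧
      (⋃ i, Set.range (E i)) = Set.univ ∧
      (∀ i j : Fin n, (i : ℕ) + 1 < j → Disjoint (Set.range (E i)) (Set.range (E j))) ∧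
      (∀ i j : Fin n, (i : ℕ) + 1 = j →
        (∃ x : F, Set.range (E i) ∩ Set.range (E j) = {x}) ∧
        IsReduced (pullback (E i) (E j))))

end Chain

end SmoothCollection

end

open SmoothCollection

/-! Every stage of the blowup sequence has an explicit affine cover. Let `L ⊔ M ⊔ U` be a partition
of the indices (coded by the values `.lt`, `.eq`, `.gt` of a function `τ`) with `M` nonempty. In the
fraction field of the ring `R` of `T_S` put `ξ = x / u_L` and `η = y / u_U`, so that `ξ η = u_M`.
The chart of the partition is `Spec R[ξ, η]`. Over the power series ring its only relations are `y =
u_U η`, `x = u_L ξ` and `u_M = ξ η` (`ker_toChart`), because the `u_j` are non-zero-divisors modulo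
these three.

The strict transform of `D_A` has the ideal `u_{A ∩ L} (ξ, u_{A ∩ M})` on such a chart
(`idealOf_strictTransform`). The factor in front is invertible, so blowing up adjoins one of the
quotients of `ξ` and `u_{A ∩ M}`. Either `u_{A ∩ M} / ξ = η / u_{M ∖ A}` becomes the new `η`, and `M
∖ A` moves to `U`; or `ξ / u_{A ∩ M}` becomes the new `ξ`, and `M ∩ A` moves to `L`
(`exists_blowupChart`). Thus a stage is described by an ordered partition of the indices, recorded
as the level sets of a function `c` with values in `ℕ`. Its charts take one level set as `M`, the
lower ones as `L` and the higher ones as `U`. Blowing up `D_A` splits each level set into its part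
inside `A`, followed by its part outside `A` (`HasCharts.blowup`). At the end `i` and `j` lie in the
same level set exactly if no `A_l` separates them, so the collection is smooth if and only if `c` is
injective, that is, every `M` is a singleton.

If `M = {j}`, the relations have the variables `y`, `x`, `u_j` as their constant terms, and partial
derivatives dual to them give regularity by a Jacobian argument (`isRegularRing_Ch`). Regularity is
needed at all primes of the power series ring; this follows from Serre's homological criterion
(`FinitePD.isRegularRing`). If `M` has at least two elements, then at the origin the equation `ξ η =
u_M` has no linear part. The embedding dimension is therefore at least `d + 3`, while the `u_j`
together with `ξ - η` cut out the origin up to radical, so the dimension is at most `d + 2`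
(`exists_not_isRegularLocalRing`).

If `c` is injective, sorting it orders the `d + 1` charts. Over the closed point the equation in a
chart is `ξ η = 0`, where `ξ = x` vanishes as well in the first chart and `η = y` in the last.
Consecutive charts satisfy `ξ_{i+1} η_i = 1`, so the `η`-axis of one and the `ξ`-axis of the next
glue to a projective line (`SortedCharts.exists_isCurve`). Charts that are not neighbours overlap
only where the `u_k` in between are invertible, hence not over the closed point. This gives a chain
of `d` lines whose nodes are the origins of the intermediate charts. -/

noncomputable section

/-! ### Projective dimension and regularity of localizations -/

namespace ProjDim

/-- The module `M` has projective dimension at most `n`. -/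
def PDLE (R : Type u) [CommRing R] (M : Type u) [AddCommGroup M] [Module R M] (n : ℕ) : Prop :=
  HasProjectiveDimensionLE (ModuleCat.of R M) n

section Basic

variable {R : Type u} [CommRing R] {M N : Type u} [AddCommGroup M] [Module R M]
  [AddCommGroup N] [Module R N]

lemma pdle_zero : PDLE R M 0 ↔ Module.Projective R M := by
  rw [PDLE, ← projective_iff_hasProjectiveDimensionLE_zero, ← IsProjective.iff_projective]

/-- Dimension shifting: the middle term of `0 → ker f → F → M → 0` is projective. -/
lemma pdle_succ {F : Type u} [AddCommGroup F] [Module R F] [Module.Projective R F]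
    (f : F →ₗ[R] M) (hf : Function.Surjective f) (n : ℕ) :
    PDLE R M (n + 1) ↔ PDLE R (LinearMap.ker f) n := by
  have hS := LinearMap.shortExact_shortComplexKer hf
  have : Projective (f.shortComplexKer).X₂ :=
    ModuleCat.projective_of_categoryTheory_projective (ModuleCat.of R F)
  exact hS.hasProjectiveDimensionLT_X₃_iff n this

lemma PDLE.mono {n m : ℕ} (h : PDLE R M n) (hnm : n ≤ m) : PDLE R M m :=
  have : HasProjectiveDimensionLT (ModuleCat.of R M) (n + 1) := h
  hasProjectiveDimensionLT_of_ge (ModuleCat.of R M) (n + 1) (m + 1) (by lia)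

lemma PDLE.retract {n : ℕ} (h : PDLE R M n) (i : N →ₗ[R] M) (r : M →ₗ[R] N)
    (hir : r ∘ₗ i = LinearMap.id) : PDLE R N n := by
  unfold PDLE at h ⊢
  exact Retract.hasProjectiveDimensionLT (X := ModuleCat.of R N) (Y := ModuleCat.of R M)
    ⟨ModuleCat.ofHom i, ModuleCat.ofHom r, by rw [← ModuleCat.ofHom_comp, hir]; rfl⟩ (n + 1)

lemma PDLE.equiv {n : ℕ} (h : PDLE R M n) (e : M ≃ₗ[R] N) : PDLE R N n :=
  h.retract e.symm.toLinearMap e.toLinearMap (by ext; simp)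

end Basic

section Reduction

variable {R : Type u} [CommRing R] {R' : Type u} [CommRing R'] [Algebra R R']
  (hsurj : Function.Surjective (algebraMap R R'))
  {x : R} (hker : ∀ r, algebraMap R R' r = 0 → ∃ s, r = x * s) (hx0 : algebraMap R R' x = 0)

-- `N` plays the role of `M / xM`. Since `x` acts as zero on an `R'`-module, `q` kills `xM` and so
-- factors through `π`; surjectivity of `R → R'` makes the factorization `R'`-linear.
include hsurj hx0 in
lemma exists_desc {M : Type u} [AddCommGroup M] [Module R M] {N : Type u} [AddCommGroup N]
    [Module R N] [Module R' N] [IsScalarTower R R' N] (π : M →ₗ[R] N)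
    (hπ : Function.Surjective π) (hπk : ∀ m, π m = 0 → ∃ m', m = x • m')
    {A : Type u} [AddCommGroup A] [Module R A] [Module R' A] [IsScalarTower R R' A]
    (q : M →ₗ[R] A) : ∃ q' : N →ₗ[R'] A, ∀ m, q' (π m) = q m := by
  have hle : LinearMap.ker π ≤ LinearMap.ker q := by
    intro m hm
    obtain ⟨m', rfl⟩ := hπk m hm
    rw [LinearMap.mem_ker, map_smul, ← algebraMap_smul R', hx0, zero_smul]
  refine ⟨LinearMap.extendScalarsOfSurjective hsurj
    ((Submodule.liftQ _ q hle) ∘ₗ (π.quotKerEquivOfSurjective hπ).symm.toLinearMap), fun m => ?_⟩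
  have : (π.quotKerEquivOfSurjective hπ).symm (π m) = Submodule.Quotient.mk m := by
    rw [LinearEquiv.symm_apply_eq]; rfl
  simp [LinearMap.extendScalarsOfSurjective, this]

-- Forward, a lifting problem over `R'` is solved over `R` and the solution descends. Backward, a
-- basis of `N = M / xM` is lifted to `M`. The lifts generate by Nakayama, and their relation module
-- is `x` times itself because `x` is `M`-regular, so Nakayama kills it too.
include hsurj hker hx0 in
lemma projective_iff_of_isSMulRegular [IsLocalRing R] [IsNoetherianRing R]
    (hx : x ∈ IsLocalRing.maximalIdeal R)
    {M : Type u} [AddCommGroup M] [Module R M] [Module.Finite R M] (hxM : IsSMulRegular M x)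
    {N : Type u} [AddCommGroup N] [Module R N] [Module R' N] [IsScalarTower R R' N]
    (π : M →ₗ[R] N) (hπ : Function.Surjective π) (hπk : ∀ m, π m = 0 → ∃ m', m = x • m') :
    Module.Projective R M ↔ Module.Projective R' N := by
  have hxbot : Ideal.span {x} ≤ Ideal.jacobson (⊥ : Ideal R) := by
    rw [IsLocalRing.jacobson_eq_maximalIdeal _ bot_ne_top, Ideal.span_le]
    simpa using hx
  constructor
  · intro hM
    refine Module.Projective.of_lifting_property'' fun f hf => ?_
    obtain ⟨g, hg⟩ := Module.projective_lifting_property (f.restrictScalars R) π hf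
    obtain ⟨q, hq⟩ := exists_desc hsurj hx0 π hπ hπk g
    refine ⟨q, LinearMap.ext fun n => ?_⟩
    obtain ⟨m, rfl⟩ := hπ n
    simpa [hq] using LinearMap.congr_fun hg m
  · intro hN
    rcases subsingleton_or_nontrivial R' with hs | hs
    · have h1 : algebraMap R R' 1 = 0 := Subsingleton.elim _ _
      obtain ⟨s, hs⟩ := hker 1 h1
      exact absurd ((Ideal.mul_mem_right s _ hx)) (by
        rw [← hs]; exact (Ideal.ne_top_iff_one _).1 (IsLocalRing.maximalIdeal.isMaximal R).ne_top)
    have : IsLocalRing R' := IsLocalRing.of_surjective' _ hsurj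
    have : Module.Finite R N := Module.Finite.of_surjective π hπ
    have : Module.Finite R' N := Module.Finite.of_restrictScalars_finite R R' N
    have : Module.Free R' N := Module.free_of_flat_of_isLocalRing
    let b := Module.Free.chooseBasis R' N
    have : Fintype (Module.Free.ChooseBasisIndex R' N) := inferInstance
    choose v hv using fun i => hπ (b i)
    let f := Fintype.linearCombination R v
    have hf : ∀ w, π (f w) = ∑ i, algebraMap R R' (w i) • b i := by
      intro w
      simp [f, Fintype.linearCombination_apply, map_sum, hv, algebraMap_smul]
    have hfsurj : Function.Surjective f := by
      rw [← LinearMap.range_eq_top, eq_top_iff]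
      refine Submodule.le_of_le_smul_of_le_jacobson_bot Module.Finite.fg_top hxbot ?_
      intro m _
      choose w hw using fun i => hsurj (b.repr (π m) i)
      have h1 : π (m - f w) = 0 := by
        rw [map_sub, hf, sub_eq_zero]
        simp [hw, b.sum_repr]
      obtain ⟨m', hm'⟩ := hπk _ h1
      refine Submodule.mem_sup.2 ⟨f w, ⟨w, rfl⟩, x • m', ?_, ?_⟩
      · exact Submodule.smul_mem_smul (Ideal.mem_span_singleton_self x) trivial
      · rw [← hm']; abel
    have hfinj : LinearMap.ker f = ⊥ := by
      refine Submodule.eq_bot_of_le_smul_of_le_jacobson_bot (Ideal.span {x}) _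
        (IsNoetherian.noetherian _) ?_ hxbot
      intro k hk
      have h1 := hf k
      rw [LinearMap.mem_ker.1 hk, map_zero] at h1
      have h2 := (Fintype.linearIndependent_iff.1 b.linearIndependent) _ h1.symm
      choose w hw using fun i => hker _ (h2 i)
      have hk' : k = x • w := funext hw
      have hwk : w ∈ LinearMap.ker f := by
        rw [hk', LinearMap.mem_ker, map_smul] at hk
        exact hxM (by simpa using hk)
      rw [hk']
      exact Submodule.smul_mem_smul (Ideal.mem_span_singleton_self x) hwk
    exact Module.Projective.of_equiv
      (LinearEquiv.ofBijective f ⟨LinearMap.ker_eq_bot.1 hfinj, hfsurj⟩)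

-- Dimension shifting on both sides: as `x` is `M`-regular, the kernel of a presentation of `M`
-- reduces modulo `x` to the kernel of the induced presentation of `N` (the vanishing of `Tor₁(M,
-- R/x)`). Being contained in a free module, the kernel is again `x`-regular.
include hsurj hker hx0 in
lemma pdle_iff_of_isSMulRegular [IsLocalRing R] [IsNoetherianRing R]
    (hx : x ∈ IsLocalRing.maximalIdeal R) (hxR : IsSMulRegular R x) (n : ℕ)
    {M : Type u} [AddCommGroup M] [Module R M] [Module.Finite R M] (hxM : IsSMulRegular M x)
    {N : Type u} [AddCommGroup N] [Module R N] [Module R' N] [IsScalarTower R R' N]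
    (π : M →ₗ[R] N) (hπ : Function.Surjective π) (hπk : ∀ m, π m = 0 → ∃ m', m = x • m') :
    PDLE R M n ↔ PDLE R' N n := by
  induction n generalizing M N with
  | zero =>
    rw [pdle_zero, pdle_zero]
    exact projective_iff_of_isSMulRegular hsurj hker hx0 hx hxM π hπ hπk
  | succ n ih =>
    obtain ⟨m, f, hf⟩ := Module.Finite.exists_fin' R M
    let f' : (Fin m → R') →ₗ[R'] N := Fintype.linearCombination R' fun i => π (f (Pi.single i 1))
    let a : (Fin m → R) →ₗ[R] (Fin m → R') := LinearMap.compLeft (Algebra.linearMap R R') (Fin m)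
    have ha : ∀ w i, a w i = algebraMap R R' (w i) := fun w i => rfl
    have haf : ∀ w, f' (a w) = π (f w) := by
      intro w
      conv_rhs => rw [← LinearMap.sum_single_apply (fun _ : Fin m => R) w, map_sum, map_sum]
      simp only [f', Fintype.linearCombination_apply]
      refine Finset.sum_congr rfl fun i _ => ?_
      rw [ha, algebraMap_smul, ← map_smul, ← map_smul, ← Pi.single_smul]
      simp
    have hasurj : Function.Surjective a := fun w => by
      choose v hv using fun i => hsurj (w i)
      exact ⟨v, funext hv⟩
    have hf' : Function.Surjective f' := fun y => by
      obtain ⟨m, rfl⟩ := hπ y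
      obtain ⟨w, rfl⟩ := hf m
      exact ⟨a w, haf w⟩
    rw [pdle_succ f hf, pdle_succ f' hf']
    let πK : LinearMap.ker f →ₗ[R] LinearMap.ker f' :=
      LinearMap.codRestrict ((LinearMap.ker f').restrictScalars R) (a ∘ₗ (LinearMap.ker f).subtype)
        (fun k => by
          have : f k = 0 := k.2
          simp [haf, this])
    refine ih (hxM := ?_) πK ?_ ?_
    · intro k l hkl
      apply Subtype.ext
      funext i
      exact hxR (congrFun (congrArg Subtype.val hkl) i)
    · rintro ⟨k', hk'⟩
      obtain ⟨v, rfl⟩ := hasurj k'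
      rw [LinearMap.mem_ker, haf] at hk'
      obtain ⟨m', hm'⟩ := hπk _ hk'
      obtain ⟨w, rfl⟩ := hf m'
      refine ⟨⟨v - x • w, by rw [LinearMap.mem_ker, map_sub, map_smul, hm', sub_self]⟩, ?_⟩
      apply Subtype.ext
      change a (v - x • w) = a v
      rw [map_sub, map_smul, sub_eq_self, ← algebraMap_smul R', hx0, zero_smul]
    · rintro ⟨k, hk⟩ hk0
      have hk0 : a k = 0 := congrArg Subtype.val hk0
      choose w hw using fun i => hker _ (congrFun hk0 i)
      have hkw : k = x • w := funext hw
      refine ⟨⟨w, ?_⟩, Subtype.ext hkw⟩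
      rw [hkw, LinearMap.mem_ker, map_smul] at hk
      exact hxM (by simpa using hk)

end Reduction

/-- Every finitely generated module has finite projective dimension. -/
def FinitePD (R : Type u) [CommRing R] : Prop :=
  ∀ (M : Type u) [AddCommGroup M] [Module R M] [Module.Finite R M], ∃ n, PDLE R M n

lemma FinitePD.of_ringEquiv {R S : Type u} [CommRing R] [CommRing S] (e : R ≃+* S)
    (h : FinitePD R) : FinitePD S := by
  intro M _ _ _
  let : Module R M := Module.compHom M e.toRingHom
  have : Module.Finite R M := by
    obtain ⟨s, hs⟩ := (Module.Finite.fg_top : (⊤ : Submodule S M).FG)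
    refine ⟨s, eq_top_iff.2 fun m _ => ?_⟩
    have hm : m ∈ Submodule.span S (s : Set M) := hs ▸ trivial
    induction hm using Submodule.span_induction with
    | mem x hx => exact Submodule.subset_span hx
    | zero => exact Submodule.zero_mem _
    | add x y _ _ hx hy => exact Submodule.add_mem _ (hx trivial) (hy trivial)
    | smul a x _ hx =>
      have : a • x = (e.symm a : R) • x := by
        change _ = e (e.symm a) • x
        simp
      rw [this]
      exact Submodule.smul_mem _ _ (hx trivial)
  obtain ⟨n, hn⟩ := h M
  refine ⟨n, ?_⟩
  unfold PDLE at hn ⊢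
  let := RingHomInvPair.of_ringEquiv e
  let := RingHomInvPair.of_ringEquiv e.symm
  exact ModuleCat.hasProjectiveDimensionLE_of_semiLinearEquiv (M := ModuleCat.of R M)
    (N := ModuleCat.of S M) e
    { toFun := id, invFun := id, map_add' := fun _ _ => rfl, map_smul' := fun _ _ => rfl,
      left_inv := fun _ => rfl, right_inv := fun _ => rfl } n

/-- `M` may have `x`-torsion, but its first syzygy lies in a free module and is `x`-regular. The
comparison is applied to that syzygy, which costs one in the dimension. -/
lemma FinitePD.of_quotient {R : Type u} [CommRing R] [IsLocalRing R] [IsNoetherianRing R]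
    {R' : Type u} [CommRing R'] [Algebra R R'] (hsurj : Function.Surjective (algebraMap R R'))
    {x : R} (hker : ∀ r, algebraMap R R' r = 0 → ∃ s, r = x * s) (hx0 : algebraMap R R' x = 0)
    (hx : x ∈ IsLocalRing.maximalIdeal R) (hxR : IsSMulRegular R x) (h : FinitePD R') :
    FinitePD R := by
  intro M _ _ _
  obtain ⟨m, f, hf⟩ := Module.Finite.exists_fin' R M
  let K := LinearMap.ker f
  let J : Submodule R K := Ideal.span {x} • ⊤
  have hI : RingHom.ker (algebraMap R R') = Ideal.span {x} := by
    ext r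
    rw [RingHom.mem_ker, Ideal.mem_span_singleton]
    exact ⟨fun hr => hker r hr, fun ⟨s, hs⟩ => by rw [hs, map_mul, hx0, zero_mul]⟩
  let e : R' ≃+* R ⧸ Ideal.span {x} :=
    (RingHom.quotientKerEquivOfSurjective hsurj).symm.trans (Ideal.quotEquivOfEq hI)
  have he : ∀ r, e (algebraMap R R' r) = Ideal.Quotient.mk _ r := fun r => by
    have : (RingHom.quotientKerEquivOfSurjective hsurj).symm (algebraMap R R' r) =
      Ideal.Quotient.mk _ r := by rw [RingEquiv.symm_apply_eq]; rfl
    simp [e, this]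
  let : Module R' (K ⧸ J) := Module.compHom (K ⧸ J) e.toRingHom
  have hsm : ∀ (r : R) (y : K ⧸ J), algebraMap R R' r • y = r • y := fun r y => by
    change e (algebraMap R R' r) • y = r • y
    rw [he]
    obtain ⟨y, rfl⟩ := Submodule.Quotient.mk_surjective _ y
    rfl
  have : IsScalarTower R R' (K ⧸ J) := IsScalarTower.of_algebraMap_smul hsm
  have : Module.Finite R' (K ⧸ J) := Module.Finite.of_restrictScalars_finite R R' _
  obtain ⟨n, hn⟩ := h (K ⧸ J)
  refine ⟨n + 1, (pdle_succ f hf n).2 ?_⟩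
  refine (pdle_iff_of_isSMulRegular hsurj hker hx0 hx hxR n (M := K) ?_ J.mkQ
    (Submodule.mkQ_surjective J) ?_).2 hn
  · intro k l hkl
    apply Subtype.ext
    funext i
    exact hxR (congrFun (congrArg Subtype.val hkl) i)
  · intro k hk
    rw [← LinearMap.mem_ker, Submodule.ker_mkQ] at hk
    replace hk : k ∈ Ideal.span {x} • (⊤ : Submodule R K) := hk
    rw [Submodule.ideal_span_singleton_smul, Submodule.mem_smul_pointwise_iff_exists] at hk
    obtain ⟨k', -, hk'⟩ := hk
    exact ⟨k', hk'.symm⟩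

end ProjDim

end

noncomputable section

namespace ProjDim

open IsLocalRing

/-! ### Serre's criterion: finite projective dimension of the residue field implies regularity -/

section Local

variable {R : Type u} [CommRing R] [IsLocalRing R] [IsNoetherianRing R]

-- A generating family of minimal length gives a minimal presentation, since a relation with a unit
-- coefficient would make one generator redundant.
omit [IsNoetherianRing R] in
lemma exists_surjective_ker_le_maximalIdeal (M : Type u) [AddCommGroup M] [Module R M]
    [Module.Finite R M] : ∃ (m : ℕ) (f : (Fin m → R) →ₗ[R] M), Function.Surjective f ∧
      ∀ k ∈ LinearMap.ker f, ∀ i, k i ∈ maximalIdeal R := by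
  classical
  have hex : ∃ m : ℕ, ∃ v : Fin m → M, Submodule.span R (Set.range v) = ⊤ := by
    obtain ⟨m, v, hv⟩ := Module.Finite.exists_fin (R := R) (M := M)
    exact ⟨m, v, hv⟩
  obtain ⟨v, hv⟩ := Nat.find_spec hex
  have hmin := @Nat.find_min _ _ hex
  generalize Nat.find hex = m at *
  refine ⟨m, Fintype.linearCombination R v, ?_, ?_⟩
  · rw [← LinearMap.range_eq_top, Fintype.range_linearCombination, hv]
  · intro k hk i
    by_contra hi
    have hu : IsUnit (k i) := by simpa using hi
    obtain ⟨a, ha⟩ := hu.exists_left_inv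
    obtain _ | m := m
    · exact i.elim0
    refine hmin (Nat.lt_succ_self m) ⟨fun j => v (i.succAbove j), ?_⟩
    rw [eq_top_iff, ← hv, Submodule.span_le]
    rintro _ ⟨j, rfl⟩
    have hmem : ∀ j, v (i.succAbove j) ∈
        Submodule.span R (Set.range fun j => v (i.succAbove j)) :=
      fun j => Submodule.subset_span ⟨j, rfl⟩
    rcases Fin.eq_self_or_eq_succAbove i j with rfl | ⟨j, rfl⟩
    · rw [LinearMap.mem_ker, Fintype.linearCombination_apply, Fin.sum_univ_succAbove _ j] at hk
      have : v j = -a • ∑ l, k (j.succAbove l) • v (j.succAbove l) := by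
        rw [eq_neg_of_add_eq_zero_right hk, smul_neg, neg_smul, neg_neg, smul_smul, ha, one_smul]
      rw [this]
      exact Submodule.smul_mem _ _ (Submodule.sum_mem _ fun l _ => Submodule.smul_mem _ _ (hmem l))
    · exact hmem j

/-- The depth zero case of the Auslander–Buchsbaum formula. The first syzygy of a minimal
presentation has entries in the maximal ideal, so `s` annihilates it; by induction it is free, hence
zero. -/
lemma projective_of_pdle_of_socle {s : R} (hs0 : s ≠ 0) (hs : ∀ a ∈ maximalIdeal R, s * a = 0)
    (n : ℕ) {M : Type u} [AddCommGroup M] [Module R M] [Module.Finite R M] (h : PDLE R M n) :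
    Module.Projective R M := by
  induction n generalizing M with
  | zero => exact pdle_zero.1 h
  | succ n ih =>
    obtain ⟨m, f, hf, hk⟩ := exists_surjective_ker_le_maximalIdeal (R := R) M
    have : Module.Projective R (LinearMap.ker f) := ih ((pdle_succ f hf n).1 h)
    have : Module.Free R (LinearMap.ker f) := Module.free_of_flat_of_isLocalRing
    have hker : Subsingleton (LinearMap.ker f) := by
      by_contra hne
      rw [not_subsingleton_iff_nontrivial] at hne
      obtain ⟨i⟩ : Nonempty (Module.Free.ChooseBasisIndex R (LinearMap.ker f)) := inferInstance
      let b := Module.Free.chooseBasis R (LinearMap.ker f)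
      have h0 : s • b i = 0 := by
        apply Subtype.ext
        funext j
        exact hs _ (hk _ (b i).2 j)
      have := congrArg (fun y => b.repr y i) h0
      simp at this
      exact hs0 this
    have hinj : Function.Injective f := by
      rw [← LinearMap.ker_eq_bot]
      exact (Submodule.subsingleton_iff_eq_bot).1 hker
    exact Module.Projective.of_equiv (LinearEquiv.ofBijective f ⟨hinj, hf⟩)

lemma spanFinrank_maximalIdeal_le_of_quotient {x : R} (hx : x ∈ maximalIdeal R)
    [IsLocalRing (R ⧸ Ideal.span {x})] :
    (maximalIdeal R).spanFinrank ≤ (maximalIdeal (R ⧸ Ideal.span {x})).spanFinrank + 1 := by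
  let m' := maximalIdeal (R ⧸ Ideal.span {x})
  have hfg : m'.FG := m'.fg_of_isNoetherianRing
  have hcard := Submodule.FG.generators_ncard hfg
  have hfin : m'.generators.Finite := Submodule.FG.finite_generators hfg
  choose g hg using Ideal.Quotient.mk_surjective (I := Ideal.span {x})
  have hmap := map_maximalIdeal_of_surjective (Ideal.Quotient.mk (Ideal.span {x}))
    Ideal.Quotient.mk_surjective
  have hm : maximalIdeal R = Ideal.span (g '' m'.generators ∪ {x}) := by
    have h1 : (Ideal.span (g '' m'.generators)).map (Ideal.Quotient.mk (Ideal.span {x})) = m' := by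
      rw [Ideal.map_span, Set.image_image]
      simp only [hg, Set.image_id']
      exact m'.span_generators
    have h2 := congrArg (Ideal.comap (Ideal.Quotient.mk (Ideal.span {x}))) (hmap.trans h1.symm)
    rw [Ideal.comap_map_of_surjective _ Ideal.Quotient.mk_surjective,
      Ideal.comap_map_of_surjective _ Ideal.Quotient.mk_surjective,
      ← RingHom.ker_eq_comap_bot, Ideal.mk_ker] at h2
    rw [Ideal.span_union, ← h2, sup_eq_left.2]
    rw [Ideal.span_le]
    simpa using hx
  have hfin' : (g '' m'.generators ∪ {x}).Finite := (hfin.image g).union (Set.finite_singleton x)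
  rw [hm]
  refine (Submodule.spanFinrank_span_le_ncard_of_finite hfin').trans ?_
  refine (Set.ncard_union_le _ _).trans ?_
  rw [Set.ncard_singleton, ← hcard]
  exact Nat.add_le_add_right (Set.ncard_image_le hfin) 1

/-- From `R / x` to `R` the dimension grows by exactly one, the embedding dimension by at most one.
-/
lemma isRegularLocalRing_of_quotient {x : R} (hx : x ∈ maximalIdeal R) (hx0 : x ∈ nonZeroDivisors R)
    [IsRegularLocalRing (R ⧸ Ideal.span {x})] : IsRegularLocalRing R := by
  refine IsRegularLocalRing.of_spanFinrank_maximalIdeal_le R ?_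
  rw [← ringKrullDim_quotient_span_singleton_succ_eq_ringKrullDim_of_mem_nonZeroDivisors hx0 hx,
    ← (isRegularLocalRing_iff (R ⧸ Ideal.span {x})).1 inferInstance]
  exact_mod_cast spanFinrank_maximalIdeal_le_of_quotient hx

/-- Prime avoidance for the associated primes and the square of the maximal ideal, which is the one
ideal in the list that need not be prime. Containment in the square contradicts Nakayama;
containment in an associated prime produces a socle element. -/
lemma exists_mem_nonZeroDivisors_notMem_sq (hm : maximalIdeal R ≠ ⊥)
    (hs : ¬ ∃ s : R, s ≠ 0 ∧ ∀ a ∈ maximalIdeal R, s * a = 0) :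
    ∃ x ∈ maximalIdeal R, x ∈ nonZeroDivisors R ∧ x ∉ maximalIdeal R ^ 2 := by
  by_contra! hcon
  have hsub : (maximalIdeal R : Set R) ⊆
      ⋃ i ∈ insert (maximalIdeal R ^ 2) (associatedPrimes R R), ((id i : Ideal R) : Set R) := by
    intro x hx
    rw [Set.biUnion_insert]
    by_cases hx0 : x ∈ nonZeroDivisors R
    · exact Or.inl (hcon x hx hx0)
    · right
      have : x ∈ (nonZeroDivisors R : Set R)ᶜ := hx0
      rw [← biUnion_associatedPrimes_eq_compl_nonZeroDivisors] at this
      exact this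
  obtain ⟨p, hp, hle⟩ := (Ideal.subset_union_prime_finite
    ((associatedPrimes.finite R R).insert (maximalIdeal R ^ 2)) (maximalIdeal R ^ 2)
    (maximalIdeal R ^ 2) (by
      rintro i (rfl | hi) h1 -
      · exact absurd rfl h1
      · exact hi.isPrime)).1 hsub
  rcases hp with rfl | hp
  · apply hm
    refine Submodule.eq_bot_of_le_smul_of_le_jacobson_bot (maximalIdeal R) _
      (IsNoetherian.noetherian _) ?_ (IsLocalRing.maximalIdeal_le_jacobson _)
    simpa [pow_two] using hle
  · obtain ⟨hpp, s, rfl⟩ := isAssociatedPrime_iff.1 hp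
    refine hs ⟨s, ?_, fun a ha => ?_⟩
    · rintro rfl
      exact hpp.ne_top (by ext; simp)
    · simpa [mul_comm] using hle ha

omit [IsNoetherianRing R] in
lemma nontrivial_quotient_span_singleton {x : R} (hx : x ∈ maximalIdeal R) :
    Nontrivial (R ⧸ Ideal.span {x}) := by
  refine Ideal.Quotient.nontrivial_iff.2 fun h => ?_
  rw [Ideal.span_singleton_eq_top] at h
  exact (mem_maximalIdeal x).1 hx h

/-- The residue field is free by the depth zero case, and the maximal ideal annihilates it. -/
lemma maximalIdeal_eq_bot_of_pdle_of_socle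
    (hs : ∃ s : R, s ≠ 0 ∧ ∀ a ∈ maximalIdeal R, s * a = 0) {n : ℕ}
    (h : PDLE R (ResidueField R) n) : maximalIdeal R = ⊥ := by
  obtain ⟨s, hs0, hs⟩ := hs
  have : Module.Projective R (ResidueField R) := projective_of_pdle_of_socle hs0 hs n h
  have : Module.Free R (ResidueField R) := Module.free_of_flat_of_isLocalRing
  obtain ⟨i⟩ : Nonempty (Module.Free.ChooseBasisIndex R (ResidueField R)) := inferInstance
  let b := Module.Free.chooseBasis R (ResidueField R)
  rw [eq_bot_iff]
  intro a ha
  have h0 : a • b i = 0 := by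
    rw [Algebra.smul_def, ResidueField.algebraMap_eq, (residue_eq_zero_iff a).2 ha, zero_mul]
  have := congrArg (fun y => b.repr y i) h0
  simpa using this

-- The maximal ideal is the first syzygy of the residue field. The bound is first weakened to `n +
-- 1`, so that `n = 0` needs no separate treatment.
omit [IsNoetherianRing R] in
lemma pdle_maximalIdeal {n : ℕ} (h : PDLE R (ResidueField R) n) : PDLE R (maximalIdeal R) n := by
  have h1 := (pdle_succ (Algebra.linearMap R (ResidueField R)) residue_surjective n).1
    (h.mono n.le_succ)
  refine h1.equiv (LinearEquiv.ofEq _ _ ?_)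
  ext r
  rw [LinearMap.mem_ker]
  exact residue_eq_zero_iff r

/-- The heart of Serre's theorem. As `x ∉ m²`, a functional on `m / m²` takes the class of `x` to
one, and it splits off the line spanned by `x` in `m / xm`. So the residue field is a direct summand
of `m / xm`, whose projective dimension over `R / x` is bounded by that of `m` over `R`. -/
lemma pdle_residueField_quotient {x : R} (hx : x ∈ maximalIdeal R) (hx0 : x ∈ nonZeroDivisors R)
    (hx2 : x ∉ maximalIdeal R ^ 2) [IsLocalRing (R ⧸ Ideal.span {x})] {n : ℕ}
    (h : PDLE R (ResidueField R) n) :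
    PDLE (R ⧸ Ideal.span {x}) (ResidueField (R ⧸ Ideal.span {x})) n := by
  let R' := R ⧸ Ideal.span {x}
  let m := maximalIdeal R
  let N := m ⧸ (Ideal.span {x} • ⊤ : Submodule R m)
  let π : m →ₗ[R] N := Submodule.mkQ _
  have hπ : Function.Surjective π := Submodule.mkQ_surjective _
  have hπk : ∀ k, π k = 0 → ∃ k', k = x • k' := by
    intro k hk
    rw [← LinearMap.mem_ker, Submodule.ker_mkQ, Submodule.ideal_span_singleton_smul,
      Submodule.mem_smul_pointwise_iff_exists] at hk
    obtain ⟨k', -, hk'⟩ := hk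
    exact ⟨k', hk'.symm⟩
  have hxR : IsSMulRegular R x := fun a b hab => (mul_cancel_left_mem_nonZeroDivisors hx0).1 hab
  have hsurj : Function.Surjective (algebraMap R R') := Ideal.Quotient.mk_surjective
  have hmx0 : algebraMap R R' x = 0 :=
    Ideal.Quotient.eq_zero_iff_mem.2 (Ideal.mem_span_singleton_self x)
  have hker : ∀ r, algebraMap R R' r = 0 → ∃ s, r = x * s := fun r hr =>
    Ideal.mem_span_singleton.1 (Ideal.Quotient.eq_zero_iff_mem.1 hr)
  have hN : PDLE R' N n := by
    refine (pdle_iff_of_isSMulRegular hsurj hker hmx0 hx hxR n (M := m) ?_ π hπ hπk).1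
      (pdle_maximalIdeal h)
    intro k l hkl
    exact Subtype.ext (hxR (congrArg Subtype.val hkl))
  let xm : m := ⟨x, hx⟩
  let v : CotangentSpace R := m.toCotangent xm
  have hv : v ≠ 0 := fun hv => hx2 ((m.toCotangent_eq_zero xm).1 hv)
  obtain ⟨l, hl⟩ := LinearMap.exists_leftInverse_of_injective
    (LinearMap.toSpanSingleton (ResidueField R) (CotangentSpace R) v)
    (LinearMap.ker_toSpanSingleton _ hv)
  have hlv : l v = 1 := by
    have := LinearMap.congr_fun hl 1
    simpa using this
  have hloc : IsLocalHom (Ideal.Quotient.mk (Ideal.span {x})) :=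
    Function.Surjective.isLocalHom _ Ideal.Quotient.mk_surjective
  let ρ : ResidueField R →ₗ[R] ResidueField R' :=
    { toFun := ResidueField.map (Ideal.Quotient.mk (Ideal.span {x}))
      map_add' := map_add _
      map_smul' := fun r y => by
        rw [Algebra.smul_def, map_mul, Algebra.smul_def]
        rfl }
  let q : m →ₗ[R] ResidueField R' := ρ ∘ₗ l.restrictScalars R ∘ₗ m.toCotangent
  have hq : q xm = 1 := by
    change ResidueField.map _ (l v) = 1
    rw [hlv, map_one]
  obtain ⟨r, hr⟩ := exists_desc hsurj hmx0 π hπ hπk q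
  -- Well defined because `a x = x a` lies in `x m` whenever `a` lies in `m`.
  let i : ResidueField R' →ₗ[R'] N := Submodule.liftQ (maximalIdeal R')
    (LinearMap.toSpanSingleton R' N (π xm)) (by
      intro a ha
      obtain ⟨a, rfl⟩ := Ideal.Quotient.mk_surjective a
      have ha' : a ∈ m := by
        by_contra hc
        have hu : IsUnit a := by simpa [m] using hc
        exact (mem_maximalIdeal _).1 ha (hu.map _)
      rw [LinearMap.mem_ker, LinearMap.toSpanSingleton_apply]
      change π (a • xm) = 0
      have : a • xm = x • (⟨a, ha'⟩ : m) := Subtype.ext (mul_comm a x)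
      rw [this, ← LinearMap.mem_ker, Submodule.ker_mkQ]
      exact Submodule.smul_mem_smul (Ideal.mem_span_singleton_self x) trivial)
  refine hN.retract i r ?_
  have h1 : (r ∘ₗ i) 1 = 1 := by
    have h2 : i 1 = π xm := one_smul R' (π xm)
    rw [LinearMap.comp_apply, h2, hr, hq]
  ext a
  obtain ⟨a, rfl⟩ := residue_surjective a
  have h2 : residue R' a = a • (1 : ResidueField R') := by
    rw [Algebra.smul_def, mul_one]; rfl
  rw [h2, map_smul, h1, LinearMap.id_apply]

end Local

/-- Induction on a bound for the dimension. Unless the maximal ideal is zero there is no socle,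
hence there is a regular element `x` outside the square of the maximal ideal. Modulo `x` the residue
field still has finite projective dimension, and the dimension drops by one. -/
lemma isRegularLocalRing_of_pdle_residueField {R : Type u} [CommRing R] [IsLocalRing R]
    [IsNoetherianRing R] {n : ℕ} (h : PDLE R (ResidueField R) n) : IsRegularLocalRing R := by
  obtain ⟨d, hd⟩ : ∃ d : ℕ, ringKrullDim R ≤ d := by
    have := (ringKrullDim_lt_top (R := R))
    exact ⟨(maximalIdeal R).spanFinrank, ringKrullDim_le_spanFinrank_maximalIdeal R⟩
  induction d generalizing R with
  | zero =>
    by_cases hm : maximalIdeal R = ⊥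
    · refine IsRegularLocalRing.of_spanFinrank_maximalIdeal_le R ?_
      rw [hm, Submodule.spanFinrank_bot]
      exact ringKrullDim_nonneg_of_nontrivial
    · by_cases hs : ∃ s : R, s ≠ 0 ∧ ∀ a ∈ maximalIdeal R, s * a = 0
      · exact absurd (maximalIdeal_eq_bot_of_pdle_of_socle hs h) hm
      · obtain ⟨x, hx, hx0, hx2⟩ := exists_mem_nonZeroDivisors_notMem_sq hm hs
        have : Nontrivial (R ⧸ Ideal.span {x}) := nontrivial_quotient_span_singleton hx
        have h1 := ringKrullDim_quotient_span_singleton_succ_eq_ringKrullDim_of_mem_nonZeroDivisors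
          hx0 hx
        have h2 := ringKrullDim_nonneg_of_nontrivial (R := R ⧸ Ideal.span {x})
        have h3 : (0 : WithBot ℕ∞) + 1 ≤ ringKrullDim (R ⧸ Ideal.span {x}) + 1 := by gcongr
        rw [h1] at h3
        exact absurd (h3.trans hd) (by simp)
  | succ d ih =>
    by_cases hm : maximalIdeal R = ⊥
    · refine IsRegularLocalRing.of_spanFinrank_maximalIdeal_le R ?_
      rw [hm, Submodule.spanFinrank_bot]
      exact ringKrullDim_nonneg_of_nontrivial
    · by_cases hs : ∃ s : R, s ≠ 0 ∧ ∀ a ∈ maximalIdeal R, s * a = 0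
      · exact absurd (maximalIdeal_eq_bot_of_pdle_of_socle hs h) hm
      · obtain ⟨x, hx, hx0, hx2⟩ := exists_mem_nonZeroDivisors_notMem_sq hm hs
        have : Nontrivial (R ⧸ Ideal.span {x}) := nontrivial_quotient_span_singleton hx
        have : IsLocalRing (R ⧸ Ideal.span {x}) :=
          IsLocalRing.of_surjective' (Ideal.Quotient.mk _) Ideal.Quotient.mk_surjective
        have h1 := ringKrullDim_quotient_span_singleton_succ_eq_ringKrullDim_of_mem_nonZeroDivisors
          hx0 hx
        have : IsRegularLocalRing (R ⧸ Ideal.span {x}) := by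
          refine ih (pdle_residueField_quotient hx hx0 hx2 h) ?_
          rw [← h1] at hd
          push_cast at hd
          exact (ENat.WithBot.add_le_add_one_right_iff).1 hd
        exact isRegularLocalRing_of_quotient hx hx0

/-- Localizing at `p` turns `R / p` into the residue field of `R_p` and does not raise the
projective dimension. -/
lemma FinitePD.isRegularRing {R : Type u} [CommRing R] [IsNoetherianRing R] (h : FinitePD R) :
    IsRegularRing R := by
  rw [isRegularRing_iff]
  intro p hp
  obtain ⟨n, hn⟩ := h (R ⧸ p)
  have hn' : HasProjectiveDimensionLE (ModuleCat.of R (R ⧸ p)) n := hn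
  have := ModuleCat.localizedModule_hasProjectiveDimensionLE n p.primeCompl
    (ModuleCat.of R (R ⧸ p))
  refine isRegularLocalRing_of_pdle_residueField (n := n) ?_
  let Rp := Localization.AtPrime p
  let J : Submodule Rp Rp := Submodule.localized' Rp p.primeCompl (Algebra.linearMap R Rp) p
  have hJ : J = maximalIdeal Rp := by
    rw [← Localization.AtPrime.map_eq_maximalIdeal]
    exact Ideal.localized'_eq_map Rp p.primeCompl p
  let N : ModuleCat.{u} R := ModuleCat.of R (R ⧸ p)
  have hinst : IsLocalizedModule p.primeCompl (N.localizedModuleMkLinearMap p.primeCompl) :=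
    ModuleCat.localizedModule_isLocalizedModule N p.primeCompl
  let e1 : N.localizedModule p.primeCompl ≃ₗ[R] (Rp ⧸ J) :=
    IsLocalizedModule.linearEquiv p.primeCompl (N.localizedModuleMkLinearMap p.primeCompl)
      (Submodule.toLocalizedQuotient' Rp p.primeCompl (Algebra.linearMap R Rp) p)
  let e2 := LinearEquiv.extendScalarsOfIsLocalization p.primeCompl Rp e1
  have h1 : PDLE Rp ((ModuleCat.of R (R ⧸ p)).localizedModule p.primeCompl) n := this
  exact (h1.equiv e2).equiv (Submodule.quotEquivOfEq J (maximalIdeal Rp) hJ)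

end ProjDim
end

/-! ### Regularity of power series rings at all primes -/

noncomputable section

namespace ProjDim

open IsLocalRing

lemma FinitePD.of_field (k : Type u) [Field k] : FinitePD k := fun _ _ _ _ =>
  ⟨0, pdle_zero.2 inferInstance⟩

lemma FinitePD.powerSeries {A : Type u} [CommRing A] [IsLocalRing A] [IsNoetherianRing A]
    (h : FinitePD A) : FinitePD (PowerSeries A) := by
  have : IsLocalRing (PowerSeries A) := inferInstanceAs (IsLocalRing (MvPowerSeries Unit A))
  let : Algebra (PowerSeries A) A := (PowerSeries.constantCoeff (R := A)).toAlgebra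
  refine FinitePD.of_quotient (R := PowerSeries A) (R' := A) (x := PowerSeries.X) ?_ ?_ ?_ ?_ ?_ h
  · exact PowerSeries.constantCoeff_surj
  · intro r hr
    exact PowerSeries.X_dvd_iff.2 hr
  · exact PowerSeries.constantCoeff_X
  · rw [mem_maximalIdeal, mem_nonunits_iff, PowerSeries.isUnit_iff_constantCoeff,
      PowerSeries.constantCoeff_X]
    exact not_isUnit_zero
  · intro a b hab
    exact PowerSeries.X_mul_cancel hab

lemma FinitePD.mvPowerSeries_fin (k : Type u) [Field k] (n : ℕ) :
    FinitePD (MvPowerSeries (Fin n) k) := by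
  induction n with
  | zero =>
    exact FinitePD.of_ringEquiv (MvPowerSeries.isEmptyEquiv (R := k) (Fin 0)).toRingEquiv.symm
      (FinitePD.of_field k)
  | succ n ih =>
    exact FinitePD.of_ringEquiv (MvPowerSeries.finSuccEquiv k n).toRingEquiv.symm ih.powerSeries

instance isRegularRing_mvPowerSeries (k : Type u) [Field k] (σ : Type) [Finite σ] :
    IsRegularRing (MvPowerSeries σ k) := by
  cases nonempty_fintype σ
  exact ((FinitePD.mvPowerSeries_fin k (Fintype.card σ)).of_ringEquiv
    (MvPowerSeries.renameEquiv k (Fintype.equivFin σ)).toRingEquiv.symm).isRegularRing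

end ProjDim

/-! ### Quotients of regular rings by elements with independent differentials -/

section RegularQuotient

open IsLocalRing

/-- Lifts of a basis of the cotangent space modulo the classes of the `f i` generate the maximal
ideal of the quotient, by Nakayama. So the embedding dimension falls by `r`, while dividing by `r`
elements lowers the dimension by at most `r`. -/
lemma isRegularLocalRing_quotient_of_linearIndependent {B : Type u} [CommRing B]
    [IsRegularLocalRing B] {r : ℕ} (f : Fin r → B) (hf : ∀ i, f i ∈ maximalIdeal B)
    (hli : LinearIndependent (ResidueField B)
      fun i => (maximalIdeal B).toCotangent ⟨f i, hf i⟩) :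
    IsRegularLocalRing (B ⧸ Ideal.span (Set.range f)) := by
  classical
  let m := maximalIdeal B
  let I := Ideal.span (Set.range f)
  have hIm : I ≤ m := Ideal.span_le.2 (by rintro _ ⟨i, rfl⟩; exact hf i)
  have hI : I ≠ ⊤ := ne_top_of_le_ne_top (Ideal.IsPrime.ne_top inferInstance) hIm
  have : Nontrivial (B ⧸ I) := Ideal.Quotient.nontrivial_iff.2 hI
  have : IsLocalRing (B ⧸ I) :=
    IsLocalRing.of_surjective' (Ideal.Quotient.mk _) Ideal.Quotient.mk_surjective
  let k := ResidueField B
  let V := CotangentSpace B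
  let v : Fin r → V := fun i => m.toCotangent ⟨f i, hf i⟩
  let W : Submodule k V := Submodule.span k (Set.range v)
  let n := Module.finrank k (V ⧸ W)
  have hW : Module.finrank k W = r := by
    rw [finrank_span_eq_card hli, Fintype.card_fin]
  have hn : n + r = Module.finrank k V := by
    rw [← hW]; exact Submodule.finrank_quotient_add_finrank W
  let b := Module.finBasis k (V ⧸ W)
  have hw : ∀ i, ∃ w : m, W.mkQ (m.toCotangent w) = b i := fun i => by
    obtain ⟨y, hy⟩ := W.mkQ_surjective (b i)
    obtain ⟨w, hw⟩ := m.toCotangent_surjective y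
    exact ⟨w, by rw [hw, hy]⟩
  choose w hw using hw
  have hgen : m ≤ Ideal.span (Set.range fun i => (w i : B)) ⊔ I := by
    refine Submodule.le_of_le_smul_of_le_jacobson_bot (I := m) (IsNoetherian.noetherian _)
      (IsLocalRing.maximalIdeal_le_jacobson _) ?_
    intro y hy
    let ym : m := ⟨y, hy⟩
    obtain ⟨c, hc⟩ : ∃ c : Fin n → B, W.mkQ (m.toCotangent ym) = ∑ i, residue B (c i) • b i := by
      choose c hc using fun i => residue_surjective (b.repr (W.mkQ (m.toCotangent ym)) i)
      exact ⟨c, by simp_rw [hc]; exact (b.sum_repr _).symm⟩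
    have h1 : m.toCotangent ym - ∑ i, residue B (c i) • m.toCotangent (w i) ∈ W := by
      rw [← W.ker_mkQ, LinearMap.mem_ker, map_sub, map_sum, sub_eq_zero, hc]
      exact Finset.sum_congr rfl fun i _ => by rw [map_smul, hw]
    obtain ⟨e, he⟩ := (Submodule.mem_span_range_iff_exists_fun k).1 h1
    choose e' he' using fun i => residue_surjective (e i)
    have h2 : m.toCotangent (ym - ∑ i, c i • w i - ∑ i, e' i • ⟨f i, hf i⟩) = 0 := by
      rw [map_sub, map_sub, map_sum, map_sum, sub_eq_zero]
      simp_rw [map_smul]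
      have h3 : ∀ (a : B) (z : m), a • m.toCotangent z = residue B a • m.toCotangent z :=
        fun _ _ => rfl
      simp_rw [h3, he']
      exact he.symm
    rw [Ideal.toCotangent_eq_zero] at h2
    rw [smul_eq_mul, ← pow_two]
    refine Submodule.mem_sup.2 ⟨∑ i, c i * w i + ∑ i, e' i * f i, ?_, _, h2, ?_⟩
    · exact Ideal.add_mem _
        (Ideal.mem_sup_left (Ideal.sum_mem _ fun i _ =>
          Ideal.mul_mem_left _ _ (Ideal.subset_span ⟨i, rfl⟩)))
        (Ideal.mem_sup_right (Ideal.sum_mem _ fun i _ =>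
          Ideal.mul_mem_left _ _ (Ideal.subset_span ⟨i, rfl⟩)))
    · simp [ym]
  have hm' : maximalIdeal (B ⧸ I) =
      Ideal.span (Set.range fun i => Ideal.Quotient.mk I (w i : B)) := by
    apply le_antisymm
    · rw [← map_maximalIdeal_of_surjective (Ideal.Quotient.mk I) Ideal.Quotient.mk_surjective]
      refine (Ideal.map_mono hgen).trans ?_
      rw [Ideal.map_sup, Ideal.map_quotient_self, sup_bot_eq, Ideal.map_span, ← Set.range_comp]
      rfl
    · rw [Ideal.span_le, ← map_maximalIdeal_of_surjective (Ideal.Quotient.mk I)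
        Ideal.Quotient.mk_surjective]
      rintro _ ⟨i, rfl⟩
      exact Ideal.mem_map_of_mem _ (w i).2
  have hspan : (maximalIdeal (B ⧸ I)).spanFinrank ≤ n := by
    rw [hm']
    refine (Submodule.spanFinrank_span_le_ncard_of_finite (Set.finite_range _)).trans ?_
    rw [← Set.image_univ]
    refine (Set.ncard_image_le Set.finite_univ).trans ?_
    simp [Set.ncard_univ, n]
  have hdimB : ((n + r : ℕ) : WithBot ℕ∞) = ringKrullDim B := by
    rw [hn]
    exact (IsRegularLocalRing.iff_finrank_cotangentSpace B).1 inferInstance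
  refine IsRegularLocalRing.of_spanFinrank_maximalIdeal_le _ ?_
  have hcard : ringKrullDim B ≤ ringKrullDim (B ⧸ I) + r := by
    have := ringKrullDim_le_ringKrullDim_quotient_add_card (R := B) (s := Finset.univ.image f) (by
      rw [IsLocalRing.ringJacobson_eq_maximalIdeal]
      simpa [Set.subset_def] using hf)
    rw [Finset.coe_image, Finset.coe_univ, Set.image_univ] at this
    refine this.trans ?_
    gcongr
    exact (Finset.card_image_le).trans (by simp)
  rw [← hdimB] at hcard
  push_cast at hcard
  refine le_trans (by exact_mod_cast hspan) (ENat.WithBot.add_le_add_natCast_right_iff.1 hcard)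

/-- A Jacobian criterion without a base field: derivations dual to the `f i` show that their classes
in the cotangent space are independent, at every prime that contains them. -/
lemma isRegularRing_quotient_of_derivation {D : Type u} [CommRing D] [IsRegularRing D] {r : ℕ}
    (f : Fin r → D) (δ : Fin r → Derivation ℤ D D)
    (hδ : ∀ i j, δ i (f j) = if i = j then 1 else 0) :
    IsRegularRing (D ⧸ Ideal.span (Set.range f)) := by
  classical
  let I := Ideal.span (Set.range f)
  rw [isRegularRing_iff]
  intro p hp
  let Q : Ideal D := p.comap (Ideal.Quotient.mk I)
  have : Q.IsPrime := Ideal.IsPrime.comap _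
  let B := Localization.AtPrime Q
  have hfQ : ∀ i, f i ∈ Q := fun i => by
    have : Ideal.Quotient.mk I (f i) = 0 :=
      Ideal.Quotient.eq_zero_iff_mem.2 (Ideal.subset_span ⟨i, rfl⟩)
    change Ideal.Quotient.mk I (f i) ∈ p
    rw [this]; exact p.zero_mem
  let g : Fin r → B := fun i => algebraMap D B (f i)
  have hg : ∀ i, g i ∈ maximalIdeal B := fun i => by
    rw [← Localization.AtPrime.map_eq_maximalIdeal]
    exact Ideal.mem_map_of_mem _ (hfQ i)
  have hli : LinearIndependent (ResidueField B)
      fun i => (maximalIdeal B).toCotangent ⟨g i, hg i⟩ := by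
    rw [Fintype.linearIndependent_iff]
    intro c' hc j
    choose c hc' using fun i => residue_surjective (c' i)
    have h1 : (maximalIdeal B).toCotangent (∑ i, c i • ⟨g i, hg i⟩) = 0 := by
      rw [← hc, map_sum]
      refine Finset.sum_congr rfl fun i _ => ?_
      rw [map_smul, ← hc']
      rfl
    rw [Ideal.toCotangent_eq_zero] at h1
    -- Denominators are cleared because the derivations act on `D` and not on its localization.
    obtain ⟨s, hs⟩ := IsLocalization.exist_integer_multiples_of_finset Q.primeCompl
      (Finset.univ.image c)
    have hs' : ∀ i, ∃ a : D, algebraMap D B a = algebraMap D B s * c i := fun i => by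
      obtain ⟨a, ha⟩ := hs (c i) (by simp)
      exact ⟨a, by rw [ha, Algebra.smul_def]⟩
    choose a ha using hs'
    have h2 : algebraMap D B (∑ i, a i * f i) ∈ (Q ^ 2).map (algebraMap D B) := by
      rw [Ideal.map_pow, Localization.AtPrime.map_eq_maximalIdeal, map_sum]
      have : ∑ i, algebraMap D B (a i * f i) =
          algebraMap D B s * ((∑ i, c i • (⟨g i, hg i⟩ : maximalIdeal B) : maximalIdeal B) : B) := by
        rw [AddSubmonoidClass.coe_finsetSum, Finset.mul_sum]
        refine Finset.sum_congr rfl fun i _ => ?_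
        rw [map_mul, ha]
        simp [g, mul_assoc]
      rw [this]
      exact Ideal.mul_mem_left _ _ h1
    rw [IsLocalization.algebraMap_mem_map_algebraMap_iff Q.primeCompl] at h2
    obtain ⟨t, ht, h3⟩ := h2
    -- By the Leibniz rule. Applied to `t * ∑ a i * f i ∈ Q²` with `t ∉ Q`, this leaves `a j ∈ Q`,
    -- since the `f i` lie in `Q`.
    have hder : ∀ z ∈ Q ^ 2, δ j z ∈ Q := by
      intro z hz
      rw [pow_two] at hz
      refine Submodule.mul_induction_on hz (fun x hx y hy => ?_) (fun x y hx hy => ?_)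
      · rw [Derivation.leibniz]
        exact Q.add_mem (Q.mul_mem_right _ hx) (Q.mul_mem_right _ hy)
      · rw [map_add]; exact Q.add_mem hx hy
    have h4 := hder _ h3
    have hsumQ : ∑ i, a i * f i ∈ Q := Q.sum_mem fun i _ => Q.mul_mem_left _ (hfQ i)
    rw [Derivation.leibniz, map_sum] at h4
    simp only [smul_eq_mul] at h4
    rw [Q.add_mem_iff_left (Q.mul_mem_right _ hsumQ)] at h4
    have h5 := (Ideal.IsPrime.mem_or_mem ‹Q.IsPrime› h4).resolve_left ht
    have h6 : ∑ i, δ j (a i * f i) = a j + ∑ i, f i * δ j (a i) := by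
      simp only [Derivation.leibniz, smul_eq_mul, hδ, Finset.sum_add_distrib]
      simp
    rw [h6, Q.add_mem_iff_left (Q.sum_mem fun i _ => Q.mul_mem_right _ (hfQ i))] at h5
    have h7 : algebraMap D B s * c j ∈ maximalIdeal B := by
      rw [← ha, ← Localization.AtPrime.map_eq_maximalIdeal]
      exact Ideal.mem_map_of_mem _ h5
    have hsu : IsUnit (algebraMap D B s) := IsLocalization.map_units B s
    rw [← hc', residue_eq_zero_iff]
    exact (Ideal.unit_mul_mem_iff_mem _ hsu).1 h7
  have hreg := isRegularLocalRing_quotient_of_linearIndependent g hg hli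
  have hmap : Ideal.span (Set.range g) = I.map (algebraMap D B) := by
    rw [Ideal.map_span, ← Set.range_comp]; rfl
  have hloc : IsLocalization (Algebra.algebraMapSubmonoid (D ⧸ I) Q.primeCompl)
    (B ⧸ I.map (algebraMap D B)) := inferInstance
  have hsub : Algebra.algebraMapSubmonoid (D ⧸ I) Q.primeCompl = p.primeCompl := by
    ext x
    constructor
    · rintro ⟨y, hy, rfl⟩
      exact hy
    · intro hx
      obtain ⟨y, rfl⟩ := Ideal.Quotient.mk_surjective x
      exact ⟨y, hx, rfl⟩
  rw [hsub] at hloc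
  rw [hmap] at hreg
  exact IsRegularLocalRing.of_ringEquiv
    (IsLocalization.algEquiv p.primeCompl (B ⧸ I.map (algebraMap D B))
      (Localization.AtPrime p)).toRingEquiv

end RegularQuotient
end

noncomputable section

namespace SmoothCollection

/-! ### Ideals generated by variables in a power series ring -/

section Variables

variable {σ : Type*} {K : Type*} [Field K]

/-- The ideal of a power series ring generated by the variables in a finite set. -/
def varIdeal (K : Type*) [Field K] (S : Finset σ) : Ideal (MvPowerSeries σ K) :=
  Ideal.span (MvPowerSeries.X '' (S : Set σ))

/-- For the converse, adding a variable `s` to `S`, the terms of `f` free of `s` are handled by `S`,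
and the remaining terms are divisible by `s`. -/
lemma mem_varIdeal_iff (S : Finset σ) (f : MvPowerSeries σ K) :
    f ∈ varIdeal K S ↔ ∀ e : σ →₀ ℕ, (∀ s ∈ S, e s = 0) → MvPowerSeries.coeff e f = 0 := by
  classical
  constructor
  · intro hf
    induction hf using Submodule.span_induction with
    | mem x hx =>
      obtain ⟨s, hs, rfl⟩ := hx
      exact fun e he => MvPowerSeries.X_dvd_iff.1 dvd_rfl e (he s hs)
    | zero => simp
    | add x y _ _ hx hy => exact fun e he => by rw [map_add, hx e he, hy e he, add_zero]
    | smul a x _ hx =>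
      intro e he
      rw [smul_eq_mul, MvPowerSeries.coeff_mul]
      refine Finset.sum_eq_zero fun p hp => ?_
      rw [hx p.2 fun s hs => ?_, mul_zero]
      have h1 := congrArg (fun g : σ →₀ ℕ => g s) (Finset.HasAntidiagonal.mem_antidiagonal.1 hp)
      simp only [Finsupp.add_apply, he s hs] at h1
      lia
  · induction S using Finset.induction_on generalizing f with
    | empty =>
      intro h
      have : f = 0 := MvPowerSeries.ext fun e => h e (by simp)
      rw [this]; exact Ideal.zero_mem _
    | insert s S _ ih =>
      intro h
      let f0 : MvPowerSeries σ K := fun e => if e s = 0 then MvPowerSeries.coeff e f else 0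
      have hf0 : ∀ e, MvPowerSeries.coeff e f0 = if e s = 0 then MvPowerSeries.coeff e f else 0 :=
        fun e => rfl
      have h1 : f0 ∈ varIdeal K S := ih f0 fun e he => by
        rw [hf0]
        split_ifs with hes
        · exact h e fun t ht => by
            rcases Finset.mem_insert.1 ht with rfl | ht
            exacts [hes, he t ht]
        · rfl
      have h2 : MvPowerSeries.X s ∣ f - f0 := MvPowerSeries.X_dvd_iff.2 fun e he => by
        rw [map_sub, hf0, if_pos he, sub_self]
      rw [← sub_add_cancel f f0]
      refine Ideal.add_mem _ (Ideal.mem_of_dvd _ h2 (Ideal.subset_span ⟨s, by simp, rfl⟩)) ?_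
      exact Ideal.span_mono (Set.image_mono (by simp)) h1

lemma X_notMem_varIdeal {S : Finset σ} {s : σ} (hs : s ∉ S) :
    (MvPowerSeries.X s : MvPowerSeries σ K) ∉ varIdeal K S := by
  classical
  rw [mem_varIdeal_iff]
  intro h
  have := h (Finsupp.single s 1) fun t ht => by
    rw [Finsupp.single_apply, if_neg]
    rintro rfl
    exact hs ht
  simp at this

/-- The kernel of the map that sets the variables in `S` to zero, whose target is a domain. -/
instance varIdeal_isPrime (S : Finset σ) : (varIdeal K S).IsPrime := by
  classical
  let e : {s // s ∉ S} ↪ σ := Function.Embedding.subtype _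
  have : varIdeal K S = RingHom.ker (MvPowerSeries.killCompl (R := K) e) := by
    ext f
    rw [mem_varIdeal_iff, RingHom.mem_ker]
    constructor
    · intro h
      ext x
      rw [MvPowerSeries.coeff_killCompl, h _ fun s hs => ?_, map_zero]
      rw [Finsupp.embDomain_of_notMem_range]
      rintro ⟨t, rfl⟩
      exact t.2 hs
    · intro h x hx
      have h1 : x ∈ Set.range (Finsupp.embDomain e) := by
        refine ⟨x.comapDomain e e.injective.injOn, ?_⟩
        refine Finsupp.embDomain_comapDomain fun s hs => ?_
        have : s ∉ S := fun hsS => by simp [hx s hsS] at hs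
        exact ⟨⟨s, this⟩, rfl⟩
      obtain ⟨y, rfl⟩ := h1
      rw [← MvPowerSeries.coeff_killCompl, h, map_zero]
  rw [this]
  have : IsDomain (MvPowerSeries {s // s ∉ S} K) := NoZeroDivisors.to_isDomain _
  exact RingHom.ker_isPrime _

end Variables

/-! ### The ring `RS` is a domain -/

section Domain

variable (K : Type u) [Field K] (d : ℕ)

open MvPowerSeries

/-- The exponent of `x y`. -/
def expXY : Fin (d + 1) ⊕ Fin 2 →₀ ℕ := Finsupp.single (Sum.inr 0) 1 + Finsupp.single (Sum.inr 1) 1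

/-- The exponent of `u_1 ⋯ u_{d+1}`. -/
def expU : Fin (d + 1) ⊕ Fin 2 →₀ ℕ := ∑ j : Fin (d + 1), Finsupp.single (Sum.inl j) 1

lemma expU_inl (j : Fin (d + 1)) : expU d (Sum.inl j) = 1 := by
  classical
  simp [expU, Finsupp.single_apply]

lemma expU_inr (i : Fin 2) : expU d (Sum.inr i) = 0 := by
  simp [expU]

lemma expXY_inl (j : Fin (d + 1)) : expXY d (Sum.inl j) = 0 := by
  simp [expXY]

lemma expXY_inr (i : Fin 2) : expXY d (Sum.inr i) = 1 := by
  fin_cases i <;> simp [expXY]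

lemma equation_eq : equation K d = monomial (expXY d) 1 - monomial (expU d) 1 := by
  have h : ∀ s : Finset (Fin (d + 1)), ∏ j ∈ s, (X (Sum.inl j) : PowerSeriesRing K d) =
      monomial (∑ j ∈ s, Finsupp.single (Sum.inl j) 1) 1 := by
    classical
    intro s
    induction s using Finset.induction_on with
    | empty => simp
    | insert a s ha ih =>
      rw [Finset.prod_insert ha, Finset.sum_insert ha, ih, X, monomial_mul_monomial, one_mul]
  rw [equation, h, X, X, monomial_mul_monomial, one_mul]
  rfl

/-- The coefficients of the quotient of a power series by `x y - u_1 ⋯ u_{d+1}`, computed by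
recursion on the exponent of `u_1`. -/
def divCoeff (f : PowerSeriesRing K d) : ℕ → (Fin (d + 1) ⊕ Fin 2 →₀ ℕ) → K
  | 0, e => coeff (e + expXY d) f
  | n + 1, e => coeff (e + expXY d) f +
      open Classical in if expU d ≤ e then divCoeff f n (e - expU d + expXY d) else 0

/-- The quotient of a power series by `x y - u_1 ⋯ u_{d+1}`. -/
def divEquation (f : PowerSeriesRing K d) : PowerSeriesRing K d :=
  fun e => divCoeff K d f (e (Sum.inl 0)) e

/-- Comparing coefficients at `e + expXY` in `f = (xy - u_1 ⋯ u_{d+1}) q` gives this recursion. It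
terminates because passing from `e` to `e - expU + expXY` lowers the exponent of the first `u`. -/
lemma coeff_divEquation (f : PowerSeriesRing K d) (e : Fin (d + 1) ⊕ Fin 2 →₀ ℕ) :
    coeff e (divEquation K d f) = coeff (e + expXY d) f +
      open Classical in
      if expU d ≤ e then coeff (e - expU d + expXY d) (divEquation K d f) else 0 := by
  change divCoeff K d f (e (Sum.inl 0)) e = _
  have hc : ∀ e, coeff e (divEquation K d f) = divCoeff K d f (e (Sum.inl 0)) e := fun e => rfl
  rw [hc]
  have h0 : (e - expU d + expXY d) (Sum.inl 0) = e (Sum.inl 0) - 1 := by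
    simp [expU_inl, expXY_inl]
  rw [h0]
  rcases hn : e (Sum.inl 0) with _ | n
  · rw [if_neg, divCoeff, add_zero]
    intro hle
    have := hle (Sum.inl 0)
    rw [expU_inl, hn] at this
    lia
  · rw [divCoeff]; rfl

lemma coeff_remainder (f : PowerSeriesRing K d) (e : Fin (d + 1) ⊕ Fin 2 →₀ ℕ)
    (he : expXY d ≤ e) : coeff e (f - equation K d * divEquation K d f) = 0 := by
  classical
  obtain ⟨e, rfl⟩ := exists_add_of_le he
  have hle : expU d ≤ expXY d + e ↔ expU d ≤ e := by
    constructor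
    · intro h s
      have := h s
      rcases s with j | i
      · simpa [expXY_inl] using this
      · rw [expU_inr]; lia
    · exact fun h => h.trans le_add_self
  rw [map_sub, equation_eq, sub_mul, map_sub, coeff_monomial_mul, coeff_monomial_mul, if_pos he,
    one_mul, add_tsub_cancel_left, coeff_divEquation, add_comm e]
  by_cases hU : expU d ≤ e
  · rw [if_pos hU, if_pos (hle.2 hU), one_mul, add_tsub_assoc_of_le hU, add_comm (expXY d) (e - expU d)]
    ring
  · rw [if_neg hU, if_neg (mt hle.1 hU)]
    ring

/-- The exponents of the monomials that parametrize `x y = u_1 ⋯ u_{d+1}`: `u_j` is sent to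
`s_j t_j`, `x` to the product of the `s_j` and `y` to the product of the `t_j`. -/
def coxExp : Fin (d + 1) ⊕ Fin 2 → (Fin (d + 1) × Fin 2 →₀ ℕ)
  | Sum.inl j => Finsupp.single (j, 0) 1 + Finsupp.single (j, 1) 1
  | Sum.inr i => ∑ j : Fin (d + 1), Finsupp.single (j, i) 1

/-- The exponent of the image of a monomial. -/
def coxMap (e : Fin (d + 1) ⊕ Fin 2 →₀ ℕ) : Fin (d + 1) × Fin 2 →₀ ℕ :=
  e.sum fun s n => n • coxExp d s

lemma coxMap_apply (e : Fin (d + 1) ⊕ Fin 2 →₀ ℕ) (j : Fin (d + 1)) (i : Fin 2) :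
    coxMap d e (j, i) = e (Sum.inl j) + e (Sum.inr i) := by
  classical
  rw [coxMap, Finsupp.sum_fintype _ _ (by simp), Finsupp.finsetSum_apply, Fintype.sum_sum_type]
  congr 1
  · rw [Finset.sum_eq_single j]
    · fin_cases i <;> simp [coxExp]
    · intro b _ hb
      simp [coxExp, hb]
    · simp
  · rw [Finset.sum_eq_single i]
    · simp [coxExp, Finsupp.single_apply]
    · intro b _ hb
      simp [coxExp, hb]
    · simp

/-- If `xy` does not divide the monomial, one of the exponents of `x` and `y` is zero. The exponent
of `u_j` is then the smaller of the exponents of `s_j` and `t_j`, and the other exponents follow. -/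
lemma coxMap_injOn {e e' : Fin (d + 1) ⊕ Fin 2 →₀ ℕ} (he : ¬ expXY d ≤ e) (he' : ¬ expXY d ≤ e')
    (h : coxMap d e = coxMap d e') : e = e' := by
  have hz : ∀ e : Fin (d + 1) ⊕ Fin 2 →₀ ℕ, ¬ expXY d ≤ e →
      e (Sum.inr 0) = 0 ∨ e (Sum.inr 1) = 0 := by
    intro e he
    by_contra hcon
    refine he fun s => ?_
    rcases s with j | i
    · simp [expXY_inl]
    · rw [expXY_inr]
      fin_cases i
      · simp only [Fin.zero_eta]; lia
      · simp only [Fin.mk_one]; lia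
  have h1 : ∀ j i, e (Sum.inl j) + e (Sum.inr i) = e' (Sum.inl j) + e' (Sum.inr i) := fun j i => by
    rw [← coxMap_apply, ← coxMap_apply, h]
  have a := hz e he
  have b := hz e' he'
  ext s
  rcases s with j | i
  · have := h1 j 0
    have := h1 j 1
    lia
  · have := h1 0 0
    have := h1 0 1
    fin_cases i
    · simp only [Fin.zero_eta]; lia
    · simp only [Fin.mk_one]; lia

/-- The images of the variables. -/
def coxVar (s : Fin (d + 1) ⊕ Fin 2) : MvPowerSeries (Fin (d + 1) × Fin 2) K :=
  monomial (coxExp d s) 1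

lemma hasSubst_coxVar : HasSubst (coxVar K d) := by
  refine hasSubst_of_constantCoeff_zero fun s => ?_
  classical
  rw [← coeff_zero_eq_constantCoeff_apply, coxVar, coeff_monomial, if_neg]
  intro h
  rcases s with j | i
  · have := congrArg (fun g => g (j, 0)) h
    simp [coxExp] at this
  · have := congrArg (fun g => g (0, i)) h
    simp [coxExp, Finsupp.single_apply] at this

lemma prod_coxVar (e : Fin (d + 1) ⊕ Fin 2 →₀ ℕ) :
    (e.prod fun s n => coxVar K d s ^ n) = monomial (coxMap d e) 1 := by
  have h : ∀ t : Finset (Fin (d + 1) ⊕ Fin 2), ∏ s ∈ t, coxVar K d s ^ e s =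
      monomial (∑ s ∈ t, e s • coxExp d s) 1 := by
    classical
    intro t
    induction t using Finset.induction_on with
    | empty => simp
    | insert a s ha ih =>
      rw [Finset.prod_insert ha, Finset.sum_insert ha, ih, coxVar, monomial_pow, one_pow,
        monomial_mul_monomial, one_mul]
  exact h _

/-- The parametrization of `x y = u_1 ⋯ u_{d+1}` by monomials. -/
def coxHom : PowerSeriesRing K d →ₐ[K] MvPowerSeries (Fin (d + 1) × Fin 2) K :=
  substAlgHom (hasSubst_coxVar K d)

lemma coeff_coxHom (f : PowerSeriesRing K d) (e) :
    coeff e (coxHom K d f) = finsum fun a => open Classical in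
      coeff a f * if e = coxMap d a then 1 else 0 := by
  classical
  rw [coxHom, coe_substAlgHom, coeff_subst (hasSubst_coxVar K d)]
  refine finsum_congr fun a => ?_
  rw [prod_coxVar, coeff_monomial, smul_eq_mul]

lemma coxHom_equation : coxHom K d (equation K d) = 0 := by
  have hX : ∀ s, coxHom K d (X s) = coxVar K d s := fun s => by
    rw [coxHom, coe_substAlgHom, subst_X (hasSubst_coxVar K d)]
  have h : ∀ s : Finset (Fin (d + 1)), ∏ j ∈ s, coxVar K d (Sum.inl j) =
      monomial (∑ j ∈ s, coxExp d (Sum.inl j)) 1 := by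
    classical
    intro s
    induction s using Finset.induction_on with
    | empty => simp
    | insert a s ha ih =>
      rw [Finset.prod_insert ha, Finset.sum_insert ha, ih, coxVar, monomial_mul_monomial, one_mul]
  rw [equation, map_sub, map_mul, map_prod, hX, hX]
  simp_rw [hX]
  rw [h, coxVar, coxVar, monomial_mul_monomial, one_mul, sub_eq_zero]
  congr 1
  simp [coxExp, Finset.sum_add_distrib]

/-- The remainder after division by the equation only involves monomials not divisible by `xy`.
Distinct monomials of this kind have distinct images, so the remainder of an element of the kernel
is zero. -/
lemma ker_coxHom : RingHom.ker (coxHom K d) = Ideal.span {equation K d} := by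
  classical
  apply le_antisymm
  · intro f hf
    rw [RingHom.mem_ker] at hf
    let g := f - equation K d * divEquation K d f
    have hg : coxHom K d g = 0 := by
      rw [map_sub, map_mul, coxHom_equation, hf, zero_mul, sub_zero]
    have hg0 : g = 0 := by
      ext e
      by_cases he : expXY d ≤ e
      · rw [coeff_remainder K d f e he, map_zero]
      · have h1 := coeff_coxHom K d g (coxMap d e)
        rw [hg, map_zero, finsum_eq_single _ e, if_pos rfl, mul_one] at h1
        · rw [← h1, map_zero]
        · intro a ha
          by_cases hea : expXY d ≤ a
          · rw [coeff_remainder K d f a hea, zero_mul]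
          · rw [if_neg, mul_zero]
            exact fun h => ha (coxMap_injOn d hea he h.symm)
    rw [Ideal.mem_span_singleton]
    exact ⟨divEquation K d f, sub_eq_zero.1 hg0⟩
  · rw [Ideal.span_le]
    simpa using coxHom_equation K d

instance : IsDomain (RS K d) := by
  have : (Ideal.span {equation K d}).IsPrime := by
    rw [← ker_coxHom]
    have : IsDomain (MvPowerSeries (Fin (d + 1) × Fin 2) K) := NoZeroDivisors.to_isDomain _
    exact RingHom.ker_isPrime _
  exact Ideal.Quotient.isDomain _

end Domain

end SmoothCollection
end

noncomputable section

namespace SmoothCollection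

/-! ### Prime ideals generated by linear polynomials -/

section LinearPrime

variable {A : Type*} [CommRing A]

lemma mem_sup_singleton {I : Ideal A} {u z : A} :
    z ∈ I ⊔ Ideal.span {u} ↔ ∃ i ∈ I, ∃ r, i + u * r = z := by
  rw [Submodule.mem_sup]
  simp only [Ideal.mem_span_singleton']
  constructor
  · rintro ⟨i, hi, _, ⟨r, rfl⟩, h⟩
    exact ⟨i, hi, r, by rw [← h, mul_comm]⟩
  · rintro ⟨i, hi, r, h⟩
    exact ⟨i, hi, u * r, ⟨r, mul_comm _ _⟩, h⟩

/-- `u` is a non-zero-divisor modulo `I`. -/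
def IsRegMod (I : Ideal A) (u : A) : Prop := ∀ z, u * z ∈ I → z ∈ I

lemma IsRegMod.of_isPrime {I : Ideal A} [I.IsPrime] {u : A} (hu : u ∉ I) : IsRegMod I u :=
  fun _ hz => (Ideal.IsPrime.mem_or_mem ‹_› hz).resolve_left hu

/-- Exchange of two members of a regular sequence. From `u z = i + f r` one gets `r = i' + u s`, and
then `u (z - f s)` lies in `I`. This is the tool that moves `u_j` past the relations of a chart. -/
lemma IsRegMod.swap {I : Ideal A} {u f : A} (hu : IsRegMod I u)
    (hf : IsRegMod (I ⊔ Ideal.span {u}) f) : IsRegMod (I ⊔ Ideal.span {f}) u := by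
  intro z hz
  obtain ⟨i, hi, r, h⟩ := mem_sup_singleton.1 hz
  have h1 : f * r ∈ I ⊔ Ideal.span {u} :=
    mem_sup_singleton.2 ⟨-i, I.neg_mem hi, z, by linear_combination -h⟩
  obtain ⟨i', hi', s, h2⟩ := mem_sup_singleton.1 (hf r h1)
  have h3 : u * (z - f * s) ∈ I := by
    have : u * (z - f * s) = i + f * i' := by rw [mul_sub, ← h, ← h2]; ring
    rw [this]
    exact I.add_mem hi (I.mul_mem_left _ hi')
  exact mem_sup_singleton.2 ⟨_, hu _ h3, s, by ring⟩

lemma IsRegMod.pow_mul {I : Ideal A} {u : A} (hu : IsRegMod I u) (n : ℕ) {z : A}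
    (h : u ^ n * z ∈ I) : z ∈ I := by
  induction n with
  | zero => simpa using h
  | succ n ih => exact ih (hu _ (by rwa [← mul_assoc, ← pow_succ']))

lemma IsRegMod.prod {ι : Type*} {I : Ideal A} (s : Finset ι) {u : ι → A}
    (hu : ∀ i ∈ s, IsRegMod I (u i)) : IsRegMod I (∏ i ∈ s, u i) := by
  classical
  induction s using Finset.induction_on with
  | empty => intro z hz; simpa using hz
  | insert a s ha ih =>
    intro z hz
    rw [Finset.prod_insert ha, mul_assoc] at hz
    exact ih (fun i hi => hu i (by simp [hi])) _ (hu a (by simp) _ hz)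

/-- One factor at a time: if `z = i + (∏ u) r` lies in the next prime, which does not contain the
product, then `r` lies in that prime. -/
lemma mem_sup_prod {ι : Type*} {I : Ideal A} (s : Finset ι) {u : ι → A}
    (hp : ∀ i ∈ s, (I ⊔ Ideal.span {u i}).IsPrime)
    (hu : ∀ i ∈ s, ∀ j ∈ s, i ≠ j → u i ∉ I ⊔ Ideal.span {u j}) {z : A}
    (hz : ∀ i ∈ s, z ∈ I ⊔ Ideal.span {u i}) : z ∈ I ⊔ Ideal.span {∏ i ∈ s, u i} := by
  classical
  induction s using Finset.induction_on with
  | empty => simp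
  | insert a s ha ih =>
    have h1 := ih (fun i hi => hp i (by simp [hi])) (fun i hi j hj =>
      hu i (by simp [hi]) j (by simp [hj])) (fun i hi => hz i (by simp [hi]))
    obtain ⟨i, hi, r, rfl⟩ := mem_sup_singleton.1 h1
    have hpa := hp a (by simp)
    have h2 : (∏ i ∈ s, u i) * r ∈ I ⊔ Ideal.span {u a} := by
      have := Ideal.sub_mem _ (hz a (by simp)) (Ideal.mem_sup_left (T := Ideal.span {u a}) hi)
      rwa [add_sub_cancel_left] at this
    have h3 : r ∈ I ⊔ Ideal.span {u a} := by
      refine (hpa.mem_or_mem h2).resolve_left fun h => ?_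
      obtain ⟨j, hj, h⟩ := (hpa.prod_mem_iff).1 h
      exact hu j (by simp [hj]) a (by simp) (by rintro rfl; exact ha hj) h
    obtain ⟨i', hi', r', rfl⟩ := mem_sup_singleton.1 h3
    refine mem_sup_singleton.2 ⟨i + (∏ i ∈ s, u i) * i', I.add_mem hi (I.mul_mem_left _ hi'), r', ?_⟩
    rw [Finset.prod_insert ha]
    ring

open Polynomial

/-- The ideal of `A[X]` generated by `J` and `a X - b`. -/
def linearIdeal (J : Ideal A) (a b : A) : Ideal A[X] :=
  J.map C ⊔ Ideal.span {C b - C a * X}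

/-- The evaluation is at `b / a` in the fraction field of `A / J`. For `f` in the kernel,
homogenizing puts `b^n` times the leading coefficient in `J + (a)`. As `b` is regular there, the
leading coefficient is `j + a r`, and subtracting `j X^n - r X^(n-1) (b - a X)` lowers the degree.
-/
lemma linearIdeal_eq_ker (J : Ideal A) [J.IsPrime] {a b : A} (ha : a ∉ J)
    (h : IsRegMod (J ⊔ Ideal.span {a}) b) :
    linearIdeal J a b = RingHom.ker (eval₂RingHom
      ((algebraMap (A ⧸ J) (FractionRing (A ⧸ J))).comp (Ideal.Quotient.mk J))
      (algebraMap (A ⧸ J) (FractionRing (A ⧸ J)) (Ideal.Quotient.mk J b) /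
        algebraMap (A ⧸ J) (FractionRing (A ⧸ J)) (Ideal.Quotient.mk J a))) := by
  set ι := (algebraMap (A ⧸ J) (FractionRing (A ⧸ J))).comp (Ideal.Quotient.mk J) with hι
  have hι0 : ∀ z, ι z = 0 ↔ z ∈ J := fun z => by
    rw [hι, RingHom.comp_apply, FaithfulSMul.algebraMap_eq_zero_iff, Ideal.Quotient.eq_zero_iff_mem]
  have ha0 : ι a ≠ 0 := mt (hι0 a).1 ha
  change linearIdeal J a b = RingHom.ker (eval₂RingHom ι (ι b / ι a))
  have hle : linearIdeal J a b ≤ RingHom.ker (eval₂RingHom ι (ι b / ι a)) := by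
    refine sup_le (Ideal.map_le_iff_le_comap.2 fun j hj => ?_) ?_
    · rw [Ideal.mem_comap, RingHom.mem_ker, coe_eval₂RingHom, eval₂_C]
      exact (hι0 j).2 hj
    · rw [Ideal.span_singleton_le_iff_mem, RingHom.mem_ker, coe_eval₂RingHom]
      simp only [eval₂_sub, eval₂_mul, eval₂_C, eval₂_X]
      field_simp
      try ring
  refine le_antisymm hle ?_
  suffices H : ∀ n, ∀ f : A[X], f.natDegree ≤ n → eval₂ ι (ι b / ι a) f = 0 →
      f ∈ linearIdeal J a b from fun f hf => H _ f le_rfl hf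
  intro n
  induction n with
  | zero =>
    intro f hn hf
    rw [eq_C_of_natDegree_le_zero hn, eval₂_C, hι0] at hf
    rw [eq_C_of_natDegree_le_zero hn]
    exact Ideal.mem_sup_left (Ideal.mem_map_of_mem _ hf)
  | succ n ih =>
    intro f hn hf
    by_cases hlt : f.natDegree ≤ n
    · exact ih f hlt hf
    have hdeg : f.natDegree = n + 1 := by lia
    -- `scaleRoots f a` at `b` is `a ^ deg f` times the value of `f` at `b / a`.
    have h1 : eval b (scaleRoots f a) ∈ J := by
      have := scaleRoots_eval₂_mul (p := f) ι (ι b / ι a) a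
      rw [hf, mul_zero, mul_div_cancel₀ _ ha0, eval₂_at_apply, hι0] at this
      exact this
    have h2 : b ^ (n + 1) * f.coeff (n + 1) ∈ J ⊔ Ideal.span {a} := by
      rw [eval_eq_sum_range, natDegree_scaleRoots, hdeg, Finset.sum_range_succ,
        coeff_scaleRoots, hdeg, Nat.sub_self, pow_zero, mul_one] at h1
      rw [mul_comm]
      rw [← add_sub_cancel_left (∑ x ∈ Finset.range (n + 1), (f.scaleRoots a).coeff x * b ^ x)
        (f.coeff (n + 1) * b ^ (n + 1))]
      refine Ideal.sub_mem _ (Ideal.mem_sup_left h1) (Ideal.mem_sup_right ?_)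
      refine Ideal.sum_mem _ fun i hi => ?_
      have hi := Finset.mem_range.1 hi
      rw [coeff_scaleRoots, hdeg, Ideal.mem_span_singleton]
      obtain ⟨m, hm⟩ : ∃ m, n + 1 - i = m + 1 := ⟨n - i, by lia⟩
      rw [hm, pow_succ]
      exact ⟨f.coeff i * a ^ m * b ^ i, by ring⟩
    obtain ⟨j, hj, r, hr⟩ := mem_sup_singleton.1 (h.pow_mul _ h2)
    have h3 : C j * X ^ (n + 1) - C r * X ^ n * (C b - C a * X) ∈ linearIdeal J a b :=
      Ideal.sub_mem _ (Ideal.mul_mem_right _ _ (Ideal.mem_sup_left (Ideal.mem_map_of_mem _ hj)))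
        (Ideal.mul_mem_left _ _ (Ideal.mem_sup_right (Ideal.mem_span_singleton_self _)))
    have h4 : f - (C j * X ^ (n + 1) - C r * X ^ n * (C b - C a * X)) ∈ linearIdeal J a b := by
      refine ih _ ?_ ?_
      · rw [natDegree_le_iff_coeff_eq_zero]
        intro N hN
        have e : f - (C j * X ^ (n + 1) - C r * X ^ n * (C b - C a * X)) =
            f - C (j + a * r) * X ^ (n + 1) + C (r * b) * X ^ n := by
          simp only [C_add, C_mul]; ring
        have hNn : N ≠ n := by lia
        rw [e, coeff_add, coeff_sub, coeff_C_mul_X_pow, coeff_C_mul_X_pow, hr, if_neg hNn, add_zero]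
        by_cases hN' : N = n + 1
        · rw [if_pos hN', hN', sub_self]
        · rw [if_neg hN', coeff_eq_zero_of_natDegree_lt (by lia), sub_zero]
      · rw [eval₂_sub, hf, zero_sub, neg_eq_zero]
        exact hle h3
    have := Ideal.add_mem _ h4 h3
    rwa [sub_add_cancel] at this

lemma linearIdeal_isPrime (J : Ideal A) [J.IsPrime] {a b : A} (ha : a ∉ J)
    (h : IsRegMod (J ⊔ Ideal.span {a}) b) : (linearIdeal J a b).IsPrime := by
  rw [linearIdeal_eq_ker J ha h]
  exact RingHom.ker_isPrime _

lemma C_mem_linearIdeal (J : Ideal A) [J.IsPrime] {a b : A} (ha : a ∉ J)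
    (h : IsRegMod (J ⊔ Ideal.span {a}) b) {r : A} (hr : C r ∈ linearIdeal J a b) : r ∈ J := by
  rw [linearIdeal_eq_ker J ha h, RingHom.mem_ker, coe_eval₂RingHom, eval₂_C] at hr
  rwa [RingHom.comp_apply, FaithfulSMul.algebraMap_eq_zero_iff,
    Ideal.Quotient.eq_zero_iff_mem] at hr

lemma linearIdeal_of_mem {J : Ideal A} {a b : A} (ha : a ∈ J) :
    linearIdeal J a b = (J ⊔ Ideal.span {b}).map C := by
  rw [linearIdeal, Ideal.map_sup, Ideal.map_span, Set.image_singleton]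
  have h1 : C a * X ∈ J.map C := Ideal.mul_mem_right _ _ (Ideal.mem_map_of_mem _ ha)
  apply le_antisymm
  · refine sup_le le_sup_left ?_
    rw [Ideal.span_singleton_le_iff_mem]
    exact Ideal.sub_mem _ (Ideal.mem_sup_right (Ideal.mem_span_singleton_self _))
      (Ideal.mem_sup_left h1)
  · refine sup_le le_sup_left ?_
    rw [Ideal.span_singleton_le_iff_mem]
    have := Ideal.add_mem _ (Ideal.mem_sup_right (S := J.map C)
      (Ideal.mem_span_singleton_self (C b - C a * X))) (Ideal.mem_sup_left h1)
    rwa [sub_add_cancel] at this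

lemma mem_linearIdeal_self (J : Ideal A) (a b : A) : C b - C a * X ∈ linearIdeal J a b :=
  Ideal.mem_sup_right (Ideal.mem_span_singleton_self _)

end LinearPrime

end SmoothCollection
end

noncomputable section

namespace SmoothCollection

/-! ### Presentations of the charts -/

section Presentation

open Polynomial

lemma map_C_sup_X {A : Type*} [CommRing A] (J : Ideal A) :
    J.map (C : A →+* A[X]) ⊔ Ideal.span {X} = J.comap constantCoeff := by
  apply le_antisymm
  · refine sup_le (Ideal.map_le_iff_le_comap.2 fun j hj => ?_) ?_
    · simpa using hj
    · rw [Ideal.span_singleton_le_iff_mem]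
      simp
  · intro z hz
    rw [← divX_mul_X_add z]
    exact Ideal.add_mem _
      (Ideal.mem_sup_right (Ideal.mul_mem_left _ _ (Ideal.mem_span_singleton_self _)))
      (Ideal.mem_sup_left (Ideal.mem_map_of_mem _ hz))

lemma mem_map_iff_of_ker_le {A B : Type*} [CommRing A] [CommRing B] {φ : A →+* B}
    (hφ : Function.Surjective φ) {Q : Ideal A} (hQ : RingHom.ker φ ≤ Q) {a : A} :
    φ a ∈ Q.map φ ↔ a ∈ Q := by
  rw [← Ideal.mem_comap, Ideal.comap_map_of_surjective φ hφ, ← RingHom.ker_eq_comap_bot,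
    sup_eq_left.2 hQ]

/-- The equation of `T_S` follows from the relations of a chart, so charts can be presented over the
power series ring itself. -/
lemma C_sub_mem_relations {P : Type*} [CommRing P] (x y a m b : P) :
    C (C (x * y - a * m * b)) ∈ Ideal.span {C (C y - C b * X)} ⊔
      Ideal.span {C (C x) - C (C a) * X} ⊔ Ideal.span {C (C m) - C X * X} := by
  have e : (C (C (x * y - a * m * b)) : P[X][X]) = C (C y) * (C (C x) - C (C a) * X) +
      C (C a) * X * C (C y - C b * X) - C (C (a * b)) * (C (C m) - C X * X) := by
    simp only [C_sub, C_mul]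
    ring
  rw [e]
  refine Ideal.sub_mem _ (Ideal.add_mem _ ?_ ?_) ?_
  · exact Ideal.mul_mem_left _ _ (Ideal.mem_sup_left (Ideal.mem_sup_right
      (Ideal.mem_span_singleton_self _)))
  · exact Ideal.mul_mem_left _ _ (Ideal.mem_sup_left (Ideal.mem_sup_left
      (Ideal.mem_span_singleton_self _)))
  · exact Ideal.mul_mem_left _ _ (Ideal.mem_sup_right (Ideal.mem_span_singleton_self _))

variable (K : Type u) [Field K] (d : ℕ)

/-- The power series ring `PowerSeriesRing K d`, with its ring structure sealed. -/
def PP : Type u := PowerSeriesRing K d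

instance : CommRing (PP K d) := inferInstanceAs (CommRing (PowerSeriesRing K d))

instance : IsDomain (PP K d) := (NoZeroDivisors.to_isDomain (PowerSeriesRing K d) :)

/-- The variables as elements of `PP K d`. -/
def Xv (s : Fin (d + 1) ⊕ Fin 2) : PP K d := (MvPowerSeries.X s : PowerSeriesRing K d)

/-- The ideal of `PP K d` generated by the variables in a finite set. -/
def vI (S : Finset (Fin (d + 1) ⊕ Fin 2)) : Ideal (PP K d) := Ideal.span (Xv K d '' S)

/-- The projection onto `RS K d`. -/
def toRS : PP K d →+* RS K d :=
  show PowerSeriesRing K d →+* RS K d from Ideal.Quotient.mk _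

lemma toRS_surjective : Function.Surjective (toRS K d) := fun z => by
  obtain ⟨p, hp⟩ := Ideal.Quotient.mk_surjective z
  exact ⟨p, hp⟩

instance vI_isPrime (S : Finset (Fin (d + 1) ⊕ Fin 2)) : (vI K d S).IsPrime :=
  (varIdeal_isPrime S : (varIdeal K S).IsPrime)

variable {K d} in
lemma Xv_mem {S : Finset (Fin (d + 1) ⊕ Fin 2)} {s : Fin (d + 1) ⊕ Fin 2} (hs : s ∈ S) :
    Xv K d s ∈ vI K d S :=
  Ideal.subset_span ⟨s, hs, rfl⟩

variable {K d} in
lemma Xv_notMem {S : Finset (Fin (d + 1) ⊕ Fin 2)} {s : Fin (d + 1) ⊕ Fin 2} (hs : s ∉ S) :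
    Xv K d s ∉ vI K d S :=
  X_notMem_varIdeal (K := K) hs

lemma vI_insert (S : Finset (Fin (d + 1) ⊕ Fin 2)) (s : Fin (d + 1) ⊕ Fin 2) :
    vI K d (insert s S) = vI K d S ⊔ Ideal.span {Xv K d s} := by
  rw [vI, Finset.coe_insert, Set.image_insert_eq, Ideal.span_insert, sup_comm, vI]

lemma vI_pair (s t : Fin (d + 1) ⊕ Fin 2) : vI K d {s, t} = Ideal.span {Xv K d s, Xv K d t} := by
  simp [vI, Set.image_insert_eq]

lemma Xv_ne_zero (s : Fin (d + 1) ⊕ Fin 2) : Xv K d s ≠ 0 :=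
  fun h => Xv_notMem (S := ∅) (by simp) (h ▸ Ideal.zero_mem _)

lemma ker_toRS : RingHom.ker (toRS K d) = Ideal.span {Xv K d (Sum.inr 0) * Xv K d (Sum.inr 1) -
    ∏ j : Fin (d + 1), Xv K d (Sum.inl j)} := by
  have h : RingHom.ker (Ideal.Quotient.mk (Ideal.span {equation K d})) =
    Ideal.span {equation K d} := Ideal.mk_ker
  exact h

/-- The product of the `u_j` with `j` in a finite set. -/
def uProd (S : Finset (Fin (d + 1))) : PP K d :=
  ∏ j ∈ S, Xv K d (Sum.inl j)

lemma uProd_notMem {S : Finset (Fin (d + 1))} {T : Finset (Fin (d + 1) ⊕ Fin 2)}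
    (h : ∀ j ∈ S, Sum.inl j ∉ T) : uProd K d S ∉ vI K d T := by
  rw [uProd, (vI_isPrime K d T).prod_mem_iff]
  rintro ⟨j, hj, hm⟩
  exact Xv_notMem (h j hj) hm

lemma uProd_mem {S : Finset (Fin (d + 1))} {T : Finset (Fin (d + 1) ⊕ Fin 2)} {j : Fin (d + 1)}
    (hj : j ∈ S) (hjT : Sum.inl j ∈ T) : uProd K d S ∈ vI K d T := by
  rw [uProd, (vI_isPrime K d T).prod_mem_iff]
  exact ⟨j, hj, Xv_mem hjT⟩

variable {d}

/-- The indices with a given value. -/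
def part (τ : Fin (d + 1) → Ordering) (o : Ordering) : Finset (Fin (d + 1)) :=
  Finset.univ.filter fun j => τ j = o

@[simp] lemma mem_part {τ : Fin (d + 1) → Ordering} {o : Ordering} {j : Fin (d + 1)} :
    j ∈ part τ o ↔ τ j = o := by
  simp [part]

lemma prod_part {M : Type*} [CommMonoid M] (τ : Fin (d + 1) → Ordering) (f : Fin (d + 1) → M) :
    (∏ j ∈ part τ .lt, f j) * (∏ j ∈ part τ .eq, f j) * (∏ j ∈ part τ .gt, f j) = ∏ j, f j := by
  classical
  rw [← Finset.prod_union, ← Finset.prod_union]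
  · congr 1
    ext j
    simp only [Finset.mem_union, mem_part, Finset.mem_univ, iff_true]
    rcases τ j <;> simp
  · rw [Finset.disjoint_left]
    intro j
    simp only [Finset.mem_union, mem_part]
    rintro (h | h) <;> simp [h]
  · rw [Finset.disjoint_left]
    intro j
    simp only [mem_part]
    intro h
    simp [h]

variable (τ : Fin (d + 1) → Ordering)

/-- The ideal of `P[η]` generated by some variables and `y - u_U η`. -/
def yIdeal (S : Finset (Fin (d + 1) ⊕ Fin 2)) : Ideal (PP K d)[X] :=
  linearIdeal (vI K d S) (uProd K d (part τ .gt)) (Xv K d (Sum.inr 1))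

variable {K} {τ} {S : Finset (Fin (d + 1) ⊕ Fin 2)}

/-- An exchange: `y` is regular modulo the variables in `S`, and `a` is regular once `y` is
adjoined. -/
lemma isRegMod_y (hy : Sum.inr 1 ∉ S) {a : PP K d}
    (ha : a ∉ vI K d (insert (Sum.inr 1) S)) :
    IsRegMod (vI K d S ⊔ Ideal.span {a}) (Xv K d (Sum.inr 1)) := by
  refine IsRegMod.swap (IsRegMod.of_isPrime (Xv_notMem hy)) ?_
  rw [← vI_insert]
  exact IsRegMod.of_isPrime ha

lemma uProd_notMem_insert_inr {T : Finset (Fin (d + 1))} {i : Fin 2}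
    (hU : ∀ k ∈ T, Sum.inl k ∉ S) : uProd K d T ∉ vI K d (insert (Sum.inr i) S) :=
  uProd_notMem K d fun j hj => by simpa using hU j hj

/-- If no factor of `u_U` is in `S`, the linear criterion applies. Otherwise `u_U` vanishes modulo
the variables and the relation degenerates to `y = 0`. -/
lemma yIdeal_isPrime (hy : Sum.inr 1 ∉ S) : (yIdeal K τ S).IsPrime := by
  by_cases hU : ∀ k ∈ part τ .gt, Sum.inl k ∉ S
  · exact linearIdeal_isPrime _ (uProd_notMem K d hU) (isRegMod_y hy (uProd_notMem_insert_inr hU))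
  · push Not at hU
    obtain ⟨k, hk, hkS⟩ := hU
    rw [yIdeal, linearIdeal_of_mem (uProd_mem K d hk hkS), ← vI_insert]
    exact Ideal.isPrime_map_C_of_isPrime

lemma C_mem_yIdeal (hy : Sum.inr 1 ∉ S) (hU : ∀ k ∈ part τ .gt, Sum.inl k ∉ S)
    {r : PP K d} (hr : C r ∈ yIdeal K τ S) : r ∈ vI K d S :=
  C_mem_linearIdeal _ (uProd_notMem K d hU) (isRegMod_y hy (uProd_notMem_insert_inr hU)) hr

lemma yIdeal_of_mem {k : Fin (d + 1)} (hk : k ∈ part τ .gt) (hkS : Sum.inl k ∈ S) :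
    yIdeal K τ S = (vI K d (insert (Sum.inr 1) S)).map C := by
  rw [yIdeal, linearIdeal_of_mem (uProd_mem K d hk hkS), ← vI_insert]

/-- Adjoining `y` weakens the conclusion but makes it valid in the degenerate case as well. -/
lemma C_mem_yIdeal_insert (hy : Sum.inr 1 ∉ S) {r : PP K d}
    (hr : C r ∈ yIdeal K τ S) : r ∈ vI K d (insert (Sum.inr 1) S) := by
  by_cases hU : ∀ k ∈ part τ .gt, Sum.inl k ∉ S
  · rw [vI_insert]
    exact Ideal.mem_sup_left (C_mem_yIdeal hy hU hr)
  · push Not at hU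
    obtain ⟨k, hk, hkS⟩ := hU
    rw [yIdeal_of_mem hk hkS, Ideal.mem_map_C_iff] at hr
    simpa using hr 0

lemma X_notMem_yIdeal (hy : Sum.inr 1 ∉ S) (hU : ∀ k ∈ part τ .gt, Sum.inl k ∉ S) :
    X ∉ yIdeal K τ S := by
  intro h
  refine Xv_notMem hy (C_mem_yIdeal (K := K) (τ := τ) hy hU ?_)
  have := Ideal.add_mem _ (mem_linearIdeal_self (vI K d S) (uProd K d (part τ .gt))
    (Xv K d (Sum.inr 1))) (Ideal.mul_mem_left _ (C (uProd K d (part τ .gt))) h)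
  rwa [sub_add_cancel] at this

lemma yIdeal_insert (s : Fin (d + 1) ⊕ Fin 2) :
    yIdeal K τ (insert s S) = yIdeal K τ S ⊔ Ideal.span {C (Xv K d s)} := by
  rw [yIdeal, yIdeal, linearIdeal, linearIdeal, vI_insert, Ideal.map_sup, Ideal.map_span,
    Set.image_singleton, sup_right_comm]

lemma yIdeal_sup_X :
    yIdeal K τ S ⊔ Ideal.span {X} = (vI K d (insert (Sum.inr 1) S)).comap constantCoeff := by
  rw [← map_C_sup_X, vI_insert, Ideal.map_sup, Ideal.map_span, Set.image_singleton, yIdeal,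
    linearIdeal, sup_assoc, sup_assoc]
  congr 1
  have hX : C (uProd K d (part τ .gt)) * X ∈ Ideal.span {(X : (PP K d)[X])} :=
    Ideal.mul_mem_left _ _ (Ideal.mem_span_singleton_self _)
  apply le_antisymm <;> refine sup_le ?_ le_sup_right <;> rw [Ideal.span_singleton_le_iff_mem]
  · exact Ideal.sub_mem _ (Ideal.mem_sup_left (Ideal.mem_span_singleton_self _))
      (Ideal.mem_sup_right hX)
  · have := Ideal.add_mem _ (Ideal.mem_sup_left (T := Ideal.span {X}) (Ideal.mem_span_singleton_self
      (C (Xv K d (Sum.inr 1)) - C (uProd K d (part τ .gt)) * X))) (Ideal.mem_sup_right hX)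
    rwa [sub_add_cancel] at this

variable (K) (τ)

/-- The relation `y = u_U η`. -/
def relY : (PP K d)[X] :=
  C (Xv K d (Sum.inr 1)) - C (uProd K d (part τ .gt)) * X

/-- The relation `x = u_L ξ`. -/
def relX : (PP K d)[X][X] :=
  C (C (Xv K d (Sum.inr 0))) - C (C (uProd K d (part τ .lt))) * X

/-- The relation `u_M = ξ η`. -/
def relM : (PP K d)[X][X] :=
  C (C (uProd K d (part τ .eq))) - C X * X

/-- The ideal of relations of a chart. -/
def chartIdeal : Ideal (PP K d)[X][X] :=
  Ideal.span {C (relY K τ)} ⊔ Ideal.span {relX K τ} ⊔ Ideal.span {relM K τ}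

variable {K}

lemma map_C_yIdeal : (yIdeal K τ S).map C =
    ((vI K d S).map C).map C ⊔ Ideal.span {C (relY K τ)} := by
  rw [yIdeal, linearIdeal, Ideal.map_sup, Ideal.map_span, Set.image_singleton]; rfl

lemma CC_mem_map_iff {J : Ideal (PP K d)[X]} {r : (PP K d)[X]} :
    C r ∈ J.map (C : _ →+* (PP K d)[X][X]) ↔ r ∈ J := by
  refine ⟨fun h => ?_, fun h => Ideal.mem_map_of_mem _ h⟩
  rw [Ideal.mem_map_C_iff] at h
  simpa using h 0

lemma relY_notMem (hy : Sum.inr 1 ∉ S) : relY K τ ∉ (vI K d S).map C := by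
  rw [Ideal.mem_map_C_iff]
  intro h
  have := h 0
  simp only [relY, coeff_sub, coeff_C_zero, mul_coeff_zero, coeff_X_zero, mul_zero, sub_zero] at this
  exact Xv_notMem hy this

lemma relX_notMem {J : Ideal (PP K d)[X]}
    (h : C (Xv K d (Sum.inr 0)) ∉ J) : relX K τ ∉ J.map C := by
  rw [Ideal.mem_map_C_iff]
  intro h'
  have := h' 0
  simp only [relX, coeff_sub, coeff_C_zero, mul_coeff_zero, coeff_X_zero, mul_zero, sub_zero] at this
  exact h this

variable {τ}

/-- Again an exchange, now of `x` and `u_L`: for `j ∉ L` the variable `u_j` is not a factor of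
`u_L`. -/
lemma isRegMod_x (j : Fin (d + 1)) (hj : τ j ≠ .lt) :
    IsRegMod (yIdeal K τ {Sum.inl j} ⊔ Ideal.span {C (uProd K d (part τ .lt))})
      (C (Xv K d (Sum.inr 0))) := by
  have hy : (Sum.inr 1 : Fin (d + 1) ⊕ Fin 2) ∉ ({Sum.inl j} : Finset _) := by simp
  have h1 := yIdeal_isPrime (K := K) (τ := τ) hy
  have h2 := yIdeal_isPrime (K := K) (τ := τ) (S := insert (Sum.inr 0) {Sum.inl j}) (by simp)
  refine IsRegMod.swap (IsRegMod.of_isPrime fun h => ?_) ?_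
  · exact Xv_notMem (by simp) (C_mem_yIdeal_insert hy h)
  · rw [← yIdeal_insert]
    refine IsRegMod.of_isPrime fun h => uProd_notMem K d ?_ (C_mem_yIdeal_insert (by simp) h)
    intro k hk
    simp only [mem_part] at hk
    simp only [Finset.mem_insert, reduceCtorEq, Sum.inl.injEq, Finset.mem_singleton, false_or]
    rintro rfl
    exact hj hk

lemma uL_notMem (j : Fin (d + 1)) (hj : τ j ≠ .lt) :
    C (uProd K d (part τ .lt)) ∉ yIdeal K τ {Sum.inl j} := fun h => by
  refine uProd_notMem K d ?_ (C_mem_yIdeal_insert (by simp) h)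
  intro k hk
  simp only [mem_part] at hk
  simp only [Finset.mem_insert, reduceCtorEq, Sum.inl.injEq, Finset.mem_singleton, false_or]
  rintro rfl
  exact hj hk

/-- In each case the ideal is prime and must not contain `u_M - ξ η`. For `j ∈ L` the relation for
`x` degenerates to `x = 0`, and the coefficient `-η` of `ξ` is nonzero. For `j ∉ L`, multiplying by
`u_L` and replacing `u_L ξ` by `x` would give the constant `u_L u_M - η x` in the ideal of `u_j` and
`y - u_U η`, which fails both for `j ∈ U` and for `j ∈ M`. -/
lemma isRegMod_relM (j : Fin (d + 1)) :
    IsRegMod (linearIdeal (yIdeal K τ {Sum.inl j}) (C (uProd K d (part τ .lt)))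
      (C (Xv K d (Sum.inr 0)))) (relM K τ) := by
  have hy : (Sum.inr 1 : Fin (d + 1) ⊕ Fin 2) ∉ ({Sum.inl j} : Finset _) := by simp
  have h1 := yIdeal_isPrime (K := K) (τ := τ) hy
  by_cases hj : τ j = .lt
  · have hu : C (uProd K d (part τ .lt)) ∈ yIdeal K τ {Sum.inl j} :=
      Ideal.mem_sup_left (Ideal.mem_map_of_mem C
        (uProd_mem K d (mem_part.2 hj) (Finset.mem_singleton_self _)))
    rw [linearIdeal_of_mem hu, ← yIdeal_insert]
    have h2 := yIdeal_isPrime (K := K) (τ := τ) (S := insert (Sum.inr 0) {Sum.inl j}) (by simp)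
    have h2' : ((yIdeal K τ (insert (Sum.inr 0) {Sum.inl j})).map C).IsPrime :=
      Ideal.isPrime_map_C_of_isPrime
    refine IsRegMod.of_isPrime fun h => ?_
    rw [Ideal.mem_map_C_iff] at h
    have h3 := h 1
    simp only [relM, coeff_sub, coeff_C_mul, coeff_X_one, mul_one, coeff_C_of_ne_zero one_ne_zero,
      zero_sub, neg_mem_iff] at h3
    refine X_notMem_yIdeal (by simp) (fun k hk => ?_) h3
    simp only [mem_part] at hk
    simp only [Finset.mem_insert, reduceCtorEq, Sum.inl.injEq, Finset.mem_singleton, false_or]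
    rintro rfl
    simp [hj] at hk
  have h2 := linearIdeal_isPrime _ (uL_notMem (K := K) j hj) (isRegMod_x j hj)
  refine IsRegMod.of_isPrime fun h => ?_
  set J := linearIdeal (yIdeal K τ {Sum.inl j}) (C (uProd K d (part τ .lt)))
      (C (Xv K d (Sum.inr 0))) with hJ
  have hC : ∀ r, C r ∈ J → r ∈ yIdeal K τ {Sum.inl j} := fun r hr =>
    C_mem_linearIdeal _ (uL_notMem (K := K) j hj) (isRegMod_x j hj) hr
  have hx : C (C (Xv K d (Sum.inr 0))) - C (C (uProd K d (part τ .lt))) * X ∈ J :=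
    mem_linearIdeal_self _ _ _
  have h3 : C (C (uProd K d (part τ .lt)) * C (uProd K d (part τ .eq)) -
      X * C (Xv K d (Sum.inr 0))) ∈ J := by
    have e : C (C (uProd K d (part τ .lt)) * C (uProd K d (part τ .eq)) -
        X * C (Xv K d (Sum.inr 0))) = C (C (uProd K d (part τ .lt))) * relM K τ -
        C X * (C (C (Xv K d (Sum.inr 0))) - C (C (uProd K d (part τ .lt))) * X) := by
      rw [relM, C_sub, C_mul, C_mul]
      ring
    rw [e]
    exact Ideal.sub_mem _ (Ideal.mul_mem_left _ _ h) (Ideal.mul_mem_left _ _ hx)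
  have h4 := hC _ h3
  by_cases hU : τ j = .gt
  · rw [yIdeal_of_mem (mem_part.2 hU) (Finset.mem_singleton_self _), Ideal.mem_map_C_iff] at h4
    have h5 := h4 1
    rw [← C_mul, mul_comm X, coeff_sub, coeff_C_mul, coeff_X_one, mul_one,
      coeff_C_of_ne_zero one_ne_zero, zero_sub, neg_mem_iff] at h5
    exact Xv_notMem (by simp) h5
  · have hM : τ j = .eq := by rcases h : τ j <;> simp_all
    have h5 : C (uProd K d (part τ .lt)) * C (uProd K d (part τ .eq)) ∈
        yIdeal K τ {Sum.inl j} :=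
      Ideal.mul_mem_left _ _ (Ideal.mem_sup_left (Ideal.mem_map_of_mem C
        (uProd_mem K d (mem_part.2 hM) (Finset.mem_singleton_self _))))
    have h6 := Ideal.sub_mem _ h5 h4
    rw [sub_sub_cancel] at h6
    rcases h1.mem_or_mem h6 with h7 | h7
    · refine X_notMem_yIdeal hy (fun k hk => ?_) h7
      simp only [mem_part] at hk
      simp only [Sum.inl.injEq, Finset.mem_singleton]
      rintro rfl
      exact hU hk
    · exact Xv_notMem (by simp) (C_mem_yIdeal_insert hy h7)

/-- Each relation is regular modulo `u_j` and the relations before it, so three exchanges carry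
`u_j` to the end of the sequence. -/
lemma isRegMod_chartIdeal (j : Fin (d + 1)) :
    IsRegMod (chartIdeal K τ) (C (C (Xv K d (Sum.inl j) : PP K d))) := by
  have hy : (Sum.inr 1 : Fin (d + 1) ⊕ Fin 2) ∉ ({Sum.inl j} : Finset _) := by simp
  have e0 : ((vI K d {Sum.inl j}).map C).map C =
      Ideal.span {(C (C (Xv K d (Sum.inl j))) : (PP K d)[X][X])} := by
    simp [vI, Ideal.map_span]
  have h0 := vI_isPrime K d {(Sum.inl j : Fin (d + 1) ⊕ Fin 2)}
  have hp0 : (((vI K d {(Sum.inl j : Fin (d + 1) ⊕ Fin 2)}).map C).map C).IsPrime :=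
    Ideal.isPrime_map_C_of_isPrime
  have h1 := yIdeal_isPrime (K := K) (τ := τ) hy
  have hp1 : ((yIdeal K τ {Sum.inl j}).map C).IsPrime := Ideal.isPrime_map_C_of_isPrime
  have s0 : IsRegMod (⊥ : Ideal (PP K d)[X][X])
      (C (C (Xv K d (Sum.inl j) : PP K d))) := by
    intro z hz
    rw [Ideal.mem_bot] at hz ⊢
    exact (mul_eq_zero.1 hz).resolve_left
      (C_ne_zero.2 (C_ne_zero.2 (Xv_ne_zero K d _)))
  have s1 : IsRegMod (Ideal.span {C (relY K τ)})
      (C (C (Xv K d (Sum.inl j) : PP K d))) := by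
    have := s0.swap (f := C (relY K τ)) (by
      rw [bot_sup_eq, ← e0]
      exact IsRegMod.of_isPrime fun h => relY_notMem τ hy (CC_mem_map_iff.1 h))
    rwa [bot_sup_eq] at this
  have s2 := s1.swap (f := relX K τ) (by
    rw [sup_comm, ← e0, ← map_C_yIdeal]
    exact IsRegMod.of_isPrime (relX_notMem τ fun h =>
      Xv_notMem (by simp) (C_mem_yIdeal_insert hy h)))
  refine s2.swap (f := relM K τ) ?_
  have := isRegMod_relM (K := K) (τ := τ) j
  rwa [linearIdeal, map_C_yIdeal, e0, sup_comm (Ideal.span {C (C _)}), sup_right_comm] at this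

end Presentation

end SmoothCollection
end

noncomputable section

namespace SmoothCollection

/-! ### The charts as subrings of the function field -/

section Chart

open Polynomial

/-- The inner variable is `η` and the outer one `ξ`. Modulo the relations `b η = y` and `a ξ = x`,
so a power of `ab` clears both variables. The property passes to sums and products and is checked on
generators. -/
lemma exists_pow_mul_sub_mem {P : Type*} [CommRing P] (x y a m b : P) (g : P[X][X]) :
    ∃ (N : ℕ) (p : P), C (C ((a * b) ^ N)) * g - C (C p) ∈ Ideal.span {C (C y - C b * X)} ⊔
      Ideal.span {C (C x) - C (C a) * X} ⊔ Ideal.span {C (C m) - C X * X} := by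
  set I := Ideal.span {C (C y - C b * X)} ⊔
      Ideal.span {C (C x) - C (C a) * X} ⊔ Ideal.span {C (C m) - C X * X} with hI
  have h1 : C (C y - C b * X) ∈ I :=
    Ideal.mem_sup_left (Ideal.mem_sup_left (Ideal.mem_span_singleton_self _))
  have h2 : C (C x) - C (C a) * X ∈ I :=
    Ideal.mem_sup_left (Ideal.mem_sup_right (Ideal.mem_span_singleton_self _))
  have hadd : ∀ g h : P[X][X], (∃ (N : ℕ) (p : P), C (C ((a * b) ^ N)) * g - C (C p) ∈ I) →
      (∃ (N : ℕ) (p : P), C (C ((a * b) ^ N)) * h - C (C p) ∈ I) →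
      ∃ (N : ℕ) (p : P), C (C ((a * b) ^ N)) * (g + h) - C (C p) ∈ I := by
    rintro g h ⟨N, p, hg⟩ ⟨M, q, hh⟩
    refine ⟨N + M, (a * b) ^ M * p + (a * b) ^ N * q, ?_⟩
    have := Ideal.add_mem _ (Ideal.mul_mem_left _ (C (C ((a * b) ^ M))) hg)
      (Ideal.mul_mem_left _ (C (C ((a * b) ^ N))) hh)
    convert this using 1
    simp only [C_add, C_mul, pow_add]
    ring
  have hmul : ∀ g h : P[X][X], (∃ (N : ℕ) (p : P), C (C ((a * b) ^ N)) * g - C (C p) ∈ I) →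
      (∃ (N : ℕ) (p : P), C (C ((a * b) ^ N)) * h - C (C p) ∈ I) →
      ∃ (N : ℕ) (p : P), C (C ((a * b) ^ N)) * (g * h) - C (C p) ∈ I := by
    rintro g h ⟨N, p, hg⟩ ⟨M, q, hh⟩
    refine ⟨N + M, p * q, ?_⟩
    have := Ideal.add_mem _ (Ideal.mul_mem_left _ (C (C ((a * b) ^ M)) * h) hg)
      (Ideal.mul_mem_left _ (C (C p)) hh)
    convert this using 1
    simp only [C_mul, pow_add]
    ring
  have hC : ∀ p : P, ∃ (N : ℕ) (q : P), C (C ((a * b) ^ N)) * C (C p) - C (C q) ∈ I := fun p =>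
    ⟨0, p, by simp⟩
  have hX : ∃ (N : ℕ) (q : P), C (C ((a * b) ^ N)) * X - C (C q) ∈ I := by
    refine ⟨1, b * x, ?_⟩
    have := Ideal.neg_mem_iff _ |>.2 (Ideal.mul_mem_left _ (C (C b)) h2)
    convert this using 1
    simp only [C_mul, pow_one]
    ring
  have hCX : ∃ (N : ℕ) (q : P), C (C ((a * b) ^ N)) * C X - C (C q) ∈ I := by
    refine ⟨1, a * y, ?_⟩
    have := Ideal.neg_mem_iff _ |>.2 (Ideal.mul_mem_left _ (C (C a)) h1)
    convert this using 1
    simp only [C_mul, pow_one, C_sub]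
    ring
  have hpow : ∀ (g : P[X][X]) (n : ℕ), (∃ (N : ℕ) (p : P), C (C ((a * b) ^ N)) * g - C (C p) ∈ I) →
      ∃ (N : ℕ) (p : P), C (C ((a * b) ^ N)) * g ^ n - C (C p) ∈ I := by
    intro g n hg
    induction n with
    | zero => simpa using hC 1
    | succ n ih => rw [pow_succ]; exact hmul _ _ ih hg
  induction g using Polynomial.induction_on' with
  | add p q hp hq => exact hadd _ _ hp hq
  | monomial n f =>
    rw [← C_mul_X_pow_eq_monomial]
    refine hmul _ _ ?_ (hpow _ _ hX)
    induction f using Polynomial.induction_on' with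
    | add p q hp hq => rw [C_add]; exact hadd _ _ hp hq
    | monomial n f =>
      rw [← C_mul_X_pow_eq_monomial, C_mul, C_pow]
      exact hmul _ _ (hC f) (hpow _ _ hCX)

/-- A power of `ab` turns an element of the kernel into a constant killed by `φ`, that is, a
multiple of the defining equation, which lies in the ideal. Regularity of `a` and `b` then cancels
the power. -/
lemma ker_eval₂_eq_relations {P F : Type*} [CommRing P] [Field F] (φ : P →+* F)
    (x y a m b : P) (hφ : RingHom.ker φ = Ideal.span {x * y - a * m * b})
    (ha : φ a ≠ 0) (hb : φ b ≠ 0) (hra : IsRegMod (Ideal.span {C (C y - C b * X)} ⊔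
      Ideal.span {C (C x) - C (C a) * X} ⊔ Ideal.span {C (C m) - C X * X}) (C (C a)))
    (hrb : IsRegMod (Ideal.span {C (C y - C b * X)} ⊔
      Ideal.span {C (C x) - C (C a) * X} ⊔ Ideal.span {C (C m) - C X * X}) (C (C b))) :
    RingHom.ker (eval₂RingHom (eval₂RingHom φ (φ y / φ b)) (φ x / φ a)) =
      Ideal.span {C (C y - C b * X)} ⊔
      Ideal.span {C (C x) - C (C a) * X} ⊔ Ideal.span {C (C m) - C X * X} := by
  set I := Ideal.span {C (C y - C b * X)} ⊔
      Ideal.span {C (C x) - C (C a) * X} ⊔ Ideal.span {C (C m) - C X * X} with hI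
  have hle : I ≤ RingHom.ker (eval₂RingHom (eval₂RingHom φ (φ y / φ b)) (φ x / φ a)) := by
    have hrel : φ x * φ y - φ a * φ m * φ b = 0 := by
      have : x * y - a * m * b ∈ RingHom.ker φ := hφ ▸ Ideal.mem_span_singleton_self _
      simpa using this
    refine sup_le (sup_le ?_ ?_) ?_ <;>
      rw [Ideal.span_singleton_le_iff_mem, RingHom.mem_ker] <;> simp
    · field_simp; simp
    · field_simp; simp
    · field_simp
      linear_combination -hrel
  refine le_antisymm (fun g hg => ?_) hle
  obtain ⟨N, p, h⟩ := exists_pow_mul_sub_mem x y a m b g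
  have h1 := hle h
  rw [RingHom.mem_ker, map_sub, map_mul, RingHom.mem_ker.1 hg, mul_zero, zero_sub,
    neg_eq_zero] at h1
  have h2 : p ∈ RingHom.ker φ := by simpa using h1
  rw [hφ, Ideal.mem_span_singleton'] at h2
  obtain ⟨q, rfl⟩ := h2
  have h3 : C (C ((a * b) ^ N)) * g ∈ I := by
    have := Ideal.add_mem _ h
      (Ideal.mul_mem_left _ (C (C q)) (C_sub_mem_relations x y a m b))
    rwa [C_mul, C_mul, sub_add_cancel] at this
  rw [mul_pow, C_mul, C_mul, C_pow, C_pow, C_pow, C_pow, mul_assoc] at h3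
  exact hrb.pow_mul N (hra.pow_mul N h3)

/-- As `u` divides `a`, killing `u` turns `x = a ξ` into `x = 0`. What remains is a tower of two
linear ideals, to which the primality criterion applies. -/
lemma linearIdeal_eq_relations {P : Type*} [CommRing P] (x y a m b u : P) (hu : u ∣ a) :
    linearIdeal (linearIdeal (Ideal.span {x, u}) b y) X (C m) =
      Ideal.span {C (C y - C b * X)} ⊔ Ideal.span {C (C x) - C (C a) * X} ⊔
        Ideal.span {C (C m) - C X * X} ⊔ Ideal.span {C (C u)} := by
  obtain ⟨a, rfl⟩ := hu
  have e1 : C (C x) - C (C (u * a)) * X + C (C a) * X * C (C u) = C (C x) := by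
    simp only [C_mul]; ring
  have e2 : C (C x) - C (C a) * X * C (C u) = C (C x) - C (C (u * a)) * X := by
    simp only [C_mul]; ring
  simp only [linearIdeal, Ideal.map_span, Set.image_insert_eq, Set.image_singleton,
    ← Ideal.span_union, Set.union_singleton]
  apply le_antisymm <;> rw [Ideal.span_le] <;> rintro g hg <;>
    simp only [Set.mem_insert_iff, Set.mem_singleton_iff] at hg <;> rw [SetLike.mem_coe] <;>
    rcases hg with rfl | rfl | rfl | rfl <;> try (apply Ideal.subset_span; simp; done)
  · have := Ideal.add_mem _ (Ideal.subset_span (s := {C (C u), C (C m) - C X * X,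
      C (C x) - C (C (u * a)) * X, C (C y - C b * X)}) (a := C (C x) - C (C (u * a)) * X) (by simp))
      (Ideal.mul_mem_left _ (C (C a) * X) (Ideal.subset_span (a := C (C u)) (by simp)))
    rwa [e1] at this
  · have := Ideal.sub_mem _ (Ideal.subset_span (s := {C (C m) - C X * X, C (C y - C b * X),
      C (C x), C (C u)}) (a := C (C x)) (by simp))
      (Ideal.mul_mem_left _ (C (C a) * X) (Ideal.subset_span (a := C (C u)) (by simp)))
    rwa [e2] at this

/-- As `u` divides `m`, killing `u` and `ξ` makes `m = ξ η` trivial and turns `x = a ξ` into `x =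
0`. -/
lemma map_C_sup_X_eq_relations {P : Type*} [CommRing P] (x y a m b u : P) (hu : u ∣ m) :
    (linearIdeal (Ideal.span {x, u}) b y).map C ⊔ Ideal.span {X} =
      Ideal.span {C (C y - C b * X)} ⊔ Ideal.span {C (C x) - C (C a) * X} ⊔
        Ideal.span {C (C m) - C X * X} ⊔ (Ideal.span {X} ⊔ Ideal.span {C (C u)}) := by
  obtain ⟨m, rfl⟩ := hu
  have eL : (linearIdeal (Ideal.span {x, u}) b y).map C ⊔ Ideal.span {X} =
      Ideal.span {C (C x), C (C u), C (C y - C b * X), X} := by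
    simp only [linearIdeal, Ideal.map_span, Set.image_insert_eq, Set.image_union,
      Set.image_singleton, ← Ideal.span_union]
    congr 1
    ext g
    simp only [Set.mem_union, Set.mem_insert_iff, Set.mem_singleton_iff, or_assoc, or_comm,
      or_left_comm]
  have eR : Ideal.span {C (C y - C b * X)} ⊔ Ideal.span {C (C x) - C (C a) * X} ⊔
        Ideal.span {C (C (u * m)) - C X * X} ⊔ (Ideal.span {X} ⊔ Ideal.span {C (C u)}) =
      Ideal.span {C (C y - C b * X), C (C x) - C (C a) * X, C (C (u * m)) - C X * X, X,
        C (C u)} := by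
    simp only [← Ideal.span_union]
    congr 1
    ext g
    simp only [Set.mem_union, Set.mem_insert_iff, Set.mem_singleton_iff, or_assoc, or_comm,
      or_left_comm]
  rw [eL, eR]
  apply le_antisymm <;> rw [Ideal.span_le] <;> intro g hg <;>
    simp only [Set.mem_insert_iff, Set.mem_singleton_iff] at hg
  · obtain rfl | rfl | rfl | rfl := hg
    · have := Ideal.add_mem _ (Ideal.subset_span (s := {C (C y - C b * X),
        C (C x) - C (C a) * X, C (C (u * m)) - C X * X, X, C (C u)})
        (a := C (C x) - C (C a) * X) (by simp))
        (Ideal.mul_mem_left _ (C (C a)) (Ideal.subset_span (a := X) (by simp)))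
      rwa [sub_add_cancel] at this
    all_goals exact Ideal.subset_span (by simp)
  · obtain rfl | rfl | rfl | rfl | rfl := hg
    · exact Ideal.subset_span (by simp)
    · exact Ideal.sub_mem _ (Ideal.subset_span (by simp))
        (Ideal.mul_mem_left _ _ (Ideal.subset_span (by simp)))
    · rw [C_mul, C_mul, mul_comm (C (C u))]
      exact Ideal.sub_mem _ (Ideal.mul_mem_left _ _ (Ideal.subset_span (by simp)))
        (Ideal.mul_mem_left _ _ (Ideal.subset_span (by simp)))
    all_goals exact Ideal.subset_span (by simp)

variable (K : Type u) [Field K] (d : ℕ)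

/-- The field of fractions of `RS K d`. -/
def FF : Type u := FractionRing (RS K d)

instance : Field (FF K d) := inferInstanceAs (Field (FractionRing (RS K d)))

instance : Algebra (RS K d) (FF K d) := inferInstanceAs (Algebra (RS K d) (FractionRing (RS K d)))

instance : IsFractionRing (RS K d) (FF K d) :=
  inferInstanceAs (IsFractionRing (RS K d) (FractionRing (RS K d)))

/-- The class of `y`. -/
def yVar : RS K d := toRS K d (Xv K d (Sum.inr 1))

lemma toRS_Xv_ne_zero (s : Fin (d + 1) ⊕ Fin 2) : toRS K d (Xv K d s) ≠ 0 := by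
  change (Ideal.Quotient.mk (Ideal.span {equation K d}) (MvPowerSeries.X s)) ≠ 0
  rw [Ne, Ideal.Quotient.eq_zero_iff_mem, ← ker_coxHom, RingHom.mem_ker, coxHom,
    MvPowerSeries.coe_substAlgHom, MvPowerSeries.subst_X (hasSubst_coxVar K d), coxVar]
  intro h
  have := congrArg (MvPowerSeries.coeff (coxExp d s)) h
  simp at this

lemma uVar_ne_zero (j : Fin (d + 1)) : uVar K d j ≠ 0 := toRS_Xv_ne_zero K d _

lemma xVar_ne_zero : xVar K d ≠ 0 := toRS_Xv_ne_zero K d _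

lemma yVar_ne_zero : yVar K d ≠ 0 := toRS_Xv_ne_zero K d _

lemma xVar_mul_yVar : xVar K d * yVar K d = ∏ j, uVar K d j := by
  have h : Xv K d (Sum.inr 0) * Xv K d (Sum.inr 1) - ∏ j : Fin (d + 1), Xv K d (Sum.inl j) ∈
      RingHom.ker (toRS K d) := by
    rw [ker_toRS]
    exact Ideal.mem_span_singleton_self _
  rw [RingHom.mem_ker, map_sub, map_mul, map_prod, sub_eq_zero] at h
  exact h

/-- The images of the products of the `u_j` in the function field. -/
def uK (S : Finset (Fin (d + 1))) : FF K d := algebraMap (RS K d) (FF K d) (∏ j ∈ S, uVar K d j)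

variable {K d} in
lemma uK_ne_zero (S : Finset (Fin (d + 1))) : uK K d S ≠ 0 := by
  rw [uK, Ne, FaithfulSMul.algebraMap_eq_zero_iff, Finset.prod_eq_zero_iff]
  rintro ⟨j, _, h⟩
  exact uVar_ne_zero K d j h

/-- The image of `x` in the function field. -/
def xK : FF K d := algebraMap (RS K d) (FF K d) (xVar K d)

/-- The image of `y` in the function field. -/
def yK : FF K d := algebraMap (RS K d) (FF K d) (yVar K d)

lemma xK_ne_zero : xK K d ≠ 0 := (FaithfulSMul.algebraMap_eq_zero_iff _ _).not.2 (xVar_ne_zero K d)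

lemma yK_ne_zero : yK K d ≠ 0 := (FaithfulSMul.algebraMap_eq_zero_iff _ _).not.2 (yVar_ne_zero K d)

variable {d} (τ : Fin (d + 1) → Ordering)

lemma xK_mul_yK : xK K d * yK K d =
    uK K d (part τ .lt) * uK K d (part τ .eq) * uK K d (part τ .gt) := by
  rw [xK, yK, uK, uK, uK, ← map_mul, ← map_mul, ← map_mul, prod_part, xVar_mul_yVar]

/-- The coordinate `ξ = x / u_L`. -/
def xi : FF K d := xK K d / uK K d (part τ .lt)

/-- The coordinate `η = y / u_U`. -/
def eta : FF K d := yK K d / uK K d (part τ .gt)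

lemma xi_ne_zero : xi K τ ≠ 0 := div_ne_zero (xK_ne_zero K d) (uK_ne_zero _)

lemma eta_ne_zero : eta K τ ≠ 0 := div_ne_zero (yK_ne_zero K d) (uK_ne_zero _)

lemma uK_mul_xi : uK K d (part τ .lt) * xi K τ = xK K d := mul_div_cancel₀ _ (uK_ne_zero _)

lemma uK_mul_eta : uK K d (part τ .gt) * eta K τ = yK K d := mul_div_cancel₀ _ (uK_ne_zero _)

lemma xi_mul_eta : xi K τ * eta K τ = uK K d (part τ .eq) := by
  rw [xi, eta, div_mul_div_comm, xK_mul_yK K τ, div_eq_iff]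
  · ring
  · exact mul_ne_zero (uK_ne_zero _) (uK_ne_zero _)

/-- The coordinate ring of a chart, as a subring of the function field. -/
def chart : Subalgebra (RS K d) (FF K d) := Algebra.adjoin (RS K d) {xi K τ, eta K τ}

lemma xi_mem : xi K τ ∈ chart K τ := Algebra.subset_adjoin (by simp)

lemma eta_mem : eta K τ ∈ chart K τ := Algebra.subset_adjoin (by simp)

/-- The map from the polynomial ring to the function field defining a chart. -/
def evalHom : (PP K d)[X][X] →+* FF K d :=
  eval₂RingHom (eval₂RingHom ((algebraMap (RS K d) (FF K d)).comp (toRS K d))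
    (eta K τ)) (xi K τ)

@[simp] lemma evalHom_C_C (p : PP K d) :
    evalHom K τ (C (C p)) = algebraMap (RS K d) (FF K d) (toRS K d p) := by
  simp [evalHom]

@[simp] lemma evalHom_C_X : evalHom K τ (C X) = eta K τ := by simp [evalHom]

@[simp] lemma evalHom_X : evalHom K τ X = xi K τ := by simp [evalHom]

lemma range_evalHom (z : FF K d) : z ∈ chart K τ ↔ ∃ g, evalHom K τ g = z := by
  constructor
  · intro hz
    induction hz using Algebra.adjoin_induction with
    | mem x hx =>
      rcases hx with rfl | rfl
      exacts [⟨_, evalHom_X K τ⟩, ⟨_, evalHom_C_X K τ⟩]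
    | algebraMap r =>
      obtain ⟨p, rfl⟩ := toRS_surjective K d r
      exact ⟨_, evalHom_C_C K τ p⟩
    | add x y _ _ hx hy =>
      obtain ⟨a, rfl⟩ := hx
      obtain ⟨b, rfl⟩ := hy
      exact ⟨a + b, map_add _ _ _⟩
    | mul x y _ _ hx hy =>
      obtain ⟨a, rfl⟩ := hx
      obtain ⟨b, rfl⟩ := hy
      exact ⟨a * b, map_mul _ _ _⟩
  · rintro ⟨g, rfl⟩
    induction g using Polynomial.induction_on' with
    | add p q hp hq => rw [map_add]; exact add_mem hp hq
    | monomial n a =>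
      rw [← C_mul_X_pow_eq_monomial, map_mul, map_pow, evalHom_X]
      refine mul_mem ?_ (pow_mem (xi_mem K τ) _)
      induction a using Polynomial.induction_on' with
      | add p q hp hq => rw [C_add, map_add]; exact add_mem hp hq
      | monomial n a =>
        rw [← C_mul_X_pow_eq_monomial, C_mul, C_pow, map_mul, map_pow, evalHom_C_X, evalHom_C_C]
        exact mul_mem (Subalgebra.algebraMap_mem _ _) (pow_mem (eta_mem K τ) _)

/-- The relations certainly generate the kernel after inverting the `u_j`; since these are regular
modulo the relations, nothing is missing. -/
lemma ker_evalHom : RingHom.ker (evalHom K τ) = chartIdeal K τ := by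
  have hI : ∀ S, IsRegMod (chartIdeal K τ) (C (C (uProd K d S))) := fun S => by
    have := IsRegMod.prod S fun j _ => isRegMod_chartIdeal (K := K) (τ := τ) j
    rwa [← map_prod, ← map_prod] at this
  have hu : ∀ S, ((algebraMap (RS K d) (FF K d)).comp (toRS K d)) (uProd K d S) =
      uK K d S := fun S => by
    rw [RingHom.comp_apply, uProd, map_prod]
    rfl
  have h := ker_eval₂_eq_relations ((algebraMap (RS K d) (FF K d)).comp (toRS K d))
    (Xv K d (Sum.inr 0)) (Xv K d (Sum.inr 1)) (uProd K d (part τ .lt))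
    (uProd K d (part τ .eq)) (uProd K d (part τ .gt)) ?_ (by rw [hu]; exact uK_ne_zero _)
    (by rw [hu]; exact uK_ne_zero _) (hI _) (hI _)
  · rw [hu, hu] at h
    exact h
  · rw [uProd, uProd, uProd,
      prod_part τ (fun j => (Xv K d (Sum.inl j) : PP K d))]
    ext p
    rw [RingHom.mem_ker, RingHom.comp_apply, FaithfulSMul.algebraMap_eq_zero_iff,
      ← RingHom.mem_ker, ker_toRS]

/-- The coordinate ring of a chart. -/
def Ch : Type u := chart K τ

instance : CommRing (Ch K τ) := inferInstanceAs (CommRing (chart K τ))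

instance : IsDomain (Ch K τ) := inferInstanceAs (IsDomain (chart K τ))

/-- The inclusion of the coordinate ring of a chart in the function field. -/
def toFF : Ch K τ →+* FF K d := (chart K τ).val.toRingHom

lemma toFF_injective : Function.Injective (toFF K τ) := Subtype.val_injective

/-- The structure map of a chart. -/
def ofRS : RS K d →+* Ch K τ := algebraMap (RS K d) (chart K τ)

lemma toFF_ofRS (r : RS K d) : toFF K τ (ofRS K τ r) = algebraMap (RS K d) (FF K d) r := rfl

lemma ofRS_injective : Function.Injective (ofRS K τ) := fun _ _ h =>
  FaithfulSMul.algebraMap_injective (RS K d) (FF K d) (congrArg (toFF K τ) h)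

/-- The presentation of the coordinate ring of a chart. -/
def toChart : (PP K d)[X][X] →+* Ch K τ :=
  (evalHom K τ).codRestrict (chart K τ) fun g => (range_evalHom K τ _).2 ⟨g, rfl⟩

lemma toFF_toChart (g : (PP K d)[X][X]) :
    toFF K τ (toChart K τ g) = evalHom K τ g := rfl

lemma toChart_surjective : Function.Surjective (toChart K τ) := fun z => by
  obtain ⟨g, hg⟩ := (range_evalHom K τ z.1).1 z.2
  exact ⟨g, toFF_injective K τ hg⟩

lemma ker_toChart : RingHom.ker (toChart K τ) = chartIdeal K τ := by
  rw [← ker_evalHom]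
  ext g
  rw [RingHom.mem_ker, RingHom.mem_ker, ← toFF_toChart]
  exact (map_eq_zero_iff _ (toFF_injective K τ)).symm

/-- `ξ` as an element of the chart. -/
def xiC : Ch K τ := ⟨xi K τ, xi_mem K τ⟩

/-- `η` as an element of the chart. -/
def etaC : Ch K τ := ⟨eta K τ, eta_mem K τ⟩

lemma toFF_xiC : toFF K τ (xiC K τ) = xi K τ := rfl

lemma toFF_etaC : toFF K τ (etaC K τ) = eta K τ := rfl

lemma toChart_X : toChart K τ X = xiC K τ := toFF_injective K τ (evalHom_X K τ)

lemma toChart_C_X : toChart K τ (C X) = etaC K τ := toFF_injective K τ (evalHom_C_X K τ)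

lemma toChart_C_C (p : PP K d) :
    toChart K τ (C (C p)) = ofRS K τ (toRS K d p) :=
  toFF_injective K τ (evalHom_C_C K τ p)

/-- The image of `u_j` in a chart. -/
def uC (j : Fin (d + 1)) : Ch K τ := ofRS K τ (uVar K d j)

/-- The lift to the polynomial ring of the prime ideal `(u_j)` of a chart, for `j ∈ L`. -/
def lowerPrime (j : Fin (d + 1)) : Ideal (PP K d)[X][X] :=
  linearIdeal (yIdeal K τ {Sum.inr 0, Sum.inl j}) X (C (uProd K d (part τ .eq)))

/-- The lift to the polynomial ring of the prime ideal `(ξ, u_j)` of a chart, for `j ∈ M`. -/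
def middlePrime (j : Fin (d + 1)) : Ideal (PP K d)[X][X] :=
  (yIdeal K τ {Sum.inr 0, Sum.inl j}).map C ⊔ Ideal.span {X}

variable {K τ} {j : Fin (d + 1)}

lemma ne_of_mem_gt (hj : τ j ≠ .gt) : ∀ k ∈ part τ .gt,
    Sum.inl k ∉ ({Sum.inr 0, Sum.inl j} : Finset (Fin (d + 1) ⊕ Fin 2)) := by
  intro k hk
  simp only [Finset.mem_insert, reduceCtorEq, Sum.inl.injEq, Finset.mem_singleton, false_or]
  rintro rfl
  exact hj (mem_part.1 hk)

lemma isRegMod_lower (hj : τ j = .lt) :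
    IsRegMod (yIdeal K τ {Sum.inr 0, Sum.inl j} ⊔ Ideal.span {X})
      (C (uProd K d (part τ .eq))) := by
  rw [yIdeal_sup_X]
  refine IsRegMod.of_isPrime fun h => ?_
  rw [Ideal.mem_comap, constantCoeff_apply, coeff_C_zero] at h
  refine uProd_notMem K d (fun k hk => ?_) h
  simp only [Finset.mem_insert, reduceCtorEq, Sum.inl.injEq, Finset.mem_singleton, false_or]
  rintro rfl
  rw [mem_part, hj] at hk
  exact absurd hk (by simp)

lemma lowerPrime_isPrime (hj : τ j = .lt) : (lowerPrime K τ j).IsPrime := by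
  have := yIdeal_isPrime (K := K) (τ := τ) (S := {Sum.inr 0, Sum.inl j}) (by simp)
  exact linearIdeal_isPrime _ (X_notMem_yIdeal (by simp) (ne_of_mem_gt (by simp [hj])))
    (isRegMod_lower hj)

lemma C_C_notMem_lowerPrime (hj : τ j = .lt) {p : PP K d}
    (hp : p ∉ vI K d {Sum.inr 0, Sum.inl j}) : C (C p) ∉ lowerPrime K τ j := fun h => by
  have := yIdeal_isPrime (K := K) (τ := τ) (S := {Sum.inr 0, Sum.inl j}) (by simp)
  exact hp (C_mem_yIdeal (by simp) (ne_of_mem_gt (by simp [hj])) (C_mem_linearIdeal _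
    (X_notMem_yIdeal (by simp) (ne_of_mem_gt (by simp [hj]))) (isRegMod_lower hj) h))

lemma lowerPrime_eq (hj : τ j = .lt) : lowerPrime K τ j =
    chartIdeal K τ ⊔ Ideal.span {C (C (Xv K d (Sum.inl j)))} := by
  rw [lowerPrime, yIdeal, vI_pair]
  exact linearIdeal_eq_relations _ _ _ _ _ _ (Finset.dvd_prod_of_mem _ (mem_part.2 hj))

lemma middlePrime_eq_comap :
    middlePrime K τ j = (yIdeal K τ {Sum.inr 0, Sum.inl j}).comap constantCoeff :=
  map_C_sup_X _

lemma middlePrime_isPrime : (middlePrime K τ j).IsPrime := by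
  have := yIdeal_isPrime (K := K) (τ := τ) (S := {Sum.inr 0, Sum.inl j}) (by simp)
  rw [middlePrime_eq_comap]
  infer_instance

lemma C_C_notMem_middlePrime (hj : τ j = .eq) {p : PP K d}
    (hp : p ∉ vI K d {Sum.inr 0, Sum.inl j}) : C (C p) ∉ middlePrime K τ j := fun h => by
  rw [middlePrime_eq_comap, Ideal.mem_comap, constantCoeff_apply, coeff_C_zero] at h
  exact hp (C_mem_yIdeal (by simp) (ne_of_mem_gt (by simp [hj])) h)

lemma middlePrime_eq (hj : τ j = .eq) : middlePrime K τ j =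
    chartIdeal K τ ⊔ (Ideal.span {X} ⊔ Ideal.span {C (C (Xv K d (Sum.inl j)))}) := by
  rw [middlePrime, yIdeal, vI_pair]
  exact map_C_sup_X_eq_relations _ _ _ _ _ _ (Finset.dvd_prod_of_mem _ (mem_part.2 hj))

lemma toChart_mem_map_iff {Q : Ideal (PP K d)[X][X]}
    (hQ : RingHom.ker (toChart K τ) ≤ Q) {g : (PP K d)[X][X]} :
    toChart K τ g ∈ Q.map (toChart K τ) ↔ g ∈ Q :=
  mem_map_iff_of_ker_le (φ := toChart K τ) (toChart_surjective K τ) hQ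

lemma map_lowerPrime (hj : τ j = .lt) :
    (lowerPrime K τ j).map (toChart K τ) = Ideal.span {uC K τ j} := by
  rw [lowerPrime_eq hj, Ideal.map_sup, ← ker_toChart, (Ideal.map_eq_bot_iff_le_ker _).2 le_rfl,
    bot_sup_eq, Ideal.map_span, Set.image_singleton, toChart_C_C]
  rfl

lemma map_middlePrime (hj : τ j = .eq) :
    (middlePrime K τ j).map (toChart K τ) = Ideal.span {xiC K τ} ⊔ Ideal.span {uC K τ j} := by
  rw [middlePrime_eq hj, Ideal.map_sup, ← ker_toChart, (Ideal.map_eq_bot_iff_le_ker _).2 le_rfl,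
    bot_sup_eq, Ideal.map_sup, Ideal.map_span, Set.image_singleton, Ideal.map_span,
    Set.image_singleton, toChart_C_C, toChart_X]
  rfl

/-- For `j ∈ L` this is the generic point of the component of the strict transform that comes from
`V(x, u_j)`. For `j ∈ M` that role is played by `(ξ, u_j)`; for `j ∈ U` there is no such component.
-/
lemma span_uC_isPrime (hj : τ j = .lt) : (Ideal.span {uC K τ j}).IsPrime := by
  have := lowerPrime_isPrime (K := K) hj
  rw [← map_lowerPrime hj]
  refine Ideal.map_isPrime_of_surjective (toChart_surjective K τ) ?_
  rw [ker_toChart, lowerPrime_eq hj]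
  exact le_sup_left

lemma span_xiC_uC_isPrime (hj : τ j = .eq) :
    (Ideal.span {xiC K τ} ⊔ Ideal.span {uC K τ j}).IsPrime := by
  have := middlePrime_isPrime (K := K) (τ := τ) (j := j)
  rw [← map_middlePrime hj]
  refine Ideal.map_isPrime_of_surjective (toChart_surjective K τ) ?_
  rw [ker_toChart, middlePrime_eq hj]
  exact le_sup_left

lemma ofRS_notMem_lower (hj : τ j = .lt) {s : Fin (d + 1) ⊕ Fin 2} (h0 : s ≠ Sum.inr 0)
    (h1 : s ≠ Sum.inl j) : ofRS K τ (toRS K d (Xv K d s)) ∉ Ideal.span {uC K τ j} := by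
  rw [← map_lowerPrime hj, ← toChart_C_C]
  have h : RingHom.ker (toChart K τ) ≤ lowerPrime K τ j := by
    rw [ker_toChart, lowerPrime_eq hj]
    exact le_sup_left
  intro hm
  refine C_C_notMem_lowerPrime (K := K) hj (p := Xv K d s)
    (Xv_notMem (by simp [h0, h1])) ?_
  exact (toChart_mem_map_iff h).1 hm

lemma ofRS_notMem_middle (hj : τ j = .eq) {s : Fin (d + 1) ⊕ Fin 2} (h0 : s ≠ Sum.inr 0)
    (h1 : s ≠ Sum.inl j) : ofRS K τ (toRS K d (Xv K d s)) ∉ Ideal.span {xiC K τ} ⊔ Ideal.span {uC K τ j} := by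
  rw [← map_middlePrime hj, ← toChart_C_C]
  have h : RingHom.ker (toChart K τ) ≤ middlePrime K τ j := by
    rw [ker_toChart, middlePrime_eq hj]
    exact le_sup_left
  intro hm
  refine C_C_notMem_middlePrime (K := K) hj (p := Xv K d s)
    (Xv_notMem (by simp [h0, h1])) ?_
  exact (toChart_mem_map_iff h).1 hm

/-- An element of a chart that lies in all the given prime ideals lies in the ideal
`u_{A ∩ L} (ξ, u_{A ∩ M})`. -/
lemma mem_centre (A : Finset (Fin (d + 1))) {z : Ch K τ}
    (hL : ∀ j ∈ A, τ j = .lt → z ∈ Ideal.span {uC K τ j})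
    (hM : ∀ j ∈ A, τ j = .eq → z ∈ Ideal.span {xiC K τ} ⊔ Ideal.span {uC K τ j}) :
    z ∈ Ideal.span {(∏ j ∈ A ∩ part τ .lt, uC K τ j) * xiC K τ,
      (∏ j ∈ A ∩ part τ .lt, uC K τ j) * ∏ j ∈ A ∩ part τ .eq, uC K τ j} := by
  have hLt : ∀ j ∈ A ∩ part τ .lt, j ∈ A ∧ τ j = .lt := fun j hj => by simpa using hj
  have hEq : ∀ j ∈ A ∩ part τ .eq, j ∈ A ∧ τ j = .eq := fun j hj => by simpa using hj
  have h1 := mem_sup_prod (I := ⊥) (A ∩ part τ .lt) (u := uC K τ) (z := z)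
    (fun i hi => by rw [bot_sup_eq]; exact span_uC_isPrime (hLt i hi).2)
    (fun i hi j hj hij => by
      rw [bot_sup_eq]
      exact ofRS_notMem_lower (hLt j hj).2 (by simp) (by simpa using hij))
    (fun i hi => by rw [bot_sup_eq]; exact hL i (hLt i hi).1 (hLt i hi).2)
  rw [bot_sup_eq, Ideal.mem_span_singleton] at h1
  obtain ⟨z', rfl⟩ := h1
  have h2 : z' ∈ Ideal.span {xiC K τ} ⊔ Ideal.span {∏ j ∈ A ∩ part τ .eq, uC K τ j} := by
    refine mem_sup_prod _ (fun i hi => span_xiC_uC_isPrime (hEq i hi).2)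
      (fun i hi j hj hij => ofRS_notMem_middle (hEq j hj).2 (by simp) (by simpa using hij))
      fun i hi => ?_
    -- The product over `A ∩ L` lies outside the prime `(ξ, u_i)`, so membership passes to the
    -- cofactor `z'`.
    have hp := span_xiC_uC_isPrime (K := K) (hEq i hi).2
    refine (hp.mem_or_mem (hM i (hEq i hi).1 (hEq i hi).2)).resolve_left fun h => ?_
    rw [hp.prod_mem_iff] at h
    obtain ⟨j, hj, h⟩ := h
    refine ofRS_notMem_middle (hEq i hi).2 (by simp) ?_ h
    intro he
    rw [Sum.inl.injEq] at he
    subst he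
    have a := (hEq j hi).2
    rw [(hLt j hj).2] at a
    exact absurd a (by simp)
  rw [← Ideal.span_union, Set.singleton_union, Ideal.mem_span_pair] at h2
  obtain ⟨a, b, rfl⟩ := h2
  rw [Ideal.mem_span_pair]
  exact ⟨a, b, by ring⟩

end Chart

end SmoothCollection
end

noncomputable section

namespace SmoothCollection

/-! ### Regularity of the charts with a single middle index -/

section Regular

open Polynomial

/-- Derivations of a commutative ring. -/
abbrev IntDer (R : Type*) [CommRing R] := Derivation ℤ R R

/-- The derivation of a polynomial ring acting on the coefficients. -/
def coeffDer {P : Type*} [CommRing P] (δ : IntDer P) : IntDer P[X] :=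
  Derivation.mk' (AddMonoidHom.toIntLinearMap
    ((PolynomialModule.equivPolynomialSelf.compDer δ.mapCoeffs : P[X] →ₗ[ℤ] P[X]) : P[X] →+ P[X]))
    (fun a b => (PolynomialModule.equivPolynomialSelf.compDer δ.mapCoeffs).leibniz a b)

@[simp] lemma coeffDer_X {P : Type*} [CommRing P] (δ : IntDer P) : coeffDer δ X = 0 := by
  change PolynomialModule.equivPolynomialSelf (δ.mapCoeffs X) = 0
  rw [Derivation.mapCoeffs_X, map_zero]

@[simp] lemma coeffDer_C {P : Type*} [CommRing P] (δ : IntDer P) (a : P) :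
    coeffDer δ (C a) = C (δ a) := by
  change PolynomialModule.equivPolynomialSelf (δ.mapCoeffs (C a)) = C (δ a)
  rw [Derivation.mapCoeffs_C]
  simp

lemma coeffDer_linear {P : Type*} [CommRing P] (δ : IntDer P) (a b : P) :
    coeffDer δ (C a - C b * X) = C (δ a) - C (δ b) * X := by
  rw [Derivation.map_sub, Derivation.leibniz, coeffDer_X, coeffDer_C, coeffDer_C, smul_zero,
    zero_add, smul_eq_mul, mul_comm X]

lemma derivation_prod_eq_zero {P ι : Type*} [CommRing P] (δ : IntDer P) (s : Finset ι)
    (f : ι → P) (h : ∀ i ∈ s, δ (f i) = 0) : δ (∏ i ∈ s, f i) = 0 := by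
  classical
  induction s using Finset.induction_on with
  | empty => simp
  | insert a s ha ih =>
    rw [Finset.prod_insert ha, Derivation.leibniz, h a (by simp),
      ih fun i hi => h i (by simp [hi]), smul_zero, smul_zero, add_zero]

lemma isRegularRing_of_ker_eq {D B : Type*} [CommRing D] [CommRing B] {φ : D →+* B}
    (hφ : Function.Surjective φ) {I : Ideal D} (hI : RingHom.ker φ = I)
    (h : IsRegularRing (D ⧸ I)) : IsRegularRing B := by
  subst hI
  exact IsRegularRing.of_ringEquiv (RingHom.quotientKerEquivOfSurjective hφ)

section Relations

variable {P : Type u} [CommRing P] (x y a m b : P)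

/-- The relations of a chart, as a family. -/
def relations : Fin 3 → P[X][X] :=
  ![C (C y - C b * X), C (C x) - C (C a) * X, C (C m) - C X * X]

lemma coeffDer_relations (δ : IntDer P) (ha : δ a = 0) (hb : δ b = 0) (i : Fin 3) :
    coeffDer (coeffDer δ) (relations x y a m b i) = C (C (![δ y, δ x, δ m] i)) := by
  fin_cases i
  · refine (coeffDer_C _ _).trans (congrArg C ((coeffDer_linear _ _ _).trans ?_))
    rw [hb, C_0, zero_mul, sub_zero]
    rfl
  · refine (coeffDer_linear _ _ _).trans ?_
    rw [coeffDer_C, coeffDer_C, ha, C_0, C_0, zero_mul, sub_zero]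
    rfl
  · refine (coeffDer_linear _ _ _).trans ?_
    rw [coeffDer_C, coeffDer_X, C_0, zero_mul, sub_zero]
    rfl

lemma span_relations : Ideal.span (Set.range (relations x y a m b)) =
    Ideal.span {C (C y - C b * X)} ⊔ Ideal.span {C (C x) - C (C a) * X} ⊔
      Ideal.span {C (C m) - C X * X} := by
  rw [← Ideal.span_union, ← Ideal.span_union, relations]
  congr 1
  simp only [Matrix.range_cons, Matrix.range_empty, Set.union_empty, Set.union_assoc]

/-- Extended coefficientwise, the `δ i` kill both polynomial variables, and they kill `a` and `b`;
so they see only the constant terms `y`, `x`, `m` of the relations. -/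
lemma isRegularRing_of_relations {B : Type u} [IsRegularRing P] [CommRing B]
    (δ : Fin 3 → IntDer P) (ha : ∀ i, δ i a = 0) (hb : ∀ i, δ i b = 0)
    (hδ : ∀ i j, δ i (![y, x, m] j) = if i = j then 1 else 0)
    (φ : P[X][X] →+* B) (hφ : Function.Surjective φ)
    (hker : RingHom.ker φ = Ideal.span {C (C y - C b * X)} ⊔ Ideal.span {C (C x) - C (C a) * X} ⊔
        Ideal.span {C (C m) - C X * X}) : IsRegularRing B := by
  have h := isRegularRing_quotient_of_derivation (relations x y a m b)
    (fun i => coeffDer (coeffDer (δ i))) (fun i j => by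
      rw [coeffDer_relations _ _ _ _ _ _ (ha i) (hb i)]
      have : ![δ i y, δ i x, δ i m] j = δ i (![y, x, m] j) := by fin_cases j <;> rfl
      rw [this, hδ]
      split_ifs <;> simp)
  exact isRegularRing_of_ker_eq hφ (hker.trans (span_relations x y a m b).symm) h

end Relations

variable (K : Type u) [Field K] {d : ℕ}

instance : IsRegularRing (PP K d) :=
  ProjDim.isRegularRing_mvPowerSeries K (Fin (d + 1) ⊕ Fin 2)

/-- The partial derivatives on `PP K d`. -/
def pderivPP (s : Fin (d + 1) ⊕ Fin 2) : IntDer (PP K d) :=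
  Derivation.mk' (AddMonoidHom.toIntLinearMap (show PP K d →+ PP K d from
    (MvPowerSeries.pderiv K s : PowerSeriesRing K d →ₗ[K] PowerSeriesRing K d).toAddMonoidHom))
    (fun a b => (MvPowerSeries.pderiv K s).leibniz (a : PowerSeriesRing K d) b)

lemma pderivPP_self (s : Fin (d + 1) ⊕ Fin 2) : pderivPP K s (Xv K d s) = 1 := by
  change MvPowerSeries.pderiv K s (MvPowerSeries.X s) = 1
  simp

lemma pderivPP_of_ne {s t : Fin (d + 1) ⊕ Fin 2} (h : s ≠ t) : pderivPP K s (Xv K d t) = 0 := by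
  change MvPowerSeries.pderiv K s (MvPowerSeries.X t) = 0
  classical
  simp [h.symm]

/-- With `M = {j}` the constant terms of the relations are the variables `y`, `x`, `u_j`, none of
which occurs in `u_L` or `u_U`. The partial derivatives are the dual derivations. -/
lemma isRegularRing_Ch (τ : Fin (d + 1) → Ordering) (j : Fin (d + 1)) (hj : part τ .eq = {j}) :
    IsRegularRing (Ch K τ) := by
  have hjτ : τ j = .eq := by rw [← mem_part, hj]; simp
  have hu : ∀ (s : Fin (d + 1) ⊕ Fin 2) (S : Finset (Fin (d + 1))), (∀ i ∈ S, s ≠ Sum.inl i) →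
      pderivPP K s (uProd K d S) = 0 := fun s S h =>
    derivation_prod_eq_zero _ _ _ fun i hi => pderivPP_of_ne K (h i hi)
  have hne : ∀ o, o ≠ .eq → ∀ i ∈ part τ o, (Sum.inl j : Fin (d + 1) ⊕ Fin 2) ≠ Sum.inl i := by
    intro o ho i hi h
    rw [Sum.inl.injEq] at h
    subst h
    exact ho ((mem_part.1 hi).symm.trans hjτ)
  refine isRegularRing_of_relations (Xv K d (Sum.inr 0)) (Xv K d (Sum.inr 1))
    (uProd K d (part τ .lt)) (uProd K d (part τ .eq)) (uProd K d (part τ .gt))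
    ![pderivPP K (Sum.inr 1), pderivPP K (Sum.inr 0), pderivPP K (Sum.inl j)]
    (fun i => ?_) (fun i => ?_) (fun i k => ?_)
    (toChart K τ) (toChart_surjective K τ) (ker_toChart K τ)
  · fin_cases i
    exacts [hu _ _ (by simp), hu _ _ (by simp), hu _ _ (hne _ (by simp))]
  · fin_cases i
    exacts [hu _ _ (by simp), hu _ _ (by simp), hu _ _ (hne _ (by simp))]
  · have hm : uProd K d (part τ .eq) = Xv K d (Sum.inl j) := by
      rw [hj, uProd, Finset.prod_singleton]
    rw [hm]
    fin_cases i <;> fin_cases k <;>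
      first | exact pderivPP_self K _ | exact pderivPP_of_ne K (by simp)

end Regular

end SmoothCollection
end

noncomputable section

namespace SmoothCollection

/-! ### Ideal sheaves on affine schemes and invertibility -/

section AffineIdeals

open Scheme.IdealSheafData

variable {C B : Type u} [CommRing C] [CommRing B]

/-- The ideal corresponding to an ideal sheaf on an affine scheme. -/
def idealOf (J : (Spec (.of C)).IdealSheafData) : Ideal C :=
  (J.ideal ⟨⊤, isAffineOpen_top _⟩).comap (Scheme.ΓSpecIso (.of C)).inv.hom

/-- The ideal sheaf corresponding to an ideal. -/
def sheafOf (I : Ideal C) : (Spec (.of C)).IdealSheafData :=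
  ofIdealTop (I.comap (Scheme.ΓSpecIso (.of C)).hom.hom)

lemma idealOf_sheafOf (I : Ideal C) : idealOf (sheafOf I) = I := by
  rw [idealOf, sheafOf]
  have : (ofIdealTop (I.comap (Scheme.ΓSpecIso (.of C)).hom.hom)).ideal
      ⟨⊤, isAffineOpen_top _⟩ = I.comap (Scheme.ΓSpecIso (.of C)).hom.hom := by
    simp
  rw [this, Ideal.comap_comap, ← CommRingCat.hom_comp, Iso.inv_hom_id]
  rfl

lemma idealOf_le_iff {I J : (Spec (.of C)).IdealSheafData} : idealOf I ≤ idealOf J ↔ I ≤ J := by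
  constructor
  · intro h
    refine le_of_isAffine fun z hz => ?_
    have h1 : (Scheme.ΓSpecIso (.of C)).inv.hom ((Scheme.ΓSpecIso (.of C)).hom.hom z) = z := by
      rw [← CommRingCat.comp_apply, Iso.hom_inv_id, CommRingCat.id_apply]
    have h2 := @h ((Scheme.ΓSpecIso (.of C)).hom.hom z) (by rwa [idealOf, Ideal.mem_comap, h1])
    rwa [idealOf, Ideal.mem_comap, h1] at h2
  · exact fun h => Ideal.comap_mono (h _)

lemma idealOf_injective : Function.Injective (idealOf (C := C)) := fun _ _ h =>
  le_antisymm (idealOf_le_iff.1 h.le) (idealOf_le_iff.1 h.ge)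

lemma sheafOf_idealOf (J : (Spec (.of C)).IdealSheafData) : sheafOf (idealOf J) = J :=
  idealOf_injective (idealOf_sheafOf _)

lemma idealOf_map (φ : C →+* B) (J : (Spec (.of B)).IdealSheafData) :
    idealOf (J.map (Spec.map (CommRingCat.ofHom φ))) = (idealOf J).comap φ := by
  rw [idealOf, ideal_map_of_isAffineHom, idealOf, Ideal.comap_comap, Ideal.comap_comap]
  have h := Scheme.ΓSpecIso_inv_naturality (CommRingCat.ofHom φ)
  exact congrArg (fun g => Ideal.comap g.hom (J.ideal ⟨⊤, isAffineOpen_top _⟩)) h.symm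

lemma sheafOf_comap (φ : C →+* B) (I : Ideal C) :
    (sheafOf I).comap (Spec.map (CommRingCat.ofHom φ)) = sheafOf (I.map φ) := by
  have h : ∀ J : (Spec (.of B)).IdealSheafData,
      (sheafOf I).comap (Spec.map (CommRingCat.ofHom φ)) ≤ J ↔ sheafOf (I.map φ) ≤ J := fun J => by
    rw [← le_map_iff_comap_le, ← idealOf_le_iff, ← idealOf_le_iff, idealOf_map, idealOf_sheafOf,
      idealOf_sheafOf, Ideal.map_le_iff_le_comap]
  exact le_antisymm ((h _).2 le_rfl) ((h _).1 le_rfl)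

variable {X : Scheme.{u}}

lemma ideal_comap_openImmersion (J : X.IdealSheafData) (i : Spec (.of B) ⟶ X)
    [IsOpenImmersion i] :
    (∃ a ∈ nonZeroDivisors Γ(X, i ''ᵁ ⊤),
      J.ideal ⟨i ''ᵁ ⊤, (isAffineOpen_top _).image_of_isOpenImmersion i⟩ = Ideal.span {a}) ↔
    ∃ g ∈ nonZeroDivisors B, J.comap i = sheafOf (Ideal.span {g}) := by
  have hnzd : ∀ {A₁ A₂ : Type u} [CommRing A₁] [CommRing A₂] (e : A₁ ≃+* A₂) (z : A₁),
      z ∈ nonZeroDivisors A₁ → e z ∈ nonZeroDivisors A₂ := fun e z hz =>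
    (MulEquivClass.map_nonZeroDivisors e).le ⟨z, hz, rfl⟩
  let θ : B ≃+* Γ(X, i ''ᵁ ⊤) :=
    ((Scheme.ΓSpecIso (.of B)).symm ≪≫ (i.appIso ⊤).symm).commRingCatIsoToRingEquiv
  have hθ : idealOf (J.comap i) =
      (J.ideal ⟨i ''ᵁ ⊤, (isAffineOpen_top _).image_of_isOpenImmersion i⟩).comap θ := by
    rw [idealOf, ideal_comap_of_isOpenImmersion, Ideal.comap_comap]
    rfl
  have hsp : ∀ g, (Ideal.span {θ g}).comap θ = Ideal.span {g} := fun g => by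
    have : Ideal.span {θ g} = (Ideal.span {g}).map θ := by rw [Ideal.map_span, Set.image_singleton]
    rw [this]
    exact Ideal.comap_map_of_bijective _ θ.bijective
  constructor
  · rintro ⟨a, ha, h⟩
    obtain ⟨g, rfl⟩ := θ.surjective a
    refine ⟨g, by simpa using hnzd θ.symm _ ha, idealOf_injective ?_⟩
    rw [hθ, h, hsp, idealOf_sheafOf]
  · rintro ⟨g, hg, h⟩
    refine ⟨θ g, hnzd θ g hg, ?_⟩
    rw [h, idealOf_sheafOf, ← hsp] at hθ
    exact (Ideal.comap_injective_of_surjective _ θ.surjective hθ).symm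

/-- Open immersions of spectra replace affine open subsets, so that the ring can be chosen and
localized freely. -/
lemma isInvertibleIdeal_iff (J : X.IdealSheafData) : IsInvertibleIdeal J ↔ ∀ x : X,
    ∃ (B : Type u) (_ : CommRing B) (i : Spec (.of B) ⟶ X), IsOpenImmersion i ∧ x ∈ Set.range i ∧
      ∃ g ∈ nonZeroDivisors B, J.comap i = sheafOf (Ideal.span {g}) := by
  constructor
  · intro h x
    obtain ⟨U, hx, h⟩ := h x
    have hU' : IsAffineOpen U.1 := U.2
    have hi : IsOpenImmersion hU'.fromSpec := hU'.isOpenImmersion_fromSpec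
    refine ⟨Γ(X, U.1), inferInstance, hU'.fromSpec, hi, ?_, ?_⟩
    · rw [hU'.range_fromSpec]
      exact hx
    · refine (ideal_comap_openImmersion J (B := Γ(X, U.1)) hU'.fromSpec).1 ?_
      have hU : (⟨hU'.fromSpec ''ᵁ ⊤, (isAffineOpen_top _).image_of_isOpenImmersion _⟩ :
          X.affineOpens) = U := Subtype.ext
          ((Scheme.Hom.image_top_eq_opensRange _).trans hU'.opensRange_fromSpec)
      exact (hU ▸ h : ∃ a ∈ nonZeroDivisors Γ(X, (⟨hU'.fromSpec ''ᵁ ⊤,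
        (isAffineOpen_top _).image_of_isOpenImmersion _⟩ : X.affineOpens).1), J.ideal _ = _)
  · intro h x
    obtain ⟨B, _, i, hi, ⟨p, rfl⟩, h⟩ := h x
    exact ⟨⟨i ''ᵁ ⊤, (isAffineOpen_top _).image_of_isOpenImmersion i⟩, ⟨p, trivial, rfl⟩,
      (ideal_comap_openImmersion J i).2 h⟩

lemma exists_chart_basicOpen (i : Spec (.of B) ⟶ X) [IsOpenImmersion i] (p : Spec (.of B))
    (W : X.Opens) (hp : i p ∈ W) : ∃ h : B,
      i p ∈ Set.range (Spec.map (CommRingCat.ofHom (algebraMap B (Localization.Away h))) ≫ i) ∧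
      Set.range (Spec.map (CommRingCat.ofHom (algebraMap B (Localization.Away h))) ≫ i) ⊆ W := by
  have hrange : ∀ h : B,
      Set.range (Spec.map (CommRingCat.ofHom (algebraMap B (Localization.Away h)))) =
      ((PrimeSpectrum.basicOpen h : Opens (PrimeSpectrum B)) : Set (PrimeSpectrum B)) := fun h =>
    PrimeSpectrum.localization_away_comap_range (Localization.Away h) h
  obtain ⟨_, ⟨h, rfl⟩, hph, hW⟩ := PrimeSpectrum.isTopologicalBasis_basic_opens.exists_subset_of_mem_open
    (a := p) (u := (i ⁻¹ᵁ W).1) hp (i ⁻¹ᵁ W).isOpen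
  refine ⟨h, ?_, ?_⟩
  · obtain ⟨q, hq⟩ := (hrange h).ge hph
    exact ⟨q, by rw [Scheme.Hom.comp_apply, hq]⟩
  · rintro _ ⟨q, rfl⟩
    rw [Scheme.Hom.comp_apply]
    exact hW ((hrange h).le ⟨q, rfl⟩)

lemma exists_chart_of_isInvertibleIdeal {J : X.IdealSheafData} (hJ : IsInvertibleIdeal J) (x : X)
    (W : X.Opens) (hx : x ∈ W) : ∃ (B : Type u) (_ : CommRing B) (i : Spec (.of B) ⟶ X),
      IsOpenImmersion i ∧ x ∈ Set.range i ∧ Set.range i ⊆ W ∧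
      ∃ g ∈ nonZeroDivisors B, J.comap i = sheafOf (Ideal.span {g}) := by
  obtain ⟨B, _, i, hi, ⟨p, rfl⟩, g, hg, h⟩ := (isInvertibleIdeal_iff J).1 hJ x
  obtain ⟨s, h1, h2⟩ := exists_chart_basicOpen i p W hx
  refine ⟨Localization.Away s, inferInstance, _, ?_, h1, h2, algebraMap B _ g, ?_, ?_⟩
  · have : IsOpenImmersion (Spec.map (CommRingCat.ofHom (algebraMap B (Localization.Away s)))) :=
      inferInstance
    infer_instance
  · exact IsLocalization.map_nonZeroDivisors_le (Submonoid.powers s) _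
      (Submonoid.mem_map_of_mem (algebraMap B (Localization.Away s)) hg)
  · rw [comap_comp, h, sheafOf_comap, Ideal.map_span, Set.image_singleton]

lemma isInvertibleIdeal_sheafOf {b : C} (hb : b ∈ nonZeroDivisors C) :
    IsInvertibleIdeal (sheafOf (Ideal.span {b})) := by
  rw [isInvertibleIdeal_iff]
  exact fun x => ⟨C, inferInstance, 𝟙 _, inferInstance, ⟨x, rfl⟩, b, hb, comap_id _⟩

lemma IsInvertibleIdeal.comap_of_isOpenImmersion {Y : Scheme.{u}} {J : X.IdealSheafData}
    (hJ : IsInvertibleIdeal J) (j : Y ⟶ X) [IsOpenImmersion j] : IsInvertibleIdeal (J.comap j) := by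
  rw [isInvertibleIdeal_iff]
  intro y
  obtain ⟨B, _, i, hi, ⟨p, hp⟩, hr, g, hg, h⟩ :=
    exists_chart_of_isInvertibleIdeal hJ (j y) j.opensRange ⟨y, rfl⟩
  have hl := IsOpenImmersion.lift_fac j i hr
  have : IsOpenImmersion (IsOpenImmersion.lift j i hr ≫ j) := by rwa [hl]
  refine ⟨B, inferInstance, IsOpenImmersion.lift j i hr, IsOpenImmersion.of_comp _ j,
    ⟨p, j.isOpenEmbedding.injective ?_⟩, g, hg, ?_⟩
  · rw [← Scheme.Hom.comp_apply, hl, hp]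
  · rw [← comap_comp, hl, h]

end AffineIdeals

end SmoothCollection
end

noncomputable section

namespace SmoothCollection

/-! ### Local structure of blowups -/

section Blowups

open Scheme.IdealSheafData Polynomial

variable {C B : Type u} [CommRing C] [CommRing B] {X X' Y : Scheme.{u}}

lemma coe_support_sheafOf (I : Ideal C) :
    ((sheafOf I).support : Set (Spec (.of C))) = PrimeSpectrum.zeroLocus (I : Set C) := by
  rw [sheafOf, coe_support_ofIdealTop, Spec_zeroLocus]
  congr 1
  ext z
  simp only [Set.mem_preimage, SetLike.mem_coe, Ideal.mem_comap]
  rw [← CommRingCat.comp_apply, Iso.inv_hom_id, CommRingCat.id_apply]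

/-- Both ideals are radical and have the same zero locus. -/
lemma idealOf_comap_vanishingIdeal (Z : Closeds X) (g : Spec (.of C) ⟶ X) [IsOpenImmersion g] :
    idealOf ((vanishingIdeal Z).comap g) = PrimeSpectrum.vanishingIdeal (g ⁻¹' Z) := by
  have hrad : (idealOf ((vanishingIdeal Z).comap g)).IsRadical := by
    rw [idealOf, ideal_comap_of_isOpenImmersion, vanishingIdeal_ideal]
    exact ((PrimeSpectrum.isRadical_vanishingIdeal _).comap _).comap _
  have hs : (((vanishingIdeal Z).comap g).support : Set (Spec (.of C))) = g ⁻¹' Z := by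
    rw [support_comap]
    simp
  have h := coe_support_sheafOf (idealOf ((vanishingIdeal Z).comap g))
  rw [sheafOf_idealOf, hs] at h
  rw [← hrad.radical, ← PrimeSpectrum.vanishingIdeal_zeroLocus_eq_radical]
  exact congrArg _ h.symm

/-- A morphism is an open immersion if it admits sections over enough open subsets. -/
lemma isOpenImmersion_of_sections (f : X ⟶ Y)
    (H : ∀ x, ∃ (Z : Scheme.{u}) (i : Z ⟶ Y) (h : Z ⟶ X), IsOpenImmersion i ∧ f x ∈ Set.range i ∧
      h ≫ f = i ∧ ∀ (V : X.Opens) (r : V.toScheme ⟶ Z), r ≫ i = V.ι ≫ f → r ≫ h = V.ι) :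
    IsOpenImmersion f := by
  refine IsZariskiLocalAtTarget.of_forall_source_exists_preimage (P := @IsOpenImmersion) f
    fun x => ?_
  obtain ⟨Z, i, h, hi, hx, hh, huniq⟩ := H x
  refine ⟨i.opensRange, hx, ?_⟩
  have hr : Set.range ((f ⁻¹ᵁ i.opensRange).ι ≫ f) ⊆ Set.range i := by
    rintro _ ⟨v, rfl⟩
    rw [Scheme.Hom.comp_apply]
    exact v.2
  have hr' := IsOpenImmersion.lift_fac i _ hr
  set r := IsOpenImmersion.lift i _ hr
  have hs : Set.range h ⊆ Set.range (f ⁻¹ᵁ i.opensRange).ι := by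
    rintro _ ⟨z, rfl⟩
    rw [Scheme.Opens.range_ι]
    exact ⟨z, by rw [← hh, Scheme.Hom.comp_apply]⟩
  have hs' := IsOpenImmersion.lift_fac _ _ hs
  set s := IsOpenImmersion.lift _ _ hs
  have : IsIso r := by
    refine ⟨s, ?_, ?_⟩
    · rw [← cancel_mono (f ⁻¹ᵁ i.opensRange).ι, Category.assoc, hs', Category.id_comp]
      exact huniq _ _ hr'
    · rw [← cancel_mono i, Category.assoc, hr', ← Category.assoc, hs', hh, Category.id_comp]
  rw [← hr']
  infer_instance

lemma IsBlowup.hom_ext {π : X' ⟶ X} {I : X.IdealSheafData} (hπ : IsBlowup π I)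
    {f₁ f₂ : Y ⟶ X'} (h : f₁ ≫ π = f₂ ≫ π) (hI : IsInvertibleIdeal (I.comap (f₁ ≫ π))) :
    f₁ = f₂ :=
  (hπ.existsUnique_lift (f₁ ≫ π) hI).unique rfl h.symm

/-- The universal property gives a section over `V`, and its uniqueness part makes the section a
two-sided inverse. -/
lemma IsBlowup.isIso_morphismRestrict {π : X' ⟶ X} {I : X.IdealSheafData} (hπ : IsBlowup π I)
    (V : X.Opens) (hV : IsInvertibleIdeal (I.comap V.ι)) : IsIso (π ∣_ V) := by
  obtain ⟨s, hs, -⟩ := hπ.existsUnique_lift V.ι hV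
  have hr : Set.range s ⊆ Set.range (π ⁻¹ᵁ V).ι := by
    rintro _ ⟨v, rfl⟩
    rw [Scheme.Opens.range_ι]
    change π (s v) ∈ V
    rw [← Scheme.Hom.comp_apply, hs]
    exact v.2
  have hs' := IsOpenImmersion.lift_fac _ _ hr
  refine ⟨IsOpenImmersion.lift _ _ hr, ?_, ?_⟩
  · rw [← cancel_mono (π ⁻¹ᵁ V).ι, Category.assoc, hs', Category.id_comp]
    refine hπ.hom_ext ?_ ?_
    · rw [Category.assoc, hs, morphismRestrict_ι]
    · rw [Category.assoc, hs, morphismRestrict_ι, comap_comp]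
      exact hπ.isInvertible_comap.comap_of_isOpenImmersion _
  · rw [← cancel_mono V.ι, Category.assoc, morphismRestrict_ι, ← Category.assoc, hs', hs,
      Category.id_comp]

/-- If `F` vanishes at `t = a / b`, clearing denominators gives an equation between `a` and `b` in
`C`. Its image says that a power of `φ b` kills the value of `F` at `s`, and `φ b` is not a zero
divisor. -/
lemma exists_lift_of_generates {C₁ : Type u} [CommRing C₁] {ι : C →+* C₁}
    (hι : Function.Injective ι) {a b : C} {t : C₁} (ht : ι b * t = ι a)
    (hgen : ∀ z : C₁, ∃ F : C[X], F.eval₂ ι t = z) (φ : C →+* B) {s : B} (hs : φ b * s = φ a)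
    (hb : φ b ∈ nonZeroDivisors B) : ∃ ψ : C₁ →+* B, ψ.comp ι = φ := by
  have hsurj : Function.Surjective (eval₂RingHom ι t) := hgen
  have hker : RingHom.ker (eval₂RingHom ι t) ≤ RingHom.ker (eval₂RingHom φ s) := by
    intro F hF
    rw [RingHom.mem_ker, coe_eval₂RingHom] at hF ⊢
    have h1 := scaleRoots_eval₂_mul (f := ι) (p := F) t b
    rw [hF, mul_zero, ht, eval₂_at_apply, map_eq_zero_iff ι hι] at h1
    have h2 := scaleRoots_eval₂_mul (f := φ) (p := F) s b
    rw [hs, eval₂_at_apply, h1, map_zero] at h2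
    exact (mul_right_mem_nonZeroDivisors_eq_zero_iff (pow_mem hb _)).1 (by rw [mul_comm, ← h2])
  refine ⟨(eval₂RingHom ι t).liftOfSurjective hsurj ⟨eval₂RingHom φ s, hker⟩, ?_⟩
  ext c
  have h := RingHom.liftOfRightInverse_comp_apply (eval₂RingHom ι t) _
    (Function.rightInverse_surjInv hsurj) ⟨eval₂RingHom φ s, hker⟩
    (Polynomial.C c)
  simpa using h

/-- Two morphisms from an integral scheme to the spectrum of `C[a/b]` agree if they agree on `C`. -/
lemma hom_ext_of_generates {C₁ : Type u} [CommRing C₁] {ι : C →+* C₁} {a b : C} {t : C₁}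
    (ht : ι b * t = ι a) (hgen : ∀ z : C₁, ∃ F : C[X], F.eval₂ ι t = z) [IsIntegral Y]
    (f₁ f₂ : Y ⟶ Spec (.of C₁))
    (h : f₁ ≫ Spec.map (CommRingCat.ofHom ι) = f₂ ≫ Spec.map (CommRingCat.ofHom ι))
    (y : Y) (hy : ι b ∉ (f₁ y).asIdeal) : f₁ = f₂ := by
  let σ (f : Y ⟶ Spec (.of C₁)) : C₁ →+* Γ(Y, ⊤) :=
    ((Scheme.ΓSpecIso (.of C₁)).inv ≫ f.appTop).hom
  have hσ : ∀ f, f = Y.toSpecΓ ≫ Spec.map (CommRingCat.ofHom (σ f)) := fun f => by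
    change f = Y.toSpecΓ ≫ Spec.map ((Scheme.ΓSpecIso (.of C₁)).inv ≫ f.appTop)
    rw [Spec.map_comp, ← Scheme.toSpecΓ_naturality_assoc, toSpecΓ_SpecMap_ΓSpecIso_inv, Category.comp_id]
  have hne : σ f₁ (ι b) ≠ 0 := by
    intro h0
    apply hy
    rw [hσ f₁, Scheme.Hom.comp_apply]
    change σ f₁ (ι b) ∈ (Y.toSpecΓ y).asIdeal
    rw [h0]
    exact zero_mem _
  have hι : ∀ c, σ f₁ (ι c) = σ f₂ (ι c) := by
    intro c
    have h1 := congrArg (fun f : Y ⟶ Spec (.of C) => ((Scheme.ΓSpecIso (.of C)).inv ≫ f.appTop).hom c) h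
    have h2 : ∀ f : Y ⟶ Spec (.of C₁), (Scheme.ΓSpecIso (.of C)).inv ≫
        (f ≫ Spec.map (CommRingCat.ofHom ι)).appTop = CommRingCat.ofHom ι ≫
          (Scheme.ΓSpecIso (.of C₁)).inv ≫ f.appTop := fun f => by
      rw [Scheme.Hom.comp_appTop, Scheme.ΓSpecIso_inv_naturality_assoc]
    simp only [h2] at h1
    exact h1
  have htt : σ f₁ t = σ f₂ t := by
    apply mul_left_cancel₀ hne
    rw [← map_mul, ht, hι b, hι a, ← map_mul, ht]
  have : σ f₁ = σ f₂ := by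
    ext z
    obtain ⟨F, rfl⟩ := hgen z
    rw [hom_eval₂, hom_eval₂, htt]
    congr 1
    ext c
    exact hι c
  rw [hσ f₁, hσ f₂, this]

/-- Pullback of an invertible ideal to an integral affine scheme. -/
lemma IsInvertibleIdeal.comap_of_ne_bot [IsDomain B] {J : X.IdealSheafData}
    (hJ : IsInvertibleIdeal J) (f : Spec (.of B) ⟶ X) (hf : J.comap f ≠ ⊥) :
    IsInvertibleIdeal (J.comap f) := by
  rw [isInvertibleIdeal_iff]
  intro y
  obtain ⟨A, _, i, hi, hy, g, hg, h⟩ := (isInvertibleIdeal_iff J).1 hJ (f y)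
  obtain ⟨s, h1, h2⟩ := exists_chart_basicOpen (𝟙 (Spec (.of B))) y (f ⁻¹ᵁ i.opensRange) hy
  rw [Category.comp_id] at h1 h2
  set k := Spec.map (CommRingCat.ofHom (algebraMap B (Localization.Away s))) with hk
  have hko : IsOpenImmersion k := by rw [hk]; infer_instance
  have hr : Set.range (k ≫ f) ⊆ Set.range i := by
    rintro _ ⟨q, rfl⟩
    rw [Scheme.Hom.comp_apply]
    exact h2 ⟨q, rfl⟩
  obtain ⟨σ, hσ⟩ := Spec.map_surjective (IsOpenImmersion.lift i (k ≫ f) hr)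
  have hfac := IsOpenImmersion.lift_fac i (k ≫ f) hr
  rw [← hσ] at hfac
  have hc : (J.comap f).comap k = sheafOf (Ideal.span {σ.hom g}) := by
    rw [← comap_comp, ← hfac, comap_comp, h]
    exact (sheafOf_comap σ.hom _).trans (by rw [Ideal.map_span, Set.image_singleton])
  have hs0 : s ≠ 0 := by
    rintro rfl
    obtain ⟨q, -⟩ := h1
    have : (algebraMap B (Localization.Away (0 : B))) 0 ∉ q.asIdeal := fun hq =>
      q.2.ne_top (Ideal.eq_top_of_isUnit_mem _ hq (IsLocalization.Away.algebraMap_isUnit 0))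
    exact this (by rw [map_zero]; exact zero_mem _)
  have : IsDomain (Localization.Away s) :=
    IsLocalization.isDomain_localization (powers_le_nonZeroDivisors_of_noZeroDivisors hs0)
  refine ⟨Localization.Away s, inferInstance, k, hko, h1, σ.hom g,
    mem_nonZeroDivisors_of_ne_zero ?_, hc⟩
  intro h0
  apply hf
  rw [h0, ← sheafOf_idealOf (J.comap f), hk, sheafOf_comap] at hc
  have h3 := congrArg idealOf hc
  rw [idealOf_sheafOf, idealOf_sheafOf, Ideal.span_singleton_eq_bot.2 rfl, Ideal.map_eq_bot_iff_of_injective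
    (IsLocalization.injective _ (powers_le_nonZeroDivisors_of_noZeroDivisors hs0))] at h3
  apply idealOf_injective
  rw [h3, idealOf]
  symm
  rw [eq_bot_iff]
  intro z hz
  have hz' : (Scheme.ΓSpecIso (.of B)).inv.hom z = 0 := hz
  have := congrArg (Scheme.ΓSpecIso (.of B)).hom.hom hz'
  rwa [← CommRingCat.comp_apply, Iso.inv_hom_id, CommRingCat.id_apply, map_zero] at this

end Blowups

end SmoothCollection
end

noncomputable section

namespace SmoothCollection

/-! ### Affine charts of blowups -/

section BlowupCharts

open Scheme.IdealSheafData Polynomial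

variable {C C₁ B : Type u} [CommRing C] [CommRing C₁] [CommRing B] {X X' Y : Scheme.{u}}

/-- `C₁` is the algebra `C[a/b]`. -/
def IsAffineBlowup (ι : C →+* C₁) (a b : C) : Prop :=
  Function.Injective ι ∧ ∃ t : C₁, ι b * t = ι a ∧ ∀ z : C₁, ∃ F : C[X], F.eval₂ ι t = z

/-- The element `b` generates the ideal generated by `a` and `b`, and it is not a zero divisor. -/
def IsGoodGenerator (a b : C) : Prop := b ∈ nonZeroDivisors C ∧ b ∣ a

lemma algebraMap_mem_nonZeroDivisors {s z : B} (hz : z ∈ nonZeroDivisors B) :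
    algebraMap B (Localization.Away s) z ∈ nonZeroDivisors (Localization.Away s) :=
  IsLocalization.map_nonZeroDivisors_le (Submonoid.powers s) _
    (Submonoid.mem_map_of_mem (algebraMap B (Localization.Away s)) hz)

lemma IsGoodGenerator.of_dvd {a b : C} (h : IsGoodGenerator b a) (hd : b ∣ a) :
    IsGoodGenerator a b := by
  obtain ⟨t, rfl⟩ := hd
  exact ⟨(mul_mem_nonZeroDivisors.1 h.1).1, dvd_mul_right _ _⟩

lemma IsGoodGenerator.localize {a b s : B} (h : IsGoodGenerator b a) (hs : a * s = b) :
    IsGoodGenerator (algebraMap B (Localization.Away s) a)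
      (algebraMap B (Localization.Away s) b) := by
  have hu : IsUnit (algebraMap B (Localization.Away s) s) :=
    IsLocalization.Away.algebraMap_isUnit s
  obtain ⟨v, hv⟩ := hu.exists_right_inv
  rw [← hs, map_mul]
  exact ⟨mul_mem_nonZeroDivisors.2 ⟨algebraMap_mem_nonZeroDivisors h.1, hu.mem_nonZeroDivisors⟩,
    v, by rw [mul_assoc, hv, mul_one]⟩

lemma specMap_comp (φ : C →+* C₁) (ψ : C₁ →+* B) : Spec.map (CommRingCat.ofHom (ψ.comp φ)) =
    Spec.map (CommRingCat.ofHom ψ) ≫ Spec.map (CommRingCat.ofHom φ) := by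
  rw [CommRingCat.ofHom_comp, Spec.map_comp]

/-- A chart of `X'` over the chart `g` of `X` in which `b` generates the ideal `(a, b)`. -/
structure IsGoodChart (π : X' ⟶ X) (g : Spec (.of C) ⟶ X) (a b : C) (i : Spec (.of B) ⟶ X')
    (φ : C →+* B) : Prop where
  isOpenImmersion : IsOpenImmersion i
  comp : i ≫ π = Spec.map (CommRingCat.ofHom φ) ≫ g
  good : IsGoodGenerator (φ a) (φ b)

instance (s : B) : IsOpenImmersion
    (Spec.map (CommRingCat.ofHom (algebraMap B (Localization.Away s)))) :=
  inferInstanceAs (IsOpenImmersion (Spec.map (CommRingCat.ofHom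
    (algebraMap (CommRingCat.of B) (Localization.Away s)))))

lemma mem_range_away {s : B} {p : Spec (.of B)} (hs : s ∉ p.asIdeal) :
    p ∈ Set.range (Spec.map (CommRingCat.ofHom (algebraMap B (Localization.Away s)))) :=
  (PrimeSpectrum.localization_away_comap_range (Localization.Away s) s).ge hs

/-- Locally `(a, b) = (h)` with `h` regular. Writing `a = h a'` and `b = h b'` gives `r a' + s b' =
1`, so at each point `a'` or `b'` can be inverted, and then `a` or `b` generates the ideal. -/
lemma exists_isGoodChart {π : X' ⟶ X} {I : X.IdealSheafData} (hπ : IsBlowup π I)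
    (g : Spec (.of C) ⟶ X) [IsOpenImmersion g] {a b : C}
    (hI : I.comap g = sheafOf (Ideal.span {a, b})) (z : X') (hz : π z ∈ Set.range g) :
    ∃ (B : Type u) (_ : CommRing B) (i : Spec (.of B) ⟶ X') (φ : C →+* B), z ∈ Set.range i ∧
      (IsGoodChart π g a b i φ ∨ IsGoodChart π g b a i φ) := by
  obtain ⟨B, _, i, hi, ⟨p, hp⟩, hr, h, hh, hJ⟩ :=
    exists_chart_of_isInvertibleIdeal hπ.isInvertible_comap z (π ⁻¹ᵁ g.opensRange) hz
  have hr' : Set.range (i ≫ π) ⊆ Set.range g := by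
    rintro _ ⟨q, rfl⟩
    rw [Scheme.Hom.comp_apply]
    exact hr ⟨q, rfl⟩
  obtain ⟨φ', hφ'⟩ := Spec.map_surjective (IsOpenImmersion.lift g (i ≫ π) hr')
  have hfac := IsOpenImmersion.lift_fac g (i ≫ π) hr'
  rw [← hφ'] at hfac
  set φ : C →+* B := φ'.hom with hφ
  have hfac' : i ≫ π = Spec.map (CommRingCat.ofHom φ) ≫ g := hfac.symm
  have hspan : Ideal.span {φ a, φ b} = Ideal.span {h} := by
    rw [← comap_comp, hfac', comap_comp, hI, sheafOf_comap, Ideal.map_span,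
      Set.image_pair] at hJ
    simpa [idealOf_sheafOf] using congrArg idealOf hJ
  obtain ⟨a', ha'⟩ := Ideal.mem_span_singleton.1
    (hspan.le (Ideal.subset_span (Set.mem_insert _ _)))
  obtain ⟨b', hb'⟩ := Ideal.mem_span_singleton.1
    (hspan.le (Ideal.subset_span (Set.mem_insert_of_mem _ rfl)))
  obtain ⟨r, s, hrs⟩ := Ideal.mem_span_pair.1 (hspan.ge (Ideal.mem_span_singleton_self h))
  have hone : r * a' + s * b' = 1 := by
    rw [ha', hb'] at hrs
    have : h * (r * a' + s * b' - 1) = 0 := by linear_combination hrs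
    exact sub_eq_zero.1 ((mul_right_mem_nonZeroDivisors_eq_zero_iff hh).1 (by rwa [mul_comm]))
  have key : ∀ (a b a' b' : B), a = h * a' → b = h * b' →
      IsGoodGenerator (algebraMap B (Localization.Away b') a)
        (algebraMap B (Localization.Away b') b) := by
    rintro _ _ a' b' rfl rfl
    have hu : IsUnit (algebraMap B (Localization.Away b') b') :=
      IsLocalization.Away.algebraMap_isUnit b'
    obtain ⟨v, hv⟩ := hu.exists_right_inv
    rw [map_mul, map_mul]
    refine ⟨mul_mem_nonZeroDivisors.2 ⟨algebraMap_mem_nonZeroDivisors hh, hu.mem_nonZeroDivisors⟩,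
      v * algebraMap _ _ a', ?_⟩
    linear_combination (-algebraMap B (Localization.Away b') h * algebraMap _ _ a') * hv
  have main : ∀ s : B, s ∉ p.asIdeal →
      z ∈ Set.range (Spec.map (CommRingCat.ofHom (algebraMap B (Localization.Away s))) ≫ i) ∧
      (Spec.map (CommRingCat.ofHom (algebraMap B (Localization.Away s))) ≫ i) ≫ π =
        Spec.map (CommRingCat.ofHom ((algebraMap B (Localization.Away s)).comp φ)) ≫ g := by
    intro s hs
    constructor
    · obtain ⟨q, hq⟩ := mem_range_away hs
      exact ⟨q, by rw [Scheme.Hom.comp_apply, hq, hp]⟩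
    · rw [Category.assoc, hfac', specMap_comp φ (algebraMap B (Localization.Away s)), Category.assoc]
  by_cases hb : b' ∈ p.asIdeal
  · have ha : a' ∉ p.asIdeal := fun ha => p.2.ne_top ((Ideal.eq_top_iff_one _).2
      (hone ▸ p.asIdeal.add_mem (Ideal.mul_mem_left _ _ ha) (Ideal.mul_mem_left _ _ hb)))
    exact ⟨_, inferInstance, _, _, (main a' ha).1, Or.inr
      ⟨inferInstance, (main a' ha).2, key _ _ _ _ hb' ha'⟩⟩
  · exact ⟨_, inferInstance, _, _, (main b' hb).1, Or.inl
      ⟨inferInstance, (main b' hb).2, key _ _ _ _ ha' hb'⟩⟩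

/-- The chart `Spec C[a/b]` of a blowup. -/
theorem exists_blowupChart {π : X' ⟶ X} {I : X.IdealSheafData} (hπ : IsBlowup π I)
    (g : Spec (.of C) ⟶ X) [IsOpenImmersion g] {a b : C} (hb : b ≠ 0)
    (hI : I.comap g = sheafOf (Ideal.span {a, b})) [IsDomain C₁] (ι : C →+* C₁)
    (hι : IsAffineBlowup ι a b) :
    ∃ f : Spec (.of C₁) ⟶ X', IsOpenImmersion f ∧
      f ≫ π = Spec.map (CommRingCat.ofHom ι) ≫ g ∧
      ∀ (B : Type u) [CommRing B] (i : Spec (.of B) ⟶ X') (φ : C →+* B),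
        IsGoodChart π g a b i φ → Set.range i ⊆ Set.range f := by
  obtain ⟨hinj, t, ht, hgen⟩ := hι
  have hbι : ι b ≠ 0 := (map_ne_zero_iff ι hinj).2 hb
  obtain ⟨f, hf, -⟩ := hπ.existsUnique_lift (Spec.map (CommRingCat.ofHom ι) ≫ g) (by
    rw [comap_comp, hI, sheafOf_comap, Ideal.map_span, Set.image_pair, ← ht, Ideal.span_insert,
      sup_eq_right.2 ((Ideal.span_singleton_le_span_singleton).2 (dvd_mul_right _ _))]
    exact isInvertibleIdeal_sheafOf (mem_nonZeroDivisors_of_ne_zero hbι))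
  -- Where `b` generates, the quotient `a / b` exists and defines a ring map out of `C[a/b]`; the
  -- uniqueness part of the universal property makes it compatible with `i`.
  have hlift : ∀ (B : Type u) [CommRing B] (i : Spec (.of B) ⟶ X') (φ : C →+* B),
      IsGoodChart π g a b i φ → ∃ ψ : C₁ →+* B, ψ.comp ι = φ ∧
        Spec.map (CommRingCat.ofHom ψ) ≫ f = i := by
    intro B _ i φ hgood
    obtain ⟨hi, hc, hnzd, s, hs⟩ := hgood
    obtain ⟨ψ, hψ⟩ := exists_lift_of_generates hinj ht hgen φ hs.symm hnzd
    refine ⟨ψ, hψ, ?_⟩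
    symm
    refine hπ.hom_ext ?_ ?_
    · rw [Category.assoc, hf, hc, ← Category.assoc, ← Spec.map_comp, ← CommRingCat.ofHom_comp, hψ]
    · rw [comap_comp]
      exact hπ.isInvertible_comap.comap_of_isOpenImmersion _
  refine ⟨f, ?_, hf, fun B _ i φ hgood => ?_⟩
  swap
  · obtain ⟨ψ, -, h⟩ := hlift B i φ hgood
    rintro _ ⟨q, rfl⟩
    exact ⟨_, by rw [← h, Scheme.Hom.comp_apply]⟩
  -- Near the image of `f`, `b` always generates. On a chart where `a` does and `b = a s`, the
  -- relation `a = b t` on `Spec C[a/b]` gives `s t = 1`, so `s` can be inverted.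
  have hchart : ∀ x : Spec (.of C₁), ∃ (B : Type u) (_ : CommRing B) (i : Spec (.of B) ⟶ X')
      (φ : C →+* B), f x ∈ Set.range i ∧ IsGoodChart π g a b i φ := by
    intro x
    obtain ⟨B, _, i, φ, ⟨p, hp⟩, hgood | hgood⟩ := exists_isGoodChart hπ g hI (f x)
      ⟨Spec.map (CommRingCat.ofHom ι) x, by
        rw [← Scheme.Hom.comp_apply, ← Scheme.Hom.comp_apply, hf]⟩
    · exact ⟨B, _, i, φ, ⟨p, hp⟩, hgood⟩
    · obtain ⟨hi, hc, hg⟩ := hgood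
      obtain ⟨s, hs⟩ := hg.2
      have hsp : s ∉ p.asIdeal := by
        obtain ⟨c, ⟨q, hq⟩, hr⟩ := exists_chart_basicOpen (𝟙 (Spec (.of C₁))) x
          (f ⁻¹ᵁ i.opensRange) ⟨p, hp⟩
        rw [Category.comp_id] at hr hq
        set k := Spec.map (CommRingCat.ofHom (algebraMap C₁ (Localization.Away c))) with hk
        have hr' : Set.range (k ≫ f) ⊆ Set.range i := by
          rintro _ ⟨q, rfl⟩
          rw [Scheme.Hom.comp_apply]
          exact hr ⟨q, rfl⟩
        obtain ⟨σ, hσ⟩ := Spec.map_surjective (IsOpenImmersion.lift i (k ≫ f) hr')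
        have hfac := IsOpenImmersion.lift_fac i (k ≫ f) hr'
        rw [← hσ] at hfac
        have hcomm : CommRingCat.ofHom φ ≫ σ =
            CommRingCat.ofHom ι ≫ CommRingCat.ofHom (algebraMap C₁ (Localization.Away c)) := by
          apply Spec.map_injective
          rw [← cancel_mono g, Spec.map_comp, Category.assoc, ← hc, ← Category.assoc, hfac,
            Category.assoc, hf, Spec.map_comp, Category.assoc]
        have hcomm' : ∀ z, σ.hom (φ z) = algebraMap C₁ (Localization.Away c) (ι z) := fun z =>
          congrArg (fun e => e.hom z) hcomm
        have hu : IsUnit (σ.hom s) := by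
          refine IsUnit.of_mul_eq_one (algebraMap C₁ (Localization.Away c) t) ?_
          have h1 := congrArg σ.hom hs
          rw [map_mul, hcomm', hcomm', ← ht, map_mul] at h1
          have h2 := algebraMap_mem_nonZeroDivisors (s := c) (mem_nonZeroDivisors_of_ne_zero hbι)
          refine (mul_cancel_left_mem_nonZeroDivisors h2).1 ?_
          linear_combination -h1
        have hpq : p = Spec.map σ q := i.isOpenEmbedding.injective (by
          rw [hp, ← Scheme.Hom.comp_apply, hfac, Scheme.Hom.comp_apply, hq]
          rfl)
        rw [hpq]
        exact fun h => q.2.ne_top (Ideal.eq_top_of_isUnit_mem _ h hu)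
      obtain ⟨q, hq⟩ := mem_range_away hsp
      refine ⟨Localization.Away s, inferInstance,
        Spec.map (CommRingCat.ofHom (algebraMap B (Localization.Away s))) ≫ i,
        (algebraMap B (Localization.Away s)).comp φ,
        ⟨q, by rw [Scheme.Hom.comp_apply, hq, hp]⟩, inferInstance, ?_, hg.localize hs.symm⟩
      rw [Category.assoc, hc, specMap_comp φ (algebraMap B (Localization.Away s)), Category.assoc]
  refine isOpenImmersion_of_sections f fun x => ?_
  obtain ⟨B, _, i, φ, hx, hgood⟩ := hchart x
  obtain ⟨ψ, hψ, hψi⟩ := hlift B i φ hgood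
  refine ⟨_, i, Spec.map (CommRingCat.ofHom ψ), hgood.isOpenImmersion, hx, hψi, fun V r hr => ?_⟩
  rcases isEmpty_or_nonempty V with hV | ⟨⟨v⟩⟩
  · exact (isInitialOfIsEmpty (X := V.toScheme)).hom_ext _ _
  · have : Nonempty V.toScheme := ⟨v⟩
    have : IsIntegral V.toScheme := isIntegral_of_isOpenImmersion V.ι
    -- The generic point lies in every nonempty open subset, and `b` does not vanish there; this is
    -- what determines a morphism to `Spec C[a/b]`.
    have hbot : (⟨⊥, Ideal.isPrime_bot⟩ : PrimeSpectrum C₁) ∈ V.1 :=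
      ((PrimeSpectrum.le_iff_specializes _ _).1 bot_le).mem_open V.isOpen v.2
    symm
    refine hom_ext_of_generates ht hgen V.ι _ ?_ ⟨_, hbot⟩ hbι
    rw [Category.assoc, ← Spec.map_comp, ← CommRingCat.ofHom_comp, hψ, ← cancel_mono g,
      Category.assoc, Category.assoc, ← hf, ← hgood.comp, ← Category.assoc, ← Category.assoc, hr]

/-- If `b` already divides `a` downstairs, charts where `a` generates need no separate treatment. -/
lemma IsGoodChart.of_dvd {π : X' ⟶ X} {g : Spec (.of C) ⟶ X} {a b : C} {i : Spec (.of B) ⟶ X'}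
    {φ : C →+* B} (h : IsGoodChart π g b a i φ) (hd : b ∣ a) : IsGoodChart π g a b i φ :=
  ⟨h.1, h.2, h.3.of_dvd (map_dvd φ hd)⟩

end BlowupCharts

end SmoothCollection
end

noncomputable section

namespace SmoothCollection

/-! ### Strict transforms on charts -/

section StrictTransform

open Scheme.IdealSheafData

/-- Used to replace a point of the strict transform by a generization over a chosen prime of `T_S`.
-/
lemma exists_specializes_of_isIso {X Y : Scheme.{u}} (φ : X ⟶ Y) (V : Y.Opens) [IsIso (φ ∣_ V)]
    {x : X} {y : Y} (hx : φ x ∈ V) (hy : y ⤳ φ x) : ∃ x' : X, x' ⤳ x ∧ φ x' = y := by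
  have hyV : y ∈ V := hy.mem_open V.isOpen hx
  have hinv : ∀ v, (φ ∣_ V) (inv (φ ∣_ V) v) = v := fun v => by
    rw [← Scheme.Hom.comp_apply, IsIso.inv_hom_id]
    rfl
  have hinv' : ∀ v, inv (φ ∣_ V) ((φ ∣_ V) v) = v := fun v => by
    rw [← Scheme.Hom.comp_apply, IsIso.hom_inv_id]
    rfl
  obtain ⟨v, hv⟩ : ∃ v : V.toScheme, v.1 = y := ⟨⟨y, hyV⟩, rfl⟩
  obtain ⟨w, hw⟩ : ∃ w : (φ ⁻¹ᵁ V).toScheme, w.1 = x := ⟨⟨x, hx⟩, rfl⟩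
  have hs : v ⤳ (φ ∣_ V) w := by
    refine Topology.IsInducing.subtypeVal.specializes_iff.1 ?_
    have h := morphismRestrict_base_coe φ V w
    rw [hw] at h
    exact (hv.symm ▸ h.symm ▸ hy)
  have h1 := (hs.map (inv (φ ∣_ V)).continuous).map continuous_subtype_val
  have h2 := morphismRestrict_base_coe φ V (inv (φ ∣_ V) v)
  rw [hinv' w] at h1
  rw [hinv v] at h2
  exact ⟨_, hw ▸ h1, h2.symm.trans hv⟩

variable {K : Type u} [Field K] {d : ℕ}

/-- The prime ideal `(x, u_j)`. -/
lemma exists_prime_le {P : Ideal (RS K d)} (hx : xVar K d ∈ P) {j : Fin (d + 1)}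
    (hj : uVar K d j ∈ P) : ∃ Q : Ideal (RS K d), Q.IsPrime ∧ Q ≤ P ∧ xVar K d ∈ Q ∧
      uVar K d j ∈ Q ∧ yVar K d ∉ Q ∧ ∀ i, i ≠ j → uVar K d i ∉ Q := by
  set S : Finset (Fin (d + 1) ⊕ Fin 2) := {Sum.inr 0, Sum.inl j} with hS
  have hker : RingHom.ker (toRS K d) ≤ vI K d S := by
    rw [ker_toRS, Ideal.span_singleton_le_iff_mem]
    exact Ideal.sub_mem _ (Ideal.mul_mem_right _ _ (Xv_mem (by simp [hS])))
      (uProd_mem K d (Finset.mem_univ j) (by simp [hS]))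
  have hn : ∀ s, s ∉ S → toRS K d (Xv K d s) ∉ (vI K d S).map (toRS K d) := fun s hs h =>
    Xv_notMem hs ((mem_map_iff_of_ker_le (toRS_surjective K d) hker).1 h)
  refine ⟨(vI K d S).map (toRS K d), Ideal.map_isPrime_of_surjective (toRS_surjective K d) hker,
    ?_, Ideal.mem_map_of_mem _ (Xv_mem (by simp [hS])), Ideal.mem_map_of_mem _ (Xv_mem (by simp [hS])),
    hn _ (by simp [hS]), fun i hi => hn _ (by simp [hS, hi])⟩
  rw [hS, vI_pair, Ideal.map_span, Ideal.span_le]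
  rintro _ ⟨s, rfl | rfl, rfl⟩
  exacts [hx, hj]

variable (τ : Fin (d + 1) → Ordering)

/-- The element `u_S` of a chart. -/
def uCProd (S : Finset (Fin (d + 1))) : Ch K τ := ∏ j ∈ S, uC K τ j

lemma toFF_uCProd (S : Finset (Fin (d + 1))) : toFF K τ (uCProd τ S) = uK K d S := by
  rw [uCProd, map_prod, uK, map_prod]
  rfl

lemma uCProd_mul_xiC : uCProd τ (part τ .lt) * xiC K τ = ofRS K τ (xVar K d) := by
  apply toFF_injective
  rw [map_mul, toFF_uCProd, toFF_xiC, uK_mul_xi, toFF_ofRS]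
  rfl

lemma uCProd_mul_etaC : uCProd τ (part τ .gt) * etaC K τ = ofRS K τ (yVar K d) := by
  apply toFF_injective
  rw [map_mul, toFF_uCProd, toFF_etaC, uK_mul_eta, toFF_ofRS]
  rfl

lemma xiC_mul_etaC : xiC K τ * etaC K τ = uCProd τ (part τ .eq) := by
  apply toFF_injective
  rw [map_mul, toFF_uCProd, toFF_etaC, toFF_xiC, xi_mul_eta]

lemma uCProd_ne_zero (S : Finset (Fin (d + 1))) : uCProd (K := K) τ S ≠ 0 := fun h =>
  uK_ne_zero (K := K) S (by rw [← toFF_uCProd τ, h, map_zero])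

lemma xiC_ne_zero : xiC K τ ≠ 0 := fun h => xi_ne_zero K τ (by rw [← toFF_xiC, h, map_zero])

lemma etaC_ne_zero : etaC K τ ≠ 0 := fun h => eta_ne_zero K τ (by rw [← toFF_etaC, h, map_zero])

/-- The structure map `Spec Ch ⟶ T_S` of a chart. -/
def chartMap : Spec (.of (Ch K τ)) ⟶ TS K d := Spec.map (CommRingCat.ofHom (ofRS K τ))

lemma chartMap_asIdeal (q : Spec (.of (Ch K τ))) :
    (chartMap τ q).asIdeal = q.asIdeal.comap (ofRS K τ) := rfl

variable {τ}

/-- The ideal of the strict transform of `D_A` on a chart. -/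
lemma idealOf_strictTransform {X : Scheme.{u}} {β : X ⟶ TS K d}
    (hβ : ∀ t : TS K d, yVar K d ∉ t.asIdeal → t ∈ isoLocus β) (g : Spec (.of (Ch K τ)) ⟶ X)
    [IsOpenImmersion g] (hg : g ≫ β = chartMap τ) (A : Finset (Fin (d + 1))) :
    (vanishingIdeal (strictTransform β (weilDivisor K d A))).comap g =
      sheafOf (Ideal.span {uCProd τ (A ∩ part τ .lt) * xiC K τ,
        uCProd τ (A ∩ part τ .lt) * uCProd τ (A ∩ part τ .eq)}) := by
  apply idealOf_injective
  rw [idealOf_sheafOf, idealOf_comap_vanishingIdeal]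
  have hcl : g ⁻¹' (strictTransform β (weilDivisor K d A) : Set X) =
      closure (g ⁻¹' (β ⁻¹' ((weilDivisor K d A : Set (TS K d)) ∩ (isoLocus β : Set (TS K d))))) :=
    g.isOpenEmbedding.isOpenMap.preimage_closure_eq_closure_preimage g.continuous _
  have hmem : ∀ q : Spec (.of (Ch K τ)),
      q ∈ g ⁻¹' (β ⁻¹' ((weilDivisor K d A : Set (TS K d)) ∩ (isoLocus β : Set (TS K d)))) ↔
      (ofRS K τ (xVar K d) ∈ q.asIdeal ∧ ∃ j ∈ A, uC K τ j ∈ q.asIdeal) ∧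
        chartMap τ q ∈ isoLocus β := by
    intro q
    rw [Set.mem_preimage, Set.mem_preimage, ← Scheme.Hom.comp_apply, hg, Set.mem_inter_iff]
    refine and_congr ?_ Iff.rfl
    change ({xVar K d, ∏ j ∈ A, uVar K d j} : Set (RS K d)) ⊆ (chartMap τ q).asIdeal ↔ _
    have := q.2
    rw [chartMap_asIdeal, Set.insert_subset_iff, Set.singleton_subset_iff, SetLike.mem_coe,
      SetLike.mem_coe, Ideal.mem_comap, Ideal.mem_comap, map_prod, this.prod_mem_iff]
    rfl
  refine (congrArg PrimeSpectrum.vanishingIdeal hcl).trans ?_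
  refine (PrimeSpectrum.vanishingIdeal_closure _).trans ?_
  apply le_antisymm
  -- The generic points `(u_j)`, `j ∈ L`, and `(ξ, u_j)`, `j ∈ M`, lie over `y ≠ 0`, so they belong
  -- to the set whose closure is taken; an element vanishing at all of them is in the asserted
  -- ideal.
  · intro z hz
    replace hz := (PrimeSpectrum.mem_vanishingIdeal _ _).1 hz
    refine mem_centre A (fun j hj hjτ => ?_) (fun j hj hjτ => ?_)
    · refine hz (⟨_, span_uC_isPrime hjτ⟩ : PrimeSpectrum (Ch K τ)) ((hmem _).2 ⟨⟨?_, j, hj, ?_⟩, hβ _ ?_⟩)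
      · rw [← uCProd_mul_xiC]
        exact Ideal.mul_mem_right _ _ (Ideal.mem_of_dvd _
          (Finset.dvd_prod_of_mem _ (mem_part.2 hjτ)) (Ideal.mem_span_singleton_self _))
      · exact Ideal.mem_span_singleton_self _
      · exact ofRS_notMem_lower hjτ (by simp) (by simp)
    · refine hz (⟨_, span_xiC_uC_isPrime hjτ⟩ : PrimeSpectrum (Ch K τ)) ((hmem _).2 ⟨⟨?_, j, hj, ?_⟩, hβ _ ?_⟩)
      · rw [← uCProd_mul_xiC]
        exact Ideal.mul_mem_left _ _ (Ideal.mem_sup_left (Ideal.mem_span_singleton_self _))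
      · exact Ideal.mem_sup_right (Ideal.mem_span_singleton_self _)
      · exact ofRS_notMem_middle hjτ (by simp) (by simp)
  · suffices h : ∀ q : Spec (.of (Ch K τ)),
        q ∈ g ⁻¹' (β ⁻¹' ((weilDivisor K d A : Set (TS K d)) ∩ (isoLocus β : Set (TS K d)))) →
        (∃ j ∈ A ∩ part τ .lt, uC K τ j ∈ q.asIdeal) ∨
          (xiC K τ ∈ q.asIdeal ∧ ∃ j ∈ A ∩ part τ .eq, uC K τ j ∈ q.asIdeal) by
      rw [Ideal.span_le]
      rintro z (rfl | rfl)
      all_goals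
        refine (PrimeSpectrum.mem_vanishingIdeal _ _).2 fun q hq => ?_
        have hp := q.2
        rcases h q hq with hL | ⟨hx, hM⟩
        · exact Ideal.mul_mem_right _ _ (hp.prod_mem_iff.2 hL)
      · exact Ideal.mul_mem_left _ _ hx
      · exact Ideal.mul_mem_left _ _ (hp.prod_mem_iff.2 hM)
    intro q hq
    obtain ⟨⟨hx, j, hjA, hj⟩, hiso⟩ := (hmem q).1 hq
    -- The point is generized to one over a prime `Q` containing `x` and `u_j`, but neither `y` nor
    -- any other `u_i`. There `x = u_L ξ` forces `ξ = 0` if `j ∈ M`, and `y = u_U η` excludes `j ∈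
    -- U`.
    obtain ⟨Q, hQ, hQt, hQx, hQj, hQy, hQi⟩ := exists_prime_le (P := (chartMap τ q).asIdeal) hx hj
    obtain ⟨V, hV, htV⟩ := Opens.mem_sSup.1 hiso
    have hVi : IsIso (β ∣_ V) := hV
    have hgq : β (g q) = chartMap τ q := by rw [← Scheme.Hom.comp_apply, hg]
    obtain ⟨x', hx', hβx'⟩ := exists_specializes_of_isIso β V (x := g q)
      (y := (⟨Q, hQ⟩ : PrimeSpectrum (RS K d))) (by rwa [hgq])
      (by rw [hgq]; exact (PrimeSpectrum.le_iff_specializes _ _).1 hQt)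
    obtain ⟨q', rfl⟩ : x' ∈ g.opensRange := hx'.mem_open g.opensRange.isOpen ⟨q, rfl⟩
    have hle : q'.asIdeal ≤ q.asIdeal := (PrimeSpectrum.le_iff_specializes _ _).2
      (g.isOpenEmbedding.isInducing.specializes_iff.1 hx')
    have hq' : q'.asIdeal.comap (ofRS K τ) = Q := by
      rw [← chartMap_asIdeal, ← hg, Scheme.Hom.comp_apply, hβx']
    rw [← hq', Ideal.mem_comap] at hQx hQj hQy
    have hQi' : ∀ i, i ≠ j → uC K τ i ∉ q'.asIdeal := fun i hi h => hQi i hi (hq' ▸ h)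
    have hp := q'.2
    cases hτ : τ j
    · exact Or.inl ⟨j, by simp [hjA, hτ], hj⟩
    · refine Or.inr ⟨hle ?_, j, by simp [hjA, hτ], hj⟩
      rw [← uCProd_mul_xiC] at hQx
      refine (hp.mem_or_mem hQx).resolve_left fun h => ?_
      obtain ⟨i, hi, h⟩ := hp.prod_mem_iff.1 h
      refine hQi' i (fun hij => ?_) h
      subst hij
      rw [mem_part, hτ] at hi
      exact absurd hi (by simp)
    · refine absurd ?_ hQy
      rw [← uCProd_mul_etaC]
      exact Ideal.mul_mem_right _ _ (Ideal.mem_of_dvd _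
          (Finset.dvd_prod_of_mem _ (mem_part.2 hτ)) hQj)

end StrictTransform

end SmoothCollection
end

noncomputable section

namespace SmoothCollection

/-! ### Charts of the stages of the blowup sequence -/

section Refinement

open Polynomial

variable {K : Type u} [Field K] {d : ℕ} (τ : Fin (d + 1) → Ordering) (A : Finset (Fin (d + 1)))

/-- The chart of the blowup of `D_A` in which `η` is divided by `u_{M ∖ A}`. -/
def refineIn (i : Fin (d + 1)) : Ordering := if τ i = .eq then (if i ∈ A then .eq else .gt) else τ i

/-- The chart of the blowup of `D_A` in which `ξ` is divided by `u_{M ∩ A}`. -/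
def refineOut (i : Fin (d + 1)) : Ordering := if τ i = .eq then (if i ∈ A then .lt else .eq) else τ i

lemma part_refineIn_lt : part (refineIn τ A) .lt = part τ .lt := by
  ext i; simp only [mem_part, refineIn]; split_ifs <;> simp_all

lemma part_refineIn_eq : part (refineIn τ A) .eq = A ∩ part τ .eq := by
  ext i; simp only [mem_part, refineIn, Finset.mem_inter]; split_ifs <;> simp_all

lemma part_refineIn_gt : part (refineIn τ A) .gt = part τ .gt ∪ part τ .eq \ A := by
  ext i; simp only [mem_part, refineIn, Finset.mem_union, Finset.mem_sdiff]; split_ifs <;> simp_all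

lemma part_refineOut_lt : part (refineOut τ A) .lt = part τ .lt ∪ A ∩ part τ .eq := by
  ext i; simp only [mem_part, refineOut, Finset.mem_union, Finset.mem_inter]; split_ifs <;> simp_all

lemma part_refineOut_gt : part (refineOut τ A) .gt = part τ .gt := by
  ext i; simp only [mem_part, refineOut]; split_ifs <;> simp_all

variable (K) in
lemma uK_union {S T : Finset (Fin (d + 1))} (h : Disjoint S T) :
    uK K d (S ∪ T) = uK K d S * uK K d T := by
  rw [uK, uK, uK, ← map_mul, Finset.prod_union h]

lemma disjoint_part {o o' : Ordering} (h : o ≠ o') : Disjoint (part τ o) (part τ o') := by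
  rw [Finset.disjoint_left]
  intro i hi hi'
  rw [mem_part] at hi hi'
  exact h (hi.symm.trans hi')

variable {τ}

lemma toFF_codRestrict {R : Type*} [CommRing R] (f : R →+* FF K d)
    (h : ∀ z, f z ∈ chart K τ) (z : R) : toFF K τ (f.codRestrict (chart K τ) h z) = f z := rfl

/-- The inclusion between two charts. -/
def chInc {τ' : Fin (d + 1) → Ordering} (h : chart K τ ≤ chart K τ') : Ch K τ →+* Ch K τ' :=
  (toFF K τ).codRestrict (chart K τ') fun z => h z.2

lemma toFF_chInc {τ' : Fin (d + 1) → Ordering} (h : chart K τ ≤ chart K τ') (z : Ch K τ) :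
    toFF K τ' (chInc h z) = toFF K τ z :=
  toFF_codRestrict (toFF K τ) _ z

lemma chInc_comp_ofRS {τ' : Fin (d + 1) → Ordering} (h : chart K τ ≤ chart K τ') :
    (chInc h).comp (ofRS K τ) = ofRS K τ' := by
  refine RingHom.ext fun r => ?_
  apply toFF_injective
  rw [RingHom.comp_apply, toFF_chInc, toFF_ofRS, toFF_ofRS]

lemma chart_le {τ' : Fin (d + 1) → Ordering} (h₁ : xi K τ ∈ chart K τ')
    (h₂ : eta K τ ∈ chart K τ') : chart K τ ≤ chart K τ' :=
  Algebra.adjoin_le (by rintro _ (rfl | rfl) <;> assumption)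

lemma ch_induction {p : Ch K τ → Prop} (hx : p (xiC K τ)) (he : p (etaC K τ))
    (hr : ∀ r, p (ofRS K τ r)) (hadd : ∀ a b, p a → p b → p (a + b))
    (hmul : ∀ a b, p a → p b → p (a * b)) (z : Ch K τ) : p z := by
  obtain ⟨z, hz⟩ := z
  induction hz using Algebra.adjoin_induction with
  | mem x h =>
    rcases h with rfl | rfl
    exacts [hx, he]
  | algebraMap r => exact hr r
  | add a b ha hb h₁ h₂ => exact hadd ⟨a, ha⟩ ⟨b, hb⟩ h₁ h₂
  | mul a b ha hb h₁ h₂ => exact hmul ⟨a, ha⟩ ⟨b, hb⟩ h₁ h₂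

lemma isAffineBlowup_chInc {τ' : Fin (d + 1) → Ordering} (h : chart K τ ≤ chart K τ')
    {a b : Ch K τ} {t : Ch K τ'} (ht : toFF K τ b * toFF K τ' t = toFF K τ a)
    (h₁ : ∃ F : (Ch K τ)[X], F.eval₂ (chInc h) t = xiC K τ')
    (h₂ : ∃ F : (Ch K τ)[X], F.eval₂ (chInc h) t = etaC K τ') :
    IsAffineBlowup (chInc h) a b := by
  refine ⟨fun p q hpq => toFF_injective K τ (by rw [← toFF_chInc h, hpq, toFF_chInc]), t, ?_, ?_⟩
  · apply toFF_injective
    rw [map_mul, toFF_chInc, toFF_chInc, ht]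
  · refine fun z => ch_induction (p := fun z => ∃ F : (Ch K τ)[X], F.eval₂ (chInc h) t = z)
      h₁ h₂ (fun r => ⟨C (ofRS K τ r), ?_⟩) ?_ ?_ z
    · rw [eval₂_C, ← chInc_comp_ofRS h, RingHom.comp_apply]
    · rintro _ _ ⟨F, rfl⟩ ⟨G, rfl⟩
      exact ⟨F + G, eval₂_add _ _⟩
    · rintro _ _ ⟨F, rfl⟩ ⟨G, rfl⟩
      exact ⟨F * G, eval₂_mul _ _⟩

variable (K τ)

lemma xi_refineIn : xi K (refineIn τ A) = xi K τ := by
  rw [xi, xi, part_refineIn_lt]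

lemma eta_refineIn : eta K (refineIn τ A) * uK K d (part τ .eq \ A) = eta K τ := by
  rw [eta, eta, part_refineIn_gt, uK_union]
  · have h₁ := uK_ne_zero (K := K) (part τ .eq \ A)
    have h₂ := uK_ne_zero (K := K) (part τ .gt)
    field_simp
  · exact (disjoint_part τ (by simp)).mono_right Finset.sdiff_subset

lemma xi_refineOut : xi K (refineOut τ A) * uK K d (A ∩ part τ .eq) = xi K τ := by
  rw [xi, xi, part_refineOut_lt, uK_union]
  · have h₁ := uK_ne_zero (K := K) (A ∩ part τ .eq)
    have h₂ := uK_ne_zero (K := K) (part τ .lt)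
    field_simp
  · exact (disjoint_part τ (by simp)).mono_right Finset.inter_subset_right

lemma eta_refineOut : eta K (refineOut τ A) = eta K τ := by
  rw [eta, eta, part_refineOut_gt]

lemma uK_mem (S : Finset (Fin (d + 1))) : uK K d S ∈ chart K τ := Subalgebra.algebraMap_mem _ _

lemma chart_le_refineIn : chart K τ ≤ chart K (refineIn τ A) :=
  chart_le (xi_refineIn K τ A ▸ xi_mem K _)
    (eta_refineIn K τ A ▸ Subalgebra.mul_mem _ (eta_mem K _) (uK_mem K _ _))

lemma chart_le_refineOut : chart K τ ≤ chart K (refineOut τ A) :=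
  chart_le (xi_refineOut K τ A ▸ Subalgebra.mul_mem _ (xi_mem K _) (uK_mem K _ _))
    (eta_refineOut K τ A ▸ eta_mem K _)

/-- The adjoined quotient `u_{A ∩ M} / ξ = η / u_{M ∖ A}` is the new `η`, and `ξ` is unchanged. The
common factor `w` does not affect the quotient. -/
lemma isAffineBlowup_refineIn (w : Ch K τ) : IsAffineBlowup (chInc (chart_le_refineIn K τ A))
    (w * uCProd τ (A ∩ part τ .eq)) (w * xiC K τ) := by
  refine isAffineBlowup_chInc _ (t := etaC K _) ?_ ⟨C (xiC K τ), ?_⟩ ⟨X, eval₂_X _ _⟩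
  · rw [map_mul, map_mul, toFF_uCProd, toFF_xiC, toFF_etaC, ← xi_refineIn K τ A, mul_assoc,
      xi_mul_eta, part_refineIn_eq]
  · rw [eval₂_C]
    apply toFF_injective
    rw [toFF_chInc, toFF_xiC, toFF_xiC, xi_refineIn]

/-- The adjoined quotient `ξ / u_{A ∩ M}` is the new `ξ`, and `η` is unchanged. -/
lemma isAffineBlowup_refineOut (w : Ch K τ) : IsAffineBlowup (chInc (chart_le_refineOut K τ A))
    (w * xiC K τ) (w * uCProd τ (A ∩ part τ .eq)) := by
  refine isAffineBlowup_chInc _ (t := xiC K _) ?_ ⟨X, eval₂_X _ _⟩ ⟨C (etaC K τ), ?_⟩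
  · rw [map_mul, map_mul, toFF_uCProd, toFF_xiC, toFF_xiC, ← xi_refineOut K τ A]
    ring
  · rw [eval₂_C]
    apply toFF_injective
    rw [toFF_chInc, toFF_etaC, toFF_etaC, eta_refineOut]

end Refinement

/-! ### The codes of the stages and their behaviour under blowing up -/

section Stages

open Scheme.IdealSheafData

variable {K : Type u} [Field K] {d : ℕ} {X X' : Scheme.{u}}

/-- The relative position of a function with respect to its value at `j`. -/
def chartOrd (c : Fin (d + 1) → ℕ) (j i : Fin (d + 1)) : Ordering := compare (c i) (c j)

/-- A scheme over `T_S` that is covered by the charts given by an integer-valued function. -/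
structure HasCharts (β : X ⟶ TS K d) (c : Fin (d + 1) → ℕ) : Prop where
  exists_chart : ∀ j, ∃ g : Spec (.of (Ch K (chartOrd c j))) ⟶ X,
    IsOpenImmersion g ∧ g ≫ β = chartMap (chartOrd c j)
  cover : ∀ z : X, ∃ j, ∃ g : Spec (.of (Ch K (chartOrd c j))) ⟶ X,
    IsOpenImmersion g ∧ g ≫ β = chartMap (chartOrd c j) ∧ z ∈ Set.range g
  uniq : ∀ (B : Type u) [CommRing B] [IsDomain B] (f₁ f₂ : Spec (.of B) ⟶ X) (φ : RS K d →+* B),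
    Function.Injective φ → f₁ ≫ β = Spec.map (CommRingCat.ofHom φ) →
    f₂ ≫ β = Spec.map (CommRingCat.ofHom φ) → f₁ = f₂
  isIso : ∃ V : (TS K d).Opens, (∀ t : TS K d, t ∈ V ↔ yVar K d ∉ t.asIdeal) ∧ IsIso (β ∣_ V)

/-- The function describing the charts of the blowup along the strict transform of `D_A`. -/
def nextCode (c : Fin (d + 1) → ℕ) (A : Finset (Fin (d + 1))) (i : Fin (d + 1)) : ℕ :=
  -- Doubling leaves room to split each level set of `c` without disturbing the others, the part
  -- inside `A` coming first.
  2 * c i + if i ∈ A then 0 else 1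

lemma nextCode_eq_iff {c : Fin (d + 1) → ℕ} {A : Finset (Fin (d + 1))} {i j : Fin (d + 1)} :
    nextCode c A i = nextCode c A j ↔ c i = c j ∧ (i ∈ A ↔ j ∈ A) := by
  unfold nextCode
  split_ifs <;> simp_all <;> omega

lemma chartOrd_nextCode_of_mem {c : Fin (d + 1) → ℕ} {A : Finset (Fin (d + 1))}
    {j : Fin (d + 1)} (hj : j ∈ A) :
    chartOrd (nextCode c A) j = refineIn (chartOrd c j) A := by
  ext1 i
  change compare (2 * c i + if i ∈ A then 0 else 1) (2 * c j + if j ∈ A then 0 else 1) =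
    if compare (c i) (c j) = .eq then _ else compare (c i) (c j)
  rcases lt_trichotomy (c i) (c j) with h | h | h
  · rw [compare_lt_iff_lt.2 h, if_neg (show ¬Ordering.lt = Ordering.eq by simp), compare_lt_iff_lt]
    split_ifs <;> omega
  · rw [h, compare_eq_iff_eq.2 rfl, if_pos rfl, if_pos hj]
    split_ifs
    · rw [compare_eq_iff_eq]
    · rw [compare_gt_iff_gt]; omega
  · rw [compare_gt_iff_gt.2 h, if_neg (show ¬Ordering.gt = Ordering.eq by simp), compare_gt_iff_gt]
    split_ifs <;> omega

lemma chartOrd_nextCode_of_notMem {c : Fin (d + 1) → ℕ} {A : Finset (Fin (d + 1))}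
    {j : Fin (d + 1)} (hj : j ∉ A) :
    chartOrd (nextCode c A) j = refineOut (chartOrd c j) A := by
  ext1 i
  change compare (2 * c i + if i ∈ A then 0 else 1) (2 * c j + if j ∈ A then 0 else 1) =
    if compare (c i) (c j) = .eq then _ else compare (c i) (c j)
  rcases lt_trichotomy (c i) (c j) with h | h | h
  · rw [compare_lt_iff_lt.2 h, if_neg (show ¬Ordering.lt = Ordering.eq by simp), compare_lt_iff_lt]
    split_ifs <;> omega
  · rw [h, compare_eq_iff_eq.2 rfl, if_pos rfl, if_neg hj]
    split_ifs
    · rw [compare_lt_iff_lt]; omega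
    · rw [compare_eq_iff_eq]
  · rw [compare_gt_iff_gt.2 h, if_neg (show ¬Ordering.gt = Ordering.eq by simp), compare_gt_iff_gt]
    split_ifs <;> omega

lemma HasCharts.mem_isoLocus {β : X ⟶ TS K d} {c : Fin (d + 1) → ℕ} (h : HasCharts β c)
    (t : TS K d) (ht : yVar K d ∉ t.asIdeal) : t ∈ isoLocus β := by
  obtain ⟨V, hV, hVi⟩ := h.isIso
  exact Opens.mem_sSup.2 ⟨V, hVi, (hV t).2 ht⟩

lemma strictTransform_le {β : X ⟶ TS K d} {Z : Closeds (TS K d)} {z : X}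
    (hz : z ∈ strictTransform β Z) : β z ∈ Z := by
  have h : closure (β ⁻¹' ((Z : Set (TS K d)) ∩ (isoLocus β : Set (TS K d)))) ⊆ β ⁻¹' Z :=
    closure_minimal (Set.preimage_mono Set.inter_subset_left) (Z.isClosed.preimage β.continuous)
  exact h hz

variable {β : X ⟶ TS K d} {c : Fin (d + 1) → ℕ} {A : Finset (Fin (d + 1))} {π : X' ⟶ X}

/-- If the centre pulled back to zero, the generic point of `Spec B` would map into `D_A`, where `x`
vanishes, although `x` is nonzero in `B`. So the pullback is invertible and the universal property
applies. -/
lemma HasCharts.uniq_blowup (h : HasCharts β c)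
    (hπ : IsBlowup π (vanishingIdeal (strictTransform β (weilDivisor K d A))))
    (B : Type u) [CommRing B] [IsDomain B] (f₁ f₂ : Spec (.of B) ⟶ X') (φ : RS K d →+* B)
    (hφ : Function.Injective φ) (h₁ : f₁ ≫ π ≫ β = Spec.map (CommRingCat.ofHom φ))
    (h₂ : f₂ ≫ π ≫ β = Spec.map (CommRingCat.ofHom φ)) : f₁ = f₂ := by
  have he : f₁ ≫ π = f₂ ≫ π := h.uniq B _ _ φ hφ (by rw [Category.assoc, h₁])
    (by rw [Category.assoc, h₂])
  refine hπ.hom_ext he ?_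
  rw [comap_comp]
  refine hπ.isInvertible_comap.comap_of_ne_bot f₁ fun hbot => ?_
  rw [← comap_comp] at hbot
  have hs := congrArg support hbot
  rw [support_comap, support_bot] at hs
  have hmem : (⟨⊥, Ideal.isPrime_bot⟩ : PrimeSpectrum B) ∈
      (vanishingIdeal (strictTransform β (weilDivisor K d A))).support.preimage
        (f₁ ≫ π).continuous := by
    rw [hs]
    trivial
  have hmem' : (f₁ ≫ π) (⟨⊥, Ideal.isPrime_bot⟩ : PrimeSpectrum B) ∈
      strictTransform β (weilDivisor K d A) := by
    have h0 : ((vanishingIdeal (strictTransform β (weilDivisor K d A))).support : Set X) =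
      strictTransform β (weilDivisor K d A) := coe_support_vanishingIdeal _
    exact h0.le hmem
  have h3 := strictTransform_le hmem'
  change ((f₁ ≫ π) ≫ β) (⟨⊥, Ideal.isPrime_bot⟩ : PrimeSpectrum B) ∈ weilDivisor K d A at h3
  rw [Category.assoc, h₁] at h3
  have h4 : xVar K d ∈ Ideal.comap φ ⊥ := h3 (Set.mem_insert _ _)
  exact xVar_ne_zero K d (hφ (by rw [map_zero]; exact h4))

/-- Where `y` is invertible, so is `η`; then `u_{A ∩ M}`, a divisor of `u_M = ξ η`, divides `ξ`, and
the ideal of the centre is principal. -/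
lemma HasCharts.isIso_blowup (h : HasCharts β c)
    (hπ : IsBlowup π (vanishingIdeal (strictTransform β (weilDivisor K d A)))) :
    ∃ V : (TS K d).Opens, (∀ t : TS K d, t ∈ V ↔ yVar K d ∉ t.asIdeal) ∧
      IsIso ((π ≫ β) ∣_ V) := by
  obtain ⟨V, hV, hVi⟩ := h.isIso
  refine ⟨V, hV, ?_⟩
  rw [morphismRestrict_comp]
  have : IsIso (π ∣_ β ⁻¹ᵁ V) := by
    refine hπ.isIso_morphismRestrict _ ((isInvertibleIdeal_iff _).2 fun v => ?_)
    obtain ⟨τ, g, hgo, hg, ⟨q, hq⟩⟩ : ∃ (τ : Fin (d + 1) → Ordering)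
        (g : Spec (.of (Ch K τ)) ⟶ X), IsOpenImmersion g ∧ g ≫ β = chartMap τ ∧
          v.1 ∈ Set.range g := by
      obtain ⟨j, g, hg⟩ := h.cover v.1
      exact ⟨_, g, hg⟩
    set s := ofRS K τ (yVar K d)
    set k := Spec.map (CommRingCat.ofHom (algebraMap (Ch K τ) (Localization.Away s))) with hk
    have hqs : s ∉ q.asIdeal := by
      have h1 := (hV _).1 v.2
      change yVar K d ∉ (β v.1).asIdeal at h1
      rwa [← hq, ← Scheme.Hom.comp_apply, hg] at h1
    have hr : Set.range (k ≫ g) ⊆ Set.range (β ⁻¹ᵁ V).ι := by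
      rintro _ ⟨p, rfl⟩
      rw [Scheme.Opens.range_ι, Scheme.Hom.comp_apply]
      refine (hV _).2 ?_
      rw [← Scheme.Hom.comp_apply, hg]
      exact fun hp => p.2.ne_top (Ideal.eq_top_of_isUnit_mem _ hp
        (IsLocalization.Away.algebraMap_isUnit s))
    have hfac := IsOpenImmersion.lift_fac _ _ hr
    have ho : IsOpenImmersion (IsOpenImmersion.lift (β ⁻¹ᵁ V).ι _ hr ≫ (β ⁻¹ᵁ V).ι) := by
      rw [hfac]
      infer_instance
    obtain ⟨p, hp⟩ := mem_range_away hqs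
    refine ⟨_, inferInstance, IsOpenImmersion.lift (β ⁻¹ᵁ V).ι _ hr,
      IsOpenImmersion.of_comp _ (β ⁻¹ᵁ V).ι, ⟨p, (β ⁻¹ᵁ V).ι.isOpenEmbedding.injective ?_⟩,
      algebraMap (Ch K τ) _ (uCProd τ (A ∩ part τ .lt) * uCProd τ (A ∩ part τ .eq)), ?_, ?_⟩
    · rw [← Scheme.Hom.comp_apply, hfac, Scheme.Hom.comp_apply, hp, hq]
      rfl
    · exact algebraMap_mem_nonZeroDivisors (mem_nonZeroDivisors_of_ne_zero
        (mul_ne_zero (uCProd_ne_zero τ _) (uCProd_ne_zero τ _)))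
    · rw [← comap_comp, hfac, comap_comp, idealOf_strictTransform h.mem_isoLocus g hg A, hk,
        sheafOf_comap, Ideal.map_span, Set.image_pair, Ideal.span_insert, sup_eq_right.2]
      rw [Ideal.span_singleton_le_span_singleton, map_mul, map_mul]
      refine mul_dvd_mul_left _ ?_
      have hu : IsUnit (algebraMap (Ch K τ) (Localization.Away s) (etaC K τ)) := by
        refine isUnit_of_dvd_unit ?_ (IsLocalization.Away.algebraMap_isUnit s)
        refine map_dvd _ ⟨uCProd τ (part τ .gt), ?_⟩
        rw [mul_comm, uCProd_mul_etaC]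
      rw [← hu.dvd_mul_right, ← map_mul, xiC_mul_etaC]
      exact map_dvd _ (Finset.prod_dvd_prod_of_subset _ _ _ Finset.inter_subset_right)
  exact @IsIso.comp_isIso _ _ _ _ _ _ _ this hVi

variable {τ : Fin (d + 1) → Ordering}

lemma comp_chInc {τ' : Fin (d + 1) → Ordering} (hle : chart K τ ≤ chart K τ')
    {f : Spec (.of (Ch K τ')) ⟶ X'} {g : Spec (.of (Ch K τ)) ⟶ X} (hg : g ≫ β = chartMap τ)
    (hf : f ≫ π = Spec.map (CommRingCat.ofHom (chInc hle)) ≫ g) :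
    f ≫ π ≫ β = chartMap τ' := by
  rw [← Category.assoc, hf, Category.assoc, hg, chartMap, chartMap, ← chInc_comp_ofRS hle]
  exact (specMap_comp _ _).symm

lemma HasCharts.exists_refineIn (h : HasCharts β c)
    (hπ : IsBlowup π (vanishingIdeal (strictTransform β (weilDivisor K d A))))
    (g : Spec (.of (Ch K τ)) ⟶ X) [IsOpenImmersion g] (hg : g ≫ β = chartMap τ) :
    ∃ f : Spec (.of (Ch K (refineIn τ A))) ⟶ X', IsOpenImmersion f ∧
      f ≫ π ≫ β = chartMap (refineIn τ A) ∧
      ∀ (B : Type u) [CommRing B] (i : Spec (.of B) ⟶ X') (φ : Ch K τ →+* B),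
        IsGoodChart π g (uCProd τ (A ∩ part τ .lt) * uCProd τ (A ∩ part τ .eq))
          (uCProd τ (A ∩ part τ .lt) * xiC K τ) i φ → Set.range i ⊆ Set.range f := by
  have hI := idealOf_strictTransform h.mem_isoLocus g hg A
  rw [Set.pair_comm] at hI
  obtain ⟨f, hfo, hf, hgood⟩ := exists_blowupChart hπ g
    (mul_ne_zero (uCProd_ne_zero τ _) (xiC_ne_zero τ)) hI _
    (isAffineBlowup_refineIn K τ A (uCProd τ (A ∩ part τ .lt)))
  exact ⟨f, hfo, comp_chInc _ hg hf, hgood⟩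

lemma HasCharts.exists_refineOut (h : HasCharts β c)
    (hπ : IsBlowup π (vanishingIdeal (strictTransform β (weilDivisor K d A))))
    (g : Spec (.of (Ch K τ)) ⟶ X) [IsOpenImmersion g] (hg : g ≫ β = chartMap τ) :
    ∃ f : Spec (.of (Ch K (refineOut τ A))) ⟶ X', IsOpenImmersion f ∧
      f ≫ π ≫ β = chartMap (refineOut τ A) ∧
      ∀ (B : Type u) [CommRing B] (i : Spec (.of B) ⟶ X') (φ : Ch K τ →+* B),
        IsGoodChart π g (uCProd τ (A ∩ part τ .lt) * xiC K τ)
          (uCProd τ (A ∩ part τ .lt) * uCProd τ (A ∩ part τ .eq)) i φ →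
          Set.range i ⊆ Set.range f := by
  have hI := idealOf_strictTransform h.mem_isoLocus g hg A
  obtain ⟨f, hfo, hf, hgood⟩ := exists_blowupChart hπ g
    (mul_ne_zero (uCProd_ne_zero τ _) (uCProd_ne_zero τ _)) hI _
    (isAffineBlowup_refineOut K τ A (uCProd τ (A ∩ part τ .lt)))
  exact ⟨f, hfo, comp_chInc _ hg hf, hgood⟩

lemma mem_part_chartOrd_eq {i j : Fin (d + 1)} :
    i ∈ part (chartOrd c j) .eq ↔ c i = c j := by
  rw [mem_part]
  exact compare_eq_iff_eq

lemma chartOrd_congr {i j : Fin (d + 1)} (h : c i = c j) : chartOrd c i = chartOrd c j := by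
  ext1 k
  unfold chartOrd
  rw [h]

/-- A level set that meets both `A` and its complement yields two charts. If it lies inside `A` or
is disjoint from it, one generator of the ideal divides the other, and a single chart, which is the
old one, suffices. -/
theorem HasCharts.blowup (h : HasCharts β c)
    (hπ : IsBlowup π (vanishingIdeal (strictTransform β (weilDivisor K d A)))) :
    HasCharts (π ≫ β) (nextCode c A) where
  uniq := h.uniq_blowup hπ
  isIso := h.isIso_blowup hπ
  exists_chart j := by
    obtain ⟨g, hgo, hg⟩ := h.exists_chart j
    by_cases hj : j ∈ A
    · rw [chartOrd_nextCode_of_mem hj]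
      obtain ⟨f, hfo, hf, -⟩ := h.exists_refineIn hπ g hg
      exact ⟨f, hfo, hf⟩
    · rw [chartOrd_nextCode_of_notMem hj]
      obtain ⟨f, hfo, hf, -⟩ := h.exists_refineOut hπ g hg
      exact ⟨f, hfo, hf⟩
  cover z := by
    obtain ⟨j, g, hgo, hg, hz⟩ := h.cover (π z)
    have hI := idealOf_strictTransform h.mem_isoLocus g hg A
    obtain ⟨f₁, hfo₁, hf₁, hgood₁⟩ := h.exists_refineIn hπ g hg
    obtain ⟨f₂, hfo₂, hf₂, hgood₂⟩ := h.exists_refineOut hπ g hg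
    have hIn : ∀ j' ∈ A, c j' = c j → z ∈ Set.range f₁ →
        ∃ j, ∃ g : Spec (.of (Ch K (chartOrd (nextCode c A) j))) ⟶ X',
          IsOpenImmersion g ∧ g ≫ π ≫ β = chartMap _ ∧ z ∈ Set.range g := by
      intro j' hj' hjj' hzf
      refine ⟨j', ?_⟩
      rw [chartOrd_nextCode_of_mem hj', chartOrd_congr hjj']
      exact ⟨f₁, hfo₁, hf₁, hzf⟩
    have hOut : ∀ j' ∉ A, c j' = c j → z ∈ Set.range f₂ →
        ∃ j, ∃ g : Spec (.of (Ch K (chartOrd (nextCode c A) j))) ⟶ X',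
          IsOpenImmersion g ∧ g ≫ π ≫ β = chartMap _ ∧ z ∈ Set.range g := by
      intro j' hj' hjj' hzf
      refine ⟨j', ?_⟩
      rw [chartOrd_nextCode_of_notMem hj', chartOrd_congr hjj']
      exact ⟨f₂, hfo₂, hf₂, hzf⟩
    obtain ⟨B, _, i, φ, hzi, hgood | hgood⟩ := exists_isGoodChart hπ g hI z hz
    · by_cases hM : ∃ j' ∉ A, c j' = c j
      · obtain ⟨j', hj', hjj'⟩ := hM
        exact hOut j' hj' hjj' (hgood₂ B i φ hgood hzi)
      · push Not at hM
        have hj : j ∈ A := by_contra fun hj => hM j hj rfl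
        refine hIn j hj rfl (hgood₁ B i φ (hgood.of_dvd (mul_dvd_mul_left _ ?_)) hzi)
        have : A ∩ part (chartOrd c j) .eq = part (chartOrd c j) .eq :=
          Finset.inter_eq_right.2 fun i hi => by_contra fun hiA =>
            hM i hiA (mem_part_chartOrd_eq.1 hi)
        rw [this, ← xiC_mul_etaC]
        exact dvd_mul_right _ _
    · by_cases hM : ∃ j' ∈ A, c j' = c j
      · obtain ⟨j', hj', hjj'⟩ := hM
        exact hIn j' hj' hjj' (hgood₁ B i φ hgood hzi)
      · push Not at hM
        have hj : j ∉ A := fun hj => hM j hj rfl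
        refine hOut j hj rfl (hgood₂ B i φ (hgood.of_dvd (mul_dvd_mul_left _ ?_)) hzi)
        have : A ∩ part (chartOrd c j) .eq = ∅ :=
          Finset.eq_empty_of_forall_notMem fun i hi => hM i (Finset.mem_inter.1 hi).1
            (mem_part_chartOrd_eq.1 (Finset.mem_inter.1 hi).2)
        rw [this]
        exact one_dvd _

/-- Here `ξ = x` and `η = y`, so nothing is adjoined. -/
lemma isIso_chartMap (hL : part τ .lt = ∅) (hU : part τ .gt = ∅) :
    IsIso (chartMap (K := K) τ) := by
  have hsurj : Function.Surjective (ofRS K τ) := fun z => by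
    refine ch_induction (p := fun z => ∃ r, ofRS K τ r = z) ?_ ?_ (fun r => ⟨r, rfl⟩) ?_ ?_ z
    · refine ⟨xVar K d, ?_⟩
      rw [← uCProd_mul_xiC, hL, uCProd, Finset.prod_empty, one_mul]
    · refine ⟨yVar K d, ?_⟩
      rw [← uCProd_mul_etaC, hU, uCProd, Finset.prod_empty, one_mul]
    · rintro _ _ ⟨r, rfl⟩ ⟨s, rfl⟩
      exact ⟨r + s, map_add _ _ _⟩
    · rintro _ _ ⟨r, rfl⟩ ⟨s, rfl⟩
      exact ⟨r * s, map_mul _ _ _⟩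
  let e : RS K d ≃+* Ch K τ := RingEquiv.ofBijective (ofRS K τ) ⟨ofRS_injective K τ, hsurj⟩
  have : IsIso (CommRingCat.ofHom (ofRS K τ)) :=
    inferInstanceAs (IsIso (e.toCommRingCatIso).hom)
  exact inferInstanceAs (IsIso (Spec.map (CommRingCat.ofHom (ofRS K τ))))

theorem hasCharts_of_isIso (β : X ⟶ TS K d) [IsIso β] : HasCharts β fun _ => 0 := by
  have hpart : ∀ (j : Fin (d + 1)) o, o ≠ .eq → part (chartOrd (fun _ => 0) j) o = ∅ := by
    intro j o ho
    refine Finset.eq_empty_of_forall_notMem fun i hi => ho ?_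
    rw [mem_part] at hi
    exact hi.symm.trans (compare_eq_iff_eq.2 rfl)
  have hiso : ∀ j : Fin (d + 1), IsIso (chartMap (K := K) (chartOrd (fun _ => 0) j)) := fun j =>
    isIso_chartMap (hpart j _ (by simp)) (hpart j _ (by simp))
  have hchart : ∀ j : Fin (d + 1), ∃ g : Spec (.of (Ch K (chartOrd (fun _ => 0) j))) ⟶ X,
      IsIso g ∧ g ≫ β = chartMap _ := fun j => by
    have := hiso j
    exact ⟨chartMap _ ≫ inv β, inferInstance, by rw [Category.assoc, IsIso.inv_hom_id,
      Category.comp_id]⟩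
  refine ⟨fun j => ?_, fun z => ⟨0, ?_⟩, fun B _ _ f₁ f₂ φ _ h₁ h₂ => ?_, ?_⟩
  · obtain ⟨g, hgi, hg⟩ := hchart j
    exact ⟨g, inferInstance, hg⟩
  · obtain ⟨g, hgi, hg⟩ := hchart 0
    exact ⟨g, inferInstance, hg, g.surjective z⟩
  · rw [← cancel_mono β, h₁, h₂]
  · obtain ⟨V, hV⟩ : ∃ V : (TS K d).Opens, ∀ t : TS K d, t ∈ V ↔ yVar K d ∉ t.asIdeal :=
      ⟨(PrimeSpectrum.basicOpen (yVar K d) : Opens (PrimeSpectrum (RS K d))), fun t => Iff.rfl⟩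
    exact ⟨V, hV, inferInstance⟩

/-- Each stage of the blowup sequence is covered by charts. -/
theorem BlowupSequence.exists_hasCharts {k : ℕ} {A : Fin k → Finset (Fin (d + 1))}
    (𝒯 : BlowupSequence fun l => weilDivisor K d (A l)) (l : Fin (k + 1)) :
    ∃ c : Fin (d + 1) → ℕ, HasCharts (𝒯.toBase l) c ∧
      ∀ i j, c i = c j ↔ ∀ m : Fin k, m.castSucc < l → (i ∈ A m ↔ j ∈ A m) := by
  induction l using Fin.induction with
  | zero =>
    have := 𝒯.isIso_toBase_zero
    exact ⟨_, hasCharts_of_isIso _, by simp⟩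
  | succ l ih =>
    obtain ⟨c, hc, hcode⟩ := ih
    refine ⟨nextCode c (A l), ?_, fun i j => ?_⟩
    · rw [𝒯.toBase_succ]
      exact hc.blowup (𝒯.isBlowup l)
    · rw [nextCode_eq_iff, hcode]
      constructor
      · rintro ⟨h₁, h₂⟩ m hm
        rcases (Fin.castSucc_lt_succ_iff.1 hm).lt_or_eq with h | h
        · exact h₁ m (Fin.castSucc_lt_castSucc_iff.2 h)
        · rwa [h]
      · exact fun h => ⟨fun m hm => h m (hm.trans (Fin.castSucc_lt_succ)), h l Fin.castSucc_lt_succ⟩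

end Stages

end SmoothCollection
end

noncomputable section

namespace SmoothCollection

/-! ### Regularity of the blowup -/

section EmbeddingDimension

open IsLocalRing

variable {R : Type*} [CommRing R] [IsLocalRing R] {K ι : Type*} [Field K] [Fintype ι]
  [DecidableEq ι]

/-- On the maximal ideal the linear part of `h` is semilinear, and its values span `K^ι`; so
generators of the maximal ideal give generators of `K^ι`. -/
lemma card_le_spanFinrank_maximalIdeal [IsNoetherianRing R] (h : R →+* TrivSqZeroExt K (ι → K))
    (hm : ∀ r ∈ maximalIdeal R, (h r).fst = 0)
    (r : ι → R) (hr : ∀ s, h (r s) = TrivSqZeroExt.inr (Pi.single s 1)) :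
    Fintype.card ι ≤ (maximalIdeal R).spanFinrank := by
  have hrm : ∀ s, r s ∈ maximalIdeal R := fun s hu => by
    have h1 := hu.map h
    rw [hr, TrivSqZeroExt.isUnit_iff_isUnit_fst, TrivSqZeroExt.fst_inr] at h1
    exact not_isUnit_zero h1
  obtain ⟨G, hG, hspan⟩ :=
    (IsNoetherian.noetherian (maximalIdeal R)).exists_span_finset_card_eq_spanFinrank
  have key : ∀ x ∈ Submodule.span R (G : Set R),
      (h x).snd ∈ Submodule.span K ((fun x => (h x).snd) '' (G : Set R)) := by
    intro x hx
    induction hx using Submodule.span_induction with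
    | mem x hx => exact Submodule.subset_span ⟨x, hx, rfl⟩
    | zero => simp
    | add x y _ _ hx hy =>
      rw [map_add, TrivSqZeroExt.snd_add]
      exact Submodule.add_mem _ hx hy
    | smul a x hx' hx =>
      have h0 : (h x).fst = 0 := hm x (hspan ▸ hx')
      rw [smul_eq_mul, map_mul, TrivSqZeroExt.snd_mul, h0, MulOpposite.op_zero, zero_smul, add_zero]
      exact Submodule.smul_mem _ _ hx
  have htop : Submodule.span K ((fun x => (h x).snd) '' (G : Set R)) = ⊤ := by
    rw [eq_top_iff, ← (Pi.basisFun K ι).span_eq, Submodule.span_le]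
    rintro _ ⟨s, rfl⟩
    have := key (r s) (hspan.symm ▸ hrm s)
    rw [hr, TrivSqZeroExt.snd_inr] at this
    rw [Pi.basisFun_apply]
    exact this
  classical
  have h1 := finrank_span_finset_le_card (R := K) (G.image fun x => (h x).snd)
  rw [Set.finrank, Finset.coe_image, htop, finrank_top, Module.finrank_fintype_fun_eq_card] at h1
  exact h1.trans (Finset.card_image_le.trans hG.le)

/-- The embedding dimension is at least `n + 2`. A prime containing all `u_j` and `ξ - η` contains
`ξ η`, hence `ξ²`, hence every coordinate. So the maximal ideal is minimal over `n + 1` elements and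
has height at most `n + 1`. -/
lemma not_isRegularLocalRing_of_relation {n : ℕ} (h : R →+* TrivSqZeroExt K (Fin n ⊕ Fin 2 → K))
    (hm : ∀ r ∈ maximalIdeal R, (h r).fst = 0)
    (r : Fin n ⊕ Fin 2 → R) (hr : ∀ s, h (r s) = TrivSqZeroExt.inr (Pi.single s 1))
    (hmax : ∀ P : Ideal R, P.IsPrime → (∀ s, r s ∈ P) → maximalIdeal R ≤ P)
    (M : Finset (Fin n)) (hM : M.Nonempty)
    (hrel : r (Sum.inr 0) * r (Sum.inr 1) = ∏ j ∈ M, r (Sum.inl j)) : ¬IsRegularLocalRing R := by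
  intro hreg
  classical
  have hrm : ∀ s, r s ∈ maximalIdeal R := fun s hu => by
    have h1 := hu.map h
    rw [hr, TrivSqZeroExt.isUnit_iff_isUnit_fst, TrivSqZeroExt.fst_inr] at h1
    exact not_isUnit_zero h1
  have h1 := card_le_spanFinrank_maximalIdeal h hm r hr
  set S : Finset R := insert (r (Sum.inr 0) - r (Sum.inr 1))
    (Finset.univ.image fun j => r (Sum.inl j)) with hS
  have hmin : maximalIdeal R ∈ (Ideal.span (S : Set R)).minimalPrimes := by
    refine ⟨⟨inferInstance, ?_⟩, ?_⟩
    · rw [Ideal.span_le, hS]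
      simp only [Finset.coe_insert, Finset.coe_image, Finset.coe_univ, Set.image_univ]
      rintro _ (rfl | ⟨j, rfl⟩)
      exacts [Ideal.sub_mem _ (hrm _) (hrm _), hrm _]
    · rintro P ⟨hP, hSP⟩ -
      have hj : ∀ j, r (Sum.inl j) ∈ P := fun j => hSP (Ideal.subset_span (by simp [hS]))
      have hd : r (Sum.inr 0) - r (Sum.inr 1) ∈ P := hSP (Ideal.subset_span (by simp [hS]))
      have hmul : r (Sum.inr 0) * r (Sum.inr 1) ∈ P := by
        rw [hrel]
        obtain ⟨j, hjM⟩ := hM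
        exact Ideal.mem_of_dvd _ (Finset.dvd_prod_of_mem _ hjM) (hj j)
      have h0 : r (Sum.inr 0) ∈ P := by
        refine hP.mem_of_pow_mem 2 ?_
        have := P.add_mem (P.mul_mem_left (r (Sum.inr 0)) hd) hmul
        convert this using 1
        ring
      have h1 : r (Sum.inr 1) ∈ P := by
        have := P.sub_mem h0 hd
        rwa [sub_sub_cancel] at this
      refine hmax P hP ?_
      rintro (j | i)
      · exact hj j
      · fin_cases i
        exacts [h0, h1]
  have h2 := Ideal.height_le_card_of_mem_minimalPrimes_span_finset hmin
  have h3 : S.card ≤ n + 1 := (Finset.card_insert_le _ _).trans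
    (Nat.succ_le_succ (Finset.card_image_le.trans (by simp)))
  have h4 := hreg.spanFinrank_maximalIdeal
  rw [← IsLocalRing.maximalIdeal_height_eq_ringKrullDim] at h4
  have h5 : ((maximalIdeal R).spanFinrank : ℕ∞) = (maximalIdeal R).height := by exact_mod_cast h4
  rw [← h5] at h2
  have h6 : (maximalIdeal R).spanFinrank ≤ S.card := by exact_mod_cast h2
  simp only [Fintype.card_sum, Fintype.card_fin] at h1
  omega

end EmbeddingDimension

/-! ### First order jets at the origin of a chart -/

section Origin

open Polynomial

variable (K : Type u) [Field K] {d : ℕ} (τ : Fin (d + 1) → Ordering)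

/-- The ring of first order jets at the origin of a chart. -/
abbrev Jets (K : Type u) [Field K] (d : ℕ) : Type u :=
  TrivSqZeroExt K (Fin (d + 1) ⊕ Fin 2 → K)

/-- The constant term of a power series. -/
def constPP (d : ℕ) : PP K d →+* K :=
  show PowerSeriesRing K d →+* K from MvPowerSeries.constantCoeff

@[simp] lemma constPP_Xv (s : Fin (d + 1) ⊕ Fin 2) : constPP K d (Xv K d s) = 0 := by
  change MvPowerSeries.constantCoeff (MvPowerSeries.X s) = 0
  simp

lemma mem_vI_univ {p : PP K d} (hp : constPP K d p = 0) : p ∈ vI K d Finset.univ := by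
  change (p : PowerSeriesRing K d) ∈ varIdeal K Finset.univ
  refine (mem_varIdeal_iff _ _).2 fun e he => ?_
  have : e = 0 := Finsupp.ext fun s => he s (Finset.mem_univ s)
  rw [this]
  exact hp

/-- The map on power series that sends the variables to given elements of square zero. -/
def jetPP (v : Fin (d + 1) ⊕ Fin 2 → Fin (d + 1) ⊕ Fin 2 → K) : PP K d →+* Jets K d where
  toFun p := TrivSqZeroExt.inl (constPP K d p) +
    TrivSqZeroExt.inr (∑ s, constPP K d (pderivPP K s p) • v s)
  map_zero' := by simp
  map_one' := by
    have : ∀ s, pderivPP K (d := d) s 1 = 0 := fun s => Derivation.map_one_eq_zero _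
    simp [this]
  map_add' p q := by
    ext1 <;> simp [add_smul, Finset.sum_add_distrib]
  map_mul' p q := by
    ext1
    · simp
    · simp only [Derivation.leibniz, smul_eq_mul, map_add, map_mul, add_smul,
        Finset.sum_add_distrib, TrivSqZeroExt.snd_add, TrivSqZeroExt.snd_inl, zero_add,
        TrivSqZeroExt.snd_inr, TrivSqZeroExt.snd_mul, TrivSqZeroExt.fst_add,
        TrivSqZeroExt.fst_inl, TrivSqZeroExt.fst_inr, add_zero, Finset.smul_sum, mul_smul,
        op_smul_eq_smul]

lemma jetPP_Xv (v : Fin (d + 1) ⊕ Fin 2 → Fin (d + 1) ⊕ Fin 2 → K) (s : Fin (d + 1) ⊕ Fin 2) :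
    jetPP K v (Xv K d s) = TrivSqZeroExt.inr (v s) := by
  change TrivSqZeroExt.inl (constPP K d (Xv K d s)) + TrivSqZeroExt.inr
    (∑ t, constPP K d (pderivPP K t (Xv K d s)) • v t) = _
  rw [Finset.sum_eq_single s]
  · rw [pderivPP_self, constPP_Xv, map_one, one_smul, TrivSqZeroExt.inl_zero, zero_add]
  · intro t _ hts
    rw [pderivPP_of_ne K hts, map_zero, zero_smul]
  · simp

lemma fst_jetPP (v : Fin (d + 1) ⊕ Fin 2 → Fin (d + 1) ⊕ Fin 2 → K) (p : PP K d) :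
    (jetPP K v p).fst = constPP K d p := by
  change (TrivSqZeroExt.inl (constPP K d p) + TrivSqZeroExt.inr _ : Jets K d).fst = _
  simp

/-- The images of the variables in the ring of jets. -/
def jetVar (s : Fin (d + 1) ⊕ Fin 2) : Fin (d + 1) ⊕ Fin 2 → K :=
  match s with
  | Sum.inl j => Pi.single (Sum.inl j) 1
  -- The linear part of `x = u_L ξ` is `ξ` if `L` is empty and zero otherwise; likewise for `y = u_U
  -- η`.
  | Sum.inr i => if part τ (![.lt, .gt] i) = ∅ then Pi.single (Sum.inr i) 1 else 0

lemma jetPP_uProd_mul {S : Finset (Fin (d + 1))} (hS : S.Nonempty)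
    (w : Fin (d + 1) ⊕ Fin 2 → K) :
    jetPP K (jetVar K τ) (uProd K d S) * TrivSqZeroExt.inr w = 0 := by
  obtain ⟨j, hj⟩ := hS
  rw [uProd, map_prod, ← Finset.mul_prod_erase S _ hj, jetPP_Xv, mul_right_comm,
    TrivSqZeroExt.inr_mul_inr, zero_mul]

lemma jetPP_uProd {S : Finset (Fin (d + 1))} (hS : 1 < S.card) :
    jetPP K (jetVar K τ) (uProd K d S) = 0 := by
  obtain ⟨i, hi, j, hj, hij⟩ := Finset.one_lt_card.1 hS
  rw [uProd, map_prod, ← Finset.mul_prod_erase S _ hi, ← Finset.mul_prod_erase (S.erase i) _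
    (Finset.mem_erase.2 ⟨hij.symm, hj⟩), jetPP_Xv, jetPP_Xv, ← mul_assoc,
    TrivSqZeroExt.inr_mul_inr, zero_mul]

lemma jetPP_linear (i : Fin 2) : jetPP K (jetVar K τ) (Xv K d (Sum.inr i)) =
    jetPP K (jetVar K τ) (uProd K d (part τ (![.lt, .gt] i))) *
      TrivSqZeroExt.inr (Pi.single (Sum.inr i) 1) := by
  rw [jetPP_Xv, jetVar]
  split_ifs with h
  · rw [h, uProd, Finset.prod_empty, map_one, one_mul]
  · rw [jetPP_uProd_mul K τ (Finset.nonempty_iff_ne_empty.2 h), TrivSqZeroExt.inr_zero]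

/-- The map from the polynomial ring to the ring of jets. -/
def jetPoly : (PP K d)[X][X] →+* Jets K d :=
  eval₂RingHom (eval₂RingHom (jetPP K (jetVar K τ))
    (TrivSqZeroExt.inr (Pi.single (Sum.inr 1) 1))) (TrivSqZeroExt.inr (Pi.single (Sum.inr 0) 1))

lemma chartIdeal_le_ker_jetPoly (hM : 1 < (part τ .eq).card) :
    chartIdeal K τ ≤ RingHom.ker (jetPoly K τ) := by
  rw [chartIdeal, sup_le_iff, sup_le_iff, Ideal.span_singleton_le_iff_mem,
    Ideal.span_singleton_le_iff_mem, Ideal.span_singleton_le_iff_mem]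
  refine ⟨⟨?_, ?_⟩, ?_⟩
  · have h := jetPP_linear K τ 1
    simp only [RingHom.mem_ker, jetPoly, relY, coe_eval₂RingHom, eval₂_C, eval₂_sub, eval₂_mul,
      eval₂_X]
    rw [h]
    exact sub_self _
  · have h := jetPP_linear K τ 0
    simp only [RingHom.mem_ker, jetPoly, relX, coe_eval₂RingHom, eval₂_C, eval₂_sub, eval₂_mul,
      eval₂_X]
    rw [h]
    exact sub_self _
  · simp only [RingHom.mem_ker, jetPoly, relM, coe_eval₂RingHom, eval₂_C, eval₂_sub, eval₂_mul,
      eval₂_X]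
    rw [jetPP_uProd K τ hM, TrivSqZeroExt.inr_mul_inr, sub_zero]

/-- The coordinates of a chart. -/
def coordC : Fin (d + 1) ⊕ Fin 2 → Ch K τ
  | Sum.inl j => uC K τ j
  | Sum.inr i => ![xiC K τ, etaC K τ] i

/-- If `M` has at least two elements, `u_M` and `ξ η` are both of second order, so the coordinates
stay independent to first order. -/
lemma exists_jet (hM : 1 < (part τ .eq).card) : ∃ h : Ch K τ →+* Jets K d,
    (∀ p, h (ofRS K τ (toRS K d p)) = jetPP K (jetVar K τ) p) ∧
      ∀ s, h (coordC K τ s) = TrivSqZeroExt.inr (Pi.single s 1) := by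
  have hk : RingHom.ker (toChart K τ) ≤ RingHom.ker (jetPoly K τ) := by
    rw [ker_toChart]
    exact chartIdeal_le_ker_jetPoly K τ hM
  let h : Ch K τ →+* Jets K d :=
    (toChart K τ).liftOfSurjective (toChart_surjective K τ) ⟨jetPoly K τ, hk⟩
  have hh : ∀ g, h (toChart K τ g) = jetPoly K τ g := fun g =>
    RingHom.liftOfRightInverse_comp_apply (toChart K τ) _
      (Function.rightInverse_surjInv (toChart_surjective K τ)) ⟨jetPoly K τ, hk⟩ g
  have hp : ∀ p, h (ofRS K τ (toRS K d p)) = jetPP K (jetVar K τ) p := fun p => by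
    rw [← toChart_C_C, hh]
    simp only [jetPoly, coe_eval₂RingHom, eval₂_C]
  refine ⟨h, hp, ?_⟩
  rintro (j | i)
  · change h (ofRS K τ (toRS K d (Xv K d (Sum.inl j)))) = _
    rw [hp, jetPP_Xv]
    rfl
  · fin_cases i
    · change h (xiC K τ) = _
      rw [← toChart_X, hh]
      simp only [jetPoly, coe_eval₂RingHom, eval₂_X]
      rfl
    · change h (etaC K τ) = _
      rw [← toChart_C_X, hh]
      simp only [jetPoly, coe_eval₂RingHom, eval₂_X, eval₂_C]
      rfl

/-- A chart with more than one index in the middle is not regular at the origin. -/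
lemma exists_not_isRegularLocalRing (hM : 1 < (part τ .eq).card) :
    ∃ q : PrimeSpectrum (Ch K τ), ¬IsRegularLocalRing (Localization.AtPrime q.asIdeal) := by
  obtain ⟨h, hp, hs⟩ := exists_jet K τ hM
  let ev : Ch K τ →+* K := (TrivSqZeroExt.fstHom K K (Fin (d + 1) ⊕ Fin 2 → K)).toRingHom.comp h
  have hev : ∀ z, ev z = (h z).fst := fun z => rfl
  let q : PrimeSpectrum (Ch K τ) := ⟨RingHom.ker ev, RingHom.ker_isPrime ev⟩
  refine ⟨q, ?_⟩
  have hqp : q.asIdeal.IsPrime := q.2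
  have hunit : ∀ z : q.asIdeal.primeCompl, IsUnit (h z) := fun z => by
    rw [TrivSqZeroExt.isUnit_iff_isUnit_fst, isUnit_iff_ne_zero]
    exact z.2
  let R := Localization.AtPrime q.asIdeal
  let H : R →+* Jets K d := IsLocalization.lift hunit
  have hH : ∀ z, H (algebraMap _ R z) = h z := IsLocalization.lift_eq hunit
  have hmap : IsLocalRing.maximalIdeal R = q.asIdeal.map (algebraMap _ R) :=
    (IsLocalization.AtPrime.map_eq_maximalIdeal q.asIdeal R).symm
  -- Modulo the coordinates every element is the image of a power series, which lies in `q` only if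
  -- its constant term vanishes; so a prime containing the coordinates contains `q`.
  have hmem : ∀ z ∈ q.asIdeal, ∀ P : Ideal (Ch K τ), P.IsPrime → (∀ s, coordC K τ s ∈ P) →
      z ∈ P := by
    intro z hz P hP hc
    have hpc : ∀ p, constPP K d p = 0 → ofRS K τ (toRS K d p) ∈ P := by
      intro p hp0
      have h1 : (vI K d Finset.univ).map ((ofRS K τ).comp (toRS K d)) ≤ P := by
        rw [vI, Ideal.map_span, Ideal.span_le]
        rintro _ ⟨_, ⟨s, -, rfl⟩, rfl⟩
        rcases s with j | i
        · exact hc (Sum.inl j)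
        · fin_cases i
          · change ofRS K τ (xVar K d) ∈ P
            rw [← uCProd_mul_xiC]
            exact P.mul_mem_left _ (hc (Sum.inr 0))
          · change ofRS K τ (yVar K d) ∈ P
            rw [← uCProd_mul_etaC]
            exact P.mul_mem_left _ (hc (Sum.inr 1))
      exact h1 (Ideal.mem_map_of_mem _ (mem_vI_univ K hp0))
    have key : ∃ p : PP K d, z - ofRS K τ (toRS K d p) ∈ P ∧
        z - ofRS K τ (toRS K d p) ∈ q.asIdeal := by
      have hq : ∀ s, coordC K τ s ∈ q.asIdeal := fun s => by
        change ev _ = 0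
        rw [hev, hs, TrivSqZeroExt.fst_inr]
      refine ch_induction (p := fun z => ∃ p : PP K d, z - ofRS K τ (toRS K d p) ∈ P ∧
        z - ofRS K τ (toRS K d p) ∈ q.asIdeal) ⟨0, ?_⟩ ⟨0, ?_⟩ (fun r => ?_) ?_ ?_ z
      · rw [map_zero, map_zero, sub_zero]
        exact ⟨hc (Sum.inr 0), hq (Sum.inr 0)⟩
      · rw [map_zero, map_zero, sub_zero]
        exact ⟨hc (Sum.inr 1), hq (Sum.inr 1)⟩
      · obtain ⟨p, rfl⟩ := toRS_surjective K d r
        exact ⟨p, by rw [sub_self]; exact ⟨zero_mem _, zero_mem _⟩⟩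
      · rintro a b ⟨p, h₁, h₂⟩ ⟨p', h₁', h₂'⟩
        refine ⟨p + p', ?_⟩
        rw [map_add, map_add, add_sub_add_comm]
        exact ⟨add_mem h₁ h₁', add_mem h₂ h₂'⟩
      · rintro a b ⟨p, h₁, h₂⟩ ⟨p', h₁', h₂'⟩
        refine ⟨p * p', ?_⟩
        have : a * b - ofRS K τ (toRS K d (p * p')) = a * (b - ofRS K τ (toRS K d p')) +
            ofRS K τ (toRS K d p') * (a - ofRS K τ (toRS K d p)) := by
          rw [map_mul, map_mul]
          ring
        rw [this]
        exact ⟨add_mem (P.mul_mem_left _ h₁') (P.mul_mem_left _ h₁),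
          add_mem (Ideal.mul_mem_left _ _ h₂') (Ideal.mul_mem_left _ _ h₂)⟩
    obtain ⟨p, h₁, h₂⟩ := key
    have h3 : ofRS K τ (toRS K d p) ∈ q.asIdeal := by
      have := sub_mem hz h₂
      rwa [sub_sub_cancel] at this
    have h4 : constPP K d p = 0 := by
      rw [← fst_jetPP K (jetVar K τ), ← hp]
      exact h3
    have := add_mem h₁ (hpc p h4)
    rwa [sub_add_cancel] at this
  refine not_isRegularLocalRing_of_relation H ?_ (fun s => algebraMap _ R (coordC K τ s))
    (fun s => by rw [hH, hs]) ?_ (part τ .eq) (Finset.card_pos.1 (by omega)) ?_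
  · have : IsLocalRing.maximalIdeal R ≤
        RingHom.ker ((TrivSqZeroExt.fstHom K K (Fin (d + 1) ⊕ Fin 2 → K)).toRingHom.comp H) := by
      rw [hmap, Ideal.map_le_iff_le_comap]
      intro z hz
      change (H (algebraMap _ R z)).fst = 0
      rw [hH]
      exact hz
    exact fun r hr => this hr
  · intro P hP hc
    rw [hmap, Ideal.map_le_iff_le_comap]
    exact fun z hz => hmem z hz _ (hP.comap _) hc
  · rw [← map_mul, ← map_prod]
    exact congrArg _ (xiC_mul_etaC τ)

end Origin

/-! ### Regularity in terms of the code -/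

section RegularCriterion

variable {K : Type u} [Field K] {d : ℕ} {X : Scheme.{u}}

lemma isRegularLocalRing_stalk_iff {C : Type u} [CommRing C] (g : Spec (.of C) ⟶ X)
    [IsOpenImmersion g] (q : Spec (.of C)) (p : PrimeSpectrum C) (h : p = q) :
    IsRegularLocalRing (X.presheaf.stalk (g q)) ↔
      IsRegularLocalRing (Localization.AtPrime p.asIdeal) := by
  have e₁ : X.presheaf.stalk (g q) ≃+* (Spec (.of C)).presheaf.stalk q :=
    (asIso (g.stalkMap q)).commRingCatIsoToRingEquiv
  let : Algebra C ((Spec (.of C)).presheaf.stalk q) := StructureSheaf.stalkAlgebra C q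
  have : IsLocalization.AtPrime ((Spec (.of C)).presheaf.stalk q) p.asIdeal := by
    subst h
    exact StructureSheaf.IsLocalization.to_stalk C p
  have e₂ : (Spec (.of C)).presheaf.stalk q ≃+* Localization.AtPrime p.asIdeal :=
    (IsLocalization.algEquiv p.asIdeal.primeCompl _ _).toRingEquiv
  exact ⟨fun h => .of_ringEquiv (e₁.trans e₂), fun h => .of_ringEquiv (e₁.trans e₂).symm⟩

variable {β : X ⟶ TS K d} {c : Fin (d + 1) → ℕ}

lemma part_chartOrd_eq_singleton (hc : Function.Injective c) (j : Fin (d + 1)) :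
    part (chartOrd c j) .eq = {j} := by
  ext i
  rw [mem_part_chartOrd_eq, hc.eq_iff, Finset.mem_singleton]

/-- The level sets of `c` are the middle blocks `M`. Two indices with the same value give a chart
that is singular at its origin; if there are none, every `M` is a singleton. -/
theorem HasCharts.isRegularScheme_iff (h : HasCharts β c) :
    IsRegularScheme X ↔ Function.Injective c := by
  constructor
  · rintro ⟨-, hreg⟩ i j hij
    by_contra hne
    obtain ⟨g, hgo, -⟩ := h.exists_chart j
    obtain ⟨q, hq⟩ := exists_not_isRegularLocalRing K (chartOrd c j)
      (Finset.one_lt_card.2 ⟨i, mem_part_chartOrd_eq.2 hij, j, mem_part_chartOrd_eq.2 rfl, hne⟩)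
    exact hq ((isRegularLocalRing_stalk_iff g q q rfl).1 (hreg _))
  · intro hc
    have hreg : ∀ j, IsRegularRing (Ch K (chartOrd c j)) := fun j =>
      isRegularRing_Ch K _ j (part_chartOrd_eq_singleton hc j)
    choose j g hgo hg hz using h.cover
    refine ⟨?_, fun z => ?_⟩
    · refine isLocallyNoetherian_of_affine_cover
        (S := fun z => ⟨g z ''ᵁ ⊤, (isAffineOpen_top _).image_of_isOpenImmersion (g z)⟩) ?_ ?_
      · rw [eq_top_iff]
        rintro z -
        obtain ⟨q, hq⟩ := hz z
        exact Opens.mem_iSup.2 ⟨z, q, trivial, hq⟩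
      · intro z
        have : IsNoetherianRing (Ch K (chartOrd c (j z))) := (hreg (j z)).toIsNoetherian
        exact isNoetherianRing_of_ringEquiv (Ch K (chartOrd c (j z)))
          ((Scheme.ΓSpecIso (.of _)).symm ≪≫ ((g z).appIso ⊤).symm).commRingCatIsoToRingEquiv
    · obtain ⟨q, hq⟩ := hz z
      rw [← hq]
      exact (isRegularLocalRing_stalk_iff (g z) q q rfl).2
        (@IsRegularRing.isRegularLocalRing_localization _ _ (hreg (j z)) q.asIdeal q.2)

theorem BlowupSequence.isRegularScheme_top_iff {k : ℕ} {A : Fin k → Finset (Fin (d + 1))}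
    (𝒯 : BlowupSequence fun l => weilDivisor K d (A l)) :
    IsRegularScheme 𝒯.top ↔ IsSmoothCollection A := by
  obtain ⟨c, hc, hcode⟩ := 𝒯.exists_hasCharts (Fin.last k)
  refine (hc.isRegularScheme_iff).trans ?_
  have hcode' : ∀ i j, c i = c j ↔ ∀ m : Fin k, (i ∈ A m ↔ j ∈ A m) := fun i j => by
    rw [hcode]
    exact forall_congr' fun m => ⟨fun hm => hm (Fin.castSucc_lt_last m), fun hm _ => hm⟩
  constructor
  · intro hinj i j hij
    by_contra! hn
    refine hij (hinj ((hcode' i j).2 fun m => ?_))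
    have := hn m
    tauto
  · intro hs i j hij
    by_contra hne
    obtain ⟨l, hl⟩ := hs i j hne
    have := (hcode' i j).1 hij l
    tauto

end RegularCriterion

end SmoothCollection
end

noncomputable section

namespace SmoothCollection

/-! ### The special fibre on a chart -/

section Residue

open Polynomial

variable (K : Type u) [Field K] (d : ℕ)

/-- The residue map of `RS K d`. -/
def resRS : RS K d →+* K :=
  Ideal.Quotient.lift _ MvPowerSeries.constantCoeff fun a ha => by
    obtain ⟨b, rfl⟩ := Ideal.mem_span_singleton'.1 ha
    simp [equation]

lemma resRS_algebraMap (a : K) : resRS K d (algebraMap K (RS K d) a) = a := by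
  change MvPowerSeries.constantCoeff (algebraMap K (PowerSeriesRing K d) a) = a
  simp [MvPowerSeries.algebraMap_apply]

lemma resRS_uVar (j : Fin (d + 1)) : resRS K d (uVar K d j) = 0 := constPP_Xv K _

lemma resRS_xVar : resRS K d (xVar K d) = 0 := constPP_Xv K _

lemma resRS_yVar : resRS K d (yVar K d) = 0 := constPP_Xv K _

lemma resRS_surjective : Function.Surjective (resRS K d) := fun a => ⟨_, resRS_algebraMap K d a⟩

lemma ker_resRS : RingHom.ker (resRS K d) = IsLocalRing.maximalIdeal (RS K d) :=
  IsLocalRing.eq_maximalIdeal (RingHom.ker_isMaximal_of_surjective _ (resRS_surjective K d))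

variable {K d} {τ : Fin (d + 1) → Ordering} {B : Type*} [CommRing B]

/-- The universal property of a chart. -/
lemma exists_chHom (φ : RS K d →+* B) (ξ η : B)
    (hy : (∏ i ∈ part τ .gt, φ (uVar K d i)) * η = φ (yVar K d))
    (hx : (∏ i ∈ part τ .lt, φ (uVar K d i)) * ξ = φ (xVar K d))
    (hM : ξ * η = ∏ i ∈ part τ .eq, φ (uVar K d i)) :
    ∃ h : Ch K τ →+* B, h.comp (ofRS K τ) = φ ∧ h (xiC K τ) = ξ ∧ h (etaC K τ) = η := by
  let F : (PP K d)[X][X] →+* B := eval₂RingHom (eval₂RingHom (φ.comp (toRS K d)) η) ξ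
  have hu : ∀ S, (φ.comp (toRS K d)) (uProd K d S) = ∏ i ∈ S, φ (uVar K d i) := fun S => by
    rw [uProd, map_prod]
    rfl
  have hk : RingHom.ker (toChart K τ) ≤ RingHom.ker F := by
    rw [ker_toChart, chartIdeal, sup_le_iff, sup_le_iff, Ideal.span_singleton_le_iff_mem,
      Ideal.span_singleton_le_iff_mem, Ideal.span_singleton_le_iff_mem]
    refine ⟨⟨?_, ?_⟩, ?_⟩
    · simp only [RingHom.mem_ker, F, relY, coe_eval₂RingHom, eval₂_C, eval₂_sub, eval₂_mul,
        eval₂_X, hu, hy]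
      exact sub_self _
    · simp only [RingHom.mem_ker, F, relX, coe_eval₂RingHom, eval₂_C, eval₂_sub, eval₂_mul,
        eval₂_X, hu, hx]
      exact sub_self _
    · simp only [RingHom.mem_ker, F, relM, coe_eval₂RingHom, eval₂_C, eval₂_sub, eval₂_mul,
        eval₂_X, hu]
      exact sub_eq_zero.2 (hM.symm.trans (mul_comm _ _))
  let h : Ch K τ →+* B :=
    (toChart K τ).liftOfSurjective (toChart_surjective K τ) ⟨F, hk⟩
  have hh : ∀ g, h (toChart K τ g) = F g := fun g =>
    RingHom.liftOfRightInverse_comp_apply (toChart K τ) _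
      (Function.rightInverse_surjInv (toChart_surjective K τ)) ⟨F, hk⟩ g
  refine ⟨h, RingHom.ext fun r => ?_, ?_, ?_⟩
  · obtain ⟨p, rfl⟩ := toRS_surjective K d r
    rw [RingHom.comp_apply, ← toChart_C_C, hh]
    simp only [F, coe_eval₂RingHom, eval₂_C]
    rfl
  · rw [← toChart_X, hh]
    simp only [F, coe_eval₂RingHom, eval₂_X]
  · rw [← toChart_C_X, hh]
    simp only [F, coe_eval₂RingHom, eval₂_X, eval₂_C]

lemma chHom_ext {f g : Ch K τ →+* B} (h : f.comp (ofRS K τ) = g.comp (ofRS K τ))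
    (hx : f (xiC K τ) = g (xiC K τ)) (he : f (etaC K τ) = g (etaC K τ)) : f = g :=
  RingHom.ext fun z => ch_induction (p := fun z => f z = g z) hx he
    (fun r => RingHom.congr_fun h r) (fun a b ha hb => by rw [map_add, map_add, ha, hb])
    (fun a b ha hb => by rw [map_mul, map_mul, ha, hb]) z

variable (τ) in
/-- The ideal of the special fibre on a chart. -/
def fibreIdeal : Ideal (Ch K τ) := (RingHom.ker (resRS K d)).map (ofRS K τ)

lemma ofRS_mem_fibreIdeal {r : RS K d} (hr : resRS K d r = 0) : ofRS K τ r ∈ fibreIdeal τ :=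
  Ideal.mem_map_of_mem _ hr

lemma uCProd_mem_fibreIdeal {S : Finset (Fin (d + 1))} (hS : S.Nonempty) :
    uCProd τ S ∈ fibreIdeal (K := K) τ := by
  obtain ⟨j, hj⟩ := hS
  exact Ideal.mem_of_dvd _ (Finset.dvd_prod_of_mem _ hj) (ofRS_mem_fibreIdeal (resRS_uVar K d j))

/-- A morphism from a chart to a line, given on the special fibre by one of the coordinates. -/
structure IsLine (ρ : Ch K τ →+* K[X]) (ξ η : Ch K τ) : Prop where
  comp_ofRS : ρ.comp (ofRS K τ) = C.comp (resRS K d)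
  map_left : ρ ξ = 0
  map_right : ρ η = X

/-- On the special fibre all `u_j` are zero. With `U` nonempty, `y = u_U η` imposes nothing on `η`,
so `η` is free along `ξ = 0`. -/
lemma exists_isLine_eta (hM : (part τ .eq).Nonempty) (hU : (part τ .gt).Nonempty) :
    ∃ ρ : Ch K τ →+* K[X], IsLine ρ (xiC K τ) (etaC K τ) := by
  have h0 : ∀ S : Finset (Fin (d + 1)), S.Nonempty →
      ∏ i ∈ S, (C.comp (resRS K d)) (uVar K d i) = 0 := fun S hS => by
    obtain ⟨j, hj⟩ := hS
    exact Finset.prod_eq_zero hj (by rw [RingHom.comp_apply, resRS_uVar, map_zero])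
  obtain ⟨ρ, h₁, h₂, h₃⟩ := exists_chHom (τ := τ) (C.comp (resRS K d)) 0 X
    (by rw [h0 _ hU, RingHom.comp_apply, resRS_yVar, map_zero, zero_mul])
    (by rw [RingHom.comp_apply, resRS_xVar, map_zero, mul_zero]) (by rw [h0 _ hM, zero_mul])
  exact ⟨ρ, h₁, h₂, h₃⟩

lemma exists_isLine_xi (hM : (part τ .eq).Nonempty) (hL : (part τ .lt).Nonempty) :
    ∃ ρ : Ch K τ →+* K[X], IsLine ρ (etaC K τ) (xiC K τ) := by
  have h0 : ∀ S : Finset (Fin (d + 1)), S.Nonempty →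
      ∏ i ∈ S, (C.comp (resRS K d)) (uVar K d i) = 0 := fun S hS => by
    obtain ⟨j, hj⟩ := hS
    exact Finset.prod_eq_zero hj (by rw [RingHom.comp_apply, resRS_uVar, map_zero])
  obtain ⟨ρ, h₁, h₂, h₃⟩ := exists_chHom (τ := τ) (C.comp (resRS K d)) X 0
    (by rw [RingHom.comp_apply, resRS_yVar, map_zero, mul_zero])
    (by rw [h0 _ hL, RingHom.comp_apply, resRS_xVar, map_zero, zero_mul])
    (by rw [h0 _ hM, mul_zero])
  exact ⟨ρ, h₁, h₃, h₂⟩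

namespace IsLine

variable {ρ : Ch K τ →+* K[X]} {ξ η : Ch K τ}

lemma map_ofRS (h : IsLine ρ ξ η) (r : RS K d) : ρ (ofRS K τ r) = C (resRS K d r) :=
  RingHom.congr_fun h.comp_ofRS r

lemma surjective (h : IsLine ρ ξ η) : Function.Surjective ρ := fun P => by
  refine ⟨P.eval₂ ((ofRS K τ).comp (algebraMap K (RS K d))) η, ?_⟩
  rw [Polynomial.hom_eval₂, h.map_right]
  have : (ρ.comp ((ofRS K τ).comp (algebraMap K (RS K d)))) = C := RingHom.ext fun a => by
    rw [RingHom.comp_apply, RingHom.comp_apply, h.map_ofRS, resRS_algebraMap]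
  rw [this, Polynomial.eval₂_C_X]

lemma fibreIdeal_le_ker (h : IsLine ρ ξ η) : fibreIdeal τ ≤ RingHom.ker ρ := by
  rw [fibreIdeal, Ideal.map_le_iff_le_comap]
  intro r hr
  change ρ (ofRS K τ r) = 0
  rw [h.map_ofRS, show resRS K d r = 0 from hr, map_zero]

/-- Modulo the fibre ideal and `ξ` every element is a polynomial in `η` over `K`, and `ρ` reads off
this polynomial. -/
lemma ker_eq (h : IsLine ρ ξ η)
    (hgen : (ξ = xiC K τ ∧ η = etaC K τ) ∨ (ξ = etaC K τ ∧ η = xiC K τ)) :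
    RingHom.ker ρ = fibreIdeal τ ⊔ Ideal.span {ξ} := by
  refine le_antisymm (fun z hz => ?_) (sup_le h.fibreIdeal_le_ker
    ((Ideal.span_singleton_le_iff_mem _).2 h.map_left))
  set κ := (ofRS K τ).comp (algebraMap K (RS K d)) with hκ
  have hξ : ∃ P : K[X], ξ - P.eval₂ κ η ∈ fibreIdeal τ ⊔ Ideal.span {ξ} :=
    ⟨0, by rw [eval₂_zero, sub_zero]; exact Ideal.mem_sup_right (Ideal.mem_span_singleton_self _)⟩
  have hη : ∃ P : K[X], η - P.eval₂ κ η ∈ fibreIdeal τ ⊔ Ideal.span {ξ} :=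
    ⟨X, by rw [eval₂_X, sub_self]; exact zero_mem _⟩
  have key : ∃ P : K[X], z - P.eval₂ κ η ∈ fibreIdeal τ ⊔ Ideal.span {ξ} := by
    refine ch_induction (p := fun z => ∃ P : K[X],
      z - P.eval₂ κ η ∈ fibreIdeal τ ⊔ Ideal.span {ξ}) ?_ ?_ (fun r => ?_) ?_ ?_ z
    · rcases hgen with ⟨h₁, h₂⟩ | ⟨h₁, h₂⟩
      exacts [h₁ ▸ hξ, h₂ ▸ hη]
    · rcases hgen with ⟨h₁, h₂⟩ | ⟨h₁, h₂⟩
      exacts [h₂ ▸ hη, h₁ ▸ hξ]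
    · refine ⟨C (resRS K d r), Ideal.mem_sup_left ?_⟩
      rw [eval₂_C, hκ, RingHom.comp_apply, ← map_sub]
      refine ofRS_mem_fibreIdeal ?_
      rw [map_sub, resRS_algebraMap, sub_self]
    · rintro a b ⟨P, hP⟩ ⟨Q, hQ⟩
      refine ⟨P + Q, ?_⟩
      rw [eval₂_add, add_sub_add_comm]
      exact add_mem hP hQ
    · rintro a b ⟨P, hP⟩ ⟨Q, hQ⟩
      refine ⟨P * Q, ?_⟩
      rw [eval₂_mul, show a * b - P.eval₂ κ η * Q.eval₂ κ η =
        a * (b - Q.eval₂ κ η) + Q.eval₂ κ η * (a - P.eval₂ κ η) by ring]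
      exact add_mem (Ideal.mul_mem_left _ _ hQ) (Ideal.mul_mem_left _ _ hP)
  obtain ⟨P, hP⟩ := key
  have h1 : ρ (z - P.eval₂ κ η) = 0 := (sup_le h.fibreIdeal_le_ker
    ((Ideal.span_singleton_le_iff_mem (RingHom.ker ρ)).2 h.map_left)) hP
  have h2 : ρ (P.eval₂ κ η) = P := by
    rw [Polynomial.hom_eval₂, h.map_right]
    have : ρ.comp κ = C := RingHom.ext fun a => by
      rw [hκ, RingHom.comp_apply, RingHom.comp_apply, h.map_ofRS, resRS_algebraMap]
    rw [this, Polynomial.eval₂_C_X]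
  rw [map_sub, h2, show ρ z = 0 from hz, zero_sub, neg_eq_zero] at h1
  rwa [h1, eval₂_zero, sub_zero] at hP

end IsLine

variable {ρ ρ' : Ch K τ →+* K[X]}

lemma IsLine.ker_xi (h : IsLine ρ (xiC K τ) (etaC K τ)) :
    RingHom.ker ρ = fibreIdeal τ ⊔ Ideal.span {xiC K τ} := h.ker_eq (.inl ⟨rfl, rfl⟩)

lemma IsLine.ker_eta (h : IsLine ρ (etaC K τ) (xiC K τ)) :
    RingHom.ker ρ = fibreIdeal τ ⊔ Ideal.span {etaC K τ} := h.ker_eq (.inr ⟨rfl, rfl⟩)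

lemma xiC_mul_etaC_mem (hM : (part τ .eq).Nonempty) :
    xiC K τ * etaC K τ ∈ fibreIdeal τ := xiC_mul_etaC (K := K) τ ▸ uCProd_mem_fibreIdeal hM

lemma xiC_mem_fibreIdeal (hL : part τ .lt = ∅) : xiC K τ ∈ fibreIdeal τ := by
  have h := uCProd_mul_xiC (K := K) τ
  rw [hL, uCProd, Finset.prod_empty, one_mul] at h
  exact h ▸ ofRS_mem_fibreIdeal (resRS_xVar K d)

lemma etaC_mem_fibreIdeal (hU : part τ .gt = ∅) : etaC K τ ∈ fibreIdeal τ := by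
  have h := uCProd_mul_etaC (K := K) τ
  rw [hU, uCProd, Finset.prod_empty, one_mul] at h
  exact h ▸ ofRS_mem_fibreIdeal (resRS_yVar K d)

/-- As for `(ξ) ∩ (η) = (ξ η)` in a polynomial ring: if `ρ'` kills `e ξ` it kills `e`, so `e` is a
multiple of `η` modulo the fibre ideal, and `ξ η = u_M` lies in that ideal. -/
lemma ker_inf_ker_le (hM : (part τ .eq).Nonempty) (h : IsLine ρ (xiC K τ) (etaC K τ))
    (h' : IsLine ρ' (etaC K τ) (xiC K τ)) : RingHom.ker ρ ⊓ RingHom.ker ρ' ≤ fibreIdeal τ := by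
  rintro z ⟨hz, hz'⟩
  rw [SetLike.mem_coe, h.ker_xi, Submodule.mem_sup] at hz
  obtain ⟨a, ha, b, hb, rfl⟩ := hz
  obtain ⟨e, rfl⟩ := Ideal.mem_span_singleton'.1 hb
  refine add_mem ha ?_
  have h1 : ρ' (a + e * xiC K τ) = 0 := hz'
  rw [map_add, show ρ' a = 0 from h'.fibreIdeal_le_ker ha, zero_add, map_mul, h'.map_right,
    mul_eq_zero, or_iff_left X_ne_zero] at h1
  have h2 : e ∈ RingHom.ker ρ' := h1
  rw [h'.ker_eta, Submodule.mem_sup] at h2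
  obtain ⟨a', ha', b', hb', rfl⟩ := h2
  obtain ⟨e', rfl⟩ := Ideal.mem_span_singleton'.1 hb'
  rw [add_mul]
  refine add_mem (Ideal.mul_mem_right _ _ ha') ?_
  rw [mul_assoc, mul_comm (etaC K τ)]
  exact Ideal.mul_mem_left _ _ (xiC_mul_etaC_mem hM)

end Residue

end SmoothCollection
end

noncomputable section

namespace SmoothCollection

/-! ### The projective line -/

/-- By `hr` the fibre product of the two pieces factors through `W`, where agreement is assumed. -/
lemma exists_glue_two {Y Z U₀ U₁ W : Scheme.{u}} (i₀ : U₀ ⟶ Y) (i₁ : U₁ ⟶ Y) [IsOpenImmersion i₀]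
    [IsOpenImmersion i₁] (hcov : ∀ y, y ∈ Set.range i₀ ∨ y ∈ Set.range i₁)
    (w₀ : W ⟶ U₀) (w₁ : W ⟶ U₁) (hw : w₀ ≫ i₀ = w₁ ≫ i₁) [IsOpenImmersion w₀]
    (hr : ∀ p q, i₀ p = i₁ q → p ∈ Set.range w₀) (f₀ : U₀ ⟶ Z) (f₁ : U₁ ⟶ Z)
    (hf : w₀ ≫ f₀ = w₁ ≫ f₁) : ∃ g : Y ⟶ Z, i₀ ≫ g = f₀ ∧ i₁ ≫ g = f₁ := by
  have key : pullback.fst i₀ i₁ ≫ f₀ = pullback.snd i₀ i₁ ≫ f₁ := by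
    have hsub : Set.range (pullback.fst i₀ i₁) ⊆ Set.range w₀ := by
      rintro _ ⟨p, rfl⟩
      refine hr _ (pullback.snd i₀ i₁ p) ?_
      rw [← Scheme.Hom.comp_apply, ← Scheme.Hom.comp_apply, pullback.condition]
    have h1 : IsOpenImmersion.lift w₀ (pullback.fst i₀ i₁) hsub ≫ w₁ = pullback.snd i₀ i₁ := by
      rw [← cancel_mono i₁, Category.assoc, ← hw, IsOpenImmersion.lift_fac_assoc,
        pullback.condition]
    rw [← h1, Category.assoc, ← hf, IsOpenImmersion.lift_fac_assoc]
  let obj : Bool → Scheme.{u} := fun b => Bool.rec U₀ U₁ b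
  let map : ∀ b, obj b ⟶ Y := fun b => Bool.rec i₀ i₁ b
  let 𝒰 : Y.OpenCover := Scheme.Cover.mkOfCovers Bool obj map
    (fun y => (hcov y).elim (fun ⟨p, hp⟩ => ⟨false, p, hp⟩) (fun ⟨p, hp⟩ => ⟨true, p, hp⟩))
    (fun b => by cases b; exacts [‹IsOpenImmersion i₀›, ‹IsOpenImmersion i₁›])
  let f : ∀ b : 𝒰.I₀, 𝒰.X b ⟶ Z := fun b => Bool.rec f₀ f₁ b
  have h : ∀ x y : 𝒰.I₀, pullback.fst (𝒰.f x) (𝒰.f y) ≫ f x =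
      pullback.snd (𝒰.f x) (𝒰.f y) ≫ f y := by
    have hself : ∀ b : 𝒰.I₀, pullback.fst (𝒰.f b) (𝒰.f b) ≫ f b =
        pullback.snd (𝒰.f b) (𝒰.f b) ≫ f b := fun b => by
      congr 1
      rw [← cancel_mono (𝒰.f b), pullback.condition]
    rintro (_ | _) (_ | _)
    · exact hself _
    · exact key
    · change pullback.fst i₁ i₀ ≫ f₁ = pullback.snd i₁ i₀ ≫ f₀
      rw [← cancel_epi (pullbackSymmetry i₀ i₁).hom, pullbackSymmetry_hom_comp_fst_assoc,
        pullbackSymmetry_hom_comp_snd_assoc, key]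
    · exact hself _
  exact ⟨𝒰.glueMorphisms f h, 𝒰.ι_glueMorphisms f h false, 𝒰.ι_glueMorphisms f h true⟩

section Standard

open HomogeneousLocalization MvPolynomial

attribute [local instance] MvPolynomial.gradedAlgebra

variable (K : Type u) [Field K]

/-- The grading on the homogeneous coordinate ring of the projective line. -/
abbrev grading : ℕ → Submodule K (MvPolynomial (Fin 2) K) := homogeneousSubmodule (Fin 2) K

lemma X_mem_grading (i : Fin 2) : (X i : MvPolynomial (Fin 2) K) ∈ grading K 1 :=
  isHomogeneous_X K i

/-- The coordinate ring of a standard chart of the projective line. -/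
abbrev StdChart (i : Fin 2) : Type u := Away (grading K) (X i : MvPolynomial (Fin 2) K)

/-- The coordinate `X_{1-i} / X_i` of a standard chart. -/
abbrev stdCoord (i : Fin 2) : StdChart K i :=
  Away.isLocalizationElem (X_mem_grading K i) (X_mem_grading K (1 - i))

/-- The map from the polynomial ring to a standard chart. -/
def stdMap (i : Fin 2) : Polynomial K →+* StdChart K i :=
  Polynomial.eval₂RingHom ((fromZeroRingHom (grading K) _).comp (algebraMap K (grading K 0)))
    (stdCoord K i)

/-- Dehomogenization. -/
def dehom (i : Fin 2) : MvPolynomial (Fin 2) K →+* Polynomial K :=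
  eval₂Hom Polynomial.C (fun k => if k = i then 1 else Polynomial.X)

/-- Dehomogenization on a standard chart. -/
def stdInv (i : Fin 2) : StdChart K i →+* Polynomial K :=
  (Localization.awayLift (dehom K i) (X i) (by simp [dehom])).comp
    (algebraMap (StdChart K i) (Localization.Away (X i : MvPolynomial (Fin 2) K)))

lemma stdInv_mk (i : Fin 2) (n : ℕ) (p : MvPolynomial (Fin 2) K) (hp : p ∈ grading K (n • 1)) :
    stdInv K i (Away.mk (grading K) (X_mem_grading K i) n p hp) = dehom K i p := by
  rw [stdInv, RingHom.comp_apply, HomogeneousLocalization.algebraMap_apply, Away.val_mk,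
    Localization.awayLift_mk (v := 1) (hv := by simp [dehom])]
  simp

lemma C_mem_grading (a : K) : (C a : MvPolynomial (Fin 2) K) ∈ grading K (0 • 1) :=
  isHomogeneous_C _ a

lemma val_stdMap_C (i : Fin 2) (a : K) : (stdMap K i (Polynomial.C a)).val =
    algebraMap (MvPolynomial (Fin 2) K) _ (C a) := by
  rw [stdMap, Polynomial.coe_eval₂RingHom, Polynomial.eval₂_C]
  rfl

lemma val_stdCoord (i : Fin 2) : (stdCoord K i).val * algebraMap (MvPolynomial (Fin 2) K) _ (X i) =
    algebraMap (MvPolynomial (Fin 2) K) (Localization.Away (X i : MvPolynomial (Fin 2) K))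
      (X (1 - i)) := by
  have h := IsLocalization.mk'_spec (Localization.Away (X i : MvPolynomial (Fin 2) K))
    (X (1 - i) ^ 1 : MvPolynomial (Fin 2) K)
    (⟨X i ^ 1, 1, rfl⟩ : Submonoid.powers (X i : MvPolynomial (Fin 2) K))
  rw [stdCoord, Away.val_mk, Localization.mk_eq_mk']
  simpa only [pow_one] using h

lemma stdMap_X (i : Fin 2) : stdMap K i Polynomial.X = stdCoord K i := by
  rw [stdMap, Polynomial.coe_eval₂RingHom, Polynomial.eval₂_X]

lemma stdInv_stdMap (i : Fin 2) (P : Polynomial K) : stdInv K i (stdMap K i P) = P := by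
  have h : (stdInv K i).comp (stdMap K i) = RingHom.id _ := by
    refine Polynomial.ringHom_ext (fun a => ?_) ?_
    · have : stdMap K i (Polynomial.C a) = Away.mk (grading K) (X_mem_grading K i) 0 (C a)
          (C_mem_grading K a) := by
        apply HomogeneousLocalization.val_injective
        rw [val_stdMap_C, Away.val_mk, Localization.mk_eq_mk']
        exact (IsLocalization.mk'_one _ _).symm.trans (by congr 1)
      rw [RingHom.comp_apply, this, stdInv_mk, dehom, coe_eval₂Hom, eval₂_C, RingHom.id_apply]
    · rw [RingHom.comp_apply, stdMap_X, stdCoord, stdInv_mk]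
      fin_cases i <;> simp [dehom]
  exact RingHom.congr_fun h P

/-- A form of degree `n` is `X_i ^ n` times its value at the quotients `X_k / X_i`; the identity is
checked on monomials. -/
lemma val_stdMap_dehom (i : Fin 2) {n : ℕ} {p : MvPolynomial (Fin 2) K} (hp : p ∈ grading K n) :
    (stdMap K i (dehom K i p)).val * algebraMap (MvPolynomial (Fin 2) K) _ (X i) ^ n =
      algebraMap (MvPolynomial (Fin 2) K) (Localization.Away (X i : MvPolynomial (Fin 2) K)) p := by
  set ψ : MvPolynomial (Fin 2) K →+* Localization.Away (X i : MvPolynomial (Fin 2) K) :=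
    (algebraMap (StdChart K i) _).comp ((stdMap K i).comp (dehom K i)) with hψ
  have hψv : ∀ p, ψ p = (stdMap K i (dehom K i p)).val := fun p => rfl
  have hX : ∀ k, ψ (X k) * algebraMap (MvPolynomial (Fin 2) K) _ (X i) =
      algebraMap (MvPolynomial (Fin 2) K) _ (X k) := fun k => by
    rw [hψv, dehom, coe_eval₂Hom, eval₂_X]
    split_ifs with h
    · rw [map_one, HomogeneousLocalization.val_one, one_mul, h]
    · rw [stdMap_X, val_stdCoord]
      congr 2
      omega
  have hC : ∀ a, ψ (C a) = algebraMap (MvPolynomial (Fin 2) K) _ (C a) := fun a => by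
    rw [hψv, dehom, coe_eval₂Hom, eval₂_C, val_stdMap_C]
  rw [← hψv, p.as_sum, map_sum, map_sum, Finset.sum_mul]
  refine Finset.sum_congr rfl fun m hm => ?_
  have hdeg : m 0 + m 1 = n := by
    have := hp (mem_support_iff.1 hm)
    rw [Finsupp.weight_apply, Finsupp.sum_fintype _ _ (by simp)] at this
    simpa using this
  rw [monomial_eq, Finsupp.prod_fintype _ _ (by simp), Fin.prod_univ_two, map_mul, map_mul,
    map_mul, map_mul, map_pow, map_pow, map_pow, map_pow, hC, ← hX 0, ← hX 1, ← hdeg, mul_pow,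
    mul_pow, pow_add]
  ring

lemma stdMap_surjective (i : Fin 2) : Function.Surjective (stdMap K i) := fun z => by
  obtain ⟨n, p, hp, rfl⟩ := Away.mk_surjective (grading K) (X_mem_grading K i) z
  refine ⟨dehom K i p, HomogeneousLocalization.val_injective _ ?_⟩
  rw [Away.val_mk, Localization.mk_eq_mk', IsLocalization.eq_mk'_iff_mul_eq, map_pow]
  exact val_stdMap_dehom K i (by simpa using hp)

/-- The standard charts are polynomial rings. -/
def stdEquiv (i : Fin 2) : Polynomial K ≃+* StdChart K i :=
  RingEquiv.ofBijective (stdMap K i)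
    ⟨Function.LeftInverse.injective (stdInv_stdMap K i), stdMap_surjective K i⟩

lemma stdCoord_mul : awayMap (grading K) (X_mem_grading K 1) rfl (stdCoord K 0) *
    awayMap (grading K) (X_mem_grading K 0) (mul_comm _ _) (stdCoord K 1) = 1 := by
  apply HomogeneousLocalization.val_injective
  rw [HomogeneousLocalization.val_mul, HomogeneousLocalization.val_one, stdCoord, stdCoord,
    awayMap_mk, awayMap_mk, Away.val_mk, Away.val_mk, Localization.mk_mul]
  refine (congrArg₂ _ ?_ rfl).trans (Localization.mk_self _)
  simp
  ring

/-- The overlap of the two standard charts. -/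
abbrev StdOverlap : Type u := Away (grading K) (X 0 * X 1 : MvPolynomial (Fin 2) K)

/-- The restriction from the first standard chart to the overlap. -/
def stdRes₀ : Polynomial K →+* StdOverlap K :=
  (awayMap (grading K) (X_mem_grading K 1) rfl).comp (stdMap K 0)

/-- The restriction from the second standard chart to the overlap. -/
def stdRes₁ : Polynomial K →+* StdOverlap K :=
  (awayMap (grading K) (X_mem_grading K 0) (mul_comm _ _)).comp (stdMap K 1)

lemma stdRes_mul : stdRes₀ K Polynomial.X * stdRes₁ K Polynomial.X = 1 := by
  rw [stdRes₀, stdRes₁, RingHom.comp_apply, RingHom.comp_apply, stdMap_X, stdMap_X, stdCoord_mul]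

lemma stdRes_C (a : K) : stdRes₀ K (Polynomial.C a) = stdRes₁ K (Polynomial.C a) := by
  rw [stdRes₀, stdRes₁, RingHom.comp_apply, RingHom.comp_apply, stdMap, stdMap,
    Polynomial.coe_eval₂RingHom, Polynomial.coe_eval₂RingHom, Polynomial.eval₂_C,
    Polynomial.eval₂_C, RingHom.comp_apply, RingHom.comp_apply, awayMap_fromZeroRingHom,
    awayMap_fromZeroRingHom]

/-- The inclusion of a standard chart in the projective line. -/
def stdAway (i : Fin 2) : Spec (.of (StdChart K i)) ⟶ ProjectiveLine K :=
  Proj.awayι (grading K) (X i) (X_mem_grading K i) one_pos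

instance (i : Fin 2) : IsOpenImmersion (stdAway K i) :=
  inferInstanceAs (IsOpenImmersion (Proj.awayι (grading K) (X i) (X_mem_grading K i) one_pos))

lemma mem_range_stdAway (i : Fin 2) (z : Proj (grading K)) :
    z ∈ Set.range (stdAway K i) ↔ z ∈ Proj.basicOpen (grading K) (X i) := by
  rw [← Proj.opensRange_awayι (grading K) (X i) (X_mem_grading K i) one_pos]
  rfl

lemma stdAway_toSpecField (i : Fin 2) : stdAway K i ≫ ProjectiveLine.toSpecField K =
    Spec.map (CommRingCat.ofHom ((fromZeroRingHom (grading K) _).comp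
      (algebraMap K (grading K 0)))) := by
  rw [specMap_comp]
  exact (Category.assoc _ _ _).symm.trans (congrArg (· ≫ _)
    (Proj.awayι_toSpecZero (grading K) (X i) (X_mem_grading K i) one_pos))

lemma mem_range_stdAway_of_notMem (i : Fin 2) (q : PrimeSpectrum (StdChart K i))
    (hq : stdCoord K i ∉ q.asIdeal) : stdAway K i q ∈ Set.range (stdAway K (1 - i)) := by
  refine (mem_range_stdAway K _ _).2 ?_
  have h := Proj.awayι_preimage_basicOpen (grading K) (X_mem_grading K i) one_pos
    (X_mem_grading K (1 - i)) one_pos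
  have hq' : q ∈ PrimeSpectrum.basicOpen (stdCoord K i) := hq
  rw [← h] at hq'
  exact hq'

lemma exists_mem_range_stdAway (z : ProjectiveLine K) :
    z ∈ Set.range (stdAway K 0) ∨ z ∈ Set.range (stdAway K 1) := by
  have h := Proj.iSup_basicOpen_eq_top' (grading K) (fun i : Fin 2 => X i)
    (fun i => ⟨1, X_mem_grading K i⟩) ?_
  · have hz : ∀ z : Proj (grading K), ∃ i : Fin 2, z ∈ Proj.basicOpen (grading K) (X i) :=
      fun z => Opens.mem_iSup.1 (h ▸ trivial : z ∈ ⨆ i : Fin 2, Proj.basicOpen (grading K) (X i))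
    obtain ⟨i, hi⟩ := hz z
    fin_cases i
    exacts [.inl ((mem_range_stdAway K 0 z).2 hi), .inr ((mem_range_stdAway K 1 z).2 hi)]
  · rw [eq_top_iff]
    rintro p -
    have hp : p ∈ Algebra.adjoin K (Set.range (X : Fin 2 → MvPolynomial (Fin 2) K)) := by
      rw [adjoin_range_X]
      trivial
    induction hp using Algebra.adjoin_induction with
    | mem x hx => exact Algebra.subset_adjoin hx
    | algebraMap r =>
      exact Subalgebra.algebraMap_mem _ (algebraMap K (grading K 0) r)
    | add x y _ _ hx hy => exact add_mem hx hy
    | mul x y _ _ hx hy => exact mul_mem hx hy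

/-- The inclusion of the overlap of the standard charts in the projective line. -/
def stdOverlap : Spec (.of (StdOverlap K)) ⟶ ProjectiveLine K :=
  Proj.awayι (grading K) (X 0 * X 1)
    (SetLike.mul_mem_graded (X_mem_grading K 0) (X_mem_grading K 1))
    (one_pos.trans_le (Nat.le_add_right 1 1))

instance : IsOpenImmersion (stdOverlap K) :=
  inferInstanceAs (IsOpenImmersion (Proj.awayι (grading K) _ _ _))

lemma specMap_awayMap₀_stdAway : Spec.map (CommRingCat.ofHom
    (awayMap (grading K) (X_mem_grading K 1) (rfl : (X 0 * X 1 : MvPolynomial (Fin 2) K) = X 0 * X 1))) ≫ stdAway K 0 =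
      stdOverlap K :=
  Proj.SpecMap_awayMap_awayι (grading K) (X_mem_grading K 0) one_pos (X_mem_grading K 1) rfl

lemma specMap_awayMap₁_stdAway : Spec.map (CommRingCat.ofHom
    (awayMap (grading K) (X_mem_grading K 0) (mul_comm (X 0 : MvPolynomial (Fin 2) K) (X 1)))) ≫ stdAway K 1 =
      stdOverlap K :=
  Proj.SpecMap_awayMap_awayι (grading K) (X_mem_grading K 1) one_pos (X_mem_grading K 0)
    (mul_comm _ _)

lemma mem_range_stdOverlap (z : ProjectiveLine K) (h₀ : z ∈ Set.range (stdAway K 0))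
    (h₁ : z ∈ Set.range (stdAway K 1)) : z ∈ Set.range (stdOverlap K) := by
  have h : ∀ z : Proj (grading K), z ∈ Proj.basicOpen (grading K) (X 0) →
      z ∈ Proj.basicOpen (grading K) (X 1) → z ∈ Set.range (stdOverlap K) := fun z h₀ h₁ => by
    have h2 : z ∈ Proj.basicOpen (grading K) (X 0 * X 1) := by
      rw [Proj.basicOpen_mul]
      exact ⟨h₀, h₁⟩
    rw [← Proj.opensRange_awayι (grading K) (X 0 * X 1)
      (SetLike.mul_mem_graded (X_mem_grading K 0) (X_mem_grading K 1))
    (one_pos.trans_le (Nat.le_add_right 1 1))] at h2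
    exact h2
  exact h z ((mem_range_stdAway K 0 z).1 h₀) ((mem_range_stdAway K 1 z).1 h₁)

/-- The standard affine lines in the projective line. -/
def stdι (i : Fin 2) : Spec (.of (Polynomial K)) ⟶ ProjectiveLine K :=
  Spec.map (CommRingCat.ofHom (stdEquiv K i).symm.toRingHom) ≫ stdAway K i

instance (i : Fin 2) : IsIso (Spec.map (CommRingCat.ofHom (stdEquiv K i).symm.toRingHom)) :=
  inferInstanceAs (IsIso (Spec.map (stdEquiv K i).symm.toCommRingCatIso.hom))

instance (i : Fin 2) : IsOpenImmersion (stdι K i) :=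
  inferInstanceAs (IsOpenImmersion
    (Spec.map (CommRingCat.ofHom (stdEquiv K i).symm.toRingHom) ≫ stdAway K i))

lemma specMap_stdMap_stdι (i : Fin 2) : Spec.map (CommRingCat.ofHom (stdMap K i)) ≫ stdι K i =
    stdAway K i := by
  rw [stdι, ← Category.assoc, ← specMap_comp (stdEquiv K i).symm.toRingHom (stdMap K i)]
  have : (stdMap K i).comp (stdEquiv K i).symm.toRingHom = RingHom.id _ :=
    RingHom.ext fun z => (stdEquiv K i).apply_symm_apply z
  rw [this]
  exact (congrArg (· ≫ _) (Spec.map_id _)).trans (Category.id_comp _)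

lemma range_stdι (i : Fin 2) : Set.range (stdι K i) = Set.range (stdAway K i) := by
  refine subset_antisymm ?_ ?_
  · rintro _ ⟨q, rfl⟩
    exact ⟨_, (Scheme.Hom.comp_apply _ (stdAway K i) q).symm⟩
  · rintro _ ⟨q, rfl⟩
    rw [← specMap_stdMap_stdι]
    exact ⟨_, (Scheme.Hom.comp_apply _ (stdι K i) q).symm⟩

lemma stdι_toSpecField (i : Fin 2) : stdι K i ≫ ProjectiveLine.toSpecField K =
    Spec.map (CommRingCat.ofHom Polynomial.C) := by
  have h : (stdEquiv K i).symm.toRingHom.comp ((fromZeroRingHom (grading K) _).comp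
      (algebraMap K (grading K 0))) = Polynomial.C := RingHom.ext fun a => by
    refine (stdEquiv K i).symm_apply_eq.2 ?_
    exact (Polynomial.eval₂_C _ _).symm
  rw [← h, specMap_comp _ (stdEquiv K i).symm.toRingHom, stdι, Category.assoc,
    stdAway_toSpecField]

lemma exists_mem_range_stdι (z : ProjectiveLine K) :
    z ∈ Set.range (stdι K 0) ∨ z ∈ Set.range (stdι K 1) := by
  rw [range_stdι, range_stdι]
  exact exists_mem_range_stdAway K z

lemma mem_range_stdι_of_notMem (i : Fin 2) (q : PrimeSpectrum (Polynomial K))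
    (hq : Polynomial.X ∉ q.asIdeal) : stdι K i q ∈ Set.range (stdι K (1 - i)) := by
  rw [range_stdι]
  have e : stdι K i q = stdAway K i (q.comap (stdEquiv K i).symm.toRingHom) :=
    Scheme.Hom.comp_apply
      (Spec.map (CommRingCat.ofHom (stdEquiv K i).symm.toRingHom)) (stdAway K i) q
  refine e ▸ mem_range_stdAway_of_notMem K i _ fun h => hq ?_
  have h1 : (stdEquiv K i).symm (stdCoord K i) ∈ q.asIdeal := h
  rwa [← stdMap_X, show (stdEquiv K i).symm (stdMap K i Polynomial.X) = Polynomial.X from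
    (stdEquiv K i).symm_apply_apply _] at h1

lemma specMap_stdRes₀_stdι : Spec.map (CommRingCat.ofHom (stdRes₀ K)) ≫ stdι K 0 =
    stdOverlap K := by
  rw [stdRes₀, specMap_comp, Category.assoc, specMap_stdMap_stdι, specMap_awayMap₀_stdAway]

lemma specMap_stdRes₁_stdι : Spec.map (CommRingCat.ofHom (stdRes₁ K)) ≫ stdι K 1 =
    stdOverlap K := by
  rw [stdRes₁, specMap_comp, Category.assoc, specMap_stdMap_stdι, specMap_awayMap₁_stdAway]

instance : IsOpenImmersion (Spec.map (CommRingCat.ofHom (stdRes₀ K))) := by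
  have : IsOpenImmersion (Spec.map (CommRingCat.ofHom (stdRes₀ K)) ≫ stdι K 0) :=
    (specMap_stdRes₀_stdι K).symm ▸ inferInstance
  exact IsOpenImmersion.of_comp _ (stdι K 0)

/-- A morphism from the projective line is given by two morphisms from the affine line that agree
on the overlap. -/
theorem ProjectiveLine.exists_glue {Z : Scheme.{u}} (f₀ f₁ : Spec (.of (Polynomial K)) ⟶ Z)
    (hf : Spec.map (CommRingCat.ofHom (stdRes₀ K)) ≫ f₀ =
      Spec.map (CommRingCat.ofHom (stdRes₁ K)) ≫ f₁) :
    ∃ g : ProjectiveLine K ⟶ Z, stdι K 0 ≫ g = f₀ ∧ stdι K 1 ≫ g = f₁ := by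
  refine exists_glue_two (stdι K 0) (stdι K 1) (exists_mem_range_stdι K)
    (Spec.map (CommRingCat.ofHom (stdRes₀ K))) (Spec.map (CommRingCat.ofHom (stdRes₁ K)))
    ((specMap_stdRes₀_stdι K).trans (specMap_stdRes₁_stdι K).symm) (fun p q h => ?_) f₀ f₁ hf
  obtain ⟨l, hl⟩ := mem_range_stdOverlap K (stdι K 0 p) (range_stdι K 0 ▸ ⟨p, rfl⟩)
    (range_stdι K 1 ▸ ⟨q, h.symm⟩)
  refine ⟨l, (stdι K 0).isOpenEmbedding.injective ?_⟩
  rw [← hl, ← specMap_stdRes₀_stdι, Scheme.Hom.comp_apply]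

end Standard

end SmoothCollection
end

noncomputable section

namespace SmoothCollection

/-! ### Closed immersions and fibres -/

section Schemes

variable {X Y : Scheme.{u}}

/-- The property is local on the target. Over each chart either the preimage is empty, or the square
with `Spec ρ` is cartesian by the condition on ranges. -/
lemma isClosedImmersion_of_charts (f : Y ⟶ X)
    (h : ∀ x : X, ∃ (C : Type u) (_ : CommRing C) (g : Spec (.of C) ⟶ X), IsOpenImmersion g ∧
      x ∈ Set.range g ∧ ((∀ y, f y ∉ Set.range g) ∨ ∃ (A : Type u) (_ : CommRing A)
        (i : Spec (.of A) ⟶ Y) (ρ : C →+* A), IsOpenImmersion i ∧ Function.Surjective ρ ∧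
        i ≫ f = Spec.map (CommRingCat.ofHom ρ) ≫ g ∧
        ∀ y, f y ∈ Set.range g → y ∈ Set.range i)) : IsClosedImmersion f := by
  refine IsZariskiLocalAtTarget.of_forall_exists_morphismRestrict (P := @IsClosedImmersion)
    fun x => ?_
  obtain ⟨C, _, g, hg, hx, hgf⟩ := h x
  refine ⟨g.opensRange, hx, ?_⟩
  refine (MorphismProperty.arrow_mk_iso_iff _ (morphismRestrictOpensRange f g)).2 ?_
  rcases hgf with hgf | ⟨A, _, i, ρ, hi, hρ, hif, hr⟩
  · have : IsEmpty ↥(pullback f g) := ⟨fun p => hgf (pullback.fst f g p) ⟨pullback.snd f g p, by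
      rw [← Scheme.Hom.comp_apply, ← Scheme.Hom.comp_apply, pullback.condition]⟩⟩
    infer_instance
  · have hp : IsPullback (Spec.map (CommRingCat.ofHom ρ)) i g f := by
      refine IsOpenImmersion.isPullback _ _ _ _ hif (Opens.ext (Set.ext fun y => ⟨hr y, ?_⟩))
      rintro ⟨q, rfl⟩
      refine ⟨Spec.map (CommRingCat.ofHom ρ) q, ?_⟩
      rw [← Scheme.Hom.comp_apply, ← Scheme.Hom.comp_apply, hif]
    have : IsClosedImmersion (Spec.map (CommRingCat.ofHom ρ)) :=
      IsClosedImmersion.spec_of_surjective _ hρ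
    rw [← hp.flip.isoPullback_inv_snd]
    infer_instance

/-- `I` is the ideal that defines `X`. Maps out of `X` bound it from below, maps into `X` bound it
from above, and radicality gives reducedness; this is all that is needed to compute with it. -/
lemma exists_ideal_of_isClosedImmersion {C : Type u} [CommRing C] (w : X ⟶ Spec (.of C))
    [IsClosedImmersion w] : ∃ I : Ideal C,
      (∀ (A R : Type u) [CommRing A] [CommRing R] (φ : R →+* C) (ρ : R →+* A)
        (a : X ⟶ Spec (.of A)), a ≫ Spec.map (CommRingCat.ofHom ρ) =
          w ≫ Spec.map (CommRingCat.ofHom φ) → RingHom.ker ρ ≤ I.comap φ) ∧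
      (∀ (A : Type u) [CommRing A] (ρ : C →+* A) (b : Spec (.of A) ⟶ X),
        b ≫ w = Spec.map (CommRingCat.ofHom ρ) → I ≤ RingHom.ker ρ) ∧
      (I.IsRadical → IsReduced X) := by
  obtain ⟨I, e, he⟩ := (IsClosedImmersion.Spec_iff (R := .of C) (f := w)).1 ‹_›
  let I' : Ideal C := I
  have he' : w = e.hom ≫ Spec.map (CommRingCat.ofHom (Ideal.Quotient.mk I')) := he
  refine ⟨I', fun A R _ _ χ ρ a ha => ?_, fun A _ ρ b hb => ?_, fun hI => ?_⟩
  · obtain ⟨φ, hφ⟩ := Spec.map_surjective (e.inv ≫ a)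
    have h1 : Spec.map (CommRingCat.ofHom (φ.hom.comp ρ)) =
        Spec.map (CommRingCat.ofHom ((Ideal.Quotient.mk I').comp χ)) := by
      rw [specMap_comp ρ φ.hom, specMap_comp χ (Ideal.Quotient.mk I')]
      refine (congrArg (· ≫ _) hφ).trans ?_
      rw [Category.assoc, ha, he', Category.assoc, Iso.inv_hom_id_assoc]
    have h2 := congrArg CommRingCat.Hom.hom (Spec.map_injective h1)
    intro z hz
    change χ z ∈ I'
    refine Ideal.Quotient.eq_zero_iff_mem.1 ?_
    refine (RingHom.congr_fun h2 z).symm.trans ?_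
    change φ.hom (ρ z) = 0
    rw [show ρ z = 0 from hz, map_zero]
  · obtain ⟨φ, hφ⟩ := Spec.map_surjective (b ≫ e.hom)
    have h1 : Spec.map (CommRingCat.ofHom (φ.hom.comp (Ideal.Quotient.mk I'))) =
        Spec.map (CommRingCat.ofHom ρ) := by
      rw [specMap_comp (Ideal.Quotient.mk I') φ.hom, ← hb, he']
      refine (congrArg (· ≫ _) hφ).trans ?_
      rw [Category.assoc]
    have h2 := congrArg CommRingCat.Hom.hom (Spec.map_injective h1)
    intro z hz
    change ρ z = 0
    rw [← show φ.hom (Ideal.Quotient.mk I' z) = ρ z from RingHom.congr_fun h2 z,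
      Ideal.Quotient.eq_zero_iff_mem.2 hz, map_zero]
  · have : _root_.IsReduced (C ⧸ I') := (Ideal.isRadical_iff_quotient_reduced I').1 hI
    have : IsReduced (Spec (.of (C ⧸ I'))) := inferInstance
    exact isReduced_of_isOpenImmersion e.hom

lemma isReduced_of_charts (h : ∀ x : X, ∃ (W : Scheme.{u}) (g : W ⟶ X), IsOpenImmersion g ∧
    x ∈ Set.range g ∧ IsReduced W) : IsReduced X := by
  choose W g hg hx hW using h
  let 𝒰 : X.OpenCover := Scheme.Cover.mkOfCovers X W g (fun x => ⟨x, hx x⟩) hg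
  have : ∀ i, IsReduced (𝒰.X i) := hW
  exact IsReduced.of_openCover X 𝒰

end Schemes

/-! ### Fibres over a rational point -/

section Fibre

variable {K : Type u} [Field K] {T X : Scheme.{u}}

/-- The composite `K → κ(x) → K` is the identity, so the second map is a surjective homomorphism of
fields. -/
lemma exists_iso_residueField (r : Spec (.of K) ⟶ T) (s : T ⟶ Spec (.of K)) (hrs : r ≫ s = 𝟙 _)
    (x : T) (hx : x ∈ Set.range r) :
    ∃ u : Spec (.of K) ≅ Spec (T.residueField x), u.hom ≫ T.fromSpecResidueField x = r := by
  obtain ⟨q, rfl⟩ := hx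
  obtain rfl : q = IsLocalRing.closedPoint K := Subsingleton.elim _ _
  have hu := Scheme.descResidueField_stalkClosedPointTo_fromSpecResidueField K T r
  set φ := Scheme.descResidueField (Scheme.stalkClosedPointTo r)
  obtain ⟨ψ, hψ⟩ := Spec.map_surjective
    (T.fromSpecResidueField (r (IsLocalRing.closedPoint K)) ≫ s)
  have h1 : ψ ≫ φ = 𝟙 _ := by
    apply Spec.map_injective
    rw [Spec.map_comp, hψ, ← Category.assoc, hu, hrs, Spec.map_id]
  have : IsIso φ := by
    rw [ConcreteCategory.isIso_iff_bijective]
    refine ⟨φ.hom.injective, fun a => ⟨ψ a, ?_⟩⟩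
    exact ConcreteCategory.congr_hom h1 a
  exact ⟨asIso (Spec.map φ), hu⟩

variable (β : X ⟶ T) (r : Spec (.of K) ⟶ T) (s : T ⟶ Spec (.of K)) (hrs : r ≫ s = 𝟙 _)
  (x : T) (hx : x ∈ Set.range r)

include hrs hx

lemma fiberι_comp : β.fiberι x ≫ β = (β.fiberι x ≫ β ≫ s) ≫ r := by
  obtain ⟨u, hu⟩ := exists_iso_residueField r s hrs x hx
  have h : T.fromSpecResidueField x = u.inv ≫ r := by rw [← hu, Iso.inv_hom_id_assoc]
  rw [← Category.assoc (β.fiberι x), Scheme.Hom.fiber_fac, h]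
  simp only [Category.assoc]
  rw [reassoc_of% hrs]

lemma exists_lift_fiber {Y : Scheme.{u}} (f : Y ⟶ X) (t : Y ⟶ Spec (.of K)) (h : f ≫ β = t ≫ r) :
    ∃ l : Y ⟶ β.fiber x, l ≫ β.fiberι x = f := by
  obtain ⟨u, hu⟩ := exists_iso_residueField r s hrs x hx
  exact ⟨pullback.lift f (t ≫ u.hom) (by rw [h, Category.assoc, hu]), pullback.lift_fst _ _ _⟩

lemma isIso_fiber_of_isIso [IsIso β] : IsIso (β.fiberι x ≫ β ≫ s) := by
  obtain ⟨u, hu⟩ := exists_iso_residueField r s hrs x hx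
  have h : T.fromSpecResidueField x = u.inv ≫ r := by rw [← hu, Iso.inv_hom_id_assoc]
  have h2 : β.fiberι x ≫ β ≫ s = β.fiberToSpecResidueField x ≫ u.inv := by
    rw [← Category.assoc, Scheme.Hom.fiber_fac, h, Category.assoc, Category.assoc, hrs,
      Category.comp_id]
  have : IsIso (β.fiberToSpecResidueField x) :=
    inferInstanceAs (IsIso (pullback.snd β (T.fromSpecResidueField x)))
  rw [h2]
  infer_instance

end Fibre

instance isClosedImmersion_fiberι {X T : Scheme.{u}} (β : X ⟶ T) (x : T) [hx : IsClosedImmersion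
    (T.fromSpecResidueField x)] : IsClosedImmersion (β.fiberι x) :=
  inferInstanceAs (IsClosedImmersion (pullback.fst β (T.fromSpecResidueField x)))

end SmoothCollection
end

noncomputable section

namespace SmoothCollection

/-! ### The curves in the special fibre -/

section Sorted

variable {K : Type u} [Field K] {d : ℕ} {X : Scheme.{u}}

/-- Charts of a scheme over `T_S` that are ordered linearly. -/
structure SortedCharts (β : X ⟶ TS K d) where
  /-- The order of the indices. -/
  σ : Equiv.Perm (Fin (d + 1))
  /-- The types of the charts. -/
  τ : Fin (d + 1) → Fin (d + 1) → Ordering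
  /-- The charts. -/
  g : ∀ i, Spec (.of (Ch K (τ i))) ⟶ X
  lt_iff : ∀ i k, τ i (σ k) = .lt ↔ k < i
  eq_iff : ∀ i k, τ i (σ k) = .eq ↔ k = i
  gt_iff : ∀ i k, τ i (σ k) = .gt ↔ i < k
  isOpenImmersion : ∀ i, IsOpenImmersion (g i)
  comp : ∀ i, g i ≫ β = chartMap (τ i)
  cover : ∀ z : X, ∃ i, z ∈ Set.range (g i)
  uniq : ∀ (B : Type u) [CommRing B] [IsDomain B] (f₁ f₂ : Spec (.of B) ⟶ X) (φ : RS K d →+* B),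
    Function.Injective φ → f₁ ≫ β = Spec.map (CommRingCat.ofHom φ) →
    f₂ ≫ β = Spec.map (CommRingCat.ofHom φ) → f₁ = f₂

lemma HasCharts.nonempty_sortedCharts {β : X ⟶ TS K d} {c : Fin (d + 1) → ℕ} (h : HasCharts β c)
    (hc : Function.Injective c) : Nonempty (SortedCharts β) := by
  choose g hgo hg using h.exists_chart
  have hm : StrictMono (c ∘ Tuple.sort c) :=
    (Tuple.monotone_sort c).strictMono_of_injective (hc.comp (Tuple.sort c).injective)
  refine ⟨⟨Tuple.sort c, fun i => chartOrd c (Tuple.sort c i), fun i => g _, fun i k => ?_,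
    fun i k => ?_, fun i k => ?_, fun i => hgo _, fun i => hg _, fun z => ?_, h.uniq⟩⟩
  · exact compare_lt_iff_lt.trans hm.lt_iff_lt
  · exact compare_eq_iff_eq.trans hm.injective.eq_iff
  · exact compare_gt_iff_gt.trans hm.lt_iff_lt
  · obtain ⟨j, g', -, hg', hz⟩ := h.cover z
    obtain ⟨i, rfl⟩ := (Tuple.sort c).surjective j
    -- The chart provided by `cover` need not be the chosen one, but morphisms over `T_S` out of an
    -- integral chart are unique.
    exact ⟨i, h.uniq _ g' _ _ (ofRS_injective K _) hg' (hg _) ▸ hz⟩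

variable {β : X ⟶ TS K d} (S : SortedCharts β)

namespace SortedCharts

instance (i : Fin (d + 1)) : IsOpenImmersion (S.g i) := S.isOpenImmersion i

lemma prod_lt {M : Type*} [CommMonoid M] (i : Fin (d + 1)) (f : Fin (d + 1) → M) :
    ∏ k ∈ part (S.τ i) .lt, f k = ∏ k ∈ Finset.Iio i, f (S.σ k) := by
  refine Eq.trans ?_ (Finset.prod_map (Finset.Iio i) S.σ.toEmbedding f)
  congr 1
  ext k
  obtain ⟨k, rfl⟩ := S.σ.surjective k
  simp [S.lt_iff]

lemma prod_eq {M : Type*} [CommMonoid M] (i : Fin (d + 1)) (f : Fin (d + 1) → M) :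
    ∏ k ∈ part (S.τ i) .eq, f k = f (S.σ i) := by
  rw [show part (S.τ i) .eq = {S.σ i} from ?_, Finset.prod_singleton]
  ext k
  obtain ⟨k, rfl⟩ := S.σ.surjective k
  simp [S.eq_iff]

lemma prod_gt {M : Type*} [CommMonoid M] (i : Fin (d + 1)) (f : Fin (d + 1) → M) :
    ∏ k ∈ part (S.τ i) .gt, f k = ∏ k ∈ Finset.Ioi i, f (S.σ k) := by
  refine Eq.trans ?_ (Finset.prod_map (Finset.Ioi i) S.σ.toEmbedding f)
  congr 1
  ext k
  obtain ⟨k, rfl⟩ := S.σ.surjective k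
  simp [S.gt_iff]

lemma nonempty_eq (i : Fin (d + 1)) : (part (S.τ i) .eq).Nonempty :=
  ⟨S.σ i, mem_part.2 ((S.eq_iff i i).2 rfl)⟩

lemma nonempty_lt {i k : Fin (d + 1)} (h : k < i) : (part (S.τ i) .lt).Nonempty :=
  ⟨S.σ k, mem_part.2 ((S.lt_iff i k).2 h)⟩

lemma nonempty_gt {i k : Fin (d + 1)} (h : i < k) : (part (S.τ i) .gt).Nonempty :=
  ⟨S.σ k, mem_part.2 ((S.gt_iff i k).2 h)⟩

section Relations

variable {B : Type*} [CommRing B] (i : Fin (d + 1)) (f : Ch K (S.τ i) →+* B) (φ : RS K d →+* B)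
  (hf : f.comp (ofRS K (S.τ i)) = φ)

include hf

lemma map_xi : (∏ k ∈ Finset.Iio i, φ (uVar K d (S.σ k))) * f (xiC K (S.τ i)) =
    φ (xVar K d) := by
  rw [← S.prod_lt i (fun k => φ (uVar K d k)), ← hf, RingHom.comp_apply, ← uCProd_mul_xiC, map_mul,
    uCProd, map_prod]
  rfl

lemma map_eta : (∏ k ∈ Finset.Ioi i, φ (uVar K d (S.σ k))) * f (etaC K (S.τ i)) =
    φ (yVar K d) := by
  rw [← S.prod_gt i (fun k => φ (uVar K d k)), ← hf, RingHom.comp_apply, ← uCProd_mul_etaC,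
    map_mul, uCProd, map_prod]
  rfl

lemma map_xi_mul_eta : f (xiC K (S.τ i)) * f (etaC K (S.τ i)) = φ (uVar K d (S.σ i)) := by
  rw [← S.prod_eq i (fun k => φ (uVar K d k)), ← map_mul, xiC_mul_etaC, uCProd, map_prod, ← hf]
  rfl

end Relations

lemma exists_chHom (i : Fin (d + 1)) {B : Type*} [CommRing B] (φ : RS K d →+* B) (ξ η : B)
    (hy : (∏ k ∈ Finset.Ioi i, φ (uVar K d (S.σ k))) * η = φ (yVar K d))
    (hx : (∏ k ∈ Finset.Iio i, φ (uVar K d (S.σ k))) * ξ = φ (xVar K d))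
    (hM : ξ * η = φ (uVar K d (S.σ i))) :
    ∃ h : Ch K (S.τ i) →+* B, h.comp (ofRS K (S.τ i)) = φ ∧ h (xiC K (S.τ i)) = ξ ∧
      h (etaC K (S.τ i)) = η :=
  SmoothCollection.exists_chHom φ ξ η (by rw [S.prod_gt, hy]) (by rw [S.prod_lt, hx])
    (by rw [S.prod_eq, hM])

/-- Multiply the two relations and cancel `xy = ∏ u`: as `i < j`, the ranges `k > i` and `k < j`
cover all indices and overlap in the open interval. -/
lemma mul_eq_one_of_relations {n : ℕ} {B : Type*} [CommRing B] [IsDomain B] {u : Fin n → B}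
    (hu : ∀ k, u k ≠ 0) {x y ξ η : B} {i j : Fin n} (hij : i < j)
    (hy : (∏ k ∈ Finset.Ioi i, u k) * η = y) (hx : (∏ k ∈ Finset.Iio j, u k) * ξ = x)
    (hxy : x * y = ∏ k, u k) : ξ * η * ∏ k ∈ Finset.Ioo i j, u k = 1 := by
  have h1 : (∏ k, u k) * ∏ k ∈ Finset.Ioo i j, u k =
      (∏ k ∈ Finset.Ioi i, u k) * ∏ k ∈ Finset.Iio j, u k := by
    rw [← Finset.prod_union_inter (s₁ := Finset.Ioi i)]
    congr 2
    · ext k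
      simp only [Finset.mem_univ, Finset.mem_union, Finset.mem_Ioi, Finset.mem_Iio, true_iff]
      omega
    · ext k
      simp
  have h0 : (∏ k, u k) ≠ 0 := Finset.prod_ne_zero_iff.2 fun k _ => hu k
  refine mul_left_cancel₀ h0 ?_
  calc (∏ k, u k) * (ξ * η * ∏ k ∈ Finset.Ioo i j, u k) =
      ((∏ k, u k) * ∏ k ∈ Finset.Ioo i j, u k) * (ξ * η) := by ring
    _ = ((∏ k ∈ Finset.Iio j, u k) * ξ) * ((∏ k ∈ Finset.Ioi i, u k) * η) := by rw [h1]; ring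
    _ = (∏ k, u k) * 1 := by rw [hx, hy, hxy, mul_one]

/-- The overlap of two charts. -/
lemma notMem_of_eq {i j : Fin (d + 1)} (hij : i < j) (p : PrimeSpectrum (Ch K (S.τ i)))
    (q : PrimeSpectrum (Ch K (S.τ j))) (h : S.g i p = S.g j q) :
    etaC K (S.τ i) ∉ p.asIdeal ∧ xiC K (S.τ j) ∉ q.asIdeal ∧ ∀ k, i < k → k < j →
      uC K (S.τ i) (S.σ k) ∉ p.asIdeal ∧ uC K (S.τ j) (S.σ k) ∉ q.asIdeal := by
  obtain ⟨s, ⟨b, hb⟩, hsub⟩ := exists_chart_basicOpen (S.g i) p (S.g j).opensRange ⟨q, h.symm⟩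
  let B := Localization.Away s
  let α : Ch K (S.τ i) →+* B := algebraMap _ B
  have hbp : Spec.map (CommRingCat.ofHom α) b = p := by
    refine (S.g i).isOpenEmbedding.injective ?_
    exact (Scheme.Hom.comp_apply _ _ _).symm.trans hb
  have hs : s ≠ 0 := by
    rintro rfl
    have h1 : IsUnit (α 0) := IsLocalization.Away.algebraMap_isUnit (0 : Ch K (S.τ i))
    rw [map_zero] at h1
    exact (b : PrimeSpectrum B).2.ne_top (Ideal.eq_top_of_isUnit_mem _ (zero_mem _) h1)
  have hle : Submonoid.powers s ≤ nonZeroDivisors (Ch K (S.τ i)) :=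
    powers_le_nonZeroDivisors_of_noZeroDivisors hs
  have : IsDomain B := IsLocalization.isDomain_localization hle
  have hα : Function.Injective α := IsLocalization.injective B hle
  obtain ⟨f, hf⟩ : ∃ f : Spec (.of B) ⟶ Spec (.of (Ch K (S.τ j))), f ≫ S.g j =
      Spec.map (CommRingCat.ofHom α) ≫ S.g i :=
    ⟨IsOpenImmersion.lift (S.g j) _ hsub, IsOpenImmersion.lift_fac _ _ _⟩
  obtain ⟨α', rfl⟩ := Spec.map_surjective f
  have hbq : Spec.map (CommRingCat.ofHom α'.hom) b = q := by
    refine (S.g j).isOpenEmbedding.injective ?_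
    refine (Scheme.Hom.comp_apply _ _ _).symm.trans ?_
    refine (congrArg (fun f : Spec (.of B) ⟶ X => f b) hf).trans ?_
    exact hb.trans h
  have hcomp : α'.hom.comp (ofRS K (S.τ j)) = α.comp (ofRS K (S.τ i)) := by
    have h1 : Spec.map (CommRingCat.ofHom (α'.hom.comp (ofRS K (S.τ j)))) =
        Spec.map (CommRingCat.ofHom (α.comp (ofRS K (S.τ i)))) := by
      rw [specMap_comp (ofRS K (S.τ j)) α'.hom, specMap_comp (ofRS K (S.τ i)) α]
      change Spec.map α' ≫ chartMap (S.τ j) = _ ≫ chartMap (S.τ i)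
      rw [← S.comp i, ← S.comp j, ← Category.assoc, hf, Category.assoc]
    exact congrArg CommRingCat.Hom.hom (Spec.map_injective h1)
  set φ := α.comp (ofRS K (S.τ i)) with hφ
  have hφi : Function.Injective φ := hα.comp (ofRS_injective K _)
  have hone := mul_eq_one_of_relations (u := fun k => φ (uVar K d (S.σ k)))
    (fun k => (map_ne_zero_iff φ hφi).2 (uVar_ne_zero K d _)) hij (S.map_eta i α φ rfl)
    (S.map_xi j α'.hom φ hcomp) (by
      rw [← map_mul, xVar_mul_yVar, map_prod, ← Equiv.prod_comp S.σ])
  have hunit : ∀ a : B, a ∣ 1 → a ∉ (b : PrimeSpectrum B).asIdeal := fun a ha hab =>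
    (b : PrimeSpectrum B).2.ne_top
      (Ideal.eq_top_of_isUnit_mem _ hab (isUnit_of_dvd_one ha))
  have hp : ∀ z, α z ∣ 1 → z ∉ p.asIdeal := fun z hz hzp => by
    rw [← hbp] at hzp
    exact hunit _ hz hzp
  have hq : ∀ z, α'.hom z ∣ 1 → z ∉ q.asIdeal := fun z hz hzq => by
    rw [← hbq] at hzq
    exact hunit _ hz hzq
  refine ⟨hp _ ?_, hq _ ?_, fun k hik hkj => ?_⟩
  · rw [← hone]
    exact Dvd.dvd.mul_right (Dvd.intro_left _ rfl) _
  · rw [← hone]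
    exact Dvd.dvd.mul_right (Dvd.intro _ rfl) _
  · have hd : φ (uVar K d (S.σ k)) ∣ 1 := by
      rw [← hone]
      exact Dvd.dvd.mul_left (Finset.dvd_prod_of_mem (fun k => φ (uVar K d (S.σ k)))
        (Finset.mem_Ioo.2 ⟨hik, hkj⟩)) _
    refine ⟨hp _ hd, hq _ ?_⟩
    exact (RingHom.congr_fun hcomp _).symm ▸ hd

end SortedCharts

end Sorted

end SmoothCollection
end

noncomputable section

namespace SmoothCollection

/-! ### Gluing the axes of consecutive charts -/

section Curves

open Polynomial

attribute [local instance] MvPolynomial.gradedAlgebra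

variable {K : Type u} [Field K] {d : ℕ} {X : Scheme.{u}} {β : X ⟶ TS K d}

namespace SortedCharts

variable (S : SortedCharts β)

lemma Ioi_castSucc (i : Fin d) : Finset.Ioi i.castSucc = insert i.succ (Finset.Ioi i.succ) := by
  ext k
  simp only [Finset.mem_Ioi, Finset.mem_insert, Fin.lt_def, Fin.ext_iff, Fin.val_castSucc,
    Fin.val_succ]
  omega

lemma Iio_succ (i : Fin d) : Finset.Iio i.succ = insert i.castSucc (Finset.Iio i.castSucc) := by
  ext k
  simp only [Finset.mem_Iio, Finset.mem_insert, Fin.lt_def, Fin.ext_iff, Fin.val_castSucc,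
    Fin.val_succ]
  omega

/-- The gluing of two adjacent charts. -/
lemma exists_transition (i : Fin d) :
    ∃ l : Ch K (S.τ i.succ) →+* Localization.Away (etaC K (S.τ i.castSucc)),
      Spec.map (CommRingCat.ofHom (algebraMap _ (Localization.Away (etaC K (S.τ i.castSucc))))) ≫
        S.g i.castSucc = Spec.map (CommRingCat.ofHom l) ≫ S.g i.succ ∧
      l.comp (ofRS K (S.τ i.succ)) = (algebraMap _ _).comp (ofRS K (S.τ i.castSucc)) ∧
      l (xiC K (S.τ i.succ)) * algebraMap _ _ (etaC K (S.τ i.castSucc)) = 1 ∧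
      l (etaC K (S.τ i.succ)) = algebraMap _ _ (etaC K (S.τ i.castSucc)) *
        algebraMap _ _ (uC K (S.τ i.castSucc) (S.σ i.succ)) := by
  let D := Localization.Away (etaC K (S.τ i.castSucc))
  let α : Ch K (S.τ i.castSucc) →+* D := algebraMap _ D
  have hle : Submonoid.powers (etaC K (S.τ i.castSucc)) ≤ nonZeroDivisors _ :=
    powers_le_nonZeroDivisors_of_noZeroDivisors (etaC_ne_zero _)
  have : IsDomain D := IsLocalization.isDomain_localization hle
  have hα : Function.Injective α := IsLocalization.injective D hle
  obtain ⟨v, hv⟩ : ∃ v, α (etaC K (S.τ i.castSucc)) * v = 1 :=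
    ⟨_, IsLocalization.Away.mul_invSelf (S := D) (etaC K (S.τ i.castSucc))⟩
  set φ := α.comp (ofRS K (S.τ i.castSucc)) with hφ
  have h1 := S.map_xi i.castSucc α φ rfl
  have h2 := S.map_eta i.castSucc α φ rfl
  have h3 := S.map_xi_mul_eta i.castSucc α φ rfl
  rw [Ioi_castSucc, Finset.prod_insert (by simp)] at h2
  -- In the function field `ξ_{i+1} = 1 / η_i` and `η_{i+1} = η_i u_{i+1}`, with `u` indexed along
  -- the sorted order.
  obtain ⟨l, hl₁, hl₂, hl₃⟩ := S.exists_chHom i.succ φ v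
    (α (etaC K (S.τ i.castSucc)) * φ (uVar K d (S.σ i.succ)))
    (by rw [← h2]; ring)
    (by
      rw [← h1, Iio_succ, Finset.prod_insert (by simp), ← h3]
      linear_combination (∏ k ∈ Finset.Iio i.castSucc, φ (uVar K d (S.σ k))) *
        α (xiC K (S.τ i.castSucc)) * hv)
    (by linear_combination φ (uVar K d (S.σ i.succ)) * hv)
  refine ⟨l, ?_, hl₁, ?_, hl₃⟩
  · refine S.uniq D _ _ φ (hα.comp (ofRS_injective K _)) ?_ ?_
    · rw [Category.assoc, S.comp, hφ, specMap_comp (ofRS K (S.τ i.castSucc)) α]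
      rfl
    · rw [Category.assoc, S.comp, ← hl₁, specMap_comp (ofRS K (S.τ i.succ)) l]
      rfl
  · rw [hl₂, mul_comm]
    exact hv

/-- A component of the special fibre. -/
structure IsCurve (i : Fin d) (f : ProjectiveLine K ⟶ X) : Prop where
  exists_left : ∃ ρ : Ch K (S.τ i.castSucc) →+* K[X],
    IsLine ρ (xiC K (S.τ i.castSucc)) (etaC K (S.τ i.castSucc)) ∧
      stdι K 0 ≫ f = Spec.map (CommRingCat.ofHom ρ) ≫ S.g i.castSucc
  exists_right : ∃ ρ : Ch K (S.τ i.succ) →+* K[X],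
    IsLine ρ (etaC K (S.τ i.succ)) (xiC K (S.τ i.succ)) ∧
      stdι K 1 ≫ f = Spec.map (CommRingCat.ofHom ρ) ≫ S.g i.succ

/-- On the fibre the transition `ξ_{i+1} = 1 / η_i` is the one between the standard charts of the
projective line, and `η_{i+1} = η_i u_{i+1}` vanishes. -/
theorem exists_isCurve (i : Fin d) : ∃ f, S.IsCurve i f := by
  obtain ⟨ρ, hρ⟩ := exists_isLine_eta (K := K) (S.nonempty_eq i.castSucc)
    (S.nonempty_gt i.castSucc_lt_succ)
  obtain ⟨ρ', hρ'⟩ := exists_isLine_xi (K := K) (S.nonempty_eq i.succ)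
    (S.nonempty_lt i.castSucc_lt_succ)
  obtain ⟨l, hl₁, hl₂, hl₃, hl₄⟩ := S.exists_transition i
  let D := Localization.Away (etaC K (S.τ i.castSucc))
  have hu : IsUnit ((stdRes₀ K).comp ρ (etaC K (S.τ i.castSucc))) := by
    rw [RingHom.comp_apply, hρ.map_right]
    exact .of_mul_eq_one _ (stdRes_mul K)
  let μ : D →+* StdOverlap K := IsLocalization.Away.lift (etaC K (S.τ i.castSucc)) hu
  have hμ : μ.comp (algebraMap _ D) = (stdRes₀ K).comp ρ :=
    IsLocalization.Away.lift_comp (etaC K (S.τ i.castSucc)) hu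
  have hμ' : ∀ z, μ (algebraMap _ D z) = stdRes₀ K (ρ z) := RingHom.congr_fun hμ
  have hμl : μ.comp l = (stdRes₁ K).comp ρ' := by
    refine chHom_ext ?_ ?_ ?_
    · rw [RingHom.comp_assoc, hl₂, ← RingHom.comp_assoc, hμ, RingHom.comp_assoc,
        RingHom.comp_assoc, hρ.comp_ofRS, hρ'.comp_ofRS]
      exact RingHom.ext fun r => stdRes_C K _
    · have h1 := congrArg μ hl₃
      rw [map_mul, map_one, hμ', hρ.map_right] at h1
      rw [RingHom.comp_apply, RingHom.comp_apply, hρ'.map_right]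
      exact left_inv_eq_right_inv h1 (stdRes_mul K)
    · rw [RingHom.comp_apply, RingHom.comp_apply, hρ'.map_left, hl₄, map_mul, hμ', hμ', uC,
        hρ.map_ofRS, resRS_uVar, map_zero, map_zero, map_zero, mul_zero]
  obtain ⟨f, hf₀, hf₁⟩ := ProjectiveLine.exists_glue K
    (Spec.map (CommRingCat.ofHom ρ) ≫ S.g i.castSucc)
    (Spec.map (CommRingCat.ofHom ρ') ≫ S.g i.succ) (by
      rw [← Category.assoc, ← Category.assoc, ← specMap_comp ρ (stdRes₀ K),
        ← specMap_comp ρ' (stdRes₁ K), ← hμ, ← hμl, specMap_comp (algebraMap _ D) μ,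
        specMap_comp l μ, Category.assoc, Category.assoc, hl₁])
  exact ⟨f, ⟨ρ, hρ, hf₀⟩, ⟨ρ', hρ', hf₁⟩⟩

end SortedCharts

end Curves

end SmoothCollection
end

noncomputable section

namespace SmoothCollection

/-! ### The curves inside the total space -/

section Curves

open Polynomial

variable {K : Type u} [Field K] {d : ℕ} {X : Scheme.{u}} {β : X ⟶ TS K d} (S : SortedCharts β)

lemma ProjectiveLine.hom_ext {Z : Scheme.{u}} {f f' : ProjectiveLine K ⟶ Z}
    (h₀ : stdι K 0 ≫ f = stdι K 0 ≫ f') (h₁ : stdι K 1 ≫ f = stdι K 1 ≫ f') : f = f' := by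
  let 𝒰 : (ProjectiveLine K).OpenCover := Scheme.Cover.mkOfCovers (Fin 2)
    (fun _ => Spec (.of K[X])) (stdι K) (fun z => (exists_mem_range_stdι K z).elim
      (fun ⟨p, hp⟩ => ⟨0, p, hp⟩) (fun ⟨p, hp⟩ => ⟨1, p, hp⟩)) (fun i => inferInstance)
  refine Scheme.Cover.hom_ext 𝒰 _ _ fun (i : Fin 2) => ?_
  fin_cases i
  exacts [h₀, h₁]

lemma IsLine.exists_comap_eq {τ : Fin (d + 1) → Ordering} {ρ : Ch K τ →+* K[X]} {ξ η : Ch K τ}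
    (h : IsLine ρ ξ η) {q : PrimeSpectrum (Ch K τ)} (hq : RingHom.ker ρ ≤ q.asIdeal) :
    ∃ q₁ : PrimeSpectrum K[X], q₁.comap ρ = q :=
  (range_comap_of_surjective _ ρ h.surjective).ge hq

lemma apply_comap {X Y : Scheme.{u}} {A C : Type u} [CommRing A] [CommRing C]
    {i : Spec (.of A) ⟶ Y} {f : Y ⟶ X} {g : Spec (.of C) ⟶ X} {ρ : C →+* A}
    (h : i ≫ f = Spec.map (CommRingCat.ofHom ρ) ≫ g) (q : PrimeSpectrum A) :
    f (i q) = g (PrimeSpectrum.comap ρ q) :=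
  (Scheme.Hom.comp_apply _ _ _).symm.trans ((congrArg (fun f : Spec (.of A) ⟶ X => f q)
    h).trans (Scheme.Hom.comp_apply _ _ _))

variable (K d) in
/-- The inclusion of the closed point of `T_S`. -/
def closedPointι : Spec (.of K) ⟶ TS K d := Spec.map (CommRingCat.ofHom (resRS K d))

lemma closedPointι_toSpecField : closedPointι K d ≫ TS.toSpecField K d = 𝟙 _ := by
  refine (specMap_comp (algebraMap K (RS K d)) (resRS K d)).symm.trans ?_
  rw [show (resRS K d).comp (algebraMap K (RS K d)) = RingHom.id K from
    RingHom.ext (resRS_algebraMap K d)]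
  exact Spec.map_id _

namespace SortedCharts.IsCurve

variable {S} {i : Fin d} {f : ProjectiveLine K ⟶ X} (h : S.IsCurve i f)

include h

lemma comp_eq : f ≫ β = ProjectiveLine.toSpecField K ≫ closedPointι K d := by
  obtain ⟨ρ, hρ, hf⟩ := h.exists_left
  obtain ⟨ρ', hρ', hf'⟩ := h.exists_right
  have key : ∀ k, stdι K k ≫ ProjectiveLine.toSpecField K ≫ closedPointι K d =
      Spec.map (CommRingCat.ofHom (C.comp (resRS K d))) := fun k => by
    rw [← Category.assoc, stdι_toSpecField, specMap_comp (resRS K d) (C : K →+* K[X])]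
    rfl
  refine ProjectiveLine.hom_ext ?_ ?_
  · rw [key, ← Category.assoc, hf, Category.assoc, S.comp, ← hρ.comp_ofRS,
      specMap_comp (ofRS K _) ρ]
    rfl
  · rw [key, ← Category.assoc, hf', Category.assoc, S.comp, ← hρ'.comp_ofRS,
      specMap_comp (ofRS K _) ρ']
    rfl

/-- The point missing from the left line is the origin of the right one, where `ξ = 0`; the overlap
of the charts lies in `ξ ≠ 0`. -/
lemma mem_range_stdι_left {z : ProjectiveLine K} (hz : f z ∈ Set.range (S.g i.castSucc)) :
    z ∈ Set.range (stdι K 0) := by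
  rcases exists_mem_range_stdι K z with hz' | ⟨q, rfl⟩
  · exact hz'
  obtain ⟨ρ, hρ, hf⟩ := h.exists_right
  obtain ⟨p, hp⟩ := hz
  have h2 := (S.notMem_of_eq i.castSucc_lt_succ p _ (hp.trans (apply_comap hf q))).2.1
  refine mem_range_stdι_of_notMem K 1 q fun hq => h2 ?_
  change ρ (xiC K _) ∈ q.asIdeal
  rwa [hρ.map_right]

lemma mem_range_stdι_right {z : ProjectiveLine K} (hz : f z ∈ Set.range (S.g i.succ)) :
    z ∈ Set.range (stdι K 1) := by
  rcases exists_mem_range_stdι K z with ⟨q, rfl⟩ | hz'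
  · obtain ⟨ρ, hρ, hf⟩ := h.exists_left
    obtain ⟨p, hp⟩ := hz
    have h2 := (S.notMem_of_eq i.castSucc_lt_succ _ p ((apply_comap hf q).symm.trans hp.symm)).1
    refine mem_range_stdι_of_notMem K 0 q fun hq => h2 ?_
    change ρ (etaC K _) ∈ q.asIdeal
    rwa [hρ.map_right]
  · exact hz'

lemma exists_eq (z : ProjectiveLine K) :
    (∃ q : PrimeSpectrum (Ch K (S.τ i.castSucc)), fibreIdeal _ ≤ q.asIdeal ∧
      xiC K _ ∈ q.asIdeal ∧ f z = S.g i.castSucc q) ∨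
    ∃ q : PrimeSpectrum (Ch K (S.τ i.succ)), fibreIdeal _ ≤ q.asIdeal ∧
      etaC K _ ∈ q.asIdeal ∧ f z = S.g i.succ q := by
  have hker : ∀ {τ : Fin (d + 1) → Ordering} (ρ : Ch K τ →+* K[X]) (q : PrimeSpectrum K[X]),
      RingHom.ker ρ ≤ (PrimeSpectrum.comap ρ q).asIdeal := fun ρ q z hz => by
    change ρ z ∈ q.asIdeal
    rw [show ρ z = 0 from hz]
    exact zero_mem _
  rcases exists_mem_range_stdι K z with ⟨q, rfl⟩ | ⟨q, rfl⟩
  · obtain ⟨ρ, hρ, hf⟩ := h.exists_left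
    exact .inl ⟨PrimeSpectrum.comap ρ q, hρ.fibreIdeal_le_ker.trans (hker ρ q),
      hker ρ q hρ.map_left, apply_comap hf q⟩
  · obtain ⟨ρ, hρ, hf⟩ := h.exists_right
    exact .inr ⟨PrimeSpectrum.comap ρ q, hρ.fibreIdeal_le_ker.trans (hker ρ q),
      hker ρ q hρ.map_left, apply_comap hf q⟩

/-- A chart further away meets the two charts of the curve only where some intermediate `u_k`, or
the coordinate vanishing on the curve, is invertible. -/
lemma notMem_range {j : Fin (d + 1)} (h₁ : j ≠ i.castSucc) (h₂ : j ≠ i.succ)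
    (z : ProjectiveLine K) : f z ∉ Set.range (S.g j) := by
  rintro ⟨p, hp⟩
  have hu : ∀ (τ : Fin (d + 1) → Ordering) k, uC K τ k ∈ fibreIdeal τ := fun τ k =>
    ofRS_mem_fibreIdeal (resRS_uVar K d k)
  rcases h.exists_eq z with ⟨q, hJ, hq, hz⟩ | ⟨q, hJ, hq, hz⟩
  · rcases lt_or_gt_of_ne h₁ with hlt | hlt
    · exact (S.notMem_of_eq hlt p q (hp.trans hz)).2.1 hq
    · have hlt' : i.succ < j := lt_of_le_of_ne (Fin.castSucc_lt_iff_succ_le.1 hlt) h₂.symm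
      exact ((S.notMem_of_eq hlt q p (hz.symm.trans hp.symm)).2.2 _ i.castSucc_lt_succ hlt').1
        (hJ (hu _ _))
  · rcases lt_or_gt_of_ne h₂ with hlt | hlt
    · have hlt' : j < i.castSucc := lt_of_le_of_ne (Fin.le_castSucc_iff.2 hlt) h₁
      exact ((S.notMem_of_eq hlt p q (hp.trans hz)).2.2 _ hlt' i.castSucc_lt_succ).2 (hJ (hu _ _))
    · exact (S.notMem_of_eq hlt q p (hz.symm.trans hp.symm)).1 hq

theorem isClosedImmersion : IsClosedImmersion f := by
  refine isClosedImmersion_of_charts f fun x => ?_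
  obtain ⟨j, hj⟩ := S.cover x
  refine ⟨_, inferInstance, S.g j, inferInstance, hj, ?_⟩
  by_cases h₁ : j = i.castSucc
  · subst h₁
    obtain ⟨ρ, hρ, hf⟩ := h.exists_left
    exact .inr ⟨K[X], inferInstance, stdι K 0, ρ, inferInstance, hρ.surjective, hf,
      fun z hz => h.mem_range_stdι_left hz⟩
  by_cases h₂ : j = i.succ
  · subst h₂
    obtain ⟨ρ, hρ, hf⟩ := h.exists_right
    exact .inr ⟨K[X], inferInstance, stdι K 1, ρ, inferInstance, hρ.surjective, hf,
      fun z hz => h.mem_range_stdι_right hz⟩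
  exact .inl (h.notMem_range h₁ h₂)

lemma mem_range_left_iff (q : PrimeSpectrum (Ch K (S.τ i.castSucc))) :
    S.g i.castSucc q ∈ Set.range f ↔ fibreIdeal _ ≤ q.asIdeal ∧ xiC K _ ∈ q.asIdeal := by
  obtain ⟨ρ, hρ, hf⟩ := h.exists_left
  constructor
  · rintro ⟨z, hz⟩
    obtain ⟨q₁, rfl⟩ := h.mem_range_stdι_left ⟨q, hz.symm⟩
    have h1 : PrimeSpectrum.comap ρ q₁ = q :=
      (S.g i.castSucc).isOpenEmbedding.injective ((apply_comap hf q₁).symm.trans hz)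
    rw [← h1]
    refine ⟨fun z hz => ?_, ?_⟩
    · change ρ z ∈ q₁.asIdeal
      rw [show ρ z = 0 from hρ.fibreIdeal_le_ker hz]
      exact zero_mem _
    · change ρ (xiC K _) ∈ q₁.asIdeal
      rw [hρ.map_left]
      exact zero_mem _
  · rintro ⟨hJ, hq⟩
    obtain ⟨q₁, rfl⟩ := hρ.exists_comap_eq (q := q) (by
      rw [hρ.ker_xi]
      exact sup_le hJ ((Ideal.span_singleton_le_iff_mem _).2 hq))
    exact ⟨stdι K 0 q₁, apply_comap hf q₁⟩

lemma mem_range_right_iff (q : PrimeSpectrum (Ch K (S.τ i.succ))) :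
    S.g i.succ q ∈ Set.range f ↔ fibreIdeal _ ≤ q.asIdeal ∧ etaC K _ ∈ q.asIdeal := by
  obtain ⟨ρ, hρ, hf⟩ := h.exists_right
  constructor
  · rintro ⟨z, hz⟩
    obtain ⟨q₁, rfl⟩ := h.mem_range_stdι_right ⟨q, hz.symm⟩
    have h1 : PrimeSpectrum.comap ρ q₁ = q :=
      (S.g i.succ).isOpenEmbedding.injective ((apply_comap hf q₁).symm.trans hz)
    rw [← h1]
    refine ⟨fun z hz => ?_, ?_⟩
    · change ρ z ∈ q₁.asIdeal
      rw [show ρ z = 0 from hρ.fibreIdeal_le_ker hz]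
      exact zero_mem _
    · change ρ (etaC K _) ∈ q₁.asIdeal
      rw [hρ.map_left]
      exact zero_mem _
  · rintro ⟨hJ, hq⟩
    obtain ⟨q₁, rfl⟩ := hρ.exists_comap_eq (q := q) (by
      rw [hρ.ker_eta]
      exact sup_le hJ ((Ideal.span_singleton_le_iff_mem _).2 hq))
    exact ⟨stdι K 1 q₁, apply_comap hf q₁⟩

end SortedCharts.IsCurve

end Curves

end SmoothCollection
end

noncomputable section

namespace SmoothCollection

/-! ### The special fibre -/

section Fibre

open Polynomial

variable {K : Type u} [Field K] {d : ℕ} {X : Scheme.{u}} {β : X ⟶ TS K d} (S : SortedCharts β)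

lemma closedPoint_mem_range : TS.closedPoint K d ∈ Set.range (closedPointι K d) := by
  refine ⟨IsLocalRing.closedPoint K, ?_⟩
  refine PrimeSpectrum.ext (?_ : (PrimeSpectrum.comap (resRS K d)
    (IsLocalRing.closedPoint K)).asIdeal = IsLocalRing.maximalIdeal (RS K d))
  rw [← ker_resRS, PrimeSpectrum.comap_asIdeal]
  change (IsLocalRing.maximalIdeal K).comap _ = _
  rw [IsLocalRing.maximalIdeal_eq_bot]
  rfl

instance : IsClosedImmersion ((TS K d).fromSpecResidueField (TS.closedPoint K d)) :=
  isClosed_singleton_iff_isClosedImmersion.1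
    (IsLocalRing.isClosed_singleton_closedPoint (RS K d))

variable (β) in
/-- The special fibre. -/
abbrev specialFibre : Scheme.{u} := β.fiber (TS.closedPoint K d)

variable (β) in
/-- The inclusion of the special fibre. -/
abbrev specialι : specialFibre β ⟶ X := β.fiberι (TS.closedPoint K d)

lemma specialι_comp : specialι β ≫ β =
    (specialι β ≫ β ≫ TS.toSpecField K d) ≫ closedPointι K d :=
  fiberι_comp β _ _ closedPointι_toSpecField _ closedPoint_mem_range

lemma specialι_injective : Function.Injective (specialι β) :=
  (specialι β).isClosedEmbedding.injective

lemma fibreIdeal_le_of_eq {τ : Fin (d + 1) → Ordering} {g : Spec (.of (Ch K τ)) ⟶ X}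
    (hg : g ≫ β = chartMap τ) {z : specialFibre β} {q : PrimeSpectrum (Ch K τ)}
    (h : specialι β z = g q) : fibreIdeal τ ≤ q.asIdeal := by
  have h1 : β (g q) = TS.closedPoint K d := by
    rw [← h]
    exact (Scheme.Hom.range_fiberι β (TS.closedPoint K d)).le ⟨z, rfl⟩
  have h2 : chartMap τ q = TS.closedPoint K d := by
    rw [← hg]
    exact (Scheme.Hom.comp_apply _ _ _).trans h1
  have h3 : q.asIdeal.comap (ofRS K τ) = IsLocalRing.maximalIdeal (RS K d) :=
    (chartMap_asIdeal τ q).symm.trans (congrArg PrimeSpectrum.asIdeal h2)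
  rw [fibreIdeal, Ideal.map_le_iff_le_comap, ker_resRS, h3]

namespace SortedCharts

lemma part_lt_eq_empty {j : Fin (d + 1)} (h : j = 0) : part (S.τ j) .lt = ∅ := by
  refine Finset.eq_empty_of_forall_notMem fun k hk => ?_
  obtain ⟨k, rfl⟩ := S.σ.surjective k
  rw [mem_part, S.lt_iff, h] at hk
  exact Fin.not_lt_zero k hk

lemma part_gt_eq_empty {j : Fin (d + 1)} (h : j = Fin.last d) : part (S.τ j) .gt = ∅ := by
  refine Finset.eq_empty_of_forall_notMem fun k hk => ?_
  obtain ⟨k, rfl⟩ := S.σ.surjective k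
  rw [mem_part, S.gt_iff, h] at hk
  exact (Fin.le_last k).not_gt hk

/-- On the fibre `ξ η = 0`: points with `ξ = 0` belong to the curve that starts in chart `j`, points
with `η = 0` to the one that ends there. In the first chart `ξ = x` vanishes and in the last `η = y`
does, so the curve needed always exists. -/
lemma exists_castSucc_or_succ (hd : 0 < d) {j : Fin (d + 1)} {q : PrimeSpectrum (Ch K (S.τ j))}
    (hq : fibreIdeal _ ≤ q.asIdeal) :
    (xiC K _ ∈ q.asIdeal ∧ ∃ i : Fin d, i.castSucc = j) ∨
      (etaC K _ ∈ q.asIdeal ∧ ∃ i : Fin d, i.succ = j) := by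
  have hL : j = 0 → xiC K _ ∈ q.asIdeal := fun h =>
    hq (xiC_mem_fibreIdeal (S.part_lt_eq_empty h))
  have hU : j = Fin.last d → etaC K _ ∈ q.asIdeal := fun h =>
    hq (etaC_mem_fibreIdeal (S.part_gt_eq_empty h))
  have h0 : ¬(j = 0 ∧ j = Fin.last d) := by
    rintro ⟨rfl, h⟩
    have := congrArg Fin.val h
    simp only [Fin.val_zero, Fin.val_last] at this
    omega
  rw [Fin.exists_castSucc_eq, Fin.exists_succ_eq]
  have := q.2.mem_or_mem (hq (xiC_mul_etaC_mem (S.nonempty_eq j)))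
  tauto

lemma isIso_of_eq_zero (S : SortedCharts β) (hd : d = 0) : IsIso β := by
  subst hd
  have : IsIso (chartMap (K := K) (S.τ 0)) :=
    isIso_chartMap (S.part_lt_eq_empty rfl) (S.part_gt_eq_empty rfl)
  have : Epi (S.g 0).base := (TopCat.epi_iff_surjective _).2 fun z => by
    obtain ⟨i, hi⟩ := S.cover z
    obtain rfl : i = 0 := Fin.ext (by omega)
    exact hi
  have : IsIso (S.g 0) := IsOpenImmersion.isIso _
  have h : β = inv (S.g 0) ≫ chartMap (S.τ 0) := by rw [← S.comp 0, IsIso.inv_hom_id_assoc]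
  rw [h]
  infer_instance

variable {S}

lemma IsCurve.exists_lift {i : Fin d} {f : ProjectiveLine K ⟶ X} (h : S.IsCurve i f) :
    ∃ E : ProjectiveLine K ⟶ specialFibre β, E ≫ specialι β = f :=
  exists_lift_fiber β _ _ closedPointι_toSpecField _ closedPoint_mem_range f _ h.comp_eq

lemma IsCurve.comp_toSpecField {i : Fin d} {f : ProjectiveLine K ⟶ X} (h : S.IsCurve i f)
    {E : ProjectiveLine K ⟶ specialFibre β} (hE : E ≫ specialι β = f) :
    E ≫ specialι β ≫ β ≫ TS.toSpecField K d = ProjectiveLine.toSpecField K := by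
  rw [← Category.assoc, hE, ← Category.assoc, h.comp_eq, Category.assoc,
    closedPointι_toSpecField, Category.comp_id]

variable (S)

/-- The ideal of the special fibre on a chart is radical and defines the special fibre. -/
lemma isReduced_chart (hd : 0 < d) (j : Fin (d + 1)) :
    IsReduced (pullback (specialι β) (S.g j)) := by
  obtain ⟨I, hI₁, hI₂, hI₃⟩ :=
    exists_ideal_of_isClosedImmersion (pullback.snd (specialι β) (S.g j))
  refine hI₃ ?_
  -- `I` is squeezed between the fibre ideal, as the fibre lies over the closed point, and the
  -- kernels of the lines, as the curves lie in the fibre.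
  have hJ : fibreIdeal _ ≤ I := by
    rw [fibreIdeal, Ideal.map_le_iff_le_comap]
    refine hI₁ K (RS K d) (ofRS K _) (resRS K d)
      (pullback.fst _ _ ≫ specialι β ≫ β ≫ TS.toSpecField K d) ?_
    change _ ≫ closedPointι K d = _ ≫ chartMap (S.τ j)
    rw [Category.assoc, ← specialι_comp, ← S.comp j, pullback.condition_assoc]
  have hlift : ∀ {i : Fin d} {f : ProjectiveLine K ⟶ X}, S.IsCurve i f →
      ∀ (k : Fin 2) (ρ : Ch K (S.τ j) →+* K[X]),
      stdι K k ≫ f = Spec.map (CommRingCat.ofHom ρ) ≫ S.g j → I ≤ RingHom.ker ρ := by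
    intro i f hf k ρ hρ
    obtain ⟨E, hE⟩ := hf.exists_lift
    exact hI₂ K[X] ρ (pullback.lift (stdι K k ≫ E) (Spec.map (CommRingCat.ofHom ρ))
      (by rw [Category.assoc, hE, hρ])) (pullback.lift_snd _ _ _)
  have hleft : j ≠ Fin.last d → ∃ ρ : Ch K (S.τ j) →+* K[X],
      IsLine ρ (xiC K _) (etaC K _) ∧ I ≤ RingHom.ker ρ := fun hj => by
    obtain ⟨i, rfl⟩ := Fin.exists_castSucc_eq.2 hj
    obtain ⟨f, hf⟩ := S.exists_isCurve i
    obtain ⟨ρ, hρ, hρf⟩ := hf.exists_left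
    exact ⟨ρ, hρ, hlift hf 0 ρ hρf⟩
  have hright : j ≠ 0 → ∃ ρ : Ch K (S.τ j) →+* K[X],
      IsLine ρ (etaC K _) (xiC K _) ∧ I ≤ RingHom.ker ρ := fun hj => by
    obtain ⟨i, rfl⟩ := Fin.exists_succ_eq.2 hj
    obtain ⟨f, hf⟩ := S.exists_isCurve i
    obtain ⟨ρ, hρ, hρf⟩ := hf.exists_right
    exact ⟨ρ, hρ, hlift hf 1 ρ hρf⟩
  -- The fibre is a single line in the two end charts, and the union of both axes in the others.
  by_cases h0 : j = 0
  · obtain ⟨ρ, hρ, hle⟩ := hleft (by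
      rintro rfl
      have := congrArg Fin.val h0
      simp only [Fin.val_zero, Fin.val_last] at this
      omega)
    have : I = RingHom.ker ρ := by
      refine le_antisymm hle ((hρ.ker_xi.le.trans (sup_le le_rfl ?_)).trans hJ)
      exact (Ideal.span_singleton_le_iff_mem _).2 (xiC_mem_fibreIdeal (S.part_lt_eq_empty h0))
    exact this ▸ (RingHom.ker_isPrime ρ).isRadical
  · obtain ⟨ρ', hρ', hle'⟩ := hright h0
    by_cases h1 : j = Fin.last d
    · have : I = RingHom.ker ρ' := by
        refine le_antisymm hle' ((hρ'.ker_eta.le.trans (sup_le le_rfl ?_)).trans hJ)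
        exact (Ideal.span_singleton_le_iff_mem _).2 (etaC_mem_fibreIdeal (S.part_gt_eq_empty h1))
      exact this ▸ (RingHom.ker_isPrime ρ').isRadical
    · obtain ⟨ρ, hρ, hle⟩ := hleft h1
      have : I = RingHom.ker ρ ⊓ RingHom.ker ρ' :=
        le_antisymm (le_inf hle hle') ((ker_inf_ker_le (S.nonempty_eq j) hρ hρ').trans hJ)
      exact this ▸ (RingHom.ker_isPrime ρ).isRadical.inf (RingHom.ker_isPrime ρ').isRadical

theorem isReduced_specialFibre (S : SortedCharts β) (hd : 0 < d) : IsReduced (specialFibre β) := by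
  refine isReduced_of_charts fun z => ?_
  obtain ⟨j, hj⟩ := S.cover (specialι β z)
  refine ⟨pullback (specialι β) (S.g j), pullback.fst _ _, inferInstance, ?_,
    S.isReduced_chart hd j⟩
  rw [IsOpenImmersion.range_pullbackFst]
  exact hj

theorem exists_mem_range (hd : 0 < d) (z : specialFibre β) : ∃ i : Fin d,
    ∀ {f : ProjectiveLine K ⟶ X}, S.IsCurve i f → specialι β z ∈ Set.range f := by
  obtain ⟨j, q, hq⟩ := S.cover (specialι β z)
  have hJ := fibreIdeal_le_of_eq (S.comp j) (q := q) hq.symm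
  rcases S.exists_castSucc_or_succ hd hJ with ⟨h, i, rfl⟩ | ⟨h, i, rfl⟩
  · exact ⟨i, fun hf => hq ▸ (hf.mem_range_left_iff q).2 ⟨hJ, h⟩⟩
  · exact ⟨i, fun hf => hq ▸ (hf.mem_range_right_iff q).2 ⟨hJ, h⟩⟩

variable {S}

lemma IsCurve.disjoint {i j : Fin d} {f f' : ProjectiveLine K ⟶ X} (h : S.IsCurve i f)
    (h' : S.IsCurve j f') (hij : (i : ℕ) + 1 < j) : Disjoint (Set.range f) (Set.range f') := by
  rw [Set.disjoint_left]
  rintro _ ⟨z, rfl⟩ ⟨z', hz⟩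
  rcases h'.exists_eq z' with ⟨q, -, -, hq⟩ | ⟨q, -, -, hq⟩
  · refine h.notMem_range (j := j.castSucc) ?_ ?_ z ⟨q, hq.symm.trans hz⟩ <;>
    · rw [Ne, Fin.ext_iff]
      simp only [Fin.val_castSucc, Fin.val_succ]
      omega
  · refine h.notMem_range (j := j.succ) ?_ ?_ z ⟨q, hq.symm.trans hz⟩ <;>
    · rw [Ne, Fin.ext_iff]
      simp only [Fin.val_castSucc, Fin.val_succ]
      omega

end SortedCharts

end Fibre

end SmoothCollection
end

noncomputable section

namespace SmoothCollection

/-! ### The nodes of the chain -/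

section Nodes

open Polynomial

variable {K : Type u} [Field K] {d : ℕ} {X : Scheme.{u}} {β : X ⟶ TS K d} {S : SortedCharts β}

/-- The kernel of `ρ` followed by evaluation at zero. -/
lemma isMaximal_origin {τ : Fin (d + 1) → Ordering} {ρ : Ch K τ →+* K[X]}
    (hρ : IsLine ρ (xiC K τ) (etaC K τ)) :
    (fibreIdeal τ ⊔ Ideal.span {xiC K τ} ⊔ Ideal.span {etaC K τ}).IsMaximal := by
  let ev : Ch K τ →+* K := (evalRingHom 0).comp ρ
  have hev : Function.Surjective ev := fun a => by
    obtain ⟨z, hz⟩ := hρ.surjective (C a)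
    exact ⟨z, by rw [RingHom.comp_apply, hz, coe_evalRingHom, eval_C]⟩
  have hle : RingHom.ker ev ≤ fibreIdeal τ ⊔ Ideal.span {xiC K τ} ⊔ Ideal.span {etaC K τ} := by
    intro z hz
    have h0 : (ρ z).eval 0 = 0 := hz
    obtain ⟨P, hP⟩ := X_dvd_iff.2 ((coeff_zero_eq_eval_zero _).trans h0)
    obtain ⟨w, rfl⟩ := hρ.surjective P
    rw [← hρ.map_right, ← map_mul, ← sub_eq_zero, ← map_sub] at hP
    have h1 : z - etaC K τ * w ∈ RingHom.ker ρ := hP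
    rw [hρ.ker_xi] at h1
    have h2 := Ideal.add_mem _ (Ideal.mem_sup_left h1) (Ideal.mem_sup_right
      (Ideal.mul_mem_right w _ (Ideal.mem_span_singleton_self (etaC K τ))))
    rwa [sub_add_cancel] at h2
  have hmax : (RingHom.ker ev).IsMaximal := RingHom.ker_isMaximal_of_surjective _ hev
  have heq : RingHom.ker ev = fibreIdeal τ ⊔ Ideal.span {xiC K τ} ⊔ Ideal.span {etaC K τ} := by
    refine le_antisymm hle (sup_le (sup_le ?_ ?_) ?_)
    · exact fun z hz => by
        change (ρ z).eval 0 = 0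
        rw [show ρ z = 0 from hρ.fibreIdeal_le_ker hz, eval_zero]
    · rw [Ideal.span_singleton_le_iff_mem]
      change (ρ _).eval 0 = 0
      rw [hρ.map_left, eval_zero]
    · rw [Ideal.span_singleton_le_iff_mem]
      change (ρ _).eval 0 = 0
      rw [hρ.map_right, eval_X]
  exact heq ▸ hmax

namespace SortedCharts

/-- Two consecutive curves share only the chart `m`, where one is `η = 0` and the other `ξ = 0` in
the fibre; they meet at the origin of `m`. -/
lemma IsCurve.exists_inter_eq {i j : Fin d} {f f' : ProjectiveLine K ⟶ X} (h : S.IsCurve i f)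
    (h' : S.IsCurve j f') (hij : (i : ℕ) + 1 = j) : ∃ x, Set.range f ∩ Set.range f' = {x} := by
  obtain ⟨m, hm, hm'⟩ : ∃ m, m = i.succ ∧ m = j.castSucc :=
    ⟨_, rfl, Fin.ext hij⟩
  have hr : ∀ q : PrimeSpectrum (Ch K (S.τ m)), S.g m q ∈ Set.range f ↔
      fibreIdeal _ ≤ q.asIdeal ∧ etaC K _ ∈ q.asIdeal := by
    rw [hm]
    exact h.mem_range_right_iff
  have hl : ∀ q : PrimeSpectrum (Ch K (S.τ m)), S.g m q ∈ Set.range f' ↔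
      fibreIdeal _ ≤ q.asIdeal ∧ xiC K _ ∈ q.asIdeal := by
    rw [hm']
    exact h'.mem_range_left_iff
  have hmax : (fibreIdeal (S.τ m) ⊔ Ideal.span {xiC K (S.τ m)} ⊔
      Ideal.span {etaC K (S.τ m)}).IsMaximal := by
    subst hm'
    obtain ⟨ρ, hρ, -⟩ := h'.exists_left
    exact isMaximal_origin hρ
  let q₀ : PrimeSpectrum (Ch K (S.τ m)) := ⟨_, hmax.isPrime⟩
  refine ⟨S.g m q₀, Set.ext fun z => ⟨?_, ?_⟩⟩
  · rintro ⟨hz, z', rfl⟩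
    obtain ⟨q, hq⟩ : ∃ q : PrimeSpectrum (Ch K (S.τ m)), f' z' = S.g m q := by
      rcases h'.exists_eq z' with ⟨q, -, -, hq⟩ | ⟨q, -, -, hq⟩
      · subst hm'
        exact ⟨q, hq⟩
      · obtain ⟨y, hy⟩ := hz
        refine absurd ⟨q, hq.symm.trans hy.symm⟩ (h.notMem_range (j := j.succ) ?_ ?_ y) <;>
        · rw [Ne, Fin.ext_iff]
          simp only [Fin.val_castSucc, Fin.val_succ]
          omega
    rw [Set.mem_singleton_iff, hq]
    have h₁ := (hr q).1 (hq ▸ hz)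
    have h₂ := (hl q).1 (hq ▸ ⟨z', rfl⟩)
    have : q₀ = q := PrimeSpectrum.ext (hmax.eq_of_le q.2.ne_top (sup_le (sup_le h₁.1
      ((Ideal.span_singleton_le_iff_mem _).2 h₂.2)) ((Ideal.span_singleton_le_iff_mem _).2 h₁.2)))
    rw [this]
  · rintro rfl
    exact ⟨(hr q₀).2 ⟨le_sup_left.trans le_sup_left,
        Ideal.mem_sup_right (Ideal.mem_span_singleton_self _)⟩,
      (hl q₀).2 ⟨le_sup_left.trans le_sup_left,
        Ideal.mem_sup_left (Ideal.mem_sup_right (Ideal.mem_span_singleton_self _))⟩⟩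

/-- The intersection is closed in the chart `m`, and its ideal contains the maximal ideal of the
origin; so it is that ideal or the unit ideal, and both are radical. -/
lemma IsCurve.isReduced_pullback {i j : Fin d} {f f' : ProjectiveLine K ⟶ X} (h : S.IsCurve i f)
    (h' : S.IsCurve j f') (hij : (i : ℕ) + 1 = j) : IsReduced (pullback f f') := by
  obtain ⟨m, hm, hm'⟩ : ∃ m, m = i.succ ∧ m = j.castSucc :=
    ⟨_, rfl, Fin.ext hij⟩
  have := h.isClosedImmersion
  have := h'.isClosedImmersion
  have hsub : ∀ w : ↥(pullback f f'), f (pullback.fst f f' w) = f' (pullback.snd f f' w) :=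
    fun w => by rw [← Scheme.Hom.comp_apply, ← Scheme.Hom.comp_apply, pullback.condition]
  have hrange : Set.range (pullback.fst f f' ≫ f) ⊆ Set.range (S.g m) := by
    rintro _ ⟨w, rfl⟩
    have hw : (pullback.fst f f' ≫ f) w = f' (pullback.snd f f' w) :=
      (Scheme.Hom.comp_apply _ _ _).trans (hsub w)
    rw [hw]
    rcases h'.exists_eq (pullback.snd f f' w) with ⟨q, -, -, hq⟩ | ⟨q, -, -, hq⟩
    · subst hm'
      exact ⟨q, hq.symm⟩
    · refine absurd ⟨q, hq.symm.trans (hsub w).symm⟩ (h.notMem_range (j := j.succ) ?_ ?_ _) <;>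
      · rw [Ne, Fin.ext_iff]
        simp only [Fin.val_castSucc, Fin.val_succ]
        omega
  let v : pullback f f' ⟶ Spec (.of (Ch K (S.τ m))) := IsOpenImmersion.lift (S.g m) _ hrange
  have hv : v ≫ S.g m = pullback.fst f f' ≫ f := IsOpenImmersion.lift_fac _ _ _
  have : IsClosedImmersion (v ≫ S.g m) := by
    rw [hv]
    infer_instance
  have : IsClosedImmersion v := IsClosedImmersion.of_comp v (S.g m)
  obtain ⟨I, hI₁, -, hI₃⟩ := exists_ideal_of_isClosedImmersion v
  refine hI₃ ?_
  have hker : ∀ (k : Fin 2) (ρ : Ch K (S.τ m) →+* K[X]) (t : pullback f f' ⟶ ProjectiveLine K)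
      (f'' : ProjectiveLine K ⟶ X), t ≫ f'' = v ≫ S.g m →
      stdι K k ≫ f'' = Spec.map (CommRingCat.ofHom ρ) ≫ S.g m →
      (∀ z, f'' z ∈ Set.range (S.g m) → z ∈ Set.range (stdι K k)) → RingHom.ker ρ ≤ I := by
    intro k ρ t f'' ht hf'' hz
    have hs : Set.range t ⊆ Set.range (stdι K k) := by
      rintro _ ⟨w, rfl⟩
      refine hz _ ?_
      rw [← Scheme.Hom.comp_apply, ht]
      exact ⟨v w, (Scheme.Hom.comp_apply _ _ _).symm⟩
    refine (hI₁ K[X] _ (RingHom.id _) ρ (IsOpenImmersion.lift (stdι K k) t hs) ?_).trans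
      (Ideal.comap_id I).le
    rw [← cancel_mono (S.g m), Category.assoc, ← hf'', IsOpenImmersion.lift_fac_assoc, ht]
    exact congrArg (· ≫ S.g m) ((congrArg (v ≫ ·) (Spec.map_id _)).trans (Category.comp_id v)).symm
  have hη : ∃ ρ : Ch K (S.τ m) →+* K[X], IsLine ρ (etaC K _) (xiC K _) ∧ RingHom.ker ρ ≤ I := by
    subst hm
    obtain ⟨ρ, hρ, hf⟩ := h.exists_right
    exact ⟨ρ, hρ, hker 1 ρ _ f hv.symm hf fun z => h.mem_range_stdι_right⟩
  have hξ : ∃ ρ : Ch K (S.τ m) →+* K[X], IsLine ρ (xiC K _) (etaC K _) ∧ RingHom.ker ρ ≤ I := by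
    subst hm'
    obtain ⟨ρ, hρ, hf⟩ := h'.exists_left
    exact ⟨ρ, hρ, hker 0 ρ _ f' (pullback.condition.symm.trans hv.symm) hf
      fun z => h'.mem_range_stdι_left⟩
  obtain ⟨ρ, hρ, hle⟩ := hξ
  obtain ⟨ρ', hρ', hle'⟩ := hη
  have hM : fibreIdeal (S.τ m) ⊔ Ideal.span {xiC K (S.τ m)} ⊔ Ideal.span {etaC K (S.τ m)} ≤ I :=
    sup_le (hρ.ker_xi.ge.trans hle)
      ((Ideal.span_singleton_le_iff_mem _).2 (hle' hρ'.map_left))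
  by_cases hI : I = ⊤
  · rw [hI]
    exact fun z _ => trivial
  · rw [← (isMaximal_origin hρ).eq_of_le hI hM]
    exact (isMaximal_origin hρ).isPrime.isRadical

end SortedCharts

/-- Lets the intersections be computed in the total space instead of the fibre. -/
lemma isReduced_pullback_of_comp_mono {Y Y' Z W : Scheme.{u}} (f : Y ⟶ Z) (f' : Y' ⟶ Z)
    (g : Z ⟶ W) [Mono g] (h : IsReduced (pullback (f ≫ g) (f' ≫ g))) :
    IsReduced (pullback f f') := by
  have h₁ : pullback.fst f f' ≫ f ≫ g = pullback.snd f f' ≫ f' ≫ g := by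
    rw [pullback.condition_assoc]
  have h₂ : pullback.fst (f ≫ g) (f' ≫ g) ≫ f = pullback.snd (f ≫ g) (f' ≫ g) ≫ f' := by
    rw [← cancel_mono g, Category.assoc, Category.assoc, pullback.condition]
  have : IsIso (pullback.lift _ _ h₁) := by
    refine ⟨pullback.lift _ _ h₂, pullback.hom_ext ?_ ?_, pullback.hom_ext ?_ ?_⟩
    · rw [Category.assoc, pullback.lift_fst, pullback.lift_fst, Category.id_comp]
    · rw [Category.assoc, pullback.lift_snd, pullback.lift_snd, Category.id_comp]
    · rw [Category.assoc, pullback.lift_fst, pullback.lift_fst, Category.id_comp]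
    · rw [Category.assoc, pullback.lift_snd, pullback.lift_snd, Category.id_comp]
  exact isReduced_of_isOpenImmersion (pullback.lift _ _ h₁)

/-- The special fibre is a chain of rational curves. -/
theorem SortedCharts.isChainOfRationalCurves (S : SortedCharts β) :
    IsChainOfRationalCurves
      (β.fiberι (TS.closedPoint K d) ≫ β ≫ TS.toSpecField K d) d := by
  refine ⟨fun hd => ?_, fun hd => ⟨S.isReduced_specialFibre hd, ?_⟩⟩
  · have := S.isIso_of_eq_zero hd
    exact isIso_fiber_of_isIso β _ _ closedPointι_toSpecField _ closedPoint_mem_range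
  choose f hf using S.exists_isCurve
  choose E hE using fun i => (hf i).exists_lift
  have hinj := specialι_injective (β := β)
  have hmem : ∀ i z, z ∈ Set.range (E i) ↔ specialι β z ∈ Set.range (f i) := fun i z => by
    rw [← hE i]
    constructor
    · rintro ⟨y, rfl⟩
      exact ⟨y, Scheme.Hom.comp_apply _ _ _⟩
    · rintro ⟨y, hy⟩
      exact ⟨y, hinj ((Scheme.Hom.comp_apply _ _ _).symm.trans hy)⟩
  have hclosed : ∀ i, IsClosedImmersion (E i) := fun i => by
    have : IsClosedImmersion (E i ≫ specialι β) := by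
      rw [hE]
      exact (hf i).isClosedImmersion
    exact IsClosedImmersion.of_comp (E i) (specialι β)
  refine ⟨E, fun i => ⟨hclosed i, (hf i).comp_toSpecField (hE i)⟩, ?_, fun i j hij => ?_,
    fun i j hij => ⟨?_, ?_⟩⟩
  · refine Set.eq_univ_of_forall fun z => ?_
    obtain ⟨i, hi⟩ := S.exists_mem_range hd z
    exact Set.mem_iUnion.2 ⟨i, (hmem i z).2 (hi (hf i))⟩
  · rw [Set.disjoint_left]
    intro z hz hz'
    exact Set.disjoint_left.1 ((hf i).disjoint (hf j) hij) ((hmem i z).1 hz) ((hmem j z).1 hz')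
  · obtain ⟨x, hx⟩ := (hf i).exists_inter_eq (hf j) hij
    obtain ⟨⟨y, hy⟩, hx'⟩ : x ∈ Set.range (f i) ∩ Set.range (f j) := hx ▸ rfl
    have hy' : specialι β (E i y) = x := by
      rw [← hy, ← hE i]
      exact (Scheme.Hom.comp_apply _ _ _).symm
    refine ⟨E i y, Set.ext fun z => ⟨fun hz => ?_, ?_⟩⟩
    · have : specialι β z ∈ Set.range (f i) ∩ Set.range (f j) :=
        ⟨(hmem i z).1 hz.1, (hmem j z).1 hz.2⟩
      rw [hx] at this
      exact hinj ((Set.mem_singleton_iff.1 this).trans hy'.symm)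
    · rintro rfl
      exact ⟨⟨y, rfl⟩, (hmem j _).2 (hy' ▸ hx')⟩
  · have := (hf i).isReduced_pullback (hf j) hij
    have h : IsReduced (pullback (E i ≫ specialι β) (E j ≫ specialι β)) := by
      rw [hE, hE]
      exact this
    exact isReduced_pullback_of_comp_mono _ _ _ h

end Nodes

end SmoothCollection
end

theorem mainTheorem3 (K : Type u) [Field K] [IsAlgClosed K] (d k : ℕ)
    (A : Fin k → Finset (Fin (d + 1)))
    (hA : ∀ l, (A l).Nonempty ∧ A l ≠ Finset.univ)
    (𝒯 : BlowupSequence fun l => weilDivisor K d (A l)) :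
    (IsRegularScheme 𝒯.top ↔ IsSmoothCollection A) ∧
    (IsSmoothCollection A →
      IsChainOfRationalCurves
        (𝒯.toT.fiberι (TS.closedPoint K d) ≫ 𝒯.toT ≫ TS.toSpecField K d) d) := by
  refine ⟨𝒯.isRegularScheme_top_iff, fun hs => ?_⟩
  obtain ⟨c, hc, -⟩ := 𝒯.exists_hasCharts (Fin.last k)
  obtain ⟨S⟩ := hc.nonempty_sortedCharts
    ((hc.isRegularScheme_iff).1 (𝒯.isRegularScheme_top_iff.2 hs))
  exact S.isChainOfRationalCurves
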